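/- Let $K$ be an algebraically closed field with $\operatorname{char} K \neq 2$. A nondegenerate $(16_6,16_6)$ configuration in $\mathbb{P}^3_K$ is a pair $(\mathcal N,\mathcal N')$ of a set $\mathcal N$ of 16 points and a set $\mathcal N'$ of 16 planes such that each point of $\mathcal N$ lies on exactly 6 planes of $\mathcal N'$, each plane of $\mathcal N'$ contains exactly 6 points of $\mathcal N$, and any two distinct planes of $\mathcal N'$ have exactly 2 points of $\mathcal N$ in common. A Kummer quartic is a quartic surface in $\mathbb{P}^3_K$ with exactly 16 singular points. Let $\mathcal K\cong(\mathbb Z/2)^4$ be the group of projectivities of $\mathbb{P}^3$ generated by the double transpositions of the coordinates and by the maps $z_i\mapsto\epsilon_i z_i$ with $\epsilon_i=\pm1$, $\epsilon_1=\epsilon_1\epsilon_2\epsilon_3\epsilon_4=1$. Call a point $(a_1:a_2:a_3:a_4)\in\mathbb{P}^3$ admissible if (I) no two of its coordinates are zero and $\sum_i a_i^2\neq0$; (II) $a_1a_2\pm a_3a_4\neq0$, $a_1a_3\pm a_2a_4\neq0$, $a_1a_4\pm a_2a_3\neq0$; (III) $a_1^2+a_2^2\neq a_3^2+a_4^2$,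 $a_1^2+a_3^2\neq a_2^2+a_4^2$, $a_1^2+a_4^2\neq a_2^2+a_3^2$. For an admissible point $a$ let $\mathcal N_a$ be its $\mathcal K$-orbit and $\mathcal N_a'$ the set of planes orthogonal, for the bilinear form $\sum_i x_iy_i$, to the points of $\mathcal N_a$. Then: (1) For every admissible $a$, $(\mathcal N_a,\mathcal N_a')$ is a nondegenerate $(16_6,16_6)$ configuration, and every nondegenerate $(16_6,16_6)$ configuration in $\mathbb{P}^3_K$ is projectively equivalent to $(\mathcal N_a,\mathcal N'_a)$ for some admissible $a$. In particular it is strictly self-dual: in suitable coordinates its planes are the planes orthogonal to its points. (2) For every nondegenerate $(16_6,16_6)$ configuration $(\mathcal N,\mathcal N')$ there is a unique Kummer quartic whose set of singular points is $\mathcal N$, and its singular points are nodes. Conversely, the singular set of every Kummer quartic is the set of points of a nondegenerate $(16_6,16_6)$ configuration; thus every Kummer quartic is projectively equivalent to one with singular set $\mathcal N_a$, for some admissible $a$. (3) For every admissible $a$, the Kummer quartic with singular set $\mathcal N_a$ has an equation in Hudson normal form $$\alpha_0\sum_i z_i^4+2\alpha_{01}(z_1^2z_2^2+z_3^2z_4^2)+2\alpha_{10}(z_1^2z_3^2+z_2^2z_4^2)+2\alpha_{11}(z_1^2z_4^2+z_2^2z_3^2)+4\beta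 z_1z_2z_3z_4=0.$$ Put $b_i=a_i^2$ and $b=a_1a_2a_3a_4$. If $b\neq0$, then the vector $v={}^t(\alpha_0,\alpha_{01},\alpha_{10},\alpha_{11},\beta)$ is, up to a nonzero scalar, the unique nonzero solution of $Bv=0$, where $$B=\begin{pmatrix} b_1^2&b_1b_2&b_1b_3&b_1b_4&b\\ b_2^2&b_2b_1&b_2b_4&b_2b_3&b\\ b_3^2&b_3b_4&b_3b_1&b_3b_2&b\\ b_4^2&b_4b_3&b_4b_2&b_4b_1&b\end{pmatrix},$$ and this solution space is one-dimensional. If $b=0$, then $\mathcal N_a=\mathcal N_{a'}$ for some admissible $a'$ with $a'_1=0$; and if $a_1=0$, then, up to a nonzero scalar, $\beta=0$ and $$\alpha_0=2b_2b_3b_4,\quad \alpha_{01}=b_2(b_2^2-b_3^2-b_4^2),\quad \alpha_{10}=b_3(b_3^2-b_4^2-b_2^2),\quad \alpha_{11}=b_4(b_4^2-b_2^2-b_3^2).$$ -/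

import Mathlib

open scoped LinearAlgebra.Projectivization

noncomputable section

/-! Projective 3-space over `K` is `ℙ K (Fin 4 → K)`; the coordinates `z₁, …, z₄` are indexed by
`0, …, 3`.  A plane is a 3-dimensional linear subspace of `Fin 4 → K`, and a point `p` lies on the
plane `W` when `p.submodule ≤ W`. -/

/-- A nondegenerate `(16₆, 16₆)` configuration of points `N` and planes `N'` in `ℙ³`. -/
structure IsNondegenerateConfig {K : Type*} [Field K]
    (N : Set (ℙ K (Fin 4 → K))) (N' : Set (Submodule K (Fin 4 → K))) : Prop where
  finrank_plane : ∀ W ∈ N', Module.finrank K W = 3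
  card_points : N.ncard = 16
  card_planes : N'.ncard = 16
  planes_through : ∀ p ∈ N, {W | W ∈ N' ∧ p.submodule ≤ W}.ncard = 6
  points_on : ∀ W ∈ N', {p | p ∈ N ∧ p.submodule ≤ W}.ncard = 6
  nondegenerate : ∀ W₁ ∈ N', ∀ W₂ ∈ N', W₁ ≠ W₂ →
    {p | p ∈ N ∧ p.submodule ≤ W₁ ∧ p.submodule ≤ W₂}.ncard = 2

/-- The image of a set of points under the projectivity induced by `g`. -/
def imagePoints {K : Type*} [Field K] (g : (Fin 4 → K) ≃ₗ[K] (Fin 4 → K))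
    (N : Set (ℙ K (Fin 4 → K))) : Set (ℙ K (Fin 4 → K)) :=
  (fun p => g • p) '' N

/-- The image of a set of planes under the projectivity induced by `g`. -/
def imagePlanes {K : Type*} [Field K] (g : (Fin 4 → K) ≃ₗ[K] (Fin 4 → K))
    (N' : Set (Submodule K (Fin 4 → K))) : Set (Submodule K (Fin 4 → K)) :=
  (fun W => W.map (g : (Fin 4 → K) →ₗ[K] (Fin 4 → K))) '' N'

/-- Projective equivalence of two configurations of points and planes. -/
def ProjectivelyEquivalent {K : Type*} [Field K]
    (N₁ : Set (ℙ K (Fin 4 → K))) (N₁' : Set (Submodule K (Fin 4 → K)))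
    (N₂ : Set (ℙ K (Fin 4 → K))) (N₂' : Set (Submodule K (Fin 4 → K))) : Prop :=
  ∃ g : (Fin 4 → K) ≃ₗ[K] (Fin 4 → K), imagePoints g N₁ = N₂ ∧ imagePlanes g N₁' = N₂'

/-- The plane orthogonal to `p` for the standard bilinear form `∑ xᵢ yᵢ`. -/
def orthogonalPlane {K : Type*} [Field K] (p : ℙ K (Fin 4 → K)) : Submodule K (Fin 4 → K) :=
  p.submodule.orthogonalBilin (dotProductBilin K K)

/-- The set of planes orthogonal to the points of `N`. -/
def orthogonalPlanes {K : Type*} [Field K] (N : Set (ℙ K (Fin 4 → K))) :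
    Set (Submodule K (Fin 4 → K)) :=
  orthogonalPlane '' N

/-- The configuration `(N, N')` is strictly self-dual: in suitable coordinates, `N'` is the set of
planes orthogonal to the points of `N`. -/
def StrictlySelfDual {K : Type*} [Field K]
    (N : Set (ℙ K (Fin 4 → K))) (N' : Set (Submodule K (Fin 4 → K))) : Prop :=
  ∃ g : (Fin 4 → K) ≃ₗ[K] (Fin 4 → K), imagePlanes g N' = orthogonalPlanes (imagePoints g N)

/-- The Klein four-group of double transpositions of the four coordinates. -/
def doubleTranspositions : Subgroup (Equiv.Perm (Fin 4)) where
  carrier := {1, Equiv.swap 0 1 * Equiv.swap 2 3, Equiv.swap 0 2 * Equiv.swap 1 3,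
    Equiv.swap 0 3 * Equiv.swap 1 2}
  mul_mem' := by
    simp only [Set.mem_insert_iff, Set.mem_singleton_iff]
    decide +revert
  one_mem' := by simp
  inv_mem' := by
    simp only [Set.mem_insert_iff, Set.mem_singleton_iff]
    decide +revert

/-- The linear maps `z ↦ (εᵢ z_{σ i})ᵢ` with `σ` a double transposition or the identity, `εᵢ = ±1`
and `ε₁ε₂ε₃ε₄ = 1`.  This group of order 32 contains `-1`, which acts trivially on `ℙ³`; modulo
`±1` one may normalize `ε₁ = 1`, and the group of projectivities that it induces is `(ℤ/2)⁴`. -/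
def heisenbergGroup (K : Type*) [Field K] : Subgroup ((Fin 4 → K) ≃ₗ[K] (Fin 4 → K)) where
  carrier := {g | ∃ σ ∈ doubleTranspositions, ∃ ε : Fin 4 → ℤˣ, ∏ i, ε i = 1 ∧
    ∀ z i, g z i = ((ε i : ℤ) : K) * z (σ i)}
  mul_mem' := by
    rintro g g' ⟨σ, hσ, ε, hε, hg⟩ ⟨σ', hσ', ε', hε', hg'⟩
    refine ⟨σ' * σ, mul_mem hσ' hσ, fun i => ε i * ε' (σ i), ?_, fun z i => ?_⟩
    · rw [Finset.prod_mul_distrib, hε, Equiv.prod_comp σ ε', hε', one_mul]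
    · rw [LinearEquiv.mul_apply, hg, hg']
      push_cast
      rw [mul_assoc]
      rfl
  one_mem' := ⟨1, one_mem _, 1, by simp, by simp⟩
  inv_mem' := by
    rintro g ⟨σ, hσ, ε, hε, hg⟩
    refine ⟨σ⁻¹, inv_mem hσ, fun i => ε (σ⁻¹ i), ?_, fun z i => ?_⟩
    · rw [Equiv.prod_comp σ⁻¹ ε, hε]
    · have h := hg (g⁻¹ z) (σ⁻¹ i)
      have hs : σ (σ⁻¹ i) = i := σ.apply_symm_apply i
      rw [← LinearEquiv.mul_apply, mul_inv_cancel, LinearEquiv.coe_one, id_eq, hs] at h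
      rw [h, ← mul_assoc, ← Int.cast_mul, ← Units.val_mul, Int.units_mul_self]
      simp

/-- The open conditions (I), (II), (III) on `(a₁, a₂, a₃, a₄)`. -/
structure Admissible {K : Type*} [Field K] (a : Fin 4 → K) : Prop where
  no_two_zero : ∀ i j, i ≠ j → ¬ (a i = 0 ∧ a j = 0)
  sum_sq : ∑ i, a i ^ 2 ≠ 0
  mul₁ : a 0 * a 1 + a 2 * a 3 ≠ 0 ∧ a 0 * a 1 - a 2 * a 3 ≠ 0
  mul₂ : a 0 * a 2 + a 1 * a 3 ≠ 0 ∧ a 0 * a 2 - a 1 * a 3 ≠ 0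
  mul₃ : a 0 * a 3 + a 1 * a 2 ≠ 0 ∧ a 0 * a 3 - a 1 * a 2 ≠ 0
  sq₁ : a 0 ^ 2 + a 1 ^ 2 ≠ a 2 ^ 2 + a 3 ^ 2
  sq₂ : a 0 ^ 2 + a 2 ^ 2 ≠ a 1 ^ 2 + a 3 ^ 2
  sq₃ : a 0 ^ 2 + a 3 ^ 2 ≠ a 1 ^ 2 + a 2 ^ 2

theorem Admissible.ne_zero {K : Type*} [Field K] {a : Fin 4 → K} (ha : Admissible a) : a ≠ 0 := by
  rintro rfl
  exact ha.no_two_zero 0 1 (by decide) ⟨rfl, rfl⟩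

/-- The orbit of the point `(a₁ : a₂ : a₃ : a₄)` under the group `(ℤ/2)⁴`. -/
def kummerOrbit {K : Type*} [Field K] (a : Fin 4 → K) (ha : Admissible a) :
    Set (ℙ K (Fin 4 → K)) :=
  MulAction.orbit (heisenbergGroup K) (Projectivization.mk K a ha.ne_zero)

/-- The singular points of the surface `F = 0`, for a homogeneous polynomial `F`. -/
def singularSet {K : Type*} [Field K] (F : MvPolynomial (Fin 4) K) : Set (ℙ K (Fin 4 → K)) :=
  {p | MvPolynomial.eval p.rep F = 0 ∧
    ∀ i, MvPolynomial.eval p.rep (MvPolynomial.pderiv i F) = 0}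

/-- `F = 0` is a Kummer quartic: a quartic surface with exactly 16 singular points.  (A surface in
`ℙ³` with finitely many singular points is automatically irreducible and normal.) -/
structure IsKummerQuartic {K : Type*} [Field K] (F : MvPolynomial (Fin 4) K) : Prop where
  ne_zero : F ≠ 0
  homogeneous : F.IsHomogeneous 4
  card_singular : (singularSet F).ncard = 16

/-- The singular point `p` of `F = 0` is a node (ordinary double point).  The line `p` is in the
kernel of the Hessian matrix, so rank 3 says (in characteristic `≠ 2`) that the tangent cone at `p`
is a cone over a smooth conic. -/
def IsNode {K : Type*} [Field K] (F : MvPolynomial (Fin 4) K) (p : ℙ K (Fin 4 → K)) : Prop :=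
  p ∈ singularSet F ∧
    (Matrix.of fun i j : Fin 4 => MvPolynomial.eval p.rep
      (MvPolynomial.pderiv i (MvPolynomial.pderiv j F))).rank = 3

/-- The equation `F ∘ g⁻¹` of the image of the surface `F = 0` under `g`. -/
def imageForm {K : Type*} [Field K] (g : (Fin 4 → K) ≃ₗ[K] (Fin 4 → K))
    (F : MvPolynomial (Fin 4) K) : MvPolynomial (Fin 4) K :=
  MvPolynomial.bind₁ (fun i => ∑ j, MvPolynomial.C (g.symm (Pi.single j 1) i) *
    MvPolynomial.X j) F

/-- The Hudson normal form with coefficient vector `v = (α₀, α₀₁, α₁₀, α₁₁, β)`. -/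
def hudson {K : Type*} [Field K] (v : Fin 5 → K) : MvPolynomial (Fin 4) K :=
  let z : Fin 4 → MvPolynomial (Fin 4) K := MvPolynomial.X
  MvPolynomial.C (v 0) * ∑ i, z i ^ 4
    + 2 * MvPolynomial.C (v 1) * (z 0 ^ 2 * z 1 ^ 2 + z 2 ^ 2 * z 3 ^ 2)
    + 2 * MvPolynomial.C (v 2) * (z 0 ^ 2 * z 2 ^ 2 + z 1 ^ 2 * z 3 ^ 2)
    + 2 * MvPolynomial.C (v 3) * (z 0 ^ 2 * z 3 ^ 2 + z 1 ^ 2 * z 2 ^ 2)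
    + 4 * MvPolynomial.C (v 4) * (z 0 * z 1 * z 2 * z 3)

/-- The `4 × 5` matrix `B`, where `bᵢ = aᵢ²` and `b = a₁a₂a₃a₄`. -/
def hudsonMatrix {K : Type*} [Field K] (a : Fin 4 → K) : Matrix (Fin 4) (Fin 5) K :=
  let b₁ := a 0 ^ 2
  let b₂ := a 1 ^ 2
  let b₃ := a 2 ^ 2
  let b₄ := a 3 ^ 2
  let b := a 0 * a 1 * a 2 * a 3
  !![b₁ ^ 2, b₁ * b₂, b₁ * b₃, b₁ * b₄, b;
     b₂ ^ 2, b₂ * b₁, b₂ * b₄, b₂ * b₃, b;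
     b₃ ^ 2, b₃ * b₄, b₃ * b₁, b₃ * b₂, b;
     b₄ ^ 2, b₄ * b₃, b₄ * b₂, b₄ * b₁, b]

/-- The Hudson coefficients in the case `a₁ = 0`, where `bᵢ = aᵢ²`. -/
def segreCoefficients {K : Type*} [Field K] (a : Fin 4 → K) : Fin 5 → K :=
  let b₂ := a 1 ^ 2
  let b₃ := a 2 ^ 2
  let b₄ := a 3 ^ 2
  ![2 * b₂ * b₃ * b₄,
    b₂ * (b₂ ^ 2 - b₃ ^ 2 - b₄ ^ 2),
    b₃ * (b₃ ^ 2 - b₄ ^ 2 - b₂ ^ 2),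
    b₄ * (b₄ ^ 2 - b₂ ^ 2 - b₃ ^ 2),
    0]

end

/-! Normal form. The incidences of a nondegenerate configuration form a symmetric 2-(16,6,2) design.
Given a block `w` and a point `x` off `w`, join two points of `w` when the second block through them
contains `x`. This graph on six vertices is 2-regular, so it is a hexagon or a pair of triangles. A
hexagon forces a pattern of incidences (`IsBiplane.IsHexagon.exists_pattern`) that linear algebra
excludes in three-space (`not_pattern`). With triangles only, the design is that of a 4 × 4 board, a
point lying on a block when their cells are distinct and share a row or a column
(`IsBiplane.exists_rook`). Solving the incidence equations gives coordinates in which the points are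
the quaternion products e_μ r_ν, where r_0 = 1 and r_1, r_2, r_3 are the rows of a rotation matrix
R, and the planes are orthogonal to the points (`exists_frame_of_rook`). A quaternion q of nonzero
norm inducing R satisfies r_ν q = q e_ν. Hence right multiplication by q, a similitude, carries the
points to e_μ q e_ν, which up to sign form the orbit of q (`imagePoints_rotq`).

The quartic. Each coordinate plane contains six points of a quaternion frame. A quartic singular at
all the points of the frame restricts to each of these planes as a multiple of the square of a
conic, and gluing the four faces determines the quartic up to a scalar (`face_square`,
`eq_kumForm_of_singAt`). Existence: Hudson forms are invariant under the group, and being singular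
at a is a system of four linear equations in five coefficients. Further singular points do not
occur, because the discriminant of the projection from a frame point is a product of six linear
forms: three are the coordinates, and the symmetry exchanging R and its transpose supplies the other
three (`exists_disc_eq`). A singular point other than the centre then lies above a common point of
two of the six lines. One Hessian exhibits a node, and transitivity of the group does the rest.

Converse. Seen from one of the sixteen singular points of a quartic, the equation is z² q + 2 z g +
h = 0, and the other fifteen lie above singular points of the curve g² - q h = 0 of degree at most
six. This curve is reduced (`squarefree_disc`). On a reduced plane curve of degree n the double
points, with weight two for those that lie below two singular points, have total weight at most
n(n-1)/2, with equality only for products of lines (`two_mul_sum_le`). This follows from Bézout's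
inequality by induction on the degree, in every characteristic. Since 15 = 6·5/2, the curve consists
of six lines, and the fifteen points lie above their intersections. The six planes so obtained
through each singular point (`hasSixPlanes_singularSet`) form a configuration by double counting
(`exists_config_of_hasSixPlanes`). -/

namespace KummerQuartic

/-! ### Singular points on vectors and on points of projective space -/

open MvPolynomial

variable {K : Type*} [Field K]

/-- The partial derivatives of `F`, and `F` itself, vanish at the vector `x`. -/
def SingAt (F : MvPolynomial (Fin 4) K) (x : Fin 4 → K) : Prop :=
  eval x F = 0 ∧ ∀ i, eval x (pderiv i F) = 0

/-- The Hessian matrix of `F` at `x`. -/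
noncomputable def hess (F : MvPolynomial (Fin 4) K) (x : Fin 4 → K) : Matrix (Fin 4) (Fin 4) K :=
  Matrix.of fun i j => eval x (pderiv i (pderiv j F))

theorem eval_smul_of_isHomogeneous {σ : Type*} {F : MvPolynomial σ K} {n : ℕ}
    (hF : F.IsHomogeneous n) (c : K) (x : σ → K) : eval (c • x) F = c ^ n * eval x F := by
  rw [eval_eq, eval_eq, Finset.mul_sum]
  refine Finset.sum_congr rfl fun d hd => ?_
  have hdeg : d.sum (fun _ e => e) = n := by
    have := hF (mem_support_iff.1 hd)
    rwa [Finsupp.weight_apply, Finsupp.sum_congr (g2 := fun _ e => e)] at this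
    intros; simp
  simp only [Pi.smul_apply, smul_eq_mul, mul_pow, Finset.prod_mul_distrib]
  rw [Finset.prod_pow_eq_pow_sum]
  rw [Finsupp.sum] at hdeg
  rw [hdeg]; ring

theorem SingAt.smul {F : MvPolynomial (Fin 4) K} {n : ℕ} (hF : F.IsHomogeneous n)
    {x : Fin 4 → K} (h : SingAt F x) (c : K) : SingAt F (c • x) := by
  refine ⟨by rw [eval_smul_of_isHomogeneous hF, h.1, mul_zero], fun i => ?_⟩
  rw [eval_smul_of_isHomogeneous hF.pderiv, h.2, mul_zero]

theorem singAt_smul_iff {F : MvPolynomial (Fin 4) K} {n : ℕ} (hF : F.IsHomogeneous n)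
    {x : Fin 4 → K} {c : K} (hc : c ≠ 0) : SingAt F (c • x) ↔ SingAt F x := by
  refine ⟨fun h => ?_, fun h => h.smul hF c⟩
  simpa [smul_smul, inv_mul_cancel₀ hc] using h.smul hF c⁻¹

theorem mem_singularSet_iff {F : MvPolynomial (Fin 4) K} (p : ℙ K (Fin 4 → K)) :
    p ∈ singularSet F ↔ SingAt F p.rep := Iff.rfl

theorem mk_mem_singularSet {F : MvPolynomial (Fin 4) K} {n : ℕ} (hF : F.IsHomogeneous n)
    {x : Fin 4 → K} (hx : x ≠ 0) :
    Projectivization.mk K x hx ∈ singularSet F ↔ SingAt F x := by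
  obtain ⟨c, hc⟩ := Projectivization.exists_smul_eq_mk_rep K x hx
  rw [mem_singularSet_iff, ← hc]
  exact singAt_smul_iff hF (c := (c : K)) c.ne_zero

theorem mk_submodule_le {x : Fin 4 → K} (hx : x ≠ 0) (W : Submodule K (Fin 4 → K)) :
    (Projectivization.mk K x hx).submodule ≤ W ↔ x ∈ W := by
  rw [Projectivization.submodule_mk, Submodule.span_singleton_le_iff_mem]

theorem submodule_le_iff_rep (p : ℙ K (Fin 4 → K)) (W : Submodule K (Fin 4 → K)) :
    p.submodule ≤ W ↔ p.rep ∈ W := by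
  rw [Projectivization.submodule_eq, Submodule.span_singleton_le_iff_mem]

theorem mk_eq_mk_of_smul {x y : Fin 4 → K} (hx : x ≠ 0) (hy : y ≠ 0) {c : K} (h : x = c • y) :
    Projectivization.mk K x hx = Projectivization.mk K y hy :=
  (Projectivization.mk_eq_mk_iff' K x y hx hy).2 ⟨c, h.symm⟩

theorem smul_mk_eq (g : (Fin 4 → K) ≃ₗ[K] (Fin 4 → K)) {x : Fin 4 → K} (hx : x ≠ 0) :
    g • Projectivization.mk K x hx = Projectivization.mk K (g x) (by simpa using hx) :=
  Projectivization.smul_mk g hx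

theorem smul_submodule_le (g : (Fin 4 → K) ≃ₗ[K] (Fin 4 → K)) (p : ℙ K (Fin 4 → K))
    (W : Submodule K (Fin 4 → K)) :
    (g • p).submodule ≤ W.map (g : (Fin 4 → K) →ₗ[K] (Fin 4 → K)) ↔ p.submodule ≤ W := by
  induction p using Projectivization.ind with
  | h x hx =>
    rw [smul_mk_eq, mk_submodule_le, mk_submodule_le]
    simp

/-! ### Linear substitutions -/

theorem eval_imageForm (g : (Fin 4 → K) ≃ₗ[K] (Fin 4 → K)) (F : MvPolynomial (Fin 4) K)
    (x : Fin 4 → K) : eval x (imageForm g F) = eval (g.symm x) F := by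
  have hx : (fun i => eval x (∑ j, C (g.symm (Pi.single j 1) i) * X j : MvPolynomial (Fin 4) K))
      = g.symm x := by
    funext i
    have : x = ∑ j, x j • (Pi.single j 1 : Fin 4 → K) := by
      simpa using pi_eq_sum_univ' x
    conv_rhs => rw [this, map_sum]
    simp [Finset.sum_apply, mul_comm]
  rw [imageForm, ← hx]
  exact eval₂Hom_bind₁ _ _ _ _

theorem pderiv_imageForm (g : (Fin 4 → K) ≃ₗ[K] (Fin 4 → K)) (F : MvPolynomial (Fin 4) K)
    (j : Fin 4) : pderiv j (imageForm g F) =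
      ∑ i, C (g.symm (Pi.single j 1) i) * imageForm g (pderiv i F) := by
  induction F using MvPolynomial.induction_on with
  | C a => simp [imageForm]
  | add p q hp hq =>
    simp only [imageForm, map_add] at *
    rw [hp, hq, ← Finset.sum_add_distrib]
    exact Finset.sum_congr rfl fun i _ => by ring
  | mul_X p k hp =>
    have h1 : pderiv j (∑ l, C (g.symm (Pi.single l 1) k) * X l : MvPolynomial (Fin 4) K)
        = C (g.symm (Pi.single j 1) k) := by
      rw [map_sum, Finset.sum_eq_single j]
      · simp
      · intro l _ hl; simp [pderiv_X_of_ne hl]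
      · simp
    have h2 : ∀ i, imageForm g (pderiv i (X k : MvPolynomial (Fin 4) K)) =
        if i = k then 1 else 0 := by
      intro i
      by_cases h : i = k
      · subst h; simp [imageForm]
      · rw [pderiv_X_of_ne (Ne.symm h)]; simp [h, imageForm]
    have h3 : ∀ q : MvPolynomial (Fin 4) K, imageForm g (q * X k) =
        imageForm g q * ∑ l, C (g.symm (Pi.single l 1) k) * X l := by
      intro q; simp [imageForm]
    have h4 : ∀ q r : MvPolynomial (Fin 4) K, imageForm g (q + r) =
        imageForm g q + imageForm g r := by
      intro q r; simp [imageForm]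
    have h5 : ∀ q r : MvPolynomial (Fin 4) K, imageForm g (q * r) =
        imageForm g q * imageForm g r := by
      intro q r; simp [imageForm]
    have h6 : ∀ i, imageForm g (pderiv i (p * X k)) = imageForm g (pderiv i p) *
        (∑ l, C (g.symm (Pi.single l 1) k) * X l) + imageForm g p * if i = k then 1 else 0 := by
      intro i
      rw [pderiv_mul, h4, h3, h5, h2]
    rw [h3, pderiv_mul, hp, h1]
    simp only [h6]
    generalize (∑ l, C (g.symm (Pi.single l 1) k) * X l : MvPolynomial (Fin 4) K) = S
    generalize imageForm g p = T
    simp only [mul_add, Finset.sum_add_distrib, mul_ite, mul_one, mul_zero,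
      Finset.sum_ite_eq', Finset.mem_univ, if_true, Finset.sum_mul, mul_assoc]
    rw [mul_comm T]

theorem SingAt.imageForm {g : (Fin 4 → K) ≃ₗ[K] (Fin 4 → K)} {F : MvPolynomial (Fin 4) K}
    {x : Fin 4 → K} (h : SingAt F (g.symm x)) : SingAt (imageForm g F) x := by
  refine ⟨by rw [eval_imageForm, h.1], fun j => ?_⟩
  rw [pderiv_imageForm, map_sum]
  refine Finset.sum_eq_zero fun i _ => ?_
  rw [map_mul, eval_imageForm, h.2, mul_zero]

/-- Over an infinite field a form is determined by its values, and on values the two substitutions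
visibly cancel. -/
theorem imageForm_symm_imageForm [Infinite K] (g : (Fin 4 → K) ≃ₗ[K] (Fin 4 → K))
    (F : MvPolynomial (Fin 4) K) : imageForm g.symm (imageForm g F) = F := by
  refine MvPolynomial.funext fun x => ?_
  simp [eval_imageForm]

theorem singAt_imageForm_iff [Infinite K] {g : (Fin 4 → K) ≃ₗ[K] (Fin 4 → K)}
    {F : MvPolynomial (Fin 4) K} {x : Fin 4 → K} :
    SingAt (imageForm g F) x ↔ SingAt F (g.symm x) := by
  refine ⟨fun h => ?_, SingAt.imageForm⟩
  have : SingAt (imageForm g F) (g.symm.symm (g.symm x)) := by simpa using h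
  simpa [imageForm_symm_imageForm] using this.imageForm

theorem isHomogeneous_imageForm (g : (Fin 4 → K) ≃ₗ[K] (Fin 4 → K)) {F : MvPolynomial (Fin 4) K}
    {n : ℕ} (hF : F.IsHomogeneous n) : (imageForm g F).IsHomogeneous n := by
  have := hF.aeval (S := K) (n := 1) (fun i => ∑ j, C (g.symm (Pi.single j 1) i) *
    (X j : MvPolynomial (Fin 4) K)) (fun i => IsHomogeneous.sum _ _ _ fun j _ => by
      simpa using (isHomogeneous_C (Fin 4) _).mul (isHomogeneous_X K j))
  rw [one_mul] at this
  exact this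

theorem singularSet_imageForm [Infinite K] (g : (Fin 4 → K) ≃ₗ[K] (Fin 4 → K))
    {F : MvPolynomial (Fin 4) K} {n : ℕ} (hF : F.IsHomogeneous n) :
    singularSet (imageForm g F) = imagePoints g (singularSet F) := by
  ext p
  induction p using Projectivization.ind with
  | h x hx =>
    rw [mk_mem_singularSet (isHomogeneous_imageForm g hF), singAt_imageForm_iff]
    constructor
    · intro h
      refine ⟨Projectivization.mk K (g.symm x) (by simpa using hx),
        (mk_mem_singularSet hF _).2 h, ?_⟩
      simp only [smul_mk_eq]
      simp
    · rintro ⟨q, hq, hqx⟩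
      induction q using Projectivization.ind with
      | h y hy =>
        simp only [smul_mk_eq] at hqx
        obtain ⟨c, hc⟩ := (Projectivization.mk_eq_mk_iff' K _ _ _ _).1 hqx
        rw [mk_mem_singularSet hF] at hq
        have hc0 : c ≠ 0 := by
          rintro rfl
          rw [zero_smul] at hc
          exact hy (by simpa using hc.symm)
        have : y = c • g.symm x := by
          apply g.injective; rw [map_smul, LinearEquiv.apply_symm_apply, hc]
        rw [this] at hq
        exact (singAt_smul_iff hF hc0).1 hq

theorem imageForm_ne_zero [Infinite K] (g : (Fin 4 → K) ≃ₗ[K] (Fin 4 → K))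
    {F : MvPolynomial (Fin 4) K} (hF : F ≠ 0) : imageForm g F ≠ 0 := by
  intro h
  apply hF
  rw [← imageForm_symm_imageForm g F, h]
  simp [imageForm]

theorem imagePoints_ncard (g : (Fin 4 → K) ≃ₗ[K] (Fin 4 → K)) (N : Set (ℙ K (Fin 4 → K))) :
    (imagePoints g N).ncard = N.ncard :=
  Set.ncard_image_of_injective _ (MulAction.injective g)

theorem IsKummerQuartic.imageForm [Infinite K] (g : (Fin 4 → K) ≃ₗ[K] (Fin 4 → K))
    {F : MvPolynomial (Fin 4) K} (hF : IsKummerQuartic F) : IsKummerQuartic (imageForm g F) :=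
  ⟨imageForm_ne_zero g hF.ne_zero, isHomogeneous_imageForm g hF.homogeneous, by
    rw [singularSet_imageForm g hF.homogeneous, imagePoints_ncard, hF.card_singular]⟩

/-- A linear substitution has no second-order part, so the Hessian changes by congruence. This makes
the rank, and hence the notion of node, projectively invariant. -/
theorem hess_imageForm (g : (Fin 4 → K) ≃ₗ[K] (Fin 4 → K)) (F : MvPolynomial (Fin 4) K)
    (x : Fin 4 → K) : hess (imageForm g F) x =
      (LinearMap.toMatrix' (g.symm : (Fin 4 → K) →ₗ[K] (Fin 4 → K))).transpose *
        hess F (g.symm x) * LinearMap.toMatrix' (g.symm : (Fin 4 → K) →ₗ[K] (Fin 4 → K)) := by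
  ext i j
  simp only [hess, Matrix.of_apply, Matrix.mul_apply, Matrix.transpose_apply,
    LinearMap.toMatrix'_apply, pderiv_imageForm, map_sum, Finset.sum_mul]
  refine Finset.sum_congr rfl fun k _ => ?_
  rw [pderiv_C_mul, pderiv_imageForm, map_mul, map_sum, Finset.mul_sum]
  refine Finset.sum_congr rfl fun l _ => ?_
  simp only [eval_imageForm, map_mul, eval_C, LinearEquiv.coe_coe]
  ring

theorem rank_hess_imageForm (g : (Fin 4 → K) ≃ₗ[K] (Fin 4 → K)) (F : MvPolynomial (Fin 4) K)
    (x : Fin 4 → K) : (hess (imageForm g F) x).rank = (hess F (g.symm x)).rank := by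
  have hu : IsUnit (LinearMap.toMatrix' (g.symm : (Fin 4 → K) →ₗ[K] (Fin 4 → K))).det := by
    rw [LinearMap.det_toMatrix']
    exact LinearEquiv.isUnit_det' g.symm
  rw [hess_imageForm, Matrix.rank_mul_eq_left_of_isUnit_det _ _ hu,
    Matrix.rank_mul_eq_right_of_isUnit_det _ _ (by rwa [Matrix.det_transpose])]

theorem rank_hess_smul {F : MvPolynomial (Fin 4) K} {n : ℕ} (hF : F.IsHomogeneous n)
    {c : K} (hc : c ≠ 0) (x : Fin 4 → K) : (hess F (c • x)).rank = (hess F x).rank := by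
  -- Second partial derivatives are homogeneous of degree `n - 1 - 1`, with truncated subtraction.
  -- The resulting power of `c` is nonzero in every case.
  have : hess F (c • x) = Matrix.diagonal (fun _ => c ^ (n - 1 - 1)) * hess F x := by
    ext i j
    simp only [hess, Matrix.of_apply, Matrix.diagonal_mul]
    rw [eval_smul_of_isHomogeneous hF.pderiv.pderiv]
  rw [this, Matrix.rank_mul_eq_right_of_isUnit_det]
  simp [Matrix.det_diagonal, hc]

theorem isNode_mk {F : MvPolynomial (Fin 4) K} {n : ℕ} (hF : F.IsHomogeneous n)
    {x : Fin 4 → K} (hx : x ≠ 0) :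
    IsNode F (Projectivization.mk K x hx) ↔ SingAt F x ∧ (hess F x).rank = 3 := by
  obtain ⟨c, hc⟩ := Projectivization.exists_smul_eq_mk_rep K x hx
  have h : (hess F (Projectivization.mk K x hx).rep).rank = (hess F x).rank := by
    rw [← hc]; exact rank_hess_smul hF (c := (c : K)) c.ne_zero x
  rw [IsNode, mk_mem_singularSet hF hx, ← h, hess]

theorem IsNode.imageForm [Infinite K] {F : MvPolynomial (Fin 4) K} {n : ℕ}
    (hF : F.IsHomogeneous n) (g : (Fin 4 → K) ≃ₗ[K] (Fin 4 → K)) {p : ℙ K (Fin 4 → K)}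
    (hp : IsNode F p) : IsNode (imageForm g F) (g • p) := by
  induction p using Projectivization.ind with
  | h x hx =>
    rw [isNode_mk hF] at hp
    rw [smul_mk_eq, isNode_mk (isHomogeneous_imageForm g hF), singAt_imageForm_iff,
      rank_hess_imageForm]
    simpa using hp

theorem imagePoints_symm (g : (Fin 4 → K) ≃ₗ[K] (Fin 4 → K)) (N : Set (ℙ K (Fin 4 → K))) :
    imagePoints g.symm (imagePoints g N) = N := by
  have h : ∀ p : ℙ K (Fin 4 → K), g.symm • g • p = p := fun p => inv_smul_smul g p
  simp [imagePoints, Set.image_image, h]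

end KummerQuartic

namespace KummerQuartic

variable {K : Type*} [Field K]

/-! ### The sixteen points of an orbit -/

/-- The four characters of `(ℤ/2)²`, whose elements are written in binary as `0, 1, 2, 3`. -/
def sgn (ν i : Fin 4) : ℤˣ :=
  ![![1, 1, 1, 1], ![1, -1, 1, -1], ![1, 1, -1, -1], ![1, -1, -1, 1]] ν i

theorem sgn_mul_sgn : ∀ ν ν' i : Fin 4, sgn ν i * sgn ν' i = sgn (ν ^^^ ν') i := by decide

theorem sgn_xor : ∀ ν i j : Fin 4, sgn ν (i ^^^ j) = sgn ν i * sgn ν j := by decide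

theorem xor_xor_self : ∀ i j : Fin 4, i ^^^ j ^^^ j = i := by decide

theorem xor_right_comm4 : ∀ i j k : Fin 4, i ^^^ j ^^^ k = i ^^^ (j ^^^ k) := by decide

/-- Translation of indices by `μ`. -/
def xorEquiv (μ : Fin 4) : Equiv.Perm (Fin 4) where
  toFun i := i ^^^ μ
  invFun i := i ^^^ μ
  left_inv i := xor_xor_self i μ
  right_inv i := xor_xor_self i μ

theorem sgn_cast_mul_self (ν i : Fin 4) : ((sgn ν i : ℤ) : K) * ((sgn ν i : ℤ) : K) = 1 := by
  rw [← Int.cast_mul, ← Units.val_mul, Int.units_mul_self]; simp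

/-- The elements `z ↦ (χ_ν(i) z_{i+μ})ᵢ` of the Heisenberg group. -/
def heis (K : Type*) [Field K] (m : Fin 4 × Fin 4) : (Fin 4 → K) ≃ₗ[K] (Fin 4 → K) where
  toFun z i := ((sgn m.2 i : ℤ) : K) * z (i ^^^ m.1)
  invFun z i := ((sgn m.2 (i ^^^ m.1) : ℤ) : K) * z (i ^^^ m.1)
  left_inv z := by
    funext i
    simp only [xor_xor_self]
    rw [← mul_assoc, sgn_cast_mul_self, one_mul]
  right_inv z := by
    funext i
    simp only [xor_xor_self]
    rw [← mul_assoc, sgn_cast_mul_self, one_mul]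
  map_add' x y := by funext i; simp [mul_add]
  map_smul' c x := by funext i; simp [mul_left_comm]

theorem heis_apply (m : Fin 4 × Fin 4) (z : Fin 4 → K) (i : Fin 4) :
    heis K m z i = ((sgn m.2 i : ℤ) : K) * z (i ^^^ m.1) := rfl

theorem heis_ne_zero (m : Fin 4 × Fin 4) {a : Fin 4 → K} (ha : a ≠ 0) : heis K m a ≠ 0 := by
  simpa using ha

theorem heis_mem (m : Fin 4 × Fin 4) : heis K m ∈ heisenbergGroup K := by
  refine ⟨xorEquiv m.1, ?_, sgn m.2, ?_, fun z i => rfl⟩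
  · change xorEquiv m.1 = 1 ∨ xorEquiv m.1 = _ ∨ xorEquiv m.1 = _ ∨ xorEquiv m.1 = _
    have : ∀ μ : Fin 4, xorEquiv μ = 1 ∨ xorEquiv μ = Equiv.swap 0 1 * Equiv.swap 2 3 ∨
      xorEquiv μ = Equiv.swap 0 2 * Equiv.swap 1 3 ∨
      xorEquiv μ = Equiv.swap 0 3 * Equiv.swap 1 2 := by decide
    exact this m.1
  · have : ∀ ν : Fin 4, ∏ i, sgn ν i = 1 := by decide
    exact this m.2

/-- A sign vector with product one is a global sign times one of the four characters, so the 32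
linear maps are the sixteen `heis K m` up to sign. -/
theorem exists_heis_of_mem {g : (Fin 4 → K) ≃ₗ[K] (Fin 4 → K)} (hg : g ∈ heisenbergGroup K) :
    ∃ (m : Fin 4 × Fin 4) (s : ℤˣ), ∀ z, g z = ((s : ℤ) : K) • heis K m z := by
  obtain ⟨σ, hσ, ε, hε, hg⟩ := hg
  have h1 : ∃ μ : Fin 4, ∀ i, σ i = i ^^^ μ := by
    rcases hσ with rfl | rfl | rfl | rfl
    · exact ⟨0, by decide⟩
    · exact ⟨1, by decide⟩
    · exact ⟨2, by decide⟩
    · exact ⟨3, by decide⟩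
  have h2 : ∀ ε : Fin 4 → ℤˣ, ∏ i, ε i = 1 → ∃ ν : Fin 4, ∃ s : ℤˣ, ∀ i, ε i = s * sgn ν i := by
    decide
  obtain ⟨μ, hμ⟩ := h1
  obtain ⟨ν, s, hs⟩ := h2 ε hε
  refine ⟨(μ, ν), s, fun z => ?_⟩
  funext i
  rw [hg, hs, hμ, Pi.smul_apply, heis_apply]
  push_cast
  simp [mul_assoc]

/-- The sixteen points of the orbit of `a`. -/
def orbitPt (a : Fin 4 → K) (ha : a ≠ 0) (m : Fin 4 × Fin 4) : ℙ K (Fin 4 → K) :=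
  Projectivization.mk K (heis K m a) (heis_ne_zero m ha)

theorem unit_cast_ne_zero (s : ℤˣ) : ((s : ℤ) : K) ≠ 0 := by
  rcases Int.units_eq_one_or s with rfl | rfl <;> simp

theorem kummerOrbit_eq_range (a : Fin 4 → K) (ha : Admissible a) :
    kummerOrbit a ha = Set.range (orbitPt a ha.ne_zero) := by
  ext p
  constructor
  · rintro ⟨⟨g, hg⟩, rfl⟩
    obtain ⟨m, s, hs⟩ := exists_heis_of_mem hg
    refine ⟨m, ?_⟩
    change _ = g • Projectivization.mk K a ha.ne_zero
    rw [smul_mk_eq]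
    exact (mk_eq_mk_of_smul _ _ (hs a)).symm
  · rintro ⟨m, rfl⟩
    exact ⟨⟨heis K m, heis_mem m⟩, smul_mk_eq _ _⟩

/-- The values `⟨a, T a⟩` for `T` in the Heisenberg group. -/
def heisForm (a : Fin 4 → K) (m : Fin 4 × Fin 4) : K :=
  ∑ i, ((sgn m.2 i : ℤ) : K) * (a i * a (i ^^^ m.1))

/-- Signed permutations are orthogonal, so up to a sign the product depends only on the difference
of the two indices: incidence within an orbit is translation invariant. -/
theorem heis_dotProduct (a : Fin 4 → K) (m n : Fin 4 × Fin 4) :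
    heis K m a ⬝ᵥ heis K n a =
      ((sgn (m.2 ^^^ n.2) m.1 : ℤ) : K) * heisForm a (m.1 ^^^ n.1, m.2 ^^^ n.2) := by
  rw [dotProduct, heisForm, Finset.mul_sum, ← Equiv.sum_comp (xorEquiv m.1)]
  refine Finset.sum_congr rfl fun i _ => ?_
  simp only [heis_apply, xorEquiv, Equiv.coe_fn_mk, xor_xor_self]
  rw [xor_right_comm4]
  have h : ((sgn m.2 (i ^^^ m.1) : ℤ) : K) * ((sgn n.2 (i ^^^ m.1) : ℤ) : K) =
      ((sgn (m.2 ^^^ n.2) m.1 : ℤ) : K) * ((sgn (m.2 ^^^ n.2) i : ℤ) : K) := by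
    rw [← Int.cast_mul, ← Units.val_mul, sgn_mul_sgn, sgn_xor, mul_comm, Units.val_mul,
      Int.cast_mul]
  linear_combination (a i * a (i ^^^ (m.1 ^^^ n.1))) * h

/-- For these six indices the signed permutation matrix is skew-symmetric; translating the summation
index by `m.1` negates the sum. -/
theorem heisForm_eq_zero (h2 : (2 : K) ≠ 0) (a : Fin 4 → K) {m : Fin 4 × Fin 4}
    (hm : sgn m.2 m.1 = -1) : heisForm a m = 0 := by
  have h : heisForm a m = - heisForm a m := by
    conv_lhs => rw [heisForm, ← Equiv.sum_comp (xorEquiv m.1)]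
    rw [heisForm, ← Finset.sum_neg_distrib]
    refine Finset.sum_congr rfl fun i _ => ?_
    simp only [xorEquiv, Equiv.coe_fn_mk, xor_xor_self, sgn_xor, hm]
    push_cast
    ring
  have : (2 : K) * heisForm a m = 0 := by linear_combination h
  exact (mul_eq_zero.1 this).resolve_left h2

/-- The ten remaining indices give the sum of squares, the differences of (III), and twice the six
expressions of (II). -/
theorem heisForm_ne_zero (h2 : (2 : K) ≠ 0) {a : Fin 4 → K} (ha : Admissible a)
    {m : Fin 4 × Fin 4} (hm : sgn m.2 m.1 = 1) : heisForm a m ≠ 0 := by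
  obtain ⟨-, s0, ⟨m1, m1'⟩, ⟨m2, m2'⟩, ⟨m3, m3'⟩, q1, q2, q3⟩ := ha
  simp only [Fin.sum_univ_four] at s0
  obtain ⟨μ, ν⟩ := m
  have key : ∀ {c d : K}, c ≠ 0 → d = 2 * c → d ≠ 0 := fun hc hd => by
    rw [hd]; exact mul_ne_zero h2 hc
  revert hm
  simp only [heisForm, Fin.sum_univ_four]
  fin_cases μ <;> fin_cases ν <;> simp [sgn]
  · exact fun h => s0 (by linear_combination h)
  · exact fun h => q2 (by linear_combination h)
  · exact fun h => q1 (by linear_combination h)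
  · exact fun h => q3 (by linear_combination h)
  · exact key m1 (by ring)
  · exact key m1' (by ring)
  · exact key m2 (by ring)
  · exact key m2' (by ring)
  · exact key m3 (by ring)
  · exact key m3' (by ring)

/-- The converse serves to transport admissibility within an orbit. Two vanishing coordinates would
make one of the sums in (II) vanish. -/
theorem admissible_of_heisForm {a : Fin 4 → K}
    (h : ∀ m : Fin 4 × Fin 4, sgn m.2 m.1 = 1 → heisForm a m ≠ 0) : Admissible a := by
  have h00 := h (0, 0) (by decide)
  have h01 := h (0, 1) (by decide)
  have h02 := h (0, 2) (by decide)
  have h03 := h (0, 3) (by decide)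
  have h10 := h (1, 0) (by decide)
  have h12 := h (1, 2) (by decide)
  have h20 := h (2, 0) (by decide)
  have h21 := h (2, 1) (by decide)
  have h30 := h (3, 0) (by decide)
  have h33 := h (3, 3) (by decide)
  simp [heisForm, Fin.sum_univ_four, sgn] at h00 h01 h02 h03 h10 h12 h20 h21 h30 h33
  refine ⟨?_, ?_, ⟨?_, ?_⟩, ⟨?_, ?_⟩, ⟨?_, ?_⟩, ?_, ?_, ?_⟩
  · intro i j hij ⟨hi, hj⟩
    fin_cases i <;> fin_cases j <;> simp_all
  · rw [Fin.sum_univ_four]; exact fun h => h00 (by linear_combination h)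
  · exact fun h => h10 (by linear_combination 2 * h)
  · exact fun h => h12 (by linear_combination 2 * h)
  · exact fun h => h20 (by linear_combination 2 * h)
  · exact fun h => h21 (by linear_combination 2 * h)
  · exact fun h => h30 (by linear_combination 2 * h)
  · exact fun h => h33 (by linear_combination 2 * h)
  · exact fun h => h02 (by linear_combination h)
  · exact fun h => h01 (by linear_combination h)
  · exact fun h => h03 (by linear_combination h)

/-- The point with index `m` lies on the plane with index `n`. -/
def oddPair (m n : Fin 4 × Fin 4) : Prop := sgn (m.2 ^^^ n.2) (m.1 ^^^ n.1) = -1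

instance : DecidableRel oddPair := fun _ _ => by unfold oddPair; infer_instance

theorem heis_dotProduct_eq_zero_iff (h2 : (2 : K) ≠ 0) {a : Fin 4 → K} (ha : Admissible a)
    (m n : Fin 4 × Fin 4) : heis K m a ⬝ᵥ heis K n a = 0 ↔ oddPair m n := by
  rw [heis_dotProduct, mul_eq_zero, or_iff_right (unit_cast_ne_zero _)]
  constructor
  · intro h
    by_contra h1
    exact heisForm_ne_zero h2 ha (m := (m.1 ^^^ n.1, m.2 ^^^ n.2))
      ((Int.units_eq_one_or _).resolve_right h1) h
  · exact fun h => heisForm_eq_zero h2 a h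

theorem mem_orthogonalPlane_mk {x : Fin 4 → K} (hx : x ≠ 0) (y : Fin 4 → K) :
    y ∈ orthogonalPlane (Projectivization.mk K x hx) ↔ x ⬝ᵥ y = 0 := by
  rw [orthogonalPlane, Projectivization.submodule_mk, Submodule.mem_orthogonalBilin_iff]
  constructor
  · exact fun h => h x (Submodule.mem_span_singleton_self x)
  · intro h z hz
    obtain ⟨c, rfl⟩ := Submodule.mem_span_singleton.1 hz
    simp [h]

theorem finrank_ker_dotProduct {x : Fin 4 → K} (hx : x ≠ 0) :
    Module.finrank K (LinearMap.ker (dotProductBilin K K x)) = 3 := by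
  have h : dotProductBilin K K x ≠ 0 := by
    intro h
    apply hx
    funext i
    simpa using LinearMap.congr_fun h (Pi.single i 1)
  have := Module.Dual.finrank_ker_add_one_of_ne_zero (f := dotProductBilin K K x) h
  simp at this
  exact this

theorem orthogonalPlane_mk {x : Fin 4 → K} (hx : x ≠ 0) :
    orthogonalPlane (Projectivization.mk K x hx) = LinearMap.ker (dotProductBilin K K x) := by
  ext y
  rw [mem_orthogonalPlane_mk]
  simp

theorem finrank_orthogonalPlane (p : ℙ K (Fin 4 → K)) :
    Module.finrank K (orthogonalPlane p) = 3 := by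
  induction p using Projectivization.ind with
  | h x hx => rw [orthogonalPlane_mk, finrank_ker_dotProduct hx]

section

variable (h2 : (2 : K) ≠ 0) {a : Fin 4 → K} (ha : Admissible a)

include h2

theorem orbitPt_le_iff (m n : Fin 4 × Fin 4) :
    (orbitPt a ha.ne_zero m).submodule ≤ orthogonalPlane (orbitPt a ha.ne_zero n) ↔
      oddPair n m := by
  rw [orbitPt, orbitPt, mk_submodule_le, mem_orthogonalPlane_mk,
    heis_dotProduct_eq_zero_iff h2 ha]

theorem orbitPt_injective : Function.Injective (orbitPt a ha.ne_zero) := by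
  intro m n h
  by_contra hmn
  -- Some plane of the configuration separates the two points.
  have : ∀ m n : Fin 4 × Fin 4, m ≠ n → ∃ k, oddPair k m ∧ ¬ oddPair k n := by decide
  obtain ⟨k, hk, hk'⟩ := this m n hmn
  rw [← orbitPt_le_iff h2 ha] at hk hk'
  exact hk' (h ▸ hk)

theorem orthogonalPlane_orbitPt_injective :
    Function.Injective fun m => orthogonalPlane (orbitPt a ha.ne_zero m) := by
  intro m n h
  by_contra hmn
  have : ∀ m n : Fin 4 × Fin 4, m ≠ n → ∃ k, oddPair m k ∧ ¬ oddPair n k := by decide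
  obtain ⟨k, hk, hk'⟩ := this m n hmn
  rw [← orbitPt_le_iff h2 ha] at hk hk'
  exact hk' ((show orthogonalPlane _ = orthogonalPlane _ from h) ▸ hk)

/-- By `orbitPt_le_iff` incidence is the relation `oddPair` on indices, so once points and planes
are known to be distinct every count is a finite check. -/
theorem isNondegenerateConfig_kummerOrbit :
    IsNondegenerateConfig (kummerOrbit a ha) (orthogonalPlanes (kummerOrbit a ha)) := by
  have hi := orbitPt_injective h2 ha
  have hi' := orthogonalPlane_orbitPt_injective h2 ha
  have hN : orthogonalPlanes (kummerOrbit a ha) =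
      Set.range fun m => orthogonalPlane (orbitPt a ha.ne_zero m) := by
    rw [orthogonalPlanes, kummerOrbit_eq_range, ← Set.range_comp]; rfl
  have count : ∀ {α : Type _} (f : Fin 4 × Fin 4 → α), Function.Injective f →
      ∀ (P : α → Prop) (s : Finset (Fin 4 × Fin 4)), (∀ m, P (f m) ↔ m ∈ s) →
      {x | x ∈ Set.range f ∧ P x}.ncard = s.card := by
    intro α f hf P s h
    have : {x | x ∈ Set.range f ∧ P x} = f '' s := by
      ext x
      constructor
      · rintro ⟨⟨m, rfl⟩, hm⟩; exact ⟨m, (h m).1 hm, rfl⟩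
      · rintro ⟨m, hm, rfl⟩; exact ⟨⟨m, rfl⟩, (h m).2 hm⟩
    rw [this, Set.ncard_image_of_injective _ hf, Set.ncard_coe_finset]
  rw [hN, kummerOrbit_eq_range]
  refine ⟨?_, ?_, ?_, ?_, ?_, ?_⟩
  · rintro _ ⟨m, rfl⟩; exact finrank_orthogonalPlane _
  · rw [Set.ncard_range_of_injective hi]; simp
  · rw [Set.ncard_range_of_injective hi']; simp
  · rintro _ ⟨m, rfl⟩
    rw [count _ hi' _ (Finset.univ.filter fun n => oddPair n m)
      (fun n => by rw [orbitPt_le_iff h2 ha]; simp)]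
    revert m; decide
  · rintro _ ⟨m, rfl⟩
    rw [count _ hi _ (Finset.univ.filter fun n => oddPair m n)
      (fun n => by rw [orbitPt_le_iff h2 ha]; simp)]
    revert m; decide
  · rintro _ ⟨m, rfl⟩ _ ⟨n, rfl⟩ hmn
    rw [count _ hi _ (Finset.univ.filter fun k => oddPair m k ∧ oddPair n k)
      (fun k => by rw [orbitPt_le_iff h2 ha, orbitPt_le_iff h2 ha]; simp)]
    have : ∀ m n : Fin 4 × Fin 4, m ≠ n →
      (Finset.univ.filter fun k => oddPair m k ∧ oddPair n k).card = 2 := by decide +kernel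
    exact this m n fun h => hmn (h ▸ rfl)

end

end KummerQuartic

namespace KummerQuartic

/-! ### Symmetric `2-(16, 6, 2)` designs -/

open scoped Classical in
/-- A symmetric `2-(16, 6, 2)` design, with incidence relation `I` of points and blocks. -/
structure IsBiplane {P B : Type*} [Fintype P] [Fintype B] (I : P → B → Prop) : Prop where
  card_points : Fintype.card P = 16
  card_blocks : Fintype.card B = 16
  through : ∀ p, (Finset.univ.filter fun b => I p b).card = 6
  on : ∀ b, (Finset.univ.filter fun p => I p b).card = 6
  meet : ∀ b b', b ≠ b' → (Finset.univ.filter fun p => I p b ∧ I p b').card = 2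

namespace IsBiplane

variable {P B : Type*} [Fintype P] [Fintype B] {I : P → B → Prop}

-- A variance argument. For fixed `p` let l(q) be the number of blocks through `p` and `q`. Counting
-- flags gives Σ l = 36 and Σ l² = 96, hence Σ (l - 2)² = 96 - 144 + 64 = 16. The term q = p already
-- contributes (6 - 2)² = 16, so all the others vanish.
open scoped Classical in
theorem join (h : IsBiplane I) {p q : P} (hpq : p ≠ q) :
    (Finset.univ.filter fun b => I p b ∧ I q b).card = 2 := by
  let i : P → B → ℤ := fun p b => if I p b then 1 else 0
  have hii : ∀ p b, i p b * i p b = i p b := fun p b => by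
    by_cases hb : I p b <;> simp [i, hb]
  let l : P → ℤ := fun q => ∑ b, i p b * i q b
  have hl : ∀ q, l q = ((Finset.univ.filter fun b => I p b ∧ I q b).card : ℤ) := by
    intro q
    simp only [l, i, Finset.card_filter]
    push_cast
    refine Finset.sum_congr rfl fun b _ => ?_
    by_cases h1 : I p b <;> by_cases h2 : I q b <;> simp [h1, h2]
  have hon : ∀ b, ∑ q, i q b = 6 := by
    intro b
    have := h.on b
    rw [Finset.card_filter] at this
    simp only [i]
    exact_mod_cast this
  have hthr : ∀ q, ∑ b, i q b = 6 := by
    intro q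
    have := h.through q
    rw [Finset.card_filter] at this
    simp only [i]
    exact_mod_cast this
  have hmeet : ∀ b b', ∑ q, i q b * i q b' = 2 + if b = b' then 4 else 0 := by
    intro b b'
    by_cases hb : b = b'
    · subst hb
      simp only [hii, hon, if_true]; norm_num
    · have := h.meet b b' hb
      rw [Finset.card_filter] at this
      simp only [hb, if_false, add_zero]
      have h2 : ∑ q, i q b * i q b' = ∑ q, if I q b ∧ I q b' then (1 : ℤ) else 0 := by
        refine Finset.sum_congr rfl fun q _ => ?_
        by_cases h1 : I q b <;> by_cases h2 : I q b' <;> simp [i, h1, h2]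
      rw [h2]
      exact_mod_cast this
  have hlp : l p = 6 := by simp only [l, hii, hthr]
  have s1 : ∑ q, l q = 36 := by
    simp only [l]
    rw [Finset.sum_comm]
    simp only [← Finset.mul_sum, hon, ← Finset.sum_mul, hthr]; norm_num
  have s2 : ∑ q, l q * l q = 96 := by
    have : ∀ q, l q * l q = ∑ b, ∑ b', i p b * i p b' * (i q b * i q b') := by
      intro q
      simp only [l, Finset.sum_mul_sum]
      refine Finset.sum_congr rfl fun b _ => Finset.sum_congr rfl fun b' _ => by ring
    simp only [this]
    rw [Finset.sum_comm]
    have h2 : ∀ b, ∑ q, ∑ b', i p b * i p b' * (i q b * i q b') = 16 * i p b := by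
      intro b
      rw [Finset.sum_comm]
      simp only [← Finset.mul_sum, hmeet, mul_add, Finset.sum_add_distrib, mul_ite, mul_zero,
        Finset.sum_ite_eq, Finset.mem_univ, if_true, hii, ← Finset.sum_mul, hthr]
      ring
    simp only [h2, ← Finset.mul_sum, hthr]; norm_num
  have hsum : ∑ q ∈ Finset.univ.erase p, (l q - 2) ^ 2 = 0 := by
    have hc : ((Finset.univ : Finset P).card : ℤ) = 16 := by
      rw [Finset.card_univ, h.card_points]; rfl
    have h1 : ∑ q, (l q - 2) ^ 2 = 16 := by
      have : ∀ q, (l q - 2) ^ 2 = l q * l q - 4 * l q + 4 := fun q => by ring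
      simp only [this, Finset.sum_add_distrib, Finset.sum_sub_distrib, ← Finset.mul_sum, s1, s2,
        Finset.sum_const, nsmul_eq_mul, hc]
      norm_num
    have h2 := Finset.add_sum_erase Finset.univ (fun q => (l q - 2) ^ 2) (Finset.mem_univ p)
    simp only [hlp] at h2
    rw [h1] at h2
    linarith
  have := (Finset.sum_eq_zero_iff_of_nonneg fun q _ => sq_nonneg _).1 hsum q
    (Finset.mem_erase.2 ⟨hpq.symm, Finset.mem_univ q⟩)
  have h3 : l q = 2 := by nlinarith
  rw [hl] at h3
  exact_mod_cast h3

theorem card_two_unique {α : Type*} {s : Finset α} (hs : s.card = 2) {x y z : α} (hx : x ∈ s)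
    (hy : y ∈ s) (hz : z ∈ s) (hyx : y ≠ x) (hzx : z ≠ x) : y = z := by
  classical
  obtain ⟨u, v, huv, rfl⟩ := Finset.card_eq_two.1 hs
  simp only [Finset.mem_insert, Finset.mem_singleton] at hx hy hz
  rcases hx with rfl | rfl <;> rcases hy with rfl | rfl <;> rcases hz with rfl | rfl <;> simp_all

theorem card_two_exists {α : Type*} {s : Finset α} (hs : s.card = 2) {x : α} (hx : x ∈ s) :
    ∃ y ∈ s, y ≠ x := by
  classical
  obtain ⟨u, v, huv, rfl⟩ := Finset.card_eq_two.1 hs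
  simp only [Finset.mem_insert, Finset.mem_singleton] at hx
  rcases hx with rfl | rfl
  · exact ⟨v, by simp, huv.symm⟩
  · exact ⟨u, by simp, huv⟩

theorem exists_block (h : IsBiplane I) {p q : P} (hpq : p ≠ q) {b : B} (hp : I p b) (hq : I q b) :
    ∃ b', b' ≠ b ∧ I p b' ∧ I q b' := by
  classical
  obtain ⟨b', hb', hne⟩ := card_two_exists (h.join hpq) (x := b) (by simp [hp, hq])
  exact ⟨b', hne, by simpa using hb'⟩

theorem block_unique (h : IsBiplane I) {p q : P} (hpq : p ≠ q) {b b' b'' : B} (hp : I p b)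
    (hq : I q b) (hp' : I p b') (hq' : I q b') (hp'' : I p b'') (hq'' : I q b'') (h' : b' ≠ b)
    (h'' : b'' ≠ b) : b' = b'' := by
  classical
  exact card_two_unique (h.join hpq) (x := b) (by simp [hp, hq]) (by simp [hp', hq'])
    (by simp [hp'', hq'']) h' h''

theorem exists_point (h : IsBiplane I) {b b' : B} (hb : b ≠ b') {p : P} (hp : I p b)
    (hp' : I p b') : ∃ q, q ≠ p ∧ I q b ∧ I q b' := by
  classical
  obtain ⟨q, hq, hne⟩ := card_two_exists (h.meet b b' hb) (x := p) (by simp [hp, hp'])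
  exact ⟨q, hne, by simpa using hq⟩

theorem point_unique (h : IsBiplane I) {b b' : B} (hb : b ≠ b') {p q r : P} (hp : I p b)
    (hp' : I p b') (hq : I q b) (hq' : I q b') (hr : I r b) (hr' : I r b') (hqp : q ≠ p)
    (hrp : r ≠ p) : q = r := by
  classical
  exact card_two_unique (h.meet b b' hb) (x := p) (by simp [hp, hp']) (by simp [hq, hq'])
    (by simp [hr, hr']) hqp hrp

/-- Two points of the block `w` are adjacent with respect to `x` if the second block through them
contains `x`. -/
def Adj (I : P → B → Prop) (w : B) (x a c : P) : Prop :=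
  a ≠ c ∧ I a w ∧ I c w ∧ ∃ b, b ≠ w ∧ I a b ∧ I c b ∧ I x b

omit [Fintype P] [Fintype B] in
theorem Adj.symm {w : B} {x a c : P} (h : Adj I w x a c) : Adj I w x c a := by
  obtain ⟨h1, h2, h3, b, h4, h5, h6, h7⟩ := h
  exact ⟨h1.symm, h3, h2, b, h4, h6, h5, h7⟩

theorem Adj.mem_block (hI : IsBiplane I) {w b : B} {x a c : P} (h : Adj I w x a c)
    (hb : b ≠ w) (ha : I a b) (hc : I c b) : I x b := by
  obtain ⟨h1, h2, h3, b', h4, h5, h6, h7⟩ := h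
  rwa [hI.block_unique h1 h2 h3 ha hc h5 h6 hb h4]

-- The points `x` and `a` lie on exactly two common blocks. Each meets `w` in `a` and one further
-- point, and these further points are the neighbours of `a`.
open scoped Classical in
theorem card_adj (hI : IsBiplane I) {w : B} {x a : P} (hx : ¬ I x w) (ha : I a w) :
    (Finset.univ.filter fun c => Adj I w x a c).card = 2 := by
  have hxa : x ≠ a := by rintro rfl; exact hx ha
  have h2 := hI.join hxa
  obtain ⟨b, b', hbb, hs⟩ := Finset.card_eq_two.1 h2
  have hb : I x b ∧ I a b := by
    have : b ∈ (Finset.univ.filter fun b => I x b ∧ I a b) := by rw [hs]; simp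
    simpa using this
  have hb' : I x b' ∧ I a b' := by
    have : b' ∈ (Finset.univ.filter fun b => I x b ∧ I a b) := by rw [hs]; simp
    simpa using this
  have hall : ∀ d, I x d → I a d → d = b ∨ d = b' := by
    intro d h1 h2
    have : d ∈ (Finset.univ.filter fun b => I x b ∧ I a b) := by simp [h1, h2]
    rw [hs] at this; simpa using this
  have hbw : b ≠ w := by rintro rfl; exact hx hb.1
  have hbw' : b' ≠ w := by rintro rfl; exact hx hb'.1
  obtain ⟨c, hca, hcb, hcw⟩ := hI.exists_point hbw hb.2 ha
  obtain ⟨c', hca', hcb', hcw'⟩ := hI.exists_point hbw' hb'.2 ha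
  have hcc : c ≠ c' := by
    rintro rfl
    exact hbb (hI.block_unique hca hcw ha hcb hb.2 hcb' hb'.2 hbw hbw')
  rw [Finset.card_eq_two]
  refine ⟨c, c', hcc, ?_⟩
  ext d
  simp only [Finset.mem_filter, Finset.mem_univ, true_and, Finset.mem_insert,
    Finset.mem_singleton]
  constructor
  · rintro ⟨h1, h2, h3, e, h4, h5, h6, h7⟩
    rcases hall e h7 h5 with rfl | rfl
    · exact Or.inl (hI.point_unique hbw hb.2 ha h6 h3 hcb hcw h1.symm hca)
    · exact Or.inr (hI.point_unique hbw' hb'.2 ha h6 h3 hcb' hcw' h1.symm hca')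
  · rintro (rfl | rfl)
    · exact ⟨hca.symm, ha, hcw, b, hbw, hb.2, hcb, hb.1⟩
    · exact ⟨hca'.symm, ha, hcw', b', hbw', hb'.2, hcb', hb'.1⟩

theorem adj_exists_other (hI : IsBiplane I) {w : B} {x a c : P} (hx : ¬ I x w)
    (h : Adj I w x a c) : ∃ d, d ≠ c ∧ Adj I w x a d := by
  classical
  obtain ⟨d, hd, hne⟩ := card_two_exists (hI.card_adj hx h.2.1) (x := c) (by simpa using h)
  exact ⟨d, hne, by simpa using hd⟩

theorem adj_unique (hI : IsBiplane I) {w : B} {x a c d e : P} (hx : ¬ I x w)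
    (hc : Adj I w x a c) (hd : Adj I w x a d) (he : Adj I w x a e) (hdc : d ≠ c) (hec : e ≠ c) :
    d = e := by
  classical
  exact card_two_unique (hI.card_adj hx hc.2.1) (x := c) (by simpa using hc) (by simpa using hd)
    (by simpa using he) hdc hec

theorem exists_adj_pair (hI : IsBiplane I) {w : B} {x a : P} (hx : ¬ I x w) (ha : I a w) :
    ∃ c d, c ≠ d ∧ Adj I w x a c ∧ Adj I w x a d := by
  classical
  obtain ⟨c, d, hcd, hs⟩ := Finset.card_eq_two.1 (hI.card_adj hx ha)
  have h1 : c ∈ (Finset.univ.filter fun c => Adj I w x a c) := by rw [hs]; simp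
  have h2 : d ∈ (Finset.univ.filter fun c => Adj I w x a c) := by rw [hs]; simp
  exact ⟨c, d, hcd, by simpa using h1, by simpa using h2⟩

/-- Distinct points outside `w` share exactly two edges. -/
theorem not_adj_three (hI : IsBiplane I) {x y : P} (hxy : x ≠ y)
    {b₁ b₂ b₃ : B} (h12 : b₁ ≠ b₂) (h13 : b₁ ≠ b₃) (h23 : b₂ ≠ b₃)
    (hx1 : I x b₁) (hx2 : I x b₂) (hx3 : I x b₃) (hy1 : I y b₁) (hy2 : I y b₂) (hy3 : I y b₃) :
    False :=
  h23 (hI.block_unique hxy hx1 hy1 hx2 hy2 hx3 hy3 h12.symm h13.symm)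

end IsBiplane

end KummerQuartic

/-! ### The forbidden pattern and hexagonal graphs -/

namespace KummerQuartic

namespace IsBiplane

variable {P B : Type*} [Fintype P] [Fintype B] {I : P → B → Prop}

/-- A pattern of incidences, contained in every design with a hexagon, that has no realization by
points and planes. -/
structure Pattern (I : P → B → Prop) (a₀ a₁ a₂ o c₀ c₂ x₀₀ x₀₁ x₁₀ : P)
    (w f₀ f₁ f₂ l₀ l₁ v₀₀ v₀₂ v₁₀ : B) : Prop where
  w_mem : I a₀ w ∧ I a₁ w ∧ I a₂ w ∧ I c₀ w ∧ I c₂ w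
  f₀_mem : I a₁ f₀ ∧ I a₂ f₀ ∧ I o f₀ ∧ I x₀₀ f₀ ∧ I x₀₁ f₀
  f₁_mem : I a₀ f₁ ∧ I a₂ f₁ ∧ I o f₁ ∧ I x₁₀ f₁
  f₂_mem : I a₀ f₂ ∧ I a₁ f₂ ∧ I o f₂
  l₀_mem : I c₂ l₀ ∧ I o l₀ ∧ I x₀₀ l₀ ∧ I x₁₀ l₀
  l₁_mem : I c₀ l₁ ∧ I c₂ l₁ ∧ I o l₁ ∧ I x₀₁ l₁
  v₀₀_mem : I a₀ v₀₀ ∧ I c₀ v₀₀ ∧ I x₀₁ v₀₀ ∧ I x₁₀ v₀₀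
  v₀₂_mem : I a₀ v₀₂ ∧ I c₂ v₀₂ ∧ I x₀₁ v₀₂ ∧ I x₀₀ v₀₂
  v₁₀_mem : I a₁ v₁₀ ∧ I c₀ v₁₀ ∧ I x₀₀ v₁₀ ∧ I x₁₀ v₁₀
  o_nmem : ¬ I o w ∧ ¬ I o v₀₀ ∧ ¬ I o v₀₂ ∧ ¬ I o v₁₀
  a_nmem : ¬ I a₀ f₀ ∧ ¬ I a₁ f₁ ∧ ¬ I a₂ f₂ ∧ ¬ I a₂ l₀ ∧ ¬ I a₂ l₁ ∧ ¬ I a₀ l₁ ∧ ¬ I a₀ v₁₀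
  c_nmem : ¬ I c₀ l₀ ∧ ¬ I c₀ f₂ ∧ ¬ I c₂ f₂ ∧ ¬ I c₀ f₀

/-- A labelling of the points of the block `w`, for which the graph of `x` is a hexagon. -/
structure IsHexagon (I : P → B → Prop) (w : B) (x : P) (h : Fin 6 → P) : Prop where
  inj : Function.Injective h
  mem : ∀ i, I (h i) w
  surj : ∀ c, I c w → ∃ i, h i = c
  adj : ∀ i, Adj I w x (h i) (h (i + 1))

omit [Fintype P] [Fintype B] in
theorem IsHexagon.rotate {w : B} {x : P} {h : Fin 6 → P} (hh : IsHexagon I w x h) (k : Fin 6) :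
    IsHexagon I w x fun i => h (i + k) where
  inj i j hij := by simpa using hh.inj hij
  mem i := hh.mem _
  surj c hc := by
    obtain ⟨i, rfl⟩ := hh.surj c hc
    exact ⟨i - k, by simp⟩
  adj i := by
    have := hh.adj (i + k)
    rwa [add_right_comm] at this

-- A 2-regular graph on six vertices with a component of more than three vertices is a hexagon,
-- since one or two vertices left over could not have two neighbours each.
open scoped Classical in
theorem exists_hexagon (hI : IsBiplane I) {w : B} {x u v t : P} (hx : ¬ I x w)
    (huv : Adj I w x u v) (hut : Adj I w x u t) (hvt : v ≠ t) (hn : ¬ Adj I w x v t) :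
    ∃ h : Fin 6 → P, IsHexagon I w x h := by
  have hw := hI.on w
  obtain ⟨v', hv'u, hv'⟩ := hI.adj_exists_other hx huv.symm
  obtain ⟨t', ht'u, ht'⟩ := hI.adj_exists_other hx hut.symm
  have huN : ∀ c, Adj I w x u c → c = v ∨ c = t := fun c hc => by
    by_contra! hcc
    exact hcc.2 (hI.adj_unique hx huv hc hut hcc.1 hvt.symm)
  have hvN : ∀ c, Adj I w x v c → c = u ∨ c = v' := fun c hc => by
    by_contra! hcc
    exact hcc.2 (hI.adj_unique hx huv.symm hc hv' hcc.1 hv'u)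
  have htN : ∀ c, Adj I w x t c → c = u ∨ c = t' := fun c hc => by
    by_contra! hcc
    exact hcc.2 (hI.adj_unique hx hut.symm hc ht' hcc.1 ht'u)
  have hv't : v' ≠ t := by rintro rfl; exact hn hv'
  have ht'v : t' ≠ v := by rintro rfl; exact hn ht'.symm
  have huv0 := huv.1
  have hut0 := hut.1
  have hvv' := hv'.1
  have htt' := ht'.1
  have hmem : ∀ {s : Finset P}, (∀ c ∈ s, I c w) → s.card ≤ 6 := fun {s} hs => by
    rw [← hw]; exact Finset.card_le_card fun c hc => by simpa using hs c hc
  -- Otherwise `u`, `v`, `v'`, `t` form a quadrilateral, and a further vertex with its two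
  -- neighbours makes seven points on `w`.
  have hvt' : v' ≠ t' := by
    rintro rfl
    have h4N : ∀ c, Adj I w x v' c → c = v ∨ c = t := fun c hc => by
      by_contra! hcc
      exact hcc.2 (hI.adj_unique hx hv'.symm hc ht'.symm hcc.1 hvt.symm)
    obtain ⟨s, hs, hs4⟩ : ∃ s ∈ (Finset.univ.filter fun p => I p w), s ∉ ({u, v, v', t} : Finset P) :=
      Finset.exists_mem_notMem_of_card_lt_card (by
        rw [hw]; exact lt_of_le_of_lt (Finset.card_le_four) (by norm_num))
    simp only [Finset.mem_filter, Finset.mem_univ, true_and] at hs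
    simp only [Finset.mem_insert, Finset.mem_singleton, not_or] at hs4
    obtain ⟨c, d, hcd, hc, hd⟩ := hI.exists_adj_pair hx hs
    have key : ∀ c, Adj I w x s c → c ≠ u ∧ c ≠ v ∧ c ≠ v' ∧ c ≠ t := by
      intro c hc
      refine ⟨?_, ?_, ?_, ?_⟩ <;> rintro rfl
      · rcases huN _ hc.symm with h | h <;> simp_all
      · rcases hvN _ hc.symm with h | h <;> simp_all
      · rcases h4N _ hc.symm with h | h <;> simp_all
      · rcases htN _ hc.symm with h | h <;> simp_all
    have kc := key c hc
    have kd := key d hd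
    have : ({u, v, v', t, s, c, d} : Finset P).card = 7 := by
      have := hc.1
      have := hd.1
      have h1 := hs4.1
      have h2 := hs4.2.1
      have h3 := hs4.2.2.1
      have h4 := hs4.2.2.2
      rw [Finset.card_insert_of_notMem, Finset.card_insert_of_notMem,
        Finset.card_insert_of_notMem, Finset.card_insert_of_notMem, Finset.card_insert_of_notMem,
        Finset.card_pair hcd] <;> simp only [Finset.mem_insert, Finset.mem_singleton] <;> grind
    have h6 := hmem (s := {u, v, v', t, s, c, d}) (by
      simp only [Finset.mem_insert, Finset.mem_singleton]
      rintro e (rfl | rfl | rfl | rfl | rfl | rfl | rfl)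
      exacts [huv.2.1, huv.2.2.1, hv'.2.2.1, hut.2.2.1, hs, hc.2.2.1, hd.2.2.1])
    omega
  have h5 : ({v', v, u, t, t'} : Finset P).card = 5 := by
    rw [Finset.card_insert_of_notMem, Finset.card_insert_of_notMem,
        Finset.card_insert_of_notMem, Finset.card_pair htt'] <;>
      simp only [Finset.mem_insert, Finset.mem_singleton] <;> grind
  obtain ⟨s, hs, hs5⟩ : ∃ s ∈ (Finset.univ.filter fun p => I p w),
      s ∉ ({v', v, u, t, t'} : Finset P) :=
    Finset.exists_mem_notMem_of_card_lt_card (by rw [hw, h5]; norm_num)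
  have h6 : insert s ({v', v, u, t, t'} : Finset P) = (Finset.univ.filter fun p => I p w) := by
    apply Finset.eq_of_subset_of_card_le
    · intro e he
      simp only [Finset.mem_insert, Finset.mem_singleton] at he
      simp only [Finset.mem_filter, Finset.mem_univ, true_and] at hs ⊢
      rcases he with rfl | rfl | rfl | rfl | rfl | rfl
      exacts [hs, hv'.2.2.1, huv.2.2.1, huv.2.1, hut.2.2.1, ht'.2.2.1]
    · rw [hw, Finset.card_insert_of_notMem hs5, h5]
  have hall : ∀ c, I c w → c = s ∨ c = v' ∨ c = v ∨ c = u ∨ c = t ∨ c = t' := by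
    intro c hc
    have : c ∈ insert s ({v', v, u, t, t'} : Finset P) := by rw [h6]; simpa using hc
    simpa using this
  simp only [Finset.mem_filter, Finset.mem_univ, true_and] at hs
  simp only [Finset.mem_insert, Finset.mem_singleton, not_or] at hs5
  obtain ⟨c, d, hcd, hc, hd⟩ := hI.exists_adj_pair hx hs
  -- The inner vertices `v`, `u`, `t` of the path have both neighbours on the path, so the sixth
  -- vertex can only be joined to its two ends.
  have key : ∀ c, Adj I w x s c → c = v' ∨ c = t' := by
    intro c hc
    have h0 := hc.1
    rcases hall c hc.2.2.1 with rfl | rfl | rfl | rfl | rfl | rfl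
    · exact absurd rfl h0
    · exact Or.inl rfl
    · rcases hvN _ hc.symm with h | h <;> simp_all
    · rcases huN _ hc.symm with h | h <;> simp_all
    · rcases htN _ hc.symm with h | h <;> simp_all
    · exact Or.inr rfl
  have hsv : Adj I w x s v' ∧ Adj I w x s t' := by
    rcases key c hc with rfl | rfl <;> rcases key d hd with rfl | rfl
    · exact absurd rfl hcd
    · exact ⟨hc, hd⟩
    · exact ⟨hd, hc⟩
    · exact absurd rfl hcd
  refine ⟨![s, v', v, u, t, t'], ?_, ?_, ?_, ?_⟩
  · rw [← List.nodup_ofFn]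
    simp
    grind
  · intro i
    fin_cases i
    exacts [hs, hv'.2.2.1, huv.2.2.1, huv.2.1, hut.2.2.1, ht'.2.2.1]
  · intro c hc
    rcases hall c hc with rfl | rfl | rfl | rfl | rfl | rfl
    exacts [⟨0, rfl⟩, ⟨1, rfl⟩, ⟨2, rfl⟩, ⟨3, rfl⟩, ⟨4, rfl⟩, ⟨5, rfl⟩]
  · intro i
    fin_cases i
    exacts [hsv.1, hv'.symm, huv.symm, hut, ht', hsv.2.symm]

end IsBiplane

end KummerQuartic

/-! ### Chords of a hexagon and the pattern they force -/

namespace KummerQuartic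

namespace IsBiplane

variable {P B : Type*} [Fintype P] [Fintype B] {I : P → B → Prop}

theorem mem_pair_of_block (hI : IsBiplane I) {w b : B} {a c e : P} (hac : a ≠ c) (ha : I a w)
    (hc : I c w) (hb : b ≠ w) (hab : I a b) (hcb : I c b) (he : I e w) (heb : I e b) :
    e = a ∨ e = c := by
  by_contra! h
  exact h.2 (hI.point_unique hb hab ha heb he hcb hc h.1 hac.symm)

omit [Fintype P] [Fintype B] in
theorem not_mem_block_of_not_adj {w b : B} {x a c : P} (hac : a ≠ c) (ha : I a w)
    (hc : I c w) (hb : b ≠ w) (hab : I a b) (hcb : I c b) (h : ¬ Adj I w x a c) : ¬ I x b :=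
  fun hxb => h ⟨hac, ha, hc, b, hb, hab, hcb, hxb⟩

/-- The graphs of two points outside `w` do not share three edges. -/
theorem not_three_edges (hI : IsBiplane I) {w : B} {x y : P} (hxy : x ≠ y) {h : Fin 6 → P}
    (hh : Function.Injective h) {i₁ j₁ i₂ j₂ i₃ j₃ : Fin 6}
    (h12 : i₁ ≠ i₂ ∧ i₁ ≠ j₂) (h13 : i₁ ≠ i₃ ∧ i₁ ≠ j₃) (h23 : i₂ ≠ i₃ ∧ i₂ ≠ j₃)
    (hx1 : Adj I w x (h i₁) (h j₁)) (hy1 : Adj I w y (h i₁) (h j₁))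
    (hx2 : Adj I w x (h i₂) (h j₂)) (hy2 : Adj I w y (h i₂) (h j₂))
    (hx3 : Adj I w x (h i₃) (h j₃)) (hy3 : Adj I w y (h i₃) (h j₃)) : False := by
  obtain ⟨n1, m1, m1', b₁, c1, d1, e1, f1⟩ := id hx1
  obtain ⟨n2, m2, m2', b₂, c2, d2, e2, f2⟩ := id hx2
  obtain ⟨n3, m3, m3', b₃, c3, d3, e3, f3⟩ := id hx3
  have k : ∀ {i j k : Fin 6} {b b' : B}, k ≠ i ∧ k ≠ j → h i ≠ h j → I (h i) w → I (h j) w →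
      b ≠ w → I (h i) b → I (h j) b → I (h k) w → I (h k) b' → b' ≠ b := by
    rintro i j k b b' ⟨hk, hk'⟩ hij hi hj hb hib hjb hkw hkb rfl
    rcases hI.mem_pair_of_block hij hi hj hb hib hjb hkw hkb with h' | h'
    · exact hk (hh h')
    · exact hk' (hh h')
  exact hI.not_adj_three hxy (k h12 n2 m2 m2' c2 d2 e2 m1 d1) (k h13 n3 m3 m3' c3 d3 e3 m1 d1)
    (k h23 n3 m3 m3' c3 d3 e3 m2 d2) f1 f2 f3 (hy1.mem_block hI c1 d1 e1)
    (hy2.mem_block hI c2 d2 e2) (hy3.mem_block hI c3 d3 e3)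

/-- The graph of `y` contains the edges `01`, `23` and no other side of the hexagon. -/
structure IsChord (I : P → B → Prop) (w : B) (h : Fin 6 → P) (y : P) : Prop where
  nmem : ¬ I y w
  a01 : Adj I w y (h 0) (h 1)
  a23 : Adj I w y (h 2) (h 3)
  n12 : ¬ Adj I w y (h 1) (h 2)
  n34 : ¬ Adj I w y (h 3) (h 4)
  n45 : ¬ Adj I w y (h 4) (h 5)
  n50 : ¬ Adj I w y (h 5) (h 0)

/-- The graph of the chord `y` consists of the triangles `014` and `235`. -/
structure IsTri (I : P → B → Prop) (w : B) (h : Fin 6 → P) (y : P) : Prop where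
  chord : IsChord I w h y
  a40 : Adj I w y (h 4) (h 0)
  a41 : Adj I w y (h 4) (h 1)
  a52 : Adj I w y (h 5) (h 2)
  a53 : Adj I w y (h 5) (h 3)

/-- The graph of the chord `y` is the hexagon `015324`. -/
structure IsHex (I : P → B → Prop) (w : B) (h : Fin 6 → P) (y : P) : Prop where
  chord : IsChord I w h y
  a40 : Adj I w y (h 4) (h 0)
  a42 : Adj I w y (h 4) (h 2)
  a51 : Adj I w y (h 5) (h 1)
  a53 : Adj I w y (h 5) (h 3)

/-- Take for `y` the second common point of the blocks that give the sides 01 and 23. These are the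
only blocks shared by `x` and `y`, so the graph of `y` contains no other side. -/
theorem IsHexagon.exists_chord (hI : IsBiplane I) {w : B} {x : P} {h : Fin 6 → P}
    (hh : IsHexagon I w x h) : ∃ y, IsChord I w h y := by
  have e : ∀ i j, h i = h j ↔ i = j := fun i j => hh.inj.eq_iff
  have h01 : Adj I w x (h 0) (h 1) := hh.adj 0
  have h12 : Adj I w x (h 1) (h 2) := hh.adj 1
  have h23 : Adj I w x (h 2) (h 3) := hh.adj 2
  have h34 : Adj I w x (h 3) (h 4) := hh.adj 3
  have h45 : Adj I w x (h 4) (h 5) := hh.adj 4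
  have h50 : Adj I w x (h 5) (h 0) := hh.adj 5
  obtain ⟨n1, m1, m1', b, c1, d1, e1, f1⟩ := id h01
  obtain ⟨n2, m2, m2', b', c2, d2, e2, f2⟩ := id h23
  have hbb : b ≠ b' := by
    rintro rfl
    rcases hI.mem_pair_of_block n1 m1 m1' c1 d1 e1 m2 d2 with h' | h' <;> simp [e] at h'
  obtain ⟨y, hyx, hyb, hyb'⟩ := hI.exists_point hbb f1 f2
  have a01 : Adj I w y (h 0) (h 1) := ⟨n1, m1, m1', b, c1, d1, e1, hyb⟩
  have a23 : Adj I w y (h 2) (h 3) := ⟨n2, m2, m2', b', c2, d2, e2, hyb'⟩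
  refine ⟨y, ⟨?_, a01, a23, ?_, ?_, ?_, ?_⟩⟩
  · intro hy
    rcases hI.mem_pair_of_block n1 m1 m1' c1 d1 e1 hy hyb with rfl | rfl <;>
    rcases hI.mem_pair_of_block n2 m2 m2' c2 d2 e2 hy hyb' with h' | h' <;> simp [e] at h'
  · intro h'
    exact hI.not_three_edges (i₁ := 0) (j₁ := 1) (i₂ := 3) (j₂ := 2) (i₃ := 1) (j₃ := 2)
      hyx hh.inj (by decide) (by decide) (by decide) a01 h01 a23.symm h23.symm h' h12
  · intro h'
    exact hI.not_three_edges (i₁ := 0) (j₁ := 1) (i₂ := 2) (j₂ := 3) (i₃ := 3) (j₃ := 4)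
      hyx hh.inj (by decide) (by decide) (by decide) a01 h01 a23 h23 h' h34
  · intro h'
    exact hI.not_three_edges (i₁ := 0) (j₁ := 1) (i₂ := 2) (j₂ := 3) (i₃ := 4) (j₃ := 5)
      hyx hh.inj (by decide) (by decide) (by decide) a01 h01 a23 h23 h' h45
  · intro h'
    exact hI.not_three_edges (i₁ := 1) (j₁ := 0) (i₂ := 2) (j₂ := 3) (i₃ := 5) (j₃ := 0)
      hyx hh.inj (by decide) (by decide) (by decide) a01.symm h01.symm a23 h23 h' h50

-- 2-regularity as linear equations between edge indicators, the form in which linear arithmetic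
-- settles the later case distinctions.
open scoped Classical in
theorem sum_adj (hI : IsBiplane I) {w : B} {y : P} {h : Fin 6 → P} (hy : ¬ I y w)
    (hinj : Function.Injective h) (hmem : ∀ i, I (h i) w) (hsurj : ∀ c, I c w → ∃ i, h i = c)
    (i : Fin 6) : ∑ j, (if Adj I w y (h i) (h j) then 1 else 0) = 2 := by
  rw [← Finset.card_filter, ← hI.card_adj hy (hmem i)]
  refine Finset.card_bij (fun j _ => h j) (fun j hj => by simpa using hj)
    (fun j _ k _ hjk => hinj hjk) fun c hc => ?_
  simp only [Finset.mem_filter, Finset.mem_univ, true_and] at hc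
  obtain ⟨j, rfl⟩ := hsurj c hc.2.2.1
  exact ⟨j, by simpa using hc, rfl⟩

/-- The excluded sides leave only 0, 1, 2 as neighbours of 4 and only 1, 2, 3 as neighbours of 5.
The degree equations then have exactly two solutions. -/
theorem IsChord.tri_or_hex (hI : IsBiplane I) {w : B} {x y : P} {h : Fin 6 → P}
    (hh : IsHexagon I w x h) (hy : IsChord I w h y) : IsTri I w h y ∨ IsHex I w h y := by
  classical
  let e : Fin 6 → Fin 6 → ℕ := fun i j => if Adj I w y (h i) (h j) then 1 else 0
  have hs : ∀ i, e i 0 + e i 1 + e i 2 + e i 3 + e i 4 + e i 5 = 2 := fun i => by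
    have := hI.sum_adj hy.nmem hh.inj hh.mem hh.surj i
    rwa [Fin.sum_univ_six] at this
  have sym : ∀ i j, e i j = e j i := fun i j => by
    simp only [e]
    by_cases hij : Adj I w y (h i) (h j)
    · simp [hij, hij.symm]
    · have : ¬ Adj I w y (h j) (h i) := fun h' => hij h'.symm
      simp [hij, this]
  have dg : ∀ i, e i i = 0 := fun i => by
    have : ¬ Adj I w y (h i) (h i) := fun h' => h'.1 rfl
    simp [e, this]
  have one : ∀ i j, e i j = 1 ↔ Adj I w y (h i) (h j) := fun i j => by simp [e]
  have zero : ∀ i j, ¬ Adj I w y (h i) (h j) → e i j = 0 := fun i j hij => by simp [e, hij]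
  have le : ∀ i j, e i j ≤ 1 := fun i j => by simp only [e]; split_ifs <;> simp
  have e01 := (one 0 1).2 hy.a01
  have e23 := (one 2 3).2 hy.a23
  have e12 := zero 1 2 hy.n12
  have e34 := zero 3 4 hy.n34
  have e45 := zero 4 5 hy.n45
  have e50 := zero 5 0 hy.n50
  have s0 := hs 0
  have s1 := hs 1
  have s2 := hs 2
  have s3 := hs 3
  have s4 := hs 4
  have s5 := hs 5
  rw [dg, sym 0 4, sym 0 5] at s0
  rw [dg, sym 1 0, sym 1 4, sym 1 5] at s1
  rw [dg, sym 2 0, sym 2 1, sym 2 4, sym 2 5] at s2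
  rw [dg, sym 3 0, sym 3 1, sym 3 2, sym 3 5] at s3
  rw [dg, sym 4 3] at s4
  rw [dg, sym 5 4] at s5
  have key : (e 4 0 = 1 ∧ e 4 1 = 1 ∧ e 5 2 = 1 ∧ e 5 3 = 1) ∨
      (e 4 0 = 1 ∧ e 4 2 = 1 ∧ e 5 1 = 1 ∧ e 5 3 = 1) := by
    have := le 4 0; have := le 4 1; have := le 4 2; have := le 5 1; have := le 5 2
    have := le 5 3
    omega
  rcases key with ⟨h1, h2, h3, h4⟩ | ⟨h1, h2, h3, h4⟩
  · exact Or.inl ⟨hy, (one _ _).1 h1, (one _ _).1 h2, (one _ _).1 h3, (one _ _).1 h4⟩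
  · exact Or.inr ⟨hy, (one _ _).1 h1, (one _ _).1 h2, (one _ _).1 h3, (one _ _).1 h4⟩

/-- The two graphs would share the three edges 40, 15 and 53. -/
theorem not_hex_hex_one (hI : IsBiplane I) {w : B} {x y y' : P} {h : Fin 6 → P}
    (hh : IsHexagon I w x h) (hy : IsHex I w h y) (hy' : IsHex I w (fun i => h (i + 1)) y') :
    False := by
  have hne : y ≠ y' := by rintro rfl; exact hy.chord.n12 hy'.chord.a01
  exact hI.not_three_edges (i₁ := 4) (j₁ := 0) (i₂ := 1) (j₂ := 5) (i₃ := 5) (j₃ := 3)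
    hne hh.inj (by decide) (by decide) (by decide) hy.a40 hy'.a53.symm hy.a51.symm hy'.a40.symm
    hy.a53 hy'.a42

/-- The two graphs would share the three edges 23, 40 and 51. -/
theorem not_hex_hex_two (hI : IsBiplane I) {w : B} {x y y' : P} {h : Fin 6 → P}
    (hh : IsHexagon I w x h) (hy : IsHex I w h y) (hy' : IsHex I w (fun i => h (i + 2)) y') :
    False := by
  have hne : y ≠ y' := by rintro rfl; exact hy.chord.n45 hy'.chord.a23
  exact hI.not_three_edges (i₁ := 2) (j₁ := 3) (i₂ := 4) (j₂ := 0) (i₃ := 5) (j₃ := 1)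
    hne hh.inj (by decide) (by decide) (by decide) hy.chord.a23 hy'.chord.a01 hy.a40 hy'.a42.symm
    hy.a51 hy'.a53.symm

/-- Besides `w`, the pattern uses only second blocks `β i j` through pairs of points of `w`. An
incidence of `x` or of a chord with such a block is an edge of its graph, and a non-incidence is a
non-edge. -/
theorem IsHexagon.exists_pattern_of_tri (hI : IsBiplane I) {w : B} {x y₀ y₃ y₅ : P}
    {h : Fin 6 → P} (hh : IsHexagon I w x h)
    (h0 : IsTri I w h y₀) (h3 : IsTri I w (fun i => h (i + 3)) y₃)
    (h5 : IsTri I w (fun i => h (i + 5)) y₅) :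
    ∃ a₀ a₁ a₂ o c₀ c₂ x₀₀ x₀₁ x₁₀ w f₀ f₁ f₂ l₀ l₁ v₀₀ v₀₂ v₁₀,
      Pattern I a₀ a₁ a₂ o c₀ c₂ x₀₀ x₀₁ x₁₀ w f₀ f₁ f₂ l₀ l₁ v₀₀ v₀₂ v₁₀ := by
  have e : ∀ i j, h i = h j ↔ i = j := fun i j => hh.inj.eq_iff
  have hb : ∀ i j : Fin 6, i ≠ j → ∃ b, b ≠ w ∧ I (h i) b ∧ I (h j) b := fun i j hij =>
    hI.exists_block (hh.inj.ne hij) (hh.mem i) (hh.mem j)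
  have : Nonempty B := ⟨w⟩
  choose! β hβ hβ1 hβ2 using hb
  have mem : ∀ {z i j}, Adj I w z (h i) (h j) → I z (β i j) := by
    intro z i j hz
    have hij : i ≠ j := fun hij => hz.1 (hij ▸ rfl)
    exact hz.mem_block hI (hβ i j hij) (hβ1 i j hij) (hβ2 i j hij)
  have nmem : ∀ {k i j}, i ≠ j → k ≠ i → k ≠ j → ¬ I (h k) (β i j) := by
    intro k i j hij hki hkj hk
    rcases hI.mem_pair_of_block (hh.inj.ne hij) (hh.mem i) (hh.mem j) (hβ i j hij) (hβ1 i j hij)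
      (hβ2 i j hij) (hh.mem k) hk with h' | h'
    · exact hki ((e _ _).1 h')
    · exact hkj ((e _ _).1 h')
  have h3c := h3.chord
  have h5c := h5.chord
  have hx23 : Adj I w x (h 2) (h 3) := hh.adj 2
  have hx12 : Adj I w x (h 1) (h 2) := hh.adj 1
  have hx34 : Adj I w x (h 3) (h 4) := hh.adj 3
  have hx50 : Adj I w x (h 5) (h 0) := hh.adj 5
  have n3 : ∀ {i j : Fin 6}, i ≠ j → ¬ Adj I w y₃ (h i) (h j) → ¬ I y₃ (β i j) := fun hij hn =>
    not_mem_block_of_not_adj (hh.inj.ne hij) (hh.mem _) (hh.mem _) (hβ _ _ hij) (hβ1 _ _ hij)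
      (hβ2 _ _ hij) hn
  have h3n : ¬ Adj I w y₃ (h 3) (h 5) := by
    intro h'
    have := hI.adj_unique h3c.nmem (c := h 4) (d := h 1) (e := h 5) h3c.a01 h3.a40.symm h'
      (by simp [e]) (by simp [e])
    simp [e] at this
  -- The chord `y₃` plays `o`. Its triangles are 341 and 502: the first supplies `a₀`, `a₁`, `a₂`,
  -- the second `c₀` and `c₂`.
  refine ⟨h 3, h 1, h 4, y₃, h 2, h 5, y₅, y₀, x, w, β 1 4, β 3 4, β 1 3, β 5 0, β 2 5, β 2 3,
    β 3 5, β 1 2, ?_⟩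
  constructor
  · exact ⟨hh.mem _, hh.mem _, hh.mem _, hh.mem _, hh.mem _⟩
  · exact ⟨hβ1 1 4 (by decide), hβ2 1 4 (by decide), mem h3.a41, mem h5.a52.symm,
      mem h0.a41.symm⟩
  · exact ⟨hβ1 3 4 (by decide), hβ2 3 4 (by decide), mem h3c.a01, mem hx34⟩
  · exact ⟨hβ2 1 3 (by decide), hβ1 1 3 (by decide), mem h3.a40⟩
  · exact ⟨hβ1 5 0 (by decide), mem h3c.a23, mem h5c.a01, mem hx50⟩
  · exact ⟨hβ1 2 5 (by decide), hβ2 2 5 (by decide), mem h3.a52, mem h0.a52.symm⟩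
  · exact ⟨hβ2 2 3 (by decide), hβ1 2 3 (by decide), mem h0.chord.a23, mem hx23⟩
  · exact ⟨hβ1 3 5 (by decide), hβ2 3 5 (by decide), mem h0.a53.symm, mem h5.a40⟩
  · exact ⟨hβ1 1 2 (by decide), hβ2 1 2 (by decide), mem h5c.a23, mem hx12⟩
  · exact ⟨h3c.nmem, n3 (by decide) (fun h' => h3c.n50 h'), n3 (by decide) h3n,
      n3 (by decide) (fun h' => h3c.n45 h')⟩
  · exact ⟨nmem (by decide) (by decide) (by decide), nmem (by decide) (by decide) (by decide),
      nmem (by decide) (by decide) (by decide), nmem (by decide) (by decide) (by decide),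
      nmem (by decide) (by decide) (by decide), nmem (by decide) (by decide) (by decide),
      nmem (by decide) (by decide) (by decide)⟩
  · exact ⟨nmem (by decide) (by decide) (by decide), nmem (by decide) (by decide) (by decide),
      nmem (by decide) (by decide) (by decide), nmem (by decide) (by decide) (by decide)⟩

/-- A design in which some graph is a hexagon contains the pattern `Pattern`. -/
theorem IsHexagon.exists_pattern (hI : IsBiplane I) {w : B} {x : P} {h : Fin 6 → P}
    (hh : IsHexagon I w x h) :
    ∃ a₀ a₁ a₂ o c₀ c₂ x₀₀ x₀₁ x₁₀ w f₀ f₁ f₂ l₀ l₁ v₀₀ v₀₂ v₁₀,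
      Pattern I a₀ a₁ a₂ o c₀ c₂ x₀₀ x₀₁ x₁₀ w f₀ f₁ f₂ l₀ l₁ v₀₀ v₀₂ v₁₀ := by
  have key : ∀ k : Fin 6, (∃ y, IsTri I w (fun i => h (i + k)) y) ∨
      ∃ y, IsHex I w (fun i => h (i + k)) y := by
    intro k
    obtain ⟨y, hy⟩ := (hh.rotate k).exists_chord hI
    exact (hy.tri_or_hex hI (hh.rotate k)).imp (fun h => ⟨y, h⟩) (fun h => ⟨y, h⟩)
  have fin : ∀ k : Fin 6, (∃ y, IsTri I w (fun i => h (i + k)) y) →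
      (∃ y, IsTri I w (fun i => h (i + (3 + k))) y) →
      (∃ y, IsTri I w (fun i => h (i + (5 + k))) y) →
      ∃ a₀ a₁ a₂ o c₀ c₂ x₀₀ x₀₁ x₁₀ w f₀ f₁ f₂ l₀ l₁ v₀₀ v₀₂ v₁₀,
      Pattern I a₀ a₁ a₂ o c₀ c₂ x₀₀ x₀₁ x₁₀ w f₀ f₁ f₂ l₀ l₁ v₀₀ v₀₂ v₁₀ := by
    rintro k ⟨y0, h0⟩ ⟨y3, h3⟩ ⟨y5, h5⟩
    simp only [← add_assoc] at h3 h5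
    exact (hh.rotate k).exists_pattern_of_tri hI h0 h3 h5
  by_cases hH : ∃ k : Fin 6, ∃ y, IsHex I w (fun i => h (i + k)) y
  · obtain ⟨k, y, hy⟩ := hH
    have h1 : ∀ z, ¬ IsHex I w (fun i => h (i + (1 + k))) z := fun z hz => by
      simp only [← add_assoc] at hz
      exact hI.not_hex_hex_one (hh.rotate k) hy hz
    have h2 : ∀ z, ¬ IsHex I w (fun i => h (i + (2 + k))) z := fun z hz => by
      simp only [← add_assoc] at hz
      exact hI.not_hex_hex_two (hh.rotate k) hy hz
    have h5 : ∀ z, ¬ IsHex I w (fun i => h (i + (5 + k))) z := fun z hz => by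
      refine hI.not_hex_hex_one (hh.rotate (5 + k)) hz (y' := y) ?_
      have : (fun i => h (i + 1 + (5 + k))) = fun i => h (i + k) := by
        funext i
        congr 1
        rw [add_assoc, ← add_assoc 1 5 k]; simp
      rw [this]; exact hy
    -- Hexagonal chords are never one or two steps apart, so the offsets k + 1, k + 2 and k + 5 are
    -- triangular. Modulo 6 these are the offsets 5, 0 and 3 counted from k + 2.
    refine fin (2 + k) ((key _).resolve_right fun ⟨z, hz⟩ => h2 z hz) ?_ ?_
    · rw [← add_assoc]; exact (key _).resolve_right fun ⟨z, hz⟩ => h5 z hz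
    · rw [← add_assoc]; exact (key _).resolve_right fun ⟨z, hz⟩ => h1 z hz
  · push Not at hH
    exact fin 0 ((key _).resolve_right fun ⟨z, hz⟩ => hH _ z hz)
      ((key _).resolve_right fun ⟨z, hz⟩ => hH _ z hz)
      ((key _).resolve_right fun ⟨z, hz⟩ => hH _ z hz)

end IsBiplane

end KummerQuartic

/-! ### Designs without hexagons are boards -/

namespace KummerQuartic

namespace IsBiplane

variable {P B : Type*} [Fintype P] [Fintype B] {I : P → B → Prop}

/-- The graph of `x` is a union of two triangles. -/
def IsTriangular (I : P → B → Prop) (w : B) (x : P) : Prop :=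
  ∀ u v t, Adj I w x u v → Adj I w x u t → v ≠ t → Adj I w x v t

theorem isTriangular_of_no_pattern (hI : IsBiplane I)
    (hno : ∀ a₀ a₁ a₂ o c₀ c₂ x₀₀ x₀₁ x₁₀ w f₀ f₁ f₂ l₀ l₁ v₀₀ v₀₂ v₁₀,
      ¬ Pattern I a₀ a₁ a₂ o c₀ c₂ x₀₀ x₀₁ x₁₀ w f₀ f₁ f₂ l₀ l₁ v₀₀ v₀₂ v₁₀)
    {w : B} {x : P} (hx : ¬ I x w) : IsTriangular I w x := by
  intro u v t huv hut hvt
  by_contra hn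
  obtain ⟨h, hh⟩ := hI.exists_hexagon hx huv hut hvt hn
  obtain ⟨a₀, a₁, a₂, o, c₀, c₂, x₀₀, x₀₁, x₁₀, w, f₀, f₁, f₂, l₀, l₁, v₀₀, v₀₂, v₁₀, hp⟩ :=
    hh.exists_pattern hI
  exact hno _ _ _ _ _ _ _ _ _ _ _ _ _ _ _ _ _ _ hp

/-- Adjacency is transitive on distinct vertices here. The edges 01 and 34 and the non-edge 02,
together with the degree equations, leave only the triangles 015 and 234. -/
theorem triangular_edges (hI : IsBiplane I) {w : B} {x : P} {h : Fin 6 → P} (hx : ¬ I x w)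
    (hinj : Function.Injective h) (hmem : ∀ i, I (h i) w) (hsurj : ∀ c, I c w → ∃ i, h i = c)
    (hT : IsTriangular I w x) (a01 : Adj I w x (h 0) (h 1)) (a34 : Adj I w x (h 3) (h 4))
    (n02 : ¬ Adj I w x (h 0) (h 2)) :
    (Adj I w x (h 0) (h 5) ∧ Adj I w x (h 1) (h 5) ∧ Adj I w x (h 2) (h 3) ∧
      Adj I w x (h 2) (h 4)) ∧ ¬ Adj I w x (h 0) (h 3) ∧ ¬ Adj I w x (h 0) (h 4) ∧
      ¬ Adj I w x (h 1) (h 3) ∧ ¬ Adj I w x (h 1) (h 4) ∧ ¬ Adj I w x (h 2) (h 5) := by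
  classical
  let e : Fin 6 → Fin 6 → ℕ := fun i j => if Adj I w x (h i) (h j) then 1 else 0
  have hs : ∀ i, e i 0 + e i 1 + e i 2 + e i 3 + e i 4 + e i 5 = 2 := fun i => by
    have := hI.sum_adj hx hinj hmem hsurj i
    rwa [Fin.sum_univ_six] at this
  have sym : ∀ i j, e i j = e j i := fun i j => by
    simp only [e]
    by_cases hij : Adj I w x (h i) (h j)
    · simp [hij, hij.symm]
    · have : ¬ Adj I w x (h j) (h i) := fun h' => hij h'.symm
      simp [hij, this]
  have dg : ∀ i, e i i = 0 := fun i => by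
    have : ¬ Adj I w x (h i) (h i) := fun h' => h'.1 rfl
    simp [e, this]
  have one : ∀ i j, e i j = 1 ↔ Adj I w x (h i) (h j) := fun i j => by simp [e]
  have zero : ∀ i j, e i j = 0 ↔ ¬ Adj I w x (h i) (h j) := fun i j => by simp [e]
  have tri : ∀ i j k, e i j = 1 → j ≠ k → e i k ≤ e j k := fun i j k hij hjk => by
    by_cases hik : Adj I w x (h i) (h k)
    · have := hT _ _ _ ((one i j).1 hij) hik (hinj.ne hjk)
      simp [e, this, hik]
    · simp [e, hik]
  have le : ∀ i j, e i j ≤ 1 := fun i j => by simp only [e]; split_ifs <;> simp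
  have e01 := (one 0 1).2 a01
  have e34 := (one 3 4).2 a34
  have e02 := (zero 0 2).2 n02
  have e43 := (sym 4 3).trans e34
  have e10 := (sym 1 0).trans e01
  have t1 := tri 0 1 3 e01 (by decide)
  have t2 := tri 0 1 4 e01 (by decide)
  have t4 := tri 1 0 2 e10 (by decide)
  have t5 := tri 1 0 3 e10 (by decide)
  have t6 := tri 1 0 4 e10 (by decide)
  have t3 := tri 3 4 0 e34 (by decide)
  have t7 := tri 4 3 0 e43 (by decide)
  have s0 := hs 0
  have s1 := hs 1
  have s2 := hs 2
  have s3 := hs 3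
  have s4 := hs 4
  have s5 := hs 5
  rw [dg] at s0 s1 s2 s3 s4 s5
  simp only [sym 1 0, sym 2 0, sym 2 1, sym 3 0, sym 3 1, sym 3 2, sym 4 0, sym 4 1, sym 4 2,
    sym 4 3, sym 5 0, sym 5 1, sym 5 2, sym 5 3, sym 5 4] at *
  simp only [← one]
  have := le 0 3; have := le 0 4; have := le 0 5; have := le 1 3; have := le 1 4
  have := le 1 5; have := le 2 3; have := le 2 4; have := le 2 5; have := le 1 2
  have := le 3 5; have := le 4 5
  omega

/-- The points and blocks of a design without hexagons are labelled by the cells of a `4 × 4`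
board, a point lying on a block if the cells are distinct and in the same row or column. -/
theorem exists_rook (hI : IsBiplane I)
    (hno : ∀ a₀ a₁ a₂ o c₀ c₂ x₀₀ x₀₁ x₁₀ w f₀ f₁ f₂ l₀ l₁ v₀₀ v₀₂ v₁₀,
      ¬ Pattern I a₀ a₁ a₂ o c₀ c₂ x₀₀ x₀₁ x₁₀ w f₀ f₁ f₂ l₀ l₁ v₀₀ v₀₂ v₁₀) :
    ∃ (pt : Fin 4 × Fin 4 ≃ P) (bl : Fin 4 × Fin 4 ≃ B),
      ∀ m n, I (pt m) (bl n) ↔ Xor (m.1 = n.1) (m.2 = n.2) := by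
  classical
  have hT : ∀ {w : B} {x : P}, ¬ I x w → IsTriangular I w x := fun hx =>
    hI.isTriangular_of_no_pattern hno hx
  obtain ⟨w⟩ : Nonempty B := Fintype.card_pos_iff.1 (by rw [hI.card_blocks]; norm_num)
  have hB : Nonempty B := ⟨w⟩
  obtain ⟨o, ho⟩ : ∃ o, ¬ I o w := by
    by_contra! h
    have := hI.on w
    rw [Finset.filter_true_of_mem fun p _ => h p, Finset.card_univ, hI.card_points] at this
    norm_num at this
  obtain ⟨a0, ha0⟩ : ∃ a, I a w := by
    by_contra! h
    have := hI.on w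
    rw [Finset.filter_false_of_mem fun p _ => h p] at this
    simp at this
  obtain ⟨a1, a2, h12, h01, h02⟩ := hI.exists_adj_pair ho ha0
  have h12' := hT ho _ _ _ h01 h02 h12
  obtain ⟨c0, hc0, hc0'⟩ : ∃ s ∈ (Finset.univ.filter fun p => I p w), s ∉ ({a0, a1, a2} : Finset P) :=
    Finset.exists_mem_notMem_of_card_lt_card (by
      rw [hI.on w]; exact lt_of_le_of_lt (Finset.card_le_three) (by norm_num))
  simp only [Finset.mem_filter, Finset.mem_univ, true_and] at hc0
  simp only [Finset.mem_insert, Finset.mem_singleton, not_or] at hc0'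
  obtain ⟨c1, c2, k12, k01, k02⟩ := hI.exists_adj_pair ho hc0
  have k12' := hT ho _ _ _ k01 k02 k12
  have na : ∀ {a a' a'' c : P}, Adj I w o a a' → Adj I w o a a'' → a' ≠ a'' → Adj I w o c a →
      c = a' ∨ c = a'' := by
    intro a a' a'' c h1 h2 h3 h4
    by_contra! hc
    exact hc.2 (hI.adj_unique ho h1 h4.symm h2 hc.1 h3.symm)
  have ncross : ∀ c, c ≠ a0 → c ≠ a1 → c ≠ a2 →
      ¬ Adj I w o c a0 ∧ ¬ Adj I w o c a1 ∧ ¬ Adj I w o c a2 := by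
    intro c n0 n1 n2
    refine ⟨fun h => ?_, fun h => ?_, fun h => ?_⟩
    · rcases na h01 h02 h12 h with h | h <;> contradiction
    · rcases na h01.symm h12' h02.1 h with h | h <;> contradiction
    · rcases na h02.symm h12'.symm h01.1 h with h | h <;> contradiction
  have nc0 := ncross c0 hc0'.1 hc0'.2.1 hc0'.2.2
  have nc1 : c1 ≠ a0 ∧ c1 ≠ a1 ∧ c1 ≠ a2 :=
    ⟨fun h => nc0.1 (h ▸ k01), fun h => nc0.2.1 (h ▸ k01), fun h => nc0.2.2 (h ▸ k01)⟩
  have nc2 : c2 ≠ a0 ∧ c2 ≠ a1 ∧ c2 ≠ a2 :=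
    ⟨fun h => nc0.1 (h ▸ k02), fun h => nc0.2.1 (h ▸ k02), fun h => nc0.2.2 (h ▸ k02)⟩
  let a : Fin 3 → P := ![a0, a1, a2]
  let c : Fin 3 → P := ![c0, c1, c2]
  have ainj : Function.Injective a := by
    rw [← List.nodup_ofFn]
    have := h01.1; have := h02.1
    simp [a]; grind
  have cinj : Function.Injective c := by
    rw [← List.nodup_ofFn]
    have := k01.1; have := k02.1
    simp [c]; grind
  have hac : ∀ i k, a i ≠ c k := by
    intro i k
    fin_cases i <;> fin_cases k <;> simp [a, c] <;> grind
  have haw : ∀ i, I (a i) w := by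
    intro i; fin_cases i; exacts [ha0, h01.2.2.1, h02.2.2.1]
  have hcw : ∀ i, I (c i) w := by
    intro i; fin_cases i; exacts [hc0, k01.2.2.1, k02.2.2.1]
  have haa : ∀ i j, i ≠ j → Adj I w o (a i) (a j) := by
    intro i j hij
    fin_cases i <;> fin_cases j <;> first | exact absurd rfl hij | skip
    exacts [h01, h02, h01.symm, h12', h02.symm, h12'.symm]
  have hcc : ∀ i j, i ≠ j → Adj I w o (c i) (c j) := by
    intro i j hij
    fin_cases i <;> fin_cases j <;> first | exact absurd rfl hij | skip
    exacts [k01, k02, k01.symm, k12', k02.symm, k12'.symm]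
  have hall : ∀ p, I p w → (∃ i, a i = p) ∨ ∃ k, c k = p := by
    have h6 : (Finset.univ.image a ∪ Finset.univ.image c) = (Finset.univ.filter fun p => I p w) := by
      apply Finset.eq_of_subset_of_card_le
      · intro e he
        simp only [Finset.mem_union, Finset.mem_image, Finset.mem_univ, true_and] at he
        simp only [Finset.mem_filter, Finset.mem_univ, true_and]
        rcases he with ⟨i, rfl⟩ | ⟨i, rfl⟩
        exacts [haw i, hcw i]
      · rw [hI.on w, Finset.card_union_of_disjoint, Finset.card_image_of_injective _ ainj,
          Finset.card_image_of_injective _ cinj]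
        · simp
        · rw [Finset.disjoint_left]
          intro e he he'
          simp only [Finset.mem_image, Finset.mem_univ, true_and] at he he'
          obtain ⟨i, rfl⟩ := he
          obtain ⟨k, hk⟩ := he'
          exact hac i k hk.symm
    intro p hp
    have : p ∈ (Finset.univ.image a ∪ Finset.univ.image c) := by rw [h6]; simpa using hp
    simpa using this
  have nac : ∀ i k, ¬ Adj I w o (a i) (c k) := by
    intro i k h
    have two : ∀ i : Fin 3, ∃ j j' : Fin 3, i ≠ j ∧ i ≠ j' ∧ j ≠ j' := by decide
    obtain ⟨j, j', hj, hj', hjj⟩ := two i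
    rcases na (haa i j hj) (haa i j' hj') (ainj.ne hjj) h.symm with h | h
    · exact hac _ _ h.symm
    · exact hac _ _ h.symm
  have hb : ∀ p q, p ≠ q → I p w → I q w → ∃ b, b ≠ w ∧ I p b ∧ I q b := fun p q hpq hp hq =>
    hI.exists_block hpq hp hq
  choose! β hβ hβ1 hβ2 using hb
  have adj_iff : ∀ {x p q}, p ≠ q → I p w → I q w → (I x (β p q) ↔ Adj I w x p q) := by
    intro x p q hpq hp hq
    refine ⟨fun h => ⟨hpq, hp, hq, _, hβ p q hpq hp hq, hβ1 p q hpq hp hq, hβ2 p q hpq hp hq, h⟩,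
      fun h => h.mem_block hI (hβ p q hpq hp hq) (hβ1 p q hpq hp hq) (hβ2 p q hpq hp hq)⟩
  have mem_w : ∀ {p q r}, p ≠ q → I p w → I q w → I r w → (I r (β p q) ↔ r = p ∨ r = q) := by
    intro p q r hpq hp hq hr
    refine ⟨hI.mem_pair_of_block hpq hp hq (hβ p q hpq hp hq) (hβ1 p q hpq hp hq)
      (hβ2 p q hpq hp hq) hr, ?_⟩
    rintro (rfl | rfl)
    exacts [hβ1 _ _ hpq hp hq, hβ2 _ _ hpq hp hq]
  have n12 : ∀ j : Fin 3, j + 1 ≠ j + 2 := by decide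
  -- The second blocks through two of the `a`, through two of the `c`, and through one of each. With
  -- `w` they number 3 + 3 + 9 + 1 = 16.
  let F : Fin 3 → B := fun j => β (a (j + 1)) (a (j + 2))
  let L : Fin 3 → B := fun l => β (c (l + 1)) (c (l + 2))
  let V : Fin 3 → Fin 3 → B := fun i k => β (a i) (c k)
  have hoF : ∀ j, I o (F j) := fun j =>
    (adj_iff (ainj.ne (n12 j)) (haw _) (haw _)).2 (haa _ _ (n12 j))
  have hoL : ∀ j, I o (L j) := fun j =>
    (adj_iff (cinj.ne (n12 j)) (hcw _) (hcw _)).2 (hcc _ _ (n12 j))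
  have hoV : ∀ i k, ¬ I o (V i k) := fun i k h =>
    nac i k ((adj_iff (hac i k) (haw _) (hcw _)).1 h)
  have i01 : ∀ j : Fin 3, j + 1 ≠ j ∧ j + 2 ≠ j ∧ j + 2 ≠ j + 1 := by decide
  have idx : ∀ i j : Fin 3, i = j + 1 ∨ i = j + 2 ↔ i ≠ j := by decide
  have haF : ∀ i j, I (a i) (F j) ↔ i ≠ j := fun i j => by
    rw [mem_w (ainj.ne (n12 j)) (haw _) (haw _) (haw _), ainj.eq_iff, ainj.eq_iff, idx]
  have hcL : ∀ i j, I (c i) (L j) ↔ i ≠ j := fun i j => by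
    rw [mem_w (cinj.ne (n12 j)) (hcw _) (hcw _) (hcw _), cinj.eq_iff, cinj.eq_iff, idx]
  have hcF : ∀ k j, ¬ I (c k) (F j) := fun k j => by
    rw [mem_w (ainj.ne (n12 j)) (haw _) (haw _) (hcw _)]
    exact fun h => h.elim (fun h => hac _ _ h.symm) fun h => hac _ _ h.symm
  have haL : ∀ k j, ¬ I (a k) (L j) := fun k j => by
    rw [mem_w (cinj.ne (n12 j)) (hcw _) (hcw _) (haw _)]
    exact fun h => h.elim (fun h => hac _ _ h) fun h => hac _ _ h
  have haV : ∀ i' i k, I (a i') (V i k) ↔ i' = i := fun i' i k => by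
    rw [mem_w (hac i k) (haw _) (hcw _) (haw _), ainj.eq_iff, or_iff_left (hac _ _)]
  have hcV : ∀ k' i k, I (c k') (V i k) ↔ k' = k := fun k' i k => by
    rw [mem_w (hac i k) (haw _) (hcw _) (hcw _), cinj.eq_iff, or_iff_right (hac _ _).symm]
  have hFL : ∀ j l, F j ≠ L l := fun j l h => by
    have := (haF (j + 1) j).2 (i01 j).1
    rw [h] at this
    exact haL _ _ this
  -- The blocks `F j` and `L l` both contain `o`. Their other common points are the nine points
  -- still missing.
  have hX : ∀ j l, ∃ q, q ≠ o ∧ I q (F j) ∧ I q (L l) := fun j l =>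
    hI.exists_point (hFL j l) (hoF j) (hoL l)
  choose X hXo hXF hXL using hX
  have hFw : ∀ j, F j ≠ w := fun j => hβ _ _ (ainj.ne (n12 j)) (haw _) (haw _)
  have hXw : ∀ j l, ¬ I (X j l) w := fun j l h => by
    rcases hall _ h with ⟨i, hi⟩ | ⟨i, hi⟩
    · have := hXL j l
      rw [← hi] at this
      exact haL _ _ this
    · have := hXF j l
      rw [← hi] at this
      exact hcF _ _ this
  have third : ∀ i j : Fin 3, i ≠ j → ∃ k, k ≠ i ∧ k ≠ j := by decide
  have hXF' : ∀ j' l j, I (X j' l) (F j) ↔ j' = j := fun j' l j => by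
    constructor
    · intro h
      by_contra hj
      obtain ⟨k, hk, hk'⟩ := third _ _ hj
      have hne : F j' ≠ F j := fun h' => by
        have := (haF j j').2 (Ne.symm hj)
        rw [h', haF] at this
        exact this rfl
      have := hI.point_unique hne (hoF _) (hoF _) (hXF j' l) h ((haF k j').2 hk) ((haF k j).2 hk')
        (hXo _ _) (fun h => ho (h ▸ haw k))
      exact hXw j' l (this ▸ haw k)
    · rintro rfl; exact hXF _ _
  have hXL' : ∀ j l' l, I (X j l') (L l) ↔ l' = l := fun j l' l => by
    constructor
    · intro h
      by_contra hj
      obtain ⟨k, hk, hk'⟩ := third _ _ hj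
      have hne : L l' ≠ L l := fun h' => by
        have := (hcL l l').2 (Ne.symm hj)
        rw [h', hcL] at this
        exact this rfl
      have := hI.point_unique hne (hoL _) (hoL _) (hXL j l') h ((hcL k l').2 hk) ((hcL k l).2 hk')
        (hXo _ _) (fun h => ho (h ▸ hcw k))
      exact hXw j l' (this ▸ hcw k)
    · rintro rfl; exact hXL _ _
  -- The graph of `X j l` has the edge between the other two `a` and the edge between the other two
  -- `c`. Its triangles therefore join the first edge to `c l` and the second to `a j`.
  have hXV : ∀ j l i k, I (X j l) (V i k) ↔ Xor (j = i) (l = k) := by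
    intro j l i k
    let h : Fin 6 → P := ![a (j + 1), a (j + 2), a j, c (l + 1), c (l + 2), c l]
    have hinj : Function.Injective h := by
      rw [← List.nodup_ofFn]
      simp [h, hac, ainj.eq_iff, cinj.eq_iff]
    have hmem : ∀ i, I (h i) w := by
      intro i; fin_cases i; exacts [haw (j + 1), haw (j + 2), haw j, hcw (l + 1), hcw (l + 2), hcw l]
    have cov : ∀ i j : Fin 3, i = j ∨ i = j + 1 ∨ i = j + 2 := by decide
    have hsurj : ∀ p, I p w → ∃ i, h i = p := by
      intro p hp
      rcases hall p hp with ⟨i, rfl⟩ | ⟨i, rfl⟩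
      · rcases cov i j with rfl | rfl | rfl
        exacts [⟨2, rfl⟩, ⟨0, rfl⟩, ⟨1, rfl⟩]
      · rcases cov i l with rfl | rfl | rfl
        exacts [⟨5, rfl⟩, ⟨3, rfl⟩, ⟨4, rfl⟩]
    have e1 : Adj I w (X j l) (h 0) (h 1) :=
      (adj_iff (ainj.ne (n12 j)) (haw _) (haw _)).1 (hXF j l)
    have e2 : Adj I w (X j l) (h 3) (h 4) :=
      (adj_iff (cinj.ne (n12 l)) (hcw _) (hcw _)).1 (hXL j l)
    have e3 : ¬ Adj I w (X j l) (h 0) (h 2) := by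
      intro h'
      have : I (X j l) (F (j + 2)) := by
        refine h'.mem_block hI (hFw _) ((haF (j + 1) _).2 (n12 j))
          ((haF j _).2 (i01 j).2.1.symm)
      rw [hXF'] at this
      exact (i01 j).2.1.symm this
    obtain ⟨⟨g1, g2, g3, g4⟩, g5, g6, g7, g8, g9⟩ :=
      hI.triangular_edges (hXw j l) hinj hmem hsurj (hT (hXw j l)) e1 e2 e3
    rw [adj_iff (hac i k) (haw _) (hcw _)]
    rcases cov i j with rfl | rfl | rfl <;> rcases cov k l with rfl | rfl | rfl
    · exact iff_of_false g9 (by simp [Xor])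
    · exact iff_of_true g3 (by simp [Xor])
    · exact iff_of_true g4 (by simp [Xor])
    · exact iff_of_true g1 (by simp [Xor])
    · exact iff_of_false g5 (by simp [Xor])
    · exact iff_of_false g6 (by simp [Xor])
    · exact iff_of_true g2 (by simp [Xor])
    · exact iff_of_false g7 (by simp [Xor])
    · exact iff_of_false g8 (by simp [Xor])
  -- For the points, `o` and the `c` fill row 0, while `o` and the `a` fill column 0. For the
  -- blocks, `w` and the `L` fill row 0, while `w` and the `F` fill column 0.
  let pt : Fin 4 × Fin 4 → P := fun m =>
    Fin.cases (Fin.cases o c m.2) (fun j => Fin.cases (a j) (X j) m.2) m.1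
  let bl : Fin 4 × Fin 4 → B := fun m =>
    Fin.cases (Fin.cases w L m.2) (fun j => Fin.cases (F j) (V j) m.2) m.1
  have table : ∀ m n, I (pt m) (bl n) ↔ Xor (m.1 = n.1) (m.2 = n.2) := by
    rintro ⟨m1, m2⟩ ⟨n1, n2⟩
    refine Fin.cases ?_ (fun j => ?_) m1 <;> refine Fin.cases ?_ (fun l => ?_) m2 <;>
    refine Fin.cases ?_ (fun i => ?_) n1 <;> refine Fin.cases ?_ (fun k => ?_) n2 <;>
    simp [pt, bl, ho, haw, hcw, hXw, hoF, hoL, hoV, haF, haL, haV, hcF, hcL, hcV, hXF', hXL', hXV,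
      Xor, (Fin.succ_ne_zero _).symm]
  -- Distinct cells have different neighbourhoods on the board, so injectivity can be read off from
  -- the incidence table.
  have pinj : Function.Injective pt := by
    intro m n hmn
    by_contra hne
    have : ∀ m n : Fin 4 × Fin 4, m ≠ n → ∃ k : Fin 4 × Fin 4,
      (Xor (m.1 = k.1) (m.2 = k.2)) ∧ ¬ Xor (n.1 = k.1) (n.2 = k.2) := by decide +kernel
    obtain ⟨k, hk, hk'⟩ := this m n hne
    rw [← table] at hk hk'
    exact hk' (hmn ▸ hk)
  have binj : Function.Injective bl := by
    intro m n hmn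
    by_contra hne
    have : ∀ m n : Fin 4 × Fin 4, m ≠ n → ∃ k : Fin 4 × Fin 4,
      (Xor (k.1 = m.1) (k.2 = m.2)) ∧ ¬ Xor (k.1 = n.1) (k.2 = n.2) := by decide +kernel
    obtain ⟨k, hk, hk'⟩ := this m n hne
    rw [← table] at hk hk'
    exact hk' (hmn ▸ hk)
  refine ⟨Equiv.ofBijective pt ((Fintype.bijective_iff_injective_and_card pt).2 ⟨pinj, ?_⟩),
    Equiv.ofBijective bl ((Fintype.bijective_iff_injective_and_card bl).2 ⟨binj, ?_⟩), table⟩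
  · rw [hI.card_points]; rfl
  · rw [hI.card_blocks]; rfl

end IsBiplane

end KummerQuartic

namespace KummerQuartic

variable {K : Type*} [Field K]

/-! ### Quaternion frames -/

/-- The product of quaternions, whose coordinates are indexed by `Fin 4`. -/
def qmul (x y : Fin 4 → K) : Fin 4 → K :=
  ![x 0 * y 0 - x 1 * y 1 - x 2 * y 2 - x 3 * y 3,
    x 0 * y 1 + x 1 * y 0 + x 2 * y 3 - x 3 * y 2,
    x 0 * y 2 - x 1 * y 3 + x 2 * y 0 + x 3 * y 1,
    x 0 * y 3 + x 1 * y 2 - x 2 * y 1 + x 3 * y 0]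

/-- The quaternion units. -/
def qe (K : Type*) [Field K] (μ : Fin 4) : Fin 4 → K := Pi.single μ 1

/-- The quaternion `1` and the pure quaternions given by the rows of `R`. -/
def rowq (R : Matrix (Fin 3) (Fin 3) K) (ν : Fin 4) : Fin 4 → K :=
  Fin.cases (qe K 0) (fun k => Fin.cons 0 (R k)) ν

/-- The sixteen products of quaternion units with the quaternions `rowq R ν`. -/
def frame (R : Matrix (Fin 3) (Fin 3) K) (m : Fin 4 × Fin 4) : Fin 4 → K :=
  qmul (qe K m.1) (rowq R m.2)

theorem frame_zero_right (R : Matrix (Fin 3) (Fin 3) K) (μ : Fin 4) : frame R (μ, 0) = qe K μ := by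
  funext i
  fin_cases μ <;> fin_cases i <;> simp [frame, qmul, qe, rowq]

theorem frame_zero_left (R : Matrix (Fin 3) (Fin 3) K) (k : Fin 3) :
    frame R (0, k.succ) = Fin.cons 0 (R k) := by
  funext i
  fin_cases i
  · simp [frame, qmul, qe, rowq]
  · simp [frame, qmul, qe, rowq]
  · simp [frame, qmul, qe, rowq]
  · simp [frame, qmul, qe, rowq]

theorem rowq_succ (R : Matrix (Fin 3) (Fin 3) K) (k : Fin 3) :
    rowq R k.succ = ![0, R k 0, R k 1, R k 2] := by
  funext i
  fin_cases i <;> rfl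

theorem frame_succ_succ (R : Matrix (Fin 3) (Fin 3) K) (j l : Fin 3) :
    frame R (j.succ, l.succ) 0 = - R l j ∧ frame R (j.succ, l.succ) j.succ = 0 ∧
    frame R (j.succ, l.succ) (j + 1).succ = - R l (j + 2) ∧
    frame R (j.succ, l.succ) (j + 2).succ = R l (j + 1) := by
  simp only [frame, rowq_succ]
  fin_cases j <;> simp [qmul, qe]

end KummerQuartic

/-! ### Solving the incidence equations of the board -/

namespace KummerQuartic

variable {K : Type*} [Field K]

theorem sum_fin_three_shift (i : Fin 3) (f : Fin 3 → K) :
    ∑ j, f j = f i + f (i + 1) + f (i + 2) := by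
  rw [Fin.sum_univ_three]
  fin_cases i
  · rfl
  · change f 0 + f 1 + f 2 = f 1 + f 2 + f 0; ring
  · change f 0 + f 1 + f 2 = f 2 + f 0 + f 1; ring

theorem fin_three_cases (i j : Fin 3) : i = j ∨ i = j + 1 ∨ i = j + 2 := by revert i j; decide

/-- Coordinates for a realization of the `4 × 4` board by points `A` and planes `Φ`: after a
rescaling, the points are the products of quaternion units with an orthonormal frame, and the
planes are orthogonal to the points. -/
theorem exists_frame_of_rook [IsAlgClosed K] {A Φ : Fin 4 × Fin 4 → Fin 4 → K}
    (hA0 : ∀ μ ν, A (μ, 0) ν = if μ = ν then 1 else 0)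
    (hΦ0 : ∀ μ ν, μ ≠ ν → Φ (μ, 0) ν = 0) (hΦ1 : ∀ μ, Φ (μ, 0) μ ≠ 0)
    (hI : ∀ m n, ∑ μ, Φ n μ * A m μ = 0 ↔ Xor (m.1 = n.1) (m.2 = n.2)) :
    ∃ (τ : Fin 4 → K) (R : Matrix (Fin 3) (Fin 3) K), (∀ μ, τ μ ≠ 0) ∧ R * R.transpose = 1 ∧
      R.det = 1 ∧ (∀ k j, R k j ≠ 0) ∧
      (∀ m, ∃ c, c ≠ 0 ∧ ∀ μ, τ μ * A m μ = c * frame R m μ) ∧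
      (∀ n, ∃ d, d ≠ 0 ∧ ∀ μ, Φ n μ = d * (τ μ * frame R n μ)) := by
  -- Incidence with the planes `Φ (ν, 0)` decides which coordinates of a point vanish.
  have hA : ∀ m ν, A m ν = 0 ↔ Xor (m.1 = ν) (m.2 = 0) := by
    intro m ν
    rw [← hI m (ν, 0), Finset.sum_eq_single ν]
    · simp [hΦ1 ν]
    · intro μ _ hμ; rw [hΦ0 ν μ hμ.symm, zero_mul]
    · simp
  have hΦ : ∀ n ν, Φ n ν = 0 ↔ Xor (ν = n.1) (0 = n.2) := by
    intro n ν
    rw [← hI (ν, 0) n, Finset.sum_eq_single ν]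
    · simp [hA0]
    · intro μ _ hμ; simp [hA0, hμ.symm]
    · simp
  have s0 : ∀ k : Fin 3, k.succ ≠ 0 := Fin.succ_ne_zero
  have s0' : ∀ k : Fin 3, (0 : Fin 4) ≠ k.succ := fun k => (s0 k).symm
  have M0 : ∀ k : Fin 3, A (0, k.succ) 0 = 0 := fun k => (hA _ _).2 (by simp [Xor, s0])
  have n0 : ∀ k : Fin 3, Φ (0, k.succ) 0 = 0 := fun k => (hΦ _ _).2 (by simp [Xor, s0'])
  obtain ⟨M, hM⟩ : ∃ M : Fin 3 → Fin 3 → K, ∀ k j, A (0, k.succ) j.succ = M k j := ⟨_, fun _ _ => rfl⟩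
  obtain ⟨n, hn⟩ : ∃ n : Fin 3 → Fin 3 → K, ∀ k j, Φ (0, k.succ) j.succ = n k j := ⟨_, fun _ _ => rfl⟩
  have Mne : ∀ k j, M k j ≠ 0 := fun k j => by
    rw [← hM, Ne, hA]; simp [Xor, s0, s0']
  have nne : ∀ k j, n k j ≠ 0 := fun k j => by
    rw [← hn, Ne, hΦ]; simp [Xor, s0, s0']
  have hnM : ∀ l k, ∑ j, n l j * M k j = 0 ↔ k ≠ l := by
    intro l k
    have := hI (0, k.succ) (0, l.succ)
    rw [Fin.sum_univ_succ, M0, mul_zero, zero_add] at this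
    simp only [hM, hn] at this
    rw [this]; simp [Xor]
  have j12 : ∀ j : Fin 3, j + 1 ≠ j ∧ j + 2 ≠ j := by decide
  -- the mixed points
  have hX : ∀ j l : Fin 3, ∃ κ h, κ ≠ 0 ∧ A (j.succ, l.succ) 0 = κ * h ∧
      A (j.succ, l.succ) j.succ = 0 ∧ A (j.succ, l.succ) (j + 1).succ = - (κ * n l (j + 2)) ∧
      A (j.succ, l.succ) (j + 2).succ = κ * n l (j + 1) := by
    intro j l
    have hj : A (j.succ, l.succ) j.succ = 0 := (hA _ _).2 (by simp [Xor, s0])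
    have hj2 : A (j.succ, l.succ) (j + 2).succ ≠ 0 := by
      rw [Ne, hA]; simp [Xor, s0, (j12 j).2.symm]
    have h1 := (hI (j.succ, l.succ) (0, l.succ)).2 (by simp [Xor, s0])
    rw [Fin.sum_univ_succ, n0, sum_fin_three_shift j, hj] at h1
    simp only [hn] at h1
    have hk : A (j.succ, l.succ) (j + 2).succ / n l (j + 1) ≠ 0 := div_ne_zero hj2 (nne _ _)
    refine ⟨A (j.succ, l.succ) (j + 2).succ / n l (j + 1), _, hk,
      (mul_div_cancel₀ (A (j.succ, l.succ) 0) hk).symm, hj, ?_, ?_⟩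
    · have := nne l (j + 1)
      field_simp
      linear_combination h1
    · have := nne l (j + 1)
      field_simp
  have hV : ∀ i k : Fin 3, ∃ σ h, σ ≠ 0 ∧ Φ (i.succ, k.succ) 0 = σ * h ∧
      Φ (i.succ, k.succ) i.succ = 0 ∧ Φ (i.succ, k.succ) (i + 1).succ = - (σ * M k (i + 2)) ∧
      Φ (i.succ, k.succ) (i + 2).succ = σ * M k (i + 1) := by
    intro j l
    have hj : Φ (j.succ, l.succ) j.succ = 0 := (hΦ _ _).2 (by simp [Xor, s0'])
    have hj2 : Φ (j.succ, l.succ) (j + 2).succ ≠ 0 := by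
      rw [Ne, hΦ]; simp [Xor, s0', (j12 j).2]
    have h1 := (hI (0, l.succ) (j.succ, l.succ)).2 (by simp [Xor, s0'])
    rw [Fin.sum_univ_succ, M0, sum_fin_three_shift j, hj] at h1
    simp only [hM] at h1
    have hk : Φ (j.succ, l.succ) (j + 2).succ / M l (j + 1) ≠ 0 := div_ne_zero hj2 (Mne _ _)
    refine ⟨Φ (j.succ, l.succ) (j + 2).succ / M l (j + 1), _, hk,
      (mul_div_cancel₀ (Φ (j.succ, l.succ) 0) hk).symm, hj, ?_, ?_⟩
    · have := Mne l (j + 1)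
      field_simp
      linear_combination h1
    · have := Mne l (j + 1)
      field_simp
  choose κ H κne hX0 hXj hX1 hX2 using hX
  choose σ c σne hV0 hVi hV1 hV2 using hV
  have Hne : ∀ j l, H j l ≠ 0 := fun j l h => by
    have : A (j.succ, l.succ) 0 ≠ 0 := by rw [Ne, hA]; simp [Xor, s0]
    exact this (by rw [hX0, h, mul_zero])
  have cne : ∀ j l, c j l ≠ 0 := fun j l h => by
    have : Φ (j.succ, l.succ) 0 ≠ 0 := by rw [Ne, hΦ]; simp [Xor, s0']
    exact this (by rw [hV0, h, mul_zero])
  have eq1 : ∀ j k l, k ≠ l → c j k * H j l = M k j * n l j := by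
    intro j k l hkl
    have h1 := (hI (j.succ, l.succ) (j.succ, k.succ)).2 (by simp [Xor, hkl.symm])
    have h2 := (hnM l k).2 hkl
    rw [Fin.sum_univ_succ, sum_fin_three_shift j, hX0, hV0, hXj, hX1, hX2, hV1, hV2] at h1
    rw [sum_fin_three_shift j] at h2
    apply mul_left_cancel₀ (mul_ne_zero (σne j k) (κne j l))
    linear_combination h1 - σ j k * κ j l * h2
  have idx : ∀ j : Fin 3, j + 2 = j + 1 + 1 ∧ j = j + 1 + 2 ∧ j + 1 = j + 2 + 2 ∧ j = j + 2 + 1 := by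
    decide
  have eq2 : ∀ i j l, i ≠ j → c i l * H j l = n l i * M l j := by
    intro i j l hij
    have h1 := (hI (j.succ, l.succ) (i.succ, l.succ)).2 (by simp [Xor, hij.symm])
    rw [Fin.sum_univ_succ, sum_fin_three_shift j, hX0, hV0, hXj, hX1, hX2] at h1
    apply mul_left_cancel₀ (mul_ne_zero (σne i l) (κne j l))
    rcases fin_three_cases i j with rfl | rfl | rfl
    · exact absurd rfl hij
    · have h2 := hV1 (j + 1) l
      rw [← (idx j).1, ← (idx j).2.1] at h2
      rw [hVi, h2] at h1
      linear_combination h1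
    · have h2 := hV2 (j + 2) l
      rw [← (idx j).2.2.1, ← (idx j).2.2.2] at h2
      rw [hVi, h2] at h1
      linear_combination h1
  have third : ∀ i i' : Fin 3, ∃ j, i ≠ j ∧ i' ≠ j := by decide
  -- By `eq2` the ratio of `c i l` to `n l i` does not depend on `i`.
  obtain ⟨q, hq, hqne⟩ : ∃ q : Fin 3 → K, (∀ i l, c i l = q l * n l i) ∧ ∀ l, q l ≠ 0 := by
    refine ⟨fun l => c 0 l / n l 0, fun i l => ?_, fun l => div_ne_zero (cne _ _) (nne _ _)⟩
    obtain ⟨j, hj, hj'⟩ := third i 0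
    have h1 := eq2 i j l hj
    have h2 := eq2 0 j l hj'
    have := nne l 0
    apply mul_right_cancel₀ (Hne j l)
    field_simp
    linear_combination n l 0 * h1 - n l i * h2
  have hH : ∀ j l, q l * H j l = M l j := by
    intro j l
    obtain ⟨i, hi, -⟩ := third j j
    have h1 := eq2 i j l hi.symm
    rw [hq] at h1
    apply mul_left_cancel₀ (nne l i)
    linear_combination h1
  -- Up to the factor `q l`, the plane `n l` is the polar of the point `M l` for the diagonal form
  -- with entries `t j`. Hence the three points `M l` are orthogonal for this form.
  obtain ⟨t, ht, htne⟩ : ∃ t : Fin 3 → K, (∀ l j, q l * n l j = t j * M l j) ∧ ∀ l, t l ≠ 0 := by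
    refine ⟨fun j => n 0 j * q 0 / M 0 j, fun l j => ?_, fun j =>
      div_ne_zero (mul_ne_zero (nne _ _) (hqne _)) (Mne _ _)⟩
    have := Mne 0 j
    by_cases hl : l = 0
    · subst hl; field_simp
    · have h1 := eq1 j l 0 hl
      rw [hq] at h1
      have h2 := hH j 0
      field_simp
      rw [← h2]
      linear_combination q 0 * h1
  have key : ∀ k l, ∑ j, t j * (M k j * M l j) = q l * ∑ j, n l j * M k j := by
    intro k l
    rw [Finset.mul_sum]
    refine Finset.sum_congr rfl fun j _ => ?_
    linear_combination (- M k j) * ht l j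
  have hd : ∀ l, q l * ∑ j, n l j * M l j ≠ 0 := fun l =>
    mul_ne_zero (hqne l) fun h => (hnM l l).1 h rfl
  -- Square roots turn the diagonal form into the standard one and the orthogonal rows into unit
  -- vectors.
  choose τ hτ using fun j => IsAlgClosed.exists_pow_nat_eq (t j) (n := 2) (by norm_num)
  choose ρ hρ using fun l => IsAlgClosed.exists_pow_nat_eq (q l * ∑ j, n l j * M l j) (n := 2)
    (by norm_num)
  have τne : ∀ j, τ j ≠ 0 := fun j h => htne j (by rw [← hτ, h]; ring)
  have ρne : ∀ j, ρ j ≠ 0 := fun j h => hd j (by rw [← hρ, h]; ring)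
  have orth : ∀ ρ : Fin 3 → K, (∀ l, ρ l ^ 2 = q l * ∑ j, n l j * M l j) →
      (Matrix.of fun l j => τ j * M l j / ρ l) * (Matrix.of fun l j => τ j * M l j / ρ l).transpose
        = (1 : Matrix (Fin 3) (Fin 3) K) := by
    intro ρ hρ
    have ρne : ∀ j, ρ j ≠ 0 := fun j h => hd j (by rw [← hρ, h]; ring)
    ext k l
    rw [Matrix.mul_apply]
    simp only [Matrix.of_apply, Matrix.transpose_apply]
    have h1 : ∑ j, τ j * M k j / ρ k * (τ j * M l j / ρ l) =
        (∑ j, t j * (M k j * M l j)) / (ρ k * ρ l) := by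
      rw [Finset.sum_div]
      refine Finset.sum_congr rfl fun j _ => ?_
      rw [← hτ]
      have := ρne k; have := ρne l
      field_simp
    rw [h1, key]
    by_cases hkl : k = l
    · subst hkl
      rw [← hρ, Matrix.one_apply_eq, pow_two, div_self (mul_ne_zero (ρne k) (ρne k))]
    · rw [(hnM l k).2 hkl, mul_zero, zero_div, Matrix.one_apply_ne hkl]
  -- The determinant is ±1. Negating all three roots `ρ l` negates it, as the size is odd.
  obtain ⟨ρ, hρ, hdet⟩ : ∃ ρ : Fin 3 → K, (∀ l, ρ l ^ 2 = q l * ∑ j, n l j * M l j) ∧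
      (Matrix.of fun l j => τ j * M l j / ρ l).det = 1 := by
    have h1 := congrArg Matrix.det (orth ρ hρ)
    rw [Matrix.det_mul, Matrix.det_transpose, Matrix.det_one] at h1
    rcases mul_self_eq_one_iff.1 h1 with h | h
    · exact ⟨ρ, hρ, h⟩
    · refine ⟨fun l => - ρ l, fun l => by rw [neg_sq, hρ], ?_⟩
      have : (Matrix.of fun l j => τ j * M l j / - ρ l) =
          - (Matrix.of fun l j => τ j * M l j / ρ l : Matrix (Fin 3) (Fin 3) K) := by
        ext l j; simp [div_neg]
      rw [this, Matrix.det_neg, h]; simp; norm_num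
  have ρne : ∀ j, ρ j ≠ 0 := fun j h => hd j (by rw [← hρ, h]; ring)
  set R : Matrix (Fin 3) (Fin 3) K := Matrix.of fun l j => τ j * M l j / ρ l with hR
  have hRM : ∀ l j, ρ l * R l j = τ j * M l j := fun l j => by
    have := ρne l
    rw [hR, Matrix.of_apply]; field_simp
  have hRn : ∀ l j, q l * n l j = τ j * ρ l * R l j := fun l j => by
    rw [ht, ← hτ]; linear_combination (- τ j) * hRM l j
  have hRH : ∀ l j, q l * τ j * H j l = ρ l * R l j := fun l j => by
    rw [hRM]; linear_combination τ j * hH j l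
  have prod : ∀ j, τ 0 * τ 1 * τ 2 = τ j * τ (j + 1) * τ (j + 2) := by
    intro j
    fin_cases j
    · rfl
    · change τ 0 * τ 1 * τ 2 = τ 1 * τ 2 * τ 0; ring
    · change τ 0 * τ 1 * τ 2 = τ 2 * τ 0 * τ 1; ring
  have pne : τ 0 * τ 1 * τ 2 ≠ 0 := mul_ne_zero (mul_ne_zero (τne _) (τne _)) (τne _)
  -- The scale of coordinate 0 is dictated by the mixed points: it makes their coordinate 0 equal to
  -- `-R l j` in proportion to the other three.
  refine ⟨Fin.cons (- (τ 0 * τ 1 * τ 2)) τ, R, ?_, orth ρ hρ, hdet, ?_, ?_, ?_⟩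
  · intro μ
    refine Fin.cases ?_ (fun j => ?_) μ
    · simpa using pne
    · exact τne j
  · intro k j
    have : ρ k * R k j ≠ 0 := by rw [hRM]; exact mul_ne_zero (τne _) (Mne _ _)
    exact right_ne_zero_of_mul this
  · rintro ⟨m1, m2⟩
    refine Fin.cases ?_ (fun l => ?_) m2
    · refine ⟨(Fin.cons (- (τ 0 * τ 1 * τ 2)) τ : Fin 4 → K) m1, ?_, fun μ => ?_⟩
      · refine Fin.cases ?_ (fun j => ?_) m1
        · simpa using pne
        · exact τne j
      · rw [frame_zero_right, hA0, qe, Pi.single_apply]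
        by_cases h : m1 = μ
        · subst h; simp
        · simp [h, Ne.symm h]
    · refine Fin.cases ?_ (fun j => ?_) m1
      · refine ⟨ρ l, ρne l, fun μ => ?_⟩
        rw [frame_zero_left]
        refine Fin.cases ?_ (fun i => ?_) μ
        · simp [M0]
        · rw [hM, Fin.cons_succ, Fin.cons_succ, hRM]
      · obtain ⟨f0, f1, f2, f3⟩ := frame_succ_succ R j l
        refine ⟨κ j l * (τ (j + 1) * τ (j + 2)) * (ρ l / q l), mul_ne_zero (mul_ne_zero (κne _ _)
          (mul_ne_zero (τne _) (τne _))) (div_ne_zero (ρne l) (hqne l)), fun μ => ?_⟩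
        have q0 := hqne l
        refine Fin.cases ?_ (fun i => ?_) μ
        · rw [hX0, f0, Fin.cons_zero, prod j]
          field_simp
          linear_combination (- κ j l * τ (j + 1) * τ (j + 2)) * hRH l j
        · rw [Fin.cons_succ]
          rcases fin_three_cases i j with rfl | rfl | rfl
          · rw [hXj, f1]; ring
          · rw [hX1, f2]
            field_simp
            linear_combination (- κ j l * τ (j + 1)) * hRn l (j + 2)
          · rw [hX2, f3]
            field_simp
            linear_combination (κ j l * τ (j + 2)) * hRn l (j + 1)
  · rintro ⟨m1, m2⟩
    refine Fin.cases ?_ (fun l => ?_) m2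
    · have hm : (Fin.cons (- (τ 0 * τ 1 * τ 2)) τ : Fin 4 → K) m1 ≠ 0 := by
        refine Fin.cases ?_ (fun j => ?_) m1
        · simpa using pne
        · exact τne j
      refine ⟨Φ (m1, 0) m1 / (Fin.cons (- (τ 0 * τ 1 * τ 2)) τ : Fin 4 → K) m1,
        div_ne_zero (hΦ1 _) hm, fun μ => ?_⟩
      rw [frame_zero_right, qe, Pi.single_apply]
      by_cases h : m1 = μ
      · subst h
        rw [if_pos rfl, mul_one, div_mul_cancel₀ _ hm]
      · rw [hΦ0 _ _ h, if_neg (Ne.symm h)]; ring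
    · refine Fin.cases ?_ (fun i => ?_) m1
      · refine ⟨ρ l / q l, div_ne_zero (ρne l) (hqne l), fun μ => ?_⟩
        have q0 := hqne l
        rw [frame_zero_left]
        refine Fin.cases ?_ (fun i => ?_) μ
        · simp [n0]
        · rw [hn, Fin.cons_succ, Fin.cons_succ]
          field_simp
          linear_combination hRn l i
      · obtain ⟨f0, f1, f2, f3⟩ := frame_succ_succ R i l
        have t1 := τne (i + 1)
        have t2 := τne (i + 2)
        refine ⟨σ i l * ρ l / (τ (i + 1) * τ (i + 2)), div_ne_zero (mul_ne_zero (σne _ _) (ρne _))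
          (mul_ne_zero t1 t2), fun μ => ?_⟩
        refine Fin.cases ?_ (fun j => ?_) μ
        · rw [hV0, hq, f0, Fin.cons_zero, prod i]
          field_simp
          linear_combination (σ i l) * hRn l i
        · rw [Fin.cons_succ]
          rcases fin_three_cases j i with rfl | rfl | rfl
          · rw [hVi, f1]; ring
          · rw [hV1, f2]
            field_simp
            linear_combination (σ i l) * hRM l (i + 2)
          · rw [hV2, f3]
            field_simp
            linear_combination (-σ i l) * hRM l (i + 1)

end KummerQuartic

/-! ### The pattern has no realization in three-space -/

namespace KummerQuartic

variable {K : Type*} [Field K]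

/-- Expansion of a vector in a basis that is biorthogonal to four given functionals. -/
theorem eq_sum_of_biorthogonal {f : Fin 4 → Module.Dual K (Fin 4 → K)} {b : Fin 4 → Fin 4 → K}
    (h0 : ∀ i j, i ≠ j → f i (b j) = 0) (h1 : ∀ i, f i (b i) ≠ 0) (v : Fin 4 → K) :
    v = ∑ i, (f i v / f i (b i)) • b i := by
  have hs : ∀ (c : Fin 4 → K) (i : Fin 4), f i (∑ j, c j • b j) = c i * f i (b i) := by
    intro c i
    rw [map_sum, Finset.sum_eq_single i]
    · simp
    · intro j _ hj; simp [h0 i j hj.symm]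
    · simp
  have hinj : Function.Injective (LinearMap.pi f) := by
    rw [LinearMap.injective_iff_surjective]
    intro y
    refine ⟨∑ j, (y j / f j (b j)) • b j, funext fun i => ?_⟩
    rw [LinearMap.pi_apply, hs, div_mul_cancel₀ _ (h1 i)]
  apply hinj
  funext i
  rw [LinearMap.pi_apply, LinearMap.pi_apply, hs, div_mul_cancel₀ _ (h1 i)]

/-- The solutions of one equation in two unknowns are the multiples of (b, -a). -/
theorem exists_cross {a b x y : K} (h : a * x + b * y = 0) (hb : b ≠ 0) :
    ∃ k, x = k * b ∧ y = - (k * a) :=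
  ⟨x / b, by field_simp, by field_simp; linear_combination h⟩

/-- The `M` are coordinates of the points `c₀`, `c₂`, the `n` those of the planes `l₀`, `l₁`, and
the remaining letters parametrize the points `x` and the planes `v`. Eliminating them shows that
`c₀` lies on `l₀`, which the pattern denies. -/
theorem pattern_absurd {M00 M01 M02 M20 M21 M22 n00 n01 n02 n10 n11 n12 κ κ' κ'' σ σ2 σ3
    C C2 C3 h h' h'' : K}
    (e1 : M20 * n00 + M21 * n01 + M22 * n02 = 0) (e2 : M00 * n10 + M01 * n11 + M02 * n12 = 0)
    (e3 : M20 * n10 + M21 * n11 + M22 * n12 = 0)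
    (e7 : σ * M02 * (κ' * n12) + - (σ * M01) * - (κ' * n11) + C * h' = 0)
    (e8 : - (σ * M01) * - (κ'' * n00) + C * h'' = 0)
    (e9 : σ2 * M22 * (κ' * n12) + - (σ2 * M21) * - (κ' * n11) + C2 * h' = 0)
    (e10 : σ2 * M22 * (κ * n02) + - (σ2 * M21) * - (κ * n01) + C2 * h = 0)
    (e11 : - (σ3 * M00) * - (κ * n01) + C3 * h = 0)
    (e12 : σ3 * M02 * (κ'' * n02) + - (σ3 * M00) * - (κ'' * n00) + C3 * h'' = 0)
    (hC : C ≠ 0) (hC2 : C2 ≠ 0) (hκ : κ ≠ 0) (hκ' : κ' ≠ 0) (hκ'' : κ'' ≠ 0)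
    (hσ : σ3 ≠ 0) (hn : n10 ≠ 0) (hM : M00 ≠ 0) : M00 * n00 + M01 * n01 + M02 * n02 = 0 := by
  have e13 : C2 * σ * M00 = C * σ2 * M20 := by
    apply mul_left_cancel₀ (mul_ne_zero hκ' hn)
    linear_combination C * e9 - C2 * e7 + C2 * σ * κ' * e2 - C * σ2 * κ' * e3
  have e14 : C * h = κ * σ * n00 * M00 := by
    apply mul_left_cancel₀ hC2
    linear_combination C * e10 - κ * n00 * e13 - C * σ2 * κ * e1
  have e15 : C3 * σ * n00 = - (C * σ3 * n01) := by
    apply mul_left_cancel₀ (mul_ne_zero hκ hM)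
    linear_combination C * e11 - C3 * e14
  have e16 : C3 * h'' = κ'' * M01 * σ3 * n01 := by
    apply mul_left_cancel₀ hC
    linear_combination C3 * e8 - κ'' * M01 * e15
  apply mul_left_cancel₀ (mul_ne_zero hσ hκ'')
  linear_combination e12 - e16

/-- The incidences of `IsBiplane.Pattern` are impossible for points and planes of projective
3-space. -/
theorem not_pattern {P B : Type*} [Fintype P] [Fintype B] {vec : P → Fin 4 → K}
    {φ : B → Module.Dual K (Fin 4 → K)}
    (hv : ∀ p, vec p ≠ 0) (a₀ a₁ a₂ o c₀ c₂ x₀₀ x₀₁ x₁₀ : P)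
    (w f₀ f₁ f₂ l₀ l₁ v₀₀ v₀₂ v₁₀ : B) :
    ¬ IsBiplane.Pattern (fun p b => φ b (vec p) = 0) a₀ a₁ a₂ o c₀ c₂ x₀₀ x₀₁ x₁₀
      w f₀ f₁ f₂ l₀ l₁ v₀₀ v₀₂ v₁₀ := by
  intro h
  -- The tetrahedron of reference has vertices `a₀`, `a₁`, `a₂`, `o` and opposite faces `f₀`, `f₁`,
  -- `f₂`, `w`.
  let f : Fin 4 → Module.Dual K (Fin 4 → K) := ![φ f₀, φ f₁, φ f₂, φ w]
  let b : Fin 4 → Fin 4 → K := ![vec a₀, vec a₁, vec a₂, vec o]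
  obtain ⟨w1, w2, w3, w4, w5⟩ := h.w_mem
  obtain ⟨f01, f02, f03, f04, f05⟩ := h.f₀_mem
  obtain ⟨f11, f12, f13, f14⟩ := h.f₁_mem
  obtain ⟨f21, f22, f23⟩ := h.f₂_mem
  obtain ⟨l01, l02, l03, l04⟩ := h.l₀_mem
  obtain ⟨l11, l12, l13, l14⟩ := h.l₁_mem
  obtain ⟨v001, v002, v003, v004⟩ := h.v₀₀_mem
  obtain ⟨v021, v022, v023, v024⟩ := h.v₀₂_mem
  obtain ⟨v101, v102, v103, v104⟩ := h.v₁₀_mem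
  obtain ⟨o1, o2, o3, o4⟩ := h.o_nmem
  obtain ⟨an1, an2, an3, an4, an5, an6, an7⟩ := h.a_nmem
  obtain ⟨cn1, cn2, cn3, cn4⟩ := h.c_nmem
  have h1 : ∀ i, f i (b i) ≠ 0 := by
    intro i; fin_cases i
    exacts [an1, an2, an3, o1]
  have h0 : ∀ i j, i ≠ j → f i (b j) = 0 := by
    intro i j; fin_cases i <;> fin_cases j <;> intro hij <;>
      first | exact absurd rfl hij | simpa [f, b]
  obtain ⟨X, hX⟩ : ∃ X : P → Fin 4 → K, ∀ p i, X p i = f i (vec p) / f i (b i) :=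
    ⟨_, fun _ _ => rfl⟩
  have hvec : ∀ p, vec p = ∑ i, X p i • b i := fun p => by
    simp only [hX]; exact eq_sum_of_biorthogonal h0 h1 (vec p)
  have hψ : ∀ β p, φ β (vec p) = φ β (vec a₀) * X p 0 + φ β (vec a₁) * X p 1 +
      φ β (vec a₂) * X p 2 + φ β (vec o) * X p 3 := fun β p => by
    conv_lhs => rw [hvec]
    simp [Fin.sum_univ_four, b, mul_comm]
  have X0 : ∀ p i, f i (vec p) = 0 → X p i = 0 := fun p i h => by rw [hX, h, zero_div]
  have Xn : ∀ p i, f i (vec p) ≠ 0 → X p i ≠ 0 := fun p i h => by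
    rw [hX]; exact div_ne_zero h (h1 i)
  have xz : ∀ p, X p 0 = 0 → X p 1 = 0 → X p 2 = 0 → X p 3 = 0 → False := fun p h0 h1 h2 h3 =>
    hv p (by rw [hvec, Fin.sum_univ_four, h0, h1, h2, h3]; simp)
  rw [hψ] at l01 l03 l04 l11 l12 l14 v002 v003 v004 v022 v023 v024 v102 v103 v104 cn1
  rw [X0 c₀ 3 w4] at l11 v002 v102 cn1
  rw [X0 c₂ 3 w5] at l01 l12 v022
  rw [X0 x₀₀ 0 f04] at l03 v024 v103
  rw [X0 x₀₁ 0 f05] at l14 v003 v023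
  rw [X0 x₁₀ 1 f14] at l04 v004 v104
  rw [l02] at l01 l03 l04 cn1
  rw [l13] at l11 l12 l14
  rw [v001] at v002 v003 v004
  rw [v021] at v022 v023 v024
  rw [v101] at v102 v103 v104
  have M02 := Xn c₀ 2 cn2
  have M22 := Xn c₂ 2 cn3
  have M00 := Xn c₀ 0 cn4
  -- In each of the following incidences two of the four products vanish, so the remaining pair of
  -- unknown coordinates has a single parameter.
  obtain ⟨κ, k1, k2⟩ := exists_cross (a := φ l₀ (vec a₁)) (b := φ l₀ (vec a₂)) (x := X x₀₀ 1)
    (y := X x₀₀ 2) (by linear_combination l03) an4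
  obtain ⟨κ', k1', k2'⟩ := exists_cross (a := φ l₁ (vec a₁)) (b := φ l₁ (vec a₂)) (x := X x₀₁ 1)
    (y := X x₀₁ 2) (by linear_combination l14) an5
  obtain ⟨κ'', k1'', k2''⟩ := exists_cross (a := φ l₀ (vec a₀)) (b := φ l₀ (vec a₂)) (x := X x₁₀ 0)
    (y := X x₁₀ 2) (by linear_combination l04) an4
  obtain ⟨σ, s1, s2⟩ := exists_cross (a := X c₀ 1) (b := X c₀ 2) (x := φ v₀₀ (vec a₁))
    (y := φ v₀₀ (vec a₂)) (by linear_combination v002) M02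
  obtain ⟨σ2, s1', s2'⟩ := exists_cross (a := X c₂ 1) (b := X c₂ 2) (x := φ v₀₂ (vec a₁))
    (y := φ v₀₂ (vec a₂)) (by linear_combination v022) M22
  obtain ⟨σ3, s1'', s2''⟩ := exists_cross (a := X c₀ 0) (b := X c₀ 2) (x := φ v₁₀ (vec a₀))
    (y := φ v₁₀ (vec a₂)) (by linear_combination v102) M02
  rw [k1, k2] at v024
  rw [k2] at v103
  rw [k1', k2'] at v003 v023
  rw [k2''] at v004
  rw [k1'', k2''] at v104
  rw [s1, s2] at v003
  rw [s2] at v004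
  rw [s1', s2'] at v023 v024
  rw [s2''] at v103
  rw [s1'', s2''] at v104
  have hσ3 : σ3 ≠ 0 := fun h => an7 (by rw [s1'', h, zero_mul])
  -- If the parameter vanished, so would all four coordinates of the point.
  have hκ : κ ≠ 0 := fun h => xz x₀₀ (X0 _ 0 f04) (by rw [k1, h, zero_mul])
    (by rw [k2, h, zero_mul, neg_zero])
    (mul_left_cancel₀ o4 (by rw [h] at v103; linear_combination v103))
  have hκ' : κ' ≠ 0 := fun h => xz x₀₁ (X0 _ 0 f05) (by rw [k1', h, zero_mul])
    (by rw [k2', h, zero_mul, neg_zero])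
    (mul_left_cancel₀ o3 (by rw [h] at v023; linear_combination v023))
  have hκ'' : κ'' ≠ 0 := fun h => xz x₁₀ (by rw [k1'', h, zero_mul]) (X0 _ 1 f14)
    (by rw [k2'', h, zero_mul, neg_zero])
    (mul_left_cancel₀ o2 (by rw [h] at v004; linear_combination v004))
  apply cn1
  have := pattern_absurd (M00 := X c₀ 0) (M01 := X c₀ 1) (M02 := X c₀ 2) (M20 := X c₂ 0)
    (M21 := X c₂ 1) (M22 := X c₂ 2) (n00 := φ l₀ (vec a₀)) (n01 := φ l₀ (vec a₁))
    (n02 := φ l₀ (vec a₂)) (n10 := φ l₁ (vec a₀)) (n11 := φ l₁ (vec a₁))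
    (n12 := φ l₁ (vec a₂)) (κ := κ) (κ' := κ') (κ'' := κ'') (σ := σ) (σ2 := σ2) (σ3 := σ3)
    (C := φ v₀₀ (vec o)) (C2 := φ v₀₂ (vec o)) (C3 := φ v₁₀ (vec o)) (h := X x₀₀ 3)
    (h' := X x₀₁ 3) (h'' := X x₁₀ 3)
    (by linear_combination l01) (by linear_combination l11) (by linear_combination l12)
    (by linear_combination v003) (by linear_combination v004) (by linear_combination v023)
    (by linear_combination v024) (by linear_combination v103) (by linear_combination v104)
    o2 o3 hκ hκ' hκ'' hσ3 an6 M00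
  linear_combination this

end KummerQuartic

/-! ### Configurations as quaternion frames -/

namespace KummerQuartic

variable {K : Type*} [Field K]

/-- Rotation matrices without zero entries. -/
structure IsGenericRotation (R : Matrix (Fin 3) (Fin 3) K) : Prop where
  mul_transpose : R * R.transpose = 1
  det_eq : R.det = 1
  ne_zero : ∀ k j, R k j ≠ 0

namespace IsGenericRotation

variable {R : Matrix (Fin 3) (Fin 3) K} (hR : IsGenericRotation R)

include hR

theorem transpose : IsGenericRotation R.transpose where
  mul_transpose := by rw [Matrix.transpose_transpose]; exact mul_eq_one_comm.1 hR.mul_transpose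
  det_eq := by rw [Matrix.det_transpose, hR.det_eq]
  ne_zero k j := hR.ne_zero j k

theorem adjugate : R.adjugate = R.transpose := by
  have h1 := Matrix.mul_adjugate R
  rw [hR.det_eq, one_smul] at h1
  have h2 := mul_eq_one_comm.1 hR.mul_transpose
  calc R.adjugate = (R.transpose * R) * R.adjugate := by rw [h2, one_mul]
    _ = R.transpose := by rw [mul_assoc, h1, mul_one]

theorem row_dot (k l : Fin 3) :
    R k 0 * R l 0 + R k 1 * R l 1 + R k 2 * R l 2 = if k = l then 1 else 0 := by
  have := congrFun (congrFun hR.mul_transpose k) l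
  rw [Matrix.mul_apply, Fin.sum_univ_three, Matrix.one_apply] at this
  exact this

/-- For a rotation the adjugate is the transpose, so every entry is its own cofactor. In this form
the rotation property enters the later computations as relations between entries. -/
theorem cofactors :
    (R 0 0 = R 1 1 * R 2 2 - R 1 2 * R 2 1 ∧ R 0 1 = R 1 2 * R 2 0 - R 1 0 * R 2 2 ∧
      R 0 2 = R 1 0 * R 2 1 - R 1 1 * R 2 0) ∧
    (R 1 0 = R 2 1 * R 0 2 - R 2 2 * R 0 1 ∧ R 1 1 = R 2 2 * R 0 0 - R 2 0 * R 0 2 ∧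
      R 1 2 = R 2 0 * R 0 1 - R 2 1 * R 0 0) ∧
    (R 2 0 = R 0 1 * R 1 2 - R 0 2 * R 1 1 ∧ R 2 1 = R 0 2 * R 1 0 - R 0 0 * R 1 2 ∧
      R 2 2 = R 0 0 * R 1 1 - R 0 1 * R 1 0) := by
  have h := hR.adjugate
  rw [Matrix.adjugate_fin_three] at h
  have e : ∀ i j, _ := fun i j => congrFun (congrFun h i) j
  have e00 := e 0 0
  have e01 := e 0 1
  have e02 := e 0 2
  have e10 := e 1 0
  have e11 := e 1 1
  have e12 := e 1 2
  have e20 := e 2 0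
  have e21 := e 2 1
  have e22 := e 2 2
  simp at e00 e01 e02 e10 e11 e12 e20 e21 e22
  refine ⟨⟨?_, ?_, ?_⟩, ⟨?_, ?_, ?_⟩, ⟨?_, ?_, ?_⟩⟩
  · linear_combination -e00
  · linear_combination -e10
  · linear_combination -e20
  · linear_combination -e01
  · linear_combination -e11
  · linear_combination -e21
  · linear_combination -e02
  · linear_combination -e12
  · linear_combination -e22

end IsGenericRotation

theorem frame_ne_zero {R : Matrix (Fin 3) (Fin 3) K} (hR : IsGenericRotation R)
    (m : Fin 4 × Fin 4) : frame R m ≠ 0 := by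
  intro h
  obtain ⟨μ, ν⟩ := m
  have h0 := hR.ne_zero
  have h1 : ∀ i, frame R (μ, ν) i = 0 := fun i => by rw [h]; rfl
  revert h1
  refine Fin.cases ?_ (fun k => ?_) ν
  · intro h1
    have := h1 μ
    simp [frame_zero_right, qe] at this
  · refine Fin.cases ?_ (fun j => ?_) μ
    · intro h1
      have := h1 (Fin.succ 0)
      rw [frame_zero_left] at this
      exact h0 _ _ this
    · intro h1
      exact h0 k j (neg_eq_zero.1 ((frame_succ_succ R j k).1.symm.trans (h1 0)))

/-- The sixteen points of a quaternion frame. -/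
def framePt {R : Matrix (Fin 3) (Fin 3) K} (hR : IsGenericRotation R) (m : Fin 4 × Fin 4) :
    ℙ K (Fin 4 → K) :=
  Projectivization.mk K (frame R m) (frame_ne_zero hR m)

theorem exists_dual_ker_eq {W : Submodule K (Fin 4 → K)} (hW : Module.finrank K W = 3) :
    ∃ φ : Module.Dual K (Fin 4 → K), LinearMap.ker φ = W := by
  have hlt : W < ⊤ := by
    rw [lt_top_iff_ne_top]
    rintro rfl
    rw [finrank_top] at hW
    simp at hW
  obtain ⟨φ, hφ, hle⟩ := Submodule.exists_le_ker_of_lt_top W hlt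
  refine ⟨φ, (Submodule.eq_of_le_of_finrank_eq hle ?_).symm⟩
  have := Module.Dual.finrank_ker_add_one_of_ne_zero hφ
  rw [hW]
  simp at this
  omega

open scoped Classical in
/-- A nondegenerate configuration is a biplane, realized by vectors and linear forms. -/
theorem exists_biplane_of_config {N : Set (ℙ K (Fin 4 → K))} {N' : Set (Submodule K (Fin 4 → K))}
    (h : IsNondegenerateConfig N N') [Fintype N] [Fintype N'] :
    ∃ φ : N' → Module.Dual K (Fin 4 → K), (∀ W, LinearMap.ker (φ W) = W.1) ∧
      IsBiplane (fun (p : N) (W : N') => φ W p.1.rep = 0) := by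
  choose φ hφ using fun W : N' => exists_dual_ker_eq (h.finrank_plane W.1 W.2)
  have hm : ∀ (p : N) (W : N'), φ W p.1.rep = 0 ↔ p.1.submodule ≤ W.1 := fun p W => by
    rw [submodule_le_iff_rep, ← hφ W, LinearMap.mem_ker]
  refine ⟨φ, hφ, ?_⟩
  have hN : ∀ q : ℙ K (Fin 4 → K) → Prop,
      (Finset.univ.filter fun p : N => q p.1).card = {p | p ∈ N ∧ q p}.ncard := by
    intro q
    rw [← Set.ncard_coe_finset, ← Set.ncard_image_of_injective _ Subtype.val_injective]
    congr 1
    ext p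
    simp [and_comm]
  have hN' : ∀ q : Submodule K (Fin 4 → K) → Prop,
      (Finset.univ.filter fun p : N' => q p.1).card = {p | p ∈ N' ∧ q p}.ncard := by
    intro q
    rw [← Set.ncard_coe_finset, ← Set.ncard_image_of_injective _ Subtype.val_injective]
    congr 1
    ext p
    simp [and_comm]
  constructor
  · rw [← Nat.card_eq_fintype_card]; exact h.card_points
  · rw [← Nat.card_eq_fintype_card]; exact h.card_planes
  · intro p
    simp only [hm]
    exact (hN' _).trans (h.planes_through p.1 p.2)
  · intro W
    simp only [hm]
    exact (hN _).trans (h.points_on W.1 W.2)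
  · intro W W' hWW
    simp only [hm]
    convert (hN _).trans (h.nondegenerate W.1 W.2 W'.1 W'.2 fun h => hWW (Subtype.ext h))

/-- Every nondegenerate configuration is projectively equivalent to a quaternion frame. -/
theorem exists_frame_of_config [IsAlgClosed K] {N : Set (ℙ K (Fin 4 → K))}
    {N' : Set (Submodule K (Fin 4 → K))} (h : IsNondegenerateConfig N N') :
    ∃ (g : (Fin 4 → K) ≃ₗ[K] (Fin 4 → K)) (R : Matrix (Fin 3) (Fin 3) K)
      (hR : IsGenericRotation R), imagePoints g N = Set.range (framePt hR) ∧
      imagePlanes g N' = orthogonalPlanes (Set.range (framePt hR)) := by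
  have fN : N.Finite := Set.finite_of_ncard_ne_zero (by rw [h.card_points]; norm_num)
  have fN' : N'.Finite := Set.finite_of_ncard_ne_zero (by rw [h.card_planes]; norm_num)
  have := fN.fintype
  have := fN'.fintype
  obtain ⟨φ, hφ, hB⟩ := exists_biplane_of_config h
  obtain ⟨pt, bl, hI⟩ := hB.exists_rook
    (fun _ _ _ _ _ _ _ _ _ _ _ _ _ _ _ _ _ _ => not_pattern
      (vec := fun p : N => p.1.rep) (φ := φ) (fun p => p.1.rep_nonzero)
      _ _ _ _ _ _ _ _ _ _ _ _ _ _ _ _ _ _)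
  -- One column of the board is a tetrahedron: distinct cells of it are incident, equal cells are
  -- not.
  let b : Fin 4 → Fin 4 → K := fun μ => (pt (μ, 0)).1.rep
  let f : Fin 4 → Module.Dual K (Fin 4 → K) := fun μ => φ (bl (μ, 0))
  have h0 : ∀ i j, i ≠ j → f i (b j) = 0 := fun i j hij => (hI _ _).2 (by simp [Xor, hij.symm])
  have h1 : ∀ i, f i (b i) ≠ 0 := fun i => by rw [Ne, hI]; simp [Xor]
  have hs := eq_sum_of_biorthogonal h0 h1
  have hΦ : ∀ n v, φ (bl n) v = ∑ μ, φ (bl n) (b μ) * (f μ v / f μ (b μ)) := by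
    intro n v
    conv_lhs => rw [hs v, map_sum]
    simp [mul_comm]
  obtain ⟨τ, R, hτ, hR, hdet, hR0, hpt, hpl⟩ := exists_frame_of_rook
    (A := fun m μ => f μ (pt m).1.rep / f μ (b μ)) (Φ := fun n μ => φ (bl n) (b μ))
    (by
      intro μ ν
      by_cases hμν : μ = ν
      · subst hμν; rw [if_pos rfl]; exact div_self (h1 μ)
      · rw [if_neg hμν]; exact div_eq_zero_iff.2 (Or.inl (h0 ν μ (Ne.symm hμν))))
    (fun μ ν hμν => h0 μ ν hμν) (fun μ => h1 μ) (fun m n => by rw [← hΦ, hI])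
  have hgen : IsGenericRotation R := ⟨hR, hdet, hR0⟩
  -- Passage to coordinates along this tetrahedron, followed by the rescaling `τ`.
  let g₀ : (Fin 4 → K) →ₗ[K] (Fin 4 → K) := LinearMap.pi fun μ => (τ μ / f μ (b μ)) • f μ
  have hg₀ : ∀ v μ, g₀ v μ = τ μ * (f μ v / f μ (b μ)) := fun v μ => by
    simp only [g₀, LinearMap.pi_apply, LinearMap.smul_apply, smul_eq_mul]; ring
  have hinj : Function.Injective g₀ := by
    rw [injective_iff_map_eq_zero]
    intro v hv
    rw [hs v]
    refine Finset.sum_eq_zero fun μ _ => ?_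
    have := congrFun hv μ
    rw [hg₀] at this
    rw [(mul_eq_zero.1 this).resolve_left (hτ μ), zero_smul]
  let g : (Fin 4 → K) ≃ₗ[K] (Fin 4 → K) := LinearEquiv.ofInjectiveEndo g₀ hinj
  have hg : ∀ v μ, g v μ = τ μ * (f μ v / f μ (b μ)) := hg₀
  have hgpt : ∀ m, g • (pt m).1 = framePt hgen m := by
    intro m
    obtain ⟨c, hc, hm⟩ := hpt m
    conv_lhs => rw [← (pt m).1.mk_rep]
    rw [smul_mk_eq]
    exact mk_eq_mk_of_smul _ _ (c := c) (funext fun μ => by rw [hg, hm]; rfl)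
  have hgpl : ∀ n, (bl n).1.map (g : (Fin 4 → K) →ₗ[K] (Fin 4 → K)) =
      orthogonalPlane (framePt hgen n) := by
    intro n
    obtain ⟨d, hd, hn⟩ := hpl n
    ext x
    obtain ⟨v, rfl⟩ := g.surjective x
    rw [framePt, mem_orthogonalPlane_mk, ← hφ, dotProduct]
    have : φ (bl n) v = d * ∑ μ, frame R n μ * g v μ := by
      rw [hΦ, Finset.mul_sum]
      refine Finset.sum_congr rfl fun μ _ => ?_
      rw [hg, hn]; ring
    constructor
    · rintro ⟨v', hv', hvv⟩
      have : v' = v := g.injective hvv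
      subst this
      rw [SetLike.mem_coe, LinearMap.mem_ker, this] at hv'
      exact (mul_eq_zero.1 hv').resolve_left hd
    · intro h
      exact ⟨v, by rw [SetLike.mem_coe, LinearMap.mem_ker, this, h, mul_zero], rfl⟩
  refine ⟨g, R, hgen, ?_, ?_⟩
  · ext p
    constructor
    · rintro ⟨q, hq, rfl⟩
      obtain ⟨m, hm⟩ := pt.surjective ⟨q, hq⟩
      exact ⟨m, by rw [← hgpt, hm]⟩
    · rintro ⟨m, rfl⟩
      exact ⟨_, (pt m).2, hgpt m⟩
  · ext W
    constructor
    · rintro ⟨q, hq, rfl⟩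
      obtain ⟨m, hm⟩ := bl.surjective ⟨q, hq⟩
      exact ⟨_, ⟨m, rfl⟩, by rw [← hgpl, hm]⟩
    · rintro ⟨_, ⟨m, rfl⟩, rfl⟩
      exact ⟨_, (bl m).2, hgpl m⟩

end KummerQuartic

/-! ### The quaternion of a rotation and the normal form -/

namespace KummerQuartic

variable {K : Type*} [Field K]

theorem qmul_assoc (x y z : Fin 4 → K) : qmul (qmul x y) z = qmul x (qmul y z) := by
  funext i
  fin_cases i <;> simp [qmul] <;> ring

/-- The polarized multiplicativity of the norm: right multiplication is a similitude, hence
compatible with taking orthogonal planes. -/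
theorem qmul_dotProduct_qmul (x y q : Fin 4 → K) :
    qmul x q ⬝ᵥ qmul y q = (q ⬝ᵥ q) * (x ⬝ᵥ y) := by
  simp [dotProduct, Fin.sum_univ_four, qmul]
  ring

/-- Right multiplication by a quaternion of nonzero norm. -/
noncomputable def qmulRight (q : Fin 4 → K) (hq : q ⬝ᵥ q ≠ 0) : (Fin 4 → K) ≃ₗ[K] (Fin 4 → K) :=
  LinearEquiv.ofInjectiveEndo
    { toFun := fun x => qmul x q
      map_add' := fun x y => by funext i; fin_cases i <;> simp [qmul] <;> ring
      map_smul' := fun c x => by funext i; fin_cases i <;> simp [qmul] <;> ring }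
    (by
      rw [injective_iff_map_eq_zero]
      intro x hx
      have hx : qmul x q = 0 := hx
      have h1 : qmul (qmul x q) ![q 0, - q 1, - q 2, - q 3] = (q ⬝ᵥ q) • x := by
        funext i
        fin_cases i <;> simp [qmul, dotProduct, Fin.sum_univ_four] <;> ring
      rw [hx] at h1
      have h2 : qmul (0 : Fin 4 → K) ![q 0, - q 1, - q 2, - q 3] = 0 := by
        funext i; fin_cases i <;> simp [qmul]
      rw [h2] at h1
      exact (smul_eq_zero.1 h1.symm).resolve_left hq)

theorem qmulRight_apply (q : Fin 4 → K) (hq : q ⬝ᵥ q ≠ 0) (x : Fin 4 → K) :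
    qmulRight q hq x = qmul x q := rfl

theorem imagePlanes_orthogonalPlanes {g : (Fin 4 → K) ≃ₗ[K] (Fin 4 → K)} {c : K} (hc : c ≠ 0)
    (hg : ∀ x y, g x ⬝ᵥ g y = c * (x ⬝ᵥ y)) (N : Set (ℙ K (Fin 4 → K))) :
    imagePlanes g (orthogonalPlanes N) = orthogonalPlanes (imagePoints g N) := by
  rw [imagePlanes, orthogonalPlanes, orthogonalPlanes, imagePoints, Set.image_image,
    Set.image_image]
  refine Set.image_congr fun p _ => ?_
  induction p using Projectivization.ind with
  | h x hx =>
    ext y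
    obtain ⟨v, rfl⟩ := g.surjective y
    rw [smul_mk_eq, mem_orthogonalPlane_mk, hg, mul_eq_zero, or_iff_right hc]
    constructor
    · rintro ⟨v', hv', hvv⟩
      rw [← g.injective hvv]
      exact (mem_orthogonalPlane_mk hx _).1 hv'
    · exact fun h => ⟨v, (mem_orthogonalPlane_mk hx _).2 h, rfl⟩

section Rotation

variable {R : Matrix (Fin 3) (Fin 3) K}

theorem IsGenericRotation.flip (hR : IsGenericRotation R) {s : Fin 3 → K}
    (hs : ∀ k, s k * s k = 1) (h1 : s 0 * s 1 * s 2 = 1) :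
    IsGenericRotation (Matrix.diagonal s * R) where
  mul_transpose := by
    rw [Matrix.transpose_mul, Matrix.diagonal_transpose, Matrix.mul_assoc, ← Matrix.mul_assoc R,
      hR.mul_transpose, Matrix.one_mul, Matrix.diagonal_mul_diagonal]
    simp [hs]
  det_eq := by
    rw [Matrix.det_mul, hR.det_eq, mul_one, Matrix.det_diagonal, Fin.prod_univ_three, h1]
  ne_zero k j := by
    rw [Matrix.diagonal_mul]
    exact mul_ne_zero (left_ne_zero_of_mul_eq_one (hs k)) (hR.ne_zero k j)

theorem frame_flip (s : Fin 3 → K) (m : Fin 4 × Fin 4) :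
    frame (Matrix.diagonal s * R) m = (Fin.cons 1 s : Fin 4 → K) m.2 • frame R m := by
  obtain ⟨μ, ν⟩ := m
  refine Fin.cases ?_ (fun k => ?_) ν
  · rw [frame_zero_right, frame_zero_right]; simp
  · simp only [frame, rowq_succ, Matrix.diagonal_mul]
    funext i
    fin_cases i <;> simp [qmul] <;> ring

theorem range_framePt_flip (hR : IsGenericRotation R) {s : Fin 3 → K}
    (hs : ∀ k, s k * s k = 1) (h1 : s 0 * s 1 * s 2 = 1) :
    Set.range (framePt (hR.flip hs h1)) = Set.range (framePt hR) := by
  congr 1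
  funext m
  exact mk_eq_mk_of_smul _ _ (frame_flip s m)

/-- Negating an even number of rows changes the vectors only by signs. Over the four choices of
signs the quantities 1 + tr add up to 4, so they do not all vanish. -/
theorem exists_flip (h2 : (2 : K) ≠ 0) (hR : IsGenericRotation R) :
    ∃ (S : Matrix (Fin 3) (Fin 3) K) (hS : IsGenericRotation S),
      Set.range (framePt hS) = Set.range (framePt hR) ∧ 1 + S 0 0 + S 1 1 + S 2 2 ≠ 0 := by
  by_contra! h
  have key : ∀ s : Fin 3 → K, (∀ k, s k * s k = 1) → s 0 * s 1 * s 2 = 1 →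
      1 + s 0 * R 0 0 + s 1 * R 1 1 + s 2 * R 2 2 = 0 := by
    intro s hs h1
    have := h _ (hR.flip hs h1) (range_framePt_flip hR hs h1)
    simpa [Matrix.diagonal_mul] using this
  have k1 := key ![1, 1, 1] (by intro k; fin_cases k <;> simp) (by simp)
  have k2 := key ![1, -1, -1] (by intro k; fin_cases k <;> simp) (by simp)
  have k3 := key ![-1, 1, -1] (by intro k; fin_cases k <;> simp) (by simp)
  have k4 := key ![-1, -1, 1] (by intro k; fin_cases k <;> simp) (by simp)
  simp at k1 k2 k3 k4
  have : (2 : K) * 2 = 0 := by linear_combination k1 + k2 + k3 + k4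
  exact h2 (mul_self_eq_zero.1 this)

/-- A quaternion that induces the rotation `R`. -/
def rotq (R : Matrix (Fin 3) (Fin 3) K) : Fin 4 → K :=
  ![1 + R 0 0 + R 1 1 + R 2 2, R 1 2 - R 2 1, R 2 0 - R 0 2, R 0 1 - R 1 0]

variable (hR : IsGenericRotation R)

include hR

theorem rotq_dotProduct_self : rotq R ⬝ᵥ rotq R = 4 * (1 + R 0 0 + R 1 1 + R 2 2) := by
  obtain ⟨⟨c00, c01, c02⟩, ⟨c10, c11, c12⟩, ⟨c20, c21, c22⟩⟩ := hR.cofactors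
  have d0 := hR.row_dot 0 0
  have d1 := hR.row_dot 1 1
  have d2 := hR.row_dot 2 2
  simp only [if_true] at d0 d1 d2
  simp [dotProduct, Fin.sum_univ_four, rotq]
  linear_combination d0 + d1 + d2 - 2 * c00 - 2 * c11 - 2 * c22

/-- Conjugation by `rotq R` is the rotation R, stated without inverses so that no condition on the
norm is needed. -/
theorem rowq_qmul_rotq (k : Fin 4) : qmul (rowq R k) (rotq R) = qmul (rotq R) (qe K k) := by
  obtain ⟨⟨c00, c01, c02⟩, ⟨c10, c11, c12⟩, ⟨c20, c21, c22⟩⟩ := hR.cofactors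
  have d00 := hR.row_dot 0 0
  have d11 := hR.row_dot 1 1
  have d22 := hR.row_dot 2 2
  have d01 := hR.row_dot 0 1
  have d02 := hR.row_dot 0 2
  have d12 := hR.row_dot 1 2
  simp only [if_true] at d00 d11 d22
  rw [if_neg (by decide)] at d01 d02 d12
  refine Fin.cases ?_ (fun k => ?_) k
  · funext i
    fin_cases i <;> simp [rowq, qmul, qe]
  · rw [rowq_succ]
    funext i
    fin_cases k <;> fin_cases i <;> simp [qmul, qe, rotq]
    · linear_combination - c21 + c12
    · linear_combination - c22 - c11 + d00
    · linear_combination c10 + d01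
    · linear_combination c20 + d02
    · linear_combination c20 - c02
    · linear_combination c01 + d01
    · linear_combination - c22 + d11 - c00
    · linear_combination c21 + d12
    · linear_combination c01 - c10
    · linear_combination c02 + d02
    · linear_combination d12 + c12
    · linear_combination d22 - c00 - c11

/-- Moving `rotq R` to the right leaves the product of a unit with a row, which is an entry of R.
The nine products are the expressions of (II) and (III) in the coordinates of `rotq R`, up to sign
and a factor 2. -/
theorem dotProduct_rotq (j k : Fin 3) :
    qmul (qe K j.succ) (rotq R) ⬝ᵥ qmul (rotq R) (qe K k.succ) =
      (rotq R ⬝ᵥ rotq R) * R k j := by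
  rw [← rowq_qmul_rotq hR, qmul_dotProduct_qmul, rowq_succ]
  congr 1
  fin_cases j <;> simp [qe, dotProduct, Fin.sum_univ_four]

/-- The nine nonzero entries of R give (II) and (III), and the nonzero norm gives the sum of
squares. -/
theorem admissible_rotq (h : rotq R ⬝ᵥ rotq R ≠ 0) : Admissible (rotq R) := by
  have key : ∀ j k : Fin 3, qmul (qe K j.succ) (rotq R) ⬝ᵥ qmul (rotq R) (qe K k.succ) ≠ 0 :=
    fun j k => by
      rw [dotProduct_rotq hR]; exact mul_ne_zero h (hR.ne_zero k j)
  generalize rotq R = a at h key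
  have h00 := key 0 0
  have h01 := key 0 1
  have h02 := key 0 2
  have h10 := key 1 0
  have h11 := key 1 1
  have h12 := key 1 2
  have h20 := key 2 0
  have h21 := key 2 1
  have h22 := key 2 2
  simp [qmul, qe, dotProduct, Fin.sum_univ_four] at h00 h01 h02 h10 h11 h12 h20 h21 h22
  simp only [dotProduct, Fin.sum_univ_four] at h
  have m1 : a 0 * a 1 + a 2 * a 3 ≠ 0 := fun h => h21 (by linear_combination 2 * h)
  have m1' : a 0 * a 1 - a 2 * a 3 ≠ 0 := fun h => h12 (by linear_combination -2 * h)
  have m2 : a 0 * a 2 + a 1 * a 3 ≠ 0 := fun h => h02 (by linear_combination 2 * h)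
  have m2' : a 0 * a 2 - a 1 * a 3 ≠ 0 := fun h => h20 (by linear_combination -2 * h)
  have m3 : a 0 * a 3 + a 1 * a 2 ≠ 0 := fun h => h10 (by linear_combination 2 * h)
  have m3' : a 0 * a 3 - a 1 * a 2 ≠ 0 := fun h => h01 (by linear_combination -2 * h)
  refine ⟨?_, ?_, ⟨m1, m1'⟩, ⟨m2, m2'⟩, ⟨m3, m3'⟩, ?_, ?_, ?_⟩
  · intro i j hij ⟨hi, hj⟩
    fin_cases i <;> fin_cases j <;> simp_all
  · rw [Fin.sum_univ_four]; exact fun h' => h (by linear_combination h')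
  · exact fun h => h00 (by linear_combination h)
  · exact fun h => h11 (by linear_combination h)
  · exact fun h => h22 (by linear_combination h)

-- Multiplication by a quaternion unit is a signed permutation with sign product 1, so up to a
-- global sign it is a Heisenberg element. Likewise on the right.
omit hR in
theorem qe_qmul (μ : Fin 4) :
    ∃ (n : Fin 4 × Fin 4) (s : ℤˣ), ∀ z : Fin 4 → K,
      qmul (qe K μ) z = ((s : ℤ) : K) • heis K n z := by
  refine ⟨(μ, ![0, 1, 3, 2] μ), ![1, -1, -1, -1] μ, fun z => ?_⟩
  funext i
  fin_cases μ <;> fin_cases i <;> simp [qmul, qe, heis_apply, sgn]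

omit hR in
theorem qmul_qe (μ : Fin 4) :
    ∃ (n : Fin 4 × Fin 4) (s : ℤˣ), ∀ z : Fin 4 → K,
      qmul z (qe K μ) = ((s : ℤ) : K) • heis K n z := by
  refine ⟨(μ, ![0, 3, 2, 1] μ), ![1, -1, -1, -1] μ, fun z => ?_⟩
  funext i
  fin_cases μ <;> fin_cases i <;> simp [qmul, qe, heis_apply, sgn]

omit hR in
theorem qe_qmul_qe (m : Fin 4 × Fin 4) :
    ∃ (n : Fin 4 × Fin 4) (s : ℤˣ), ∀ z : Fin 4 → K,
      qmul (qe K m.1) (qmul z (qe K m.2)) = ((s : ℤ) : K) • heis K n z := by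
  obtain ⟨n, s, h⟩ := qe_qmul (K := K) m.1
  obtain ⟨n', s', h'⟩ := qmul_qe (K := K) m.2
  obtain ⟨k, t, hk⟩ := exists_heis_of_mem (mul_mem (heis_mem (K := K) n) (heis_mem n'))
  refine ⟨k, s * s' * t, fun z => ?_⟩
  rw [h, h', map_smul, ← LinearEquiv.mul_apply, hk, smul_smul, smul_smul]
  push_cast
  rfl

/-- Since r_ν q = q e_ν, the point e_μ r_ν goes to e_μ q e_ν, a point of the orbit of q. Both sets
have sixteen points, so the inclusion is an equality. -/
theorem imagePoints_rotq (h2 : (2 : K) ≠ 0) (h : rotq R ⬝ᵥ rotq R ≠ 0)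
    (h16 : (Set.range (framePt hR)).ncard = 16) :
    imagePoints (qmulRight _ h) (Set.range (framePt hR)) =
      kummerOrbit (rotq R) (admissible_rotq hR h) := by
  have hc := (isNondegenerateConfig_kummerOrbit h2 (admissible_rotq hR h)).card_points
  refine Set.eq_of_subset_of_ncard_le ?_ (by rw [imagePoints_ncard, h16, hc])
    (Set.finite_of_ncard_ne_zero (by rw [hc]; norm_num))
  rintro _ ⟨_, ⟨m, rfl⟩, rfl⟩
  obtain ⟨n, s, hn⟩ := qe_qmul_qe (K := K) m
  rw [kummerOrbit_eq_range]
  refine ⟨n, ?_⟩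
  symm
  rw [framePt]
  simp only [smul_mk_eq]
  refine mk_eq_mk_of_smul _ _ (c := ((s : ℤ) : K)) ?_
  rw [qmulRight_apply, frame, qmul_assoc, rowq_qmul_rotq hR, hn]

end Rotation

/-- The normal form of a nondegenerate configuration. -/
theorem exists_admissible_of_config [IsAlgClosed K] (h2 : (2 : K) ≠ 0) {N : Set (ℙ K (Fin 4 → K))}
    {N' : Set (Submodule K (Fin 4 → K))} (h : IsNondegenerateConfig N N') :
    ∃ (a : Fin 4 → K) (ha : Admissible a),
      ProjectivelyEquivalent N N' (kummerOrbit a ha) (orthogonalPlanes (kummerOrbit a ha)) := by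
  obtain ⟨g, R, hR, hg, hg'⟩ := exists_frame_of_config h
  obtain ⟨S, hS, hSR, hS1⟩ := exists_flip h2 hR
  rw [← hSR] at hg hg'
  have hq : rotq S ⬝ᵥ rotq S ≠ 0 := by
    rw [rotq_dotProduct_self hS]
    exact mul_ne_zero (by simpa [show (4 : K) = 2 * 2 by norm_num] using h2) hS1
  have e1 := imagePoints_rotq hS h2 hq (by rw [← hg, imagePoints_ncard, h.card_points])
  have e2 := imagePlanes_orthogonalPlanes (g := qmulRight _ hq) hq
    (fun x y => qmul_dotProduct_qmul x y (rotq S)) (Set.range (framePt hS))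
  refine ⟨rotq S, admissible_rotq hS hq, g.trans (qmulRight _ hq), ?_, ?_⟩
  · rw [← e1, ← hg, imagePoints, imagePoints, imagePoints, Set.image_image]
    refine Set.image_congr fun p _ => ?_
    exact mul_smul (qmulRight _ hq) g p
  · rw [← e1, ← e2, ← hg', imagePlanes, imagePlanes, imagePlanes, Set.image_image]
    refine Set.image_congr fun W _ => ?_
    exact Submodule.map_comp _ _ W

theorem ProjectivelyEquivalent.strictlySelfDual {N N₁ : Set (ℙ K (Fin 4 → K))}
    {N' : Set (Submodule K (Fin 4 → K))}
    (h : ProjectivelyEquivalent N N' N₁ (orthogonalPlanes N₁)) : StrictlySelfDual N N' := by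
  obtain ⟨g, h1, h2⟩ := h
  exact ⟨g, by rw [h1, h2]⟩

end KummerQuartic

/-! ### Quartic forms singular at the coordinate points -/

namespace KummerQuartic

open MvPolynomial

variable {K : Type*} [Field K]

theorem eq_sum_antidiagonalTuple {n d : ℕ} {F : MvPolynomial (Fin n) K} (hF : F.IsHomogeneous d) :
    F = ∑ t ∈ Finset.Nat.antidiagonalTuple n d,
      C (coeff (Finsupp.equivFunOnFinite.symm t) F) * ∏ i, X i ^ t i := by
  have hm : ∀ t : Fin n → ℕ, C (coeff (Finsupp.equivFunOnFinite.symm t) F) * ∏ i, X i ^ t i =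
      monomial (Finsupp.equivFunOnFinite.symm t) (coeff (Finsupp.equivFunOnFinite.symm t) F) := by
    intro t
    rw [monomial_eq, Finsupp.prod_fintype _ _ (by simp)]
    rfl
  simp only [hm]
  ext s
  rw [coeff_sum]
  simp only [coeff_monomial]
  by_cases hs : ∑ i, s i = d
  · rw [Finset.sum_eq_single (s : Fin n → ℕ)]
    · simp
    · intro t _ hts
      rw [if_neg]
      rintro rfl
      exact hts rfl
    · intro h
      exact absurd (Finset.Nat.mem_antidiagonalTuple.2 hs) h
  · rw [hF.coeff_eq_zero (by rwa [Finsupp.degree_eq_sum]), Finset.sum_eq_zero]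
    intro t ht
    rw [if_neg]
    rintro rfl
    exact hs (Finset.Nat.mem_antidiagonalTuple.1 ht)

theorem antidiagonalTuple_four_four : List.Nat.antidiagonalTuple 4 4 = [
    ![0, 0, 0, 4], ![0, 0, 1, 3], ![0, 0, 2, 2], ![0, 0, 3, 1], ![0, 0, 4, 0], ![0, 1, 0, 3],
      ![0, 1, 1, 2], ![0, 1, 2, 1], ![0, 1, 3, 0], ![0, 2, 0, 2], ![0, 2, 1, 1], ![0, 2, 2, 0],
      ![0, 3, 0, 1], ![0, 3, 1, 0], ![0, 4, 0, 0], ![1, 0, 0, 3], ![1, 0, 1, 2], ![1, 0, 2, 1],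
      ![1, 0, 3, 0], ![1, 1, 0, 2], ![1, 1, 1, 1], ![1, 1, 2, 0], ![1, 2, 0, 1], ![1, 2, 1, 0],
      ![1, 3, 0, 0], ![2, 0, 0, 2], ![2, 0, 1, 1], ![2, 0, 2, 0], ![2, 1, 0, 1], ![2, 1, 1, 0],
      ![2, 2, 0, 0], ![3, 0, 0, 1], ![3, 0, 1, 0], ![3, 1, 0, 0], ![4, 0, 0, 0]] := by decide

theorem eval_single_of_isHomogeneous {n : ℕ} {σ : Type*} [Fintype σ] [DecidableEq σ]
    {F : MvPolynomial σ K} (hF : F.IsHomogeneous n) (μ : σ) :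
    eval (Pi.single μ 1) F = coeff (Finsupp.single μ n) F := by
  rw [eval_eq', Finset.sum_eq_single (Finsupp.single μ n)]
  · rw [Finset.prod_eq_one, mul_one]
    intro i _
    by_cases h : i = μ
    · subst h; simp
    · simp [h]
  · intro d hd hne
    rw [mul_eq_zero]
    right
    by_contra h
    rw [← Ne, Finset.prod_ne_zero_iff] at h
    apply hne
    have h0 : ∀ i, i ≠ μ → d i = 0 := by
      intro i hi
      by_contra hdi
      exact h i (Finset.mem_univ _) (by rw [Pi.single_eq_of_ne hi, zero_pow hdi])
    have hdeg : ∑ i, d i = n := by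
      have := hF (mem_support_iff.1 hd)
      rw [Finsupp.weight_apply, Finsupp.sum_fintype _ _ (by simp)] at this
      simpa using this
    rw [Finset.sum_eq_single μ (fun i _ hi => h0 i hi) (by simp)] at hdeg
    ext i
    by_cases hi : i = μ
    · subst hi; simp [hdeg]
    · rw [h0 i hi, Finsupp.single_eq_of_ne hi]
  · intro h
    rw [notMem_support_iff.1 h, zero_mul]

/-- At a coordinate point the value of a form of degree n + 1 is the coefficient of X_μ^(n+1), and
the derivative by another variable X_j is the coefficient of X_μ^n X_j. -/
theorem coeff_eq_zero_of_singAt {F : MvPolynomial (Fin 4) K} {n : ℕ} (hF : F.IsHomogeneous (n + 1))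
    {μ : Fin 4} (hs : SingAt F (Pi.single μ 1)) {d : Fin 4 →₀ ℕ} (hd : n ≤ d μ) :
    coeff d F = 0 := by
  by_cases hdeg : d.degree = n + 1
  swap
  · exact hF.coeff_eq_zero hdeg
  rw [Finsupp.degree_eq_sum, ← Finset.add_sum_erase _ _ (Finset.mem_univ μ)] at hdeg
  rcases Nat.lt_or_ge n (d μ) with h | h
  · have h0 : ∀ i ∈ Finset.univ.erase μ, d i = 0 := by
      rw [← Finset.sum_eq_zero_iff]; omega
    have : d = Finsupp.single μ (n + 1) := by
      rw [Finset.sum_eq_zero h0] at hdeg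
      ext i
      by_cases hi : i = μ
      · subst hi; simpa using hdeg
      · rw [h0 i (by simp [hi]), Finsupp.single_eq_of_ne hi]
    rw [this, ← eval_single_of_isHomogeneous hF, hs.1]
  · have hdμ : d μ = n := le_antisymm h hd
    have h1 : ∑ i ∈ Finset.univ.erase μ, d i = 1 := by omega
    obtain ⟨j, hj, hj0⟩ : ∃ j ∈ Finset.univ.erase μ, d j ≠ 0 :=
      Finset.exists_ne_zero_of_sum_ne_zero (by rw [h1]; norm_num)
    rw [← Finset.add_sum_erase _ _ hj] at h1
    have hz : ∀ i ∈ (Finset.univ.erase μ).erase j, d i = 0 := by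
      rw [← Finset.sum_eq_zero_iff]; omega
    have hjμ : j ≠ μ := (Finset.mem_erase.1 hj).1
    have : d = Finsupp.single μ n + Finsupp.single j 1 := by
      rw [Finset.sum_eq_zero hz] at h1
      ext i
      by_cases hi : i = μ
      · subst hi; simp [hdμ, hjμ]
      · by_cases hij : i = j
        · subst hij; simp [hi]; omega
        · rw [hz i (by simp [hi, hij])]; simp [hi, hij]
    -- The monomial is linear in X_j with j ≠ μ, so differentiation introduces no factor depending
    -- on the characteristic.
    have hp := eval_single_of_isHomogeneous (hF.pderiv (i := j)) μ
    rw [hs.2, Nat.add_sub_cancel, coeff_pderiv] at hp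
    rw [this]
    simpa [hjμ] using hp.symm

/-- A quartic form that is singular at the four coordinate points has no terms of degree at least
three in one of the coordinates. -/
theorem exists_coeff_quartic_of_singAt {F : MvPolynomial (Fin 4) K} (hF : F.IsHomogeneous 4)
    (hs : ∀ μ, SingAt F (Pi.single μ 1)) :
    ∃ A01 A02 A03 A12 A13 A23 B012 B013 B023 B102 B103 B123 B201 B203 B213 B301 B302 B312 E : K, F =
      C A01 * (X 0 ^ 2 * X 1 ^ 2) + C A02 * (X 0 ^ 2 * X 2 ^ 2) + C A03 * (X 0 ^ 2 * X 3 ^ 2) +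
      C A12 * (X 1 ^ 2 * X 2 ^ 2) + C A13 * (X 1 ^ 2 * X 3 ^ 2) + C A23 * (X 2 ^ 2 * X 3 ^ 2) +
      C B012 * (X 0 ^ 2 * X 1 * X 2) + C B013 * (X 0 ^ 2 * X 1 * X 3) +
      C B023 * (X 0 ^ 2 * X 2 * X 3) + C B102 * (X 0 * X 1 ^ 2 * X 2) +
      C B103 * (X 0 * X 1 ^ 2 * X 3) + C B123 * (X 1 ^ 2 * X 2 * X 3) +
      C B201 * (X 0 * X 1 * X 2 ^ 2) + C B203 * (X 0 * X 2 ^ 2 * X 3) +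
      C B213 * (X 1 * X 2 ^ 2 * X 3) + C B301 * (X 0 * X 1 * X 3 ^ 2) +
      C B302 * (X 0 * X 2 * X 3 ^ 2) + C B312 * (X 1 * X 2 * X 3 ^ 2) +
      C E * (X 0 * X 1 * X 2 * X 3) := by
  obtain ⟨c, hc, hz⟩ : ∃ c : (Fin 4 → ℕ) → K, (F = ((List.Nat.antidiagonalTuple 4 4).map fun t =>
      C (c t) * ∏ i, X i ^ t i).sum) ∧ ∀ t, (∃ μ, 3 ≤ t μ) → c t = 0 :=
    ⟨_, eq_sum_antidiagonalTuple hF, fun t ⟨μ, hμ⟩ => coeff_eq_zero_of_singAt hF (hs μ) hμ⟩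
  refine ⟨c ![2, 2, 0, 0], c ![2, 0, 2, 0], c ![2, 0, 0, 2], c ![0, 2, 2, 0], c ![0, 2, 0, 2],
    c ![0, 0, 2, 2], c ![2, 1, 1, 0], c ![2, 1, 0, 1], c ![2, 0, 1, 1], c ![1, 2, 1, 0],
    c ![1, 2, 0, 1], c ![0, 2, 1, 1], c ![1, 1, 2, 0], c ![1, 0, 2, 1], c ![0, 1, 2, 1],
    c ![1, 1, 0, 2], c ![1, 0, 1, 2], c ![0, 1, 1, 2], c ![1, 1, 1, 1], ?_⟩
  rw [hc, antidiagonalTuple_four_four]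
  simp only [List.map_cons, List.map_nil, List.sum_cons, List.sum_nil, Fin.prod_univ_four]
  rw [hz ![0, 0, 0, 4] ⟨3, by decide⟩, hz ![0, 0, 1, 3] ⟨3, by decide⟩,
    hz ![0, 0, 3, 1] ⟨2, by decide⟩, hz ![0, 0, 4, 0] ⟨2, by decide⟩,
    hz ![0, 1, 0, 3] ⟨3, by decide⟩, hz ![0, 1, 3, 0] ⟨2, by decide⟩,
    hz ![0, 3, 0, 1] ⟨1, by decide⟩, hz ![0, 3, 1, 0] ⟨1, by decide⟩,
    hz ![0, 4, 0, 0] ⟨1, by decide⟩, hz ![1, 0, 0, 3] ⟨3, by decide⟩,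
    hz ![1, 0, 3, 0] ⟨2, by decide⟩, hz ![1, 3, 0, 0] ⟨1, by decide⟩,
    hz ![3, 0, 0, 1] ⟨0, by decide⟩, hz ![3, 0, 1, 0] ⟨0, by decide⟩,
    hz ![3, 1, 0, 0] ⟨0, by decide⟩, hz ![4, 0, 0, 0] ⟨0, by decide⟩]
  simp only [Matrix.cons_val, pow_zero, pow_one, one_mul, mul_one, map_zero, zero_mul, add_zero,
    zero_add]
  ring

end KummerQuartic

/-! ### Restriction to a face: squares of conics -/

namespace KummerQuartic

open MvPolynomial

variable {K : Type*} [Field K]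

section Face

variable {A₀ A₁ A₂ B₀ B₁ B₂ : K}

/-- The equations for a form `A₀ z₁²z₂² + ⋯ + B₀ z₀²z₁z₂ + ⋯` to be singular at `z`. -/
structure FaceSing (A₀ A₁ A₂ B₀ B₁ B₂ : K) (z₀ z₁ z₂ : K) : Prop where
  eval : A₀ * (z₁ ^ 2 * z₂ ^ 2) + A₁ * (z₀ ^ 2 * z₂ ^ 2) + A₂ * (z₀ ^ 2 * z₁ ^ 2) +
    z₀ * z₁ * z₂ * (B₀ * z₀ + B₁ * z₁ + B₂ * z₂) = 0
  d₀ : 2 * A₁ * (z₀ * z₂ ^ 2) + 2 * A₂ * (z₀ * z₁ ^ 2) +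
    z₁ * z₂ * (2 * B₀ * z₀ + B₁ * z₁ + B₂ * z₂) = 0
  d₁ : 2 * A₀ * (z₁ * z₂ ^ 2) + 2 * A₂ * (z₁ * z₀ ^ 2) +
    z₀ * z₂ * (B₀ * z₀ + 2 * B₁ * z₁ + B₂ * z₂) = 0
  d₂ : 2 * A₀ * (z₂ * z₁ ^ 2) + 2 * A₁ * (z₂ * z₀ ^ 2) +
    z₀ * z₁ * (B₀ * z₀ + B₁ * z₁ + 2 * B₂ * z₂) = 0

/-- In the Cremona coordinates z₁z₂, z₀z₂, z₀z₁ the form is quadratic. A singular point off the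
coordinate lines therefore gives a vector in the kernel of its symmetric matrix. -/
theorem FaceSing.rows {z₀ z₁ z₂ : K} (h : FaceSing A₀ A₁ A₂ B₀ B₁ B₂ z₀ z₁ z₂) (h₀ : z₀ ≠ 0)
    (h₁ : z₁ ≠ 0) (h₂ : z₂ ≠ 0) :
    2 * A₀ * (z₁ * z₂) + B₂ * (z₀ * z₂) + B₁ * (z₀ * z₁) = 0 ∧
    B₂ * (z₁ * z₂) + 2 * A₁ * (z₀ * z₂) + B₀ * (z₀ * z₁) = 0 ∧
    B₁ * (z₁ * z₂) + B₀ * (z₀ * z₂) + 2 * A₂ * (z₀ * z₁) = 0 := by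
  refine ⟨?_, ?_, ?_⟩
  · apply mul_left_cancel₀ (mul_ne_zero h₁ h₂)
    linear_combination 2 * h.eval - z₀ * h.d₀
  · apply mul_left_cancel₀ (mul_ne_zero h₀ h₂)
    linear_combination 2 * h.eval - z₁ * h.d₁
  · apply mul_left_cancel₀ (mul_ne_zero h₀ h₁)
    linear_combination 2 * h.eval - z₂ * h.d₂

/-- The restriction of the quartic to a plane of the configuration is the square of a conic. -/
theorem face_square (h2 : (2 : K) ≠ 0) {u : Fin 3 → Fin 3 → K} (hu : ∀ k j, u k j ≠ 0) {l : K}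
    (hl : l ≠ 0)
    (m₀ : u 0 1 * u 1 2 - u 0 2 * u 1 1 = l * u 2 0)
    (m₁ : u 0 2 * u 1 0 - u 0 0 * u 1 2 = l * u 2 1)
    (m₂ : u 0 0 * u 1 1 - u 0 1 * u 1 0 = l * u 2 2)
    (hs : ∀ k, FaceSing A₀ A₁ A₂ B₀ B₁ B₂ (u k 0) (u k 1) (u k 2)) :
    ∃ c, ∀ c₀ c₁ c₂, c₀ = u 0 0 * u 1 0 * u 2 0 → c₁ = u 0 1 * u 1 1 * u 2 1 →
      c₂ = u 0 2 * u 1 2 * u 2 2 → A₀ = c * c₀ ^ 2 ∧ A₁ = c * c₁ ^ 2 ∧ A₂ = c * c₂ ^ 2 ∧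
        B₀ = 2 * c * (c₁ * c₂) ∧ B₁ = 2 * c * (c₀ * c₂) ∧ B₂ = 2 * c * (c₀ * c₁) := by
  obtain ⟨p0, p1, p2⟩ := (hs 0).rows (hu _ _) (hu _ _) (hu _ _)
  obtain ⟨q0, q1, q2⟩ := (hs 1).rows (hu _ _) (hu _ _) (hu _ _)
  obtain ⟨c₀, hc₀⟩ : ∃ c, c = u 0 0 * u 1 0 * u 2 0 := ⟨_, rfl⟩
  obtain ⟨c₁, hc₁⟩ : ∃ c, c = u 0 1 * u 1 1 * u 2 1 := ⟨_, rfl⟩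
  obtain ⟨c₂, hc₂⟩ : ∃ c, c = u 0 2 * u 1 2 * u 2 2 := ⟨_, rfl⟩
  have n₀ : c₀ ≠ 0 := by
    rw [hc₀]; exact mul_ne_zero (mul_ne_zero (hu _ _) (hu _ _)) (hu _ _)
  have n₁ : c₁ ≠ 0 := by
    rw [hc₁]; exact mul_ne_zero (mul_ne_zero (hu _ _) (hu _ _)) (hu _ _)
  -- Each row of the symmetric matrix is orthogonal to the Cremona images of the first two points.
  -- Their cross product is a nonzero multiple of (c₀, c₁, c₂), so all rows are proportional to it
  -- and the matrix has rank at most one.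
  have key : ∀ {x y z : K},
      x * (u 0 1 * u 0 2) + y * (u 0 0 * u 0 2) + z * (u 0 0 * u 0 1) = 0 →
      x * (u 1 1 * u 1 2) + y * (u 1 0 * u 1 2) + z * (u 1 0 * u 1 1) = 0 →
      x * c₁ = y * c₀ ∧ x * c₂ = z * c₀ ∧ y * c₂ = z * c₁ := by
    intro x y z hx hy
    rw [hc₀, hc₁, hc₂]
    refine ⟨?_, ?_, ?_⟩ <;> apply mul_left_cancel₀ hl
    · linear_combination (u 1 0 * u 1 1) * hx - (u 0 0 * u 0 1) * hy -
        x * u 0 1 * u 1 1 * m₁ + y * u 0 0 * u 1 0 * m₀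
    · linear_combination - (u 1 0 * u 1 2) * hx + (u 0 0 * u 0 2) * hy -
        x * u 0 2 * u 1 2 * m₂ + z * u 0 0 * u 1 0 * m₀
    · linear_combination (u 1 1 * u 1 2) * hx - (u 0 1 * u 0 2) * hy -
        y * u 0 2 * u 1 2 * m₂ + z * u 0 1 * u 1 1 * m₁
  obtain ⟨a1, a2, a3⟩ := key p0 q0
  obtain ⟨b1, b2, b3⟩ := key p1 q1
  obtain ⟨d1, d2, d3⟩ := key p2 q2
  refine ⟨A₀ / c₀ ^ 2, fun c₀' c₁' c₂' h₀ h₁ h₂ => ?_⟩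
  rw [h₀, h₁, h₂, ← hc₀, ← hc₁, ← hc₂]
  have eB2 : B₂ = 2 * (A₀ / c₀ ^ 2) * (c₀ * c₁) := by
    field_simp; linear_combination - a1
  have eB1 : B₁ = 2 * (A₀ / c₀ ^ 2) * (c₀ * c₂) := by
    field_simp; linear_combination - a2
  have eA1 : A₁ = A₀ / c₀ ^ 2 * c₁ ^ 2 := by
    apply mul_left_cancel₀ h2
    apply mul_left_cancel₀ n₀
    rw [eB2] at b1
    field_simp at b1 ⊢
    linear_combination - b1
  refine ⟨by field_simp, eA1, ?_, ?_, eB1, eB2⟩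
  · apply mul_left_cancel₀ h2
    apply mul_left_cancel₀ n₀
    rw [eB1] at d2
    field_simp at d2 ⊢
    linear_combination - d2
  · apply mul_left_cancel₀ n₁
    rw [eA1] at b3
    field_simp at b3 ⊢
    linear_combination - b3

end Face

/-! ### The quartic with nodes at a quaternion frame -/

/-- The tangent cone at the first coordinate point. -/
noncomputable def kumQ (c : Fin 3 → K) : MvPolynomial (Fin 4) K :=
  C (c 0 ^ 2) * X 1 ^ 2 + C (c 1 ^ 2) * X 2 ^ 2 + C (c 2 ^ 2) * X 3 ^ 2 -
    2 * C (c 0 * c 1) * (X 1 * X 2) - 2 * C (c 0 * c 2) * (X 1 * X 3) -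
    2 * C (c 1 * c 2) * (X 2 * X 3)

/-- Half of the coefficient of the first coordinate. -/
noncomputable def kumG (c : Fin 3 → K) (e : K) : MvPolynomial (Fin 4) K :=
  C (c 0 * c 1) * (X 1 ^ 2 * X 3 - X 2 ^ 2 * X 3) +
    C (c 0 * c 2) * (X 2 * X 3 ^ 2 - X 1 ^ 2 * X 2) +
    C (c 1 * c 2) * (X 1 * X 2 ^ 2 - X 1 * X 3 ^ 2) + C e * (X 1 * X 2 * X 3)

/-- The conic in the plane where the first coordinate vanishes. -/
noncomputable def kumL (c : Fin 3 → K) : MvPolynomial (Fin 4) K :=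
  C (c 0) * (X 2 * X 3) + C (c 1) * (X 1 * X 3) + C (c 2) * (X 1 * X 2)

/-- The quartic with nodes at a quaternion frame. -/
noncomputable def kumForm (c : Fin 3 → K) (e : K) : MvPolynomial (Fin 4) K :=
  X 0 ^ 2 * kumQ c + 2 * X 0 * kumG c e + kumL c ^ 2

/-- The products of the entries in the columns of `R`. -/
def colProd (R : Matrix (Fin 3) (Fin 3) K) (j : Fin 3) : K := R 0 j * R 1 j * R 2 j

/-- The coefficient of the product of the coordinates. -/
noncomputable def kumE (R : Matrix (Fin 3) (Fin 3) K) : K :=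
  - (colProd R 0 * colProd R 1 * (R 0 0 ^ 2 * R 0 2 - R 0 1 ^ 2 * R 0 2) +
    colProd R 0 * colProd R 2 * (R 0 1 * R 0 2 ^ 2 - R 0 0 ^ 2 * R 0 1) +
    colProd R 1 * colProd R 2 * (R 0 0 * R 0 1 ^ 2 - R 0 0 * R 0 2 ^ 2)) /
    (R 0 0 * R 0 1 * R 0 2)

section Frame

variable (R : Matrix (Fin 3) (Fin 3) K) (k : Fin 3)

theorem frame_zero : frame R (0, k.succ) = ![0, R k 0, R k 1, R k 2] := by
  funext i; fin_cases i <;> simp [frame, rowq_succ, qmul, qe]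

theorem frame_one : frame R (1, k.succ) = ![- R k 0, 0, - R k 2, R k 1] := by
  funext i; fin_cases i <;> simp [frame, rowq_succ, qmul, qe]

theorem frame_two : frame R (2, k.succ) = ![- R k 1, R k 2, 0, - R k 0] := by
  funext i; fin_cases i <;> simp [frame, rowq_succ, qmul, qe]

theorem frame_three : frame R (3, k.succ) = ![- R k 2, - R k 1, R k 0, 0] := by
  funext i; fin_cases i <;> simp [frame, rowq_succ, qmul, qe]

end Frame

-- On each coordinate plane the three frame points besides the coordinate points satisfy
-- `face_square`. This gives every coefficient except that of the product of all coordinates, up to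
-- one scalar per face. A shared coefficient makes the four scalars equal, and one more derivative
-- yields the last coefficient.
set_option maxHeartbeats 1000000 in
theorem eq_kumForm_of_singAt (h2 : (2 : K) ≠ 0) {R : Matrix (Fin 3) (Fin 3) K}
    (hR : IsGenericRotation R) {F : MvPolynomial (Fin 4) K} (hF : F.IsHomogeneous 4)
    (hs : ∀ m, SingAt F (frame R m)) : ∃ c, F = C c * kumForm (colProd R) (kumE R) := by
  obtain ⟨A01, A02, A03, A12, A13, A23, B012, B013, B023, B102, B103, B123, B201, B203, B213, B301, B302, B312, E, hFe⟩ :=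
    exists_coeff_quartic_of_singAt hF fun μ => by
      have := hs (μ, 0)
      rwa [frame_zero_right] at this
  have hev : ∀ x : Fin 4 → K, eval x F =
      A01 * x 0 ^ 2 * x 1 ^ 2 + A02 * x 0 ^ 2 * x 2 ^ 2 + A03 * x 0 ^ 2 * x 3 ^ 2 +
      A12 * x 1 ^ 2 * x 2 ^ 2 + A13 * x 1 ^ 2 * x 3 ^ 2 + A23 * x 2 ^ 2 * x 3 ^ 2 +
      B012 * x 0 ^ 2 * x 1 * x 2 + B013 * x 0 ^ 2 * x 1 * x 3 + B023 * x 0 ^ 2 * x 2 * x 3 +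
      B102 * x 0 * x 1 ^ 2 * x 2 + B103 * x 0 * x 1 ^ 2 * x 3 + B123 * x 1 ^ 2 * x 2 * x 3 +
      B201 * x 0 * x 1 * x 2 ^ 2 + B203 * x 0 * x 2 ^ 2 * x 3 + B213 * x 1 * x 2 ^ 2 * x 3 +
      B301 * x 0 * x 1 * x 3 ^ 2 + B302 * x 0 * x 2 * x 3 ^ 2 + B312 * x 1 * x 2 * x 3 ^ 2 +
      E * x 0 * x 1 * x 2 * x 3 := by
    intro x
    rw [hFe]
    simp
    ring
  have hd0 : ∀ x : Fin 4 → K, eval x (pderiv 0 F) =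
      2 * A01 * x 0 * x 1 ^ 2 + 2 * A02 * x 0 * x 2 ^ 2 + 2 * A03 * x 0 * x 3 ^ 2 +
      2 * B012 * x 0 * x 1 * x 2 + 2 * B013 * x 0 * x 1 * x 3 + 2 * B023 * x 0 * x 2 * x 3 +
      B102 * x 1 ^ 2 * x 2 + B103 * x 1 ^ 2 * x 3 + B201 * x 1 * x 2 ^ 2 + B203 * x 2 ^ 2 * x 3 +
      B301 * x 1 * x 3 ^ 2 + B302 * x 2 * x 3 ^ 2 + E * x 1 * x 2 * x 3 := by
    intro x
    rw [hFe]
    simp [pderiv_X]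
    ring
  have hd1 : ∀ x : Fin 4 → K, eval x (pderiv 1 F) =
      2 * A01 * x 0 ^ 2 * x 1 + 2 * A12 * x 1 * x 2 ^ 2 + 2 * A13 * x 1 * x 3 ^ 2 +
      B012 * x 0 ^ 2 * x 2 + B013 * x 0 ^ 2 * x 3 + 2 * B102 * x 0 * x 1 * x 2 +
      2 * B103 * x 0 * x 1 * x 3 + 2 * B123 * x 1 * x 2 * x 3 + B201 * x 0 * x 2 ^ 2 +
      B213 * x 2 ^ 2 * x 3 + B301 * x 0 * x 3 ^ 2 + B312 * x 2 * x 3 ^ 2 + E * x 0 * x 2 * x 3 := by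
    intro x
    rw [hFe]
    simp [pderiv_X]
    ring
  have hd2 : ∀ x : Fin 4 → K, eval x (pderiv 2 F) =
      2 * A02 * x 0 ^ 2 * x 2 + 2 * A12 * x 1 ^ 2 * x 2 + 2 * A23 * x 2 * x 3 ^ 2 +
      B012 * x 0 ^ 2 * x 1 + B023 * x 0 ^ 2 * x 3 + B102 * x 0 * x 1 ^ 2 + B123 * x 1 ^ 2 * x 3 +
      2 * B201 * x 0 * x 1 * x 2 + 2 * B203 * x 0 * x 2 * x 3 + 2 * B213 * x 1 * x 2 * x 3 +
      B302 * x 0 * x 3 ^ 2 + B312 * x 1 * x 3 ^ 2 + E * x 0 * x 1 * x 3 := by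
    intro x
    rw [hFe]
    simp [pderiv_X]
    ring
  have hd3 : ∀ x : Fin 4 → K, eval x (pderiv 3 F) =
      2 * A03 * x 0 ^ 2 * x 3 + 2 * A13 * x 1 ^ 2 * x 3 + 2 * A23 * x 2 ^ 2 * x 3 +
      B013 * x 0 ^ 2 * x 1 + B023 * x 0 ^ 2 * x 2 + B103 * x 0 * x 1 ^ 2 + B123 * x 1 ^ 2 * x 2 +
      B203 * x 0 * x 2 ^ 2 + B213 * x 1 * x 2 ^ 2 + 2 * B301 * x 0 * x 1 * x 3 +
      2 * B302 * x 0 * x 2 * x 3 + 2 * B312 * x 1 * x 2 * x 3 + E * x 0 * x 1 * x 2 := by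
    intro x
    rw [hFe]
    simp [pderiv_X]
    ring
  obtain ⟨⟨c00, c01, c02⟩, ⟨c10, c11, c12⟩, ⟨c20, c21, c22⟩⟩ := hR.cofactors
  have hn := hR.ne_zero
  have hs0 : ∀ k : Fin 3, FaceSing A23 A13 A12 B123 B213 B312 (R k 0) (R k 1) (R k 2) := by
    intro k
    obtain ⟨h, hd⟩ := hs (0, k.succ)
    have h0 := hd 1
    have h1 := hd 2
    have h2 := hd 3
    rw [frame_zero] at h h0 h1 h2
    rw [hev] at h
    rw [hd1] at h0
    rw [hd2] at h1
    rw [hd3] at h2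
    simp only [Matrix.cons_val] at h h0 h1 h2
    exact ⟨by linear_combination h, by linear_combination h0, by linear_combination h1,
      by linear_combination h2⟩
  obtain ⟨t0, ht0⟩ := face_square h2 (u := fun k => ![R k 0, R k 1, R k 2]) (l := 1)
    (by intro k j; fin_cases j <;> simp [hn]) (by simp)
    (by simp only [Matrix.cons_val]; linear_combination - c20)
    (by simp only [Matrix.cons_val]; linear_combination - c21)
    (by simp only [Matrix.cons_val]; linear_combination - c22) hs0
  have hs1 : ∀ k : Fin 3, FaceSing A23 A03 A02 B023 B203 B302 (- R k 0) (- R k 2) (R k 1) := by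
    intro k
    obtain ⟨h, hd⟩ := hs (1, k.succ)
    have h0 := hd 0
    have h1 := hd 2
    have h2 := hd 3
    rw [frame_one] at h h0 h1 h2
    rw [hev] at h
    rw [hd0] at h0
    rw [hd2] at h1
    rw [hd3] at h2
    simp only [Matrix.cons_val] at h h0 h1 h2
    exact ⟨by linear_combination h, by linear_combination h0, by linear_combination h1,
      by linear_combination h2⟩
  obtain ⟨t1, ht1⟩ := face_square h2 (u := fun k => ![- R k 0, - R k 2, R k 1]) (l := -1)
    (by intro k j; fin_cases j <;> simp [hn]) (by simp)
    (by simp only [Matrix.cons_val]; linear_combination - c20)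
    (by simp only [Matrix.cons_val]; linear_combination - c22)
    (by simp only [Matrix.cons_val]; linear_combination c21) hs1
  have hs2 : ∀ k : Fin 3, FaceSing A13 A03 A01 B013 B103 B301 (- R k 1) (R k 2) (- R k 0) := by
    intro k
    obtain ⟨h, hd⟩ := hs (2, k.succ)
    have h0 := hd 0
    have h1 := hd 1
    have h2 := hd 3
    rw [frame_two] at h h0 h1 h2
    rw [hev] at h
    rw [hd0] at h0
    rw [hd1] at h1
    rw [hd3] at h2
    simp only [Matrix.cons_val] at h h0 h1 h2
    exact ⟨by linear_combination h, by linear_combination h0, by linear_combination h1,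
      by linear_combination h2⟩
  obtain ⟨t2, ht2⟩ := face_square h2 (u := fun k => ![- R k 1, R k 2, - R k 0]) (l := 1)
    (by intro k j; fin_cases j <;> simp [hn]) (by simp)
    (by simp only [Matrix.cons_val]; linear_combination c21)
    (by simp only [Matrix.cons_val]; linear_combination - c22)
    (by simp only [Matrix.cons_val]; linear_combination c20) hs2
  have hs3 : ∀ k : Fin 3, FaceSing A12 A02 A01 B012 B102 B201 (- R k 2) (- R k 1) (R k 0) := by
    intro k
    obtain ⟨h, hd⟩ := hs (3, k.succ)
    have h0 := hd 0
    have h1 := hd 1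
    have h2 := hd 2
    rw [frame_three] at h h0 h1 h2
    rw [hev] at h
    rw [hd0] at h0
    rw [hd1] at h1
    rw [hd2] at h2
    simp only [Matrix.cons_val] at h h0 h1 h2
    exact ⟨by linear_combination h, by linear_combination h0, by linear_combination h1,
      by linear_combination h2⟩
  obtain ⟨t3, ht3⟩ := face_square h2 (u := fun k => ![- R k 2, - R k 1, R k 0]) (l := -1)
    (by intro k j; fin_cases j <;> simp [hn]) (by simp)
    (by simp only [Matrix.cons_val]; linear_combination - c22)
    (by simp only [Matrix.cons_val]; linear_combination - c21)
    (by simp only [Matrix.cons_val]; linear_combination c20) hs3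
  obtain ⟨f0a, f0b, f0c, f0d, f0e, f0f⟩ := ht0 (colProd R 0) (colProd R 1) (colProd R 2)
    (by simp [colProd]) (by simp [colProd]) (by simp [colProd])
  obtain ⟨f1a, f1b, f1c, f1d, f1e, f1f⟩ := ht1 (- colProd R 0) (- colProd R 2) (colProd R 1)
    (by simp [colProd]) (by simp [colProd]) (by simp [colProd])
  obtain ⟨f2a, f2b, f2c, f2d, f2e, f2f⟩ := ht2 (- colProd R 1) (colProd R 2) (- colProd R 0)
    (by simp [colProd]) (by simp [colProd]) (by simp [colProd])
  obtain ⟨f3a, f3b, f3c, f3d, f3e, f3f⟩ := ht3 (- colProd R 2) (- colProd R 1) (colProd R 0)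
    (by simp [colProd]) (by simp [colProd]) (by simp [colProd])
  -- The coefficient `E` is invisible on the faces; the derivative by the first coordinate at the
  -- frame point r_1 determines it.
  have hE := (hs (0, Fin.succ 0)).2 0
  rw [frame_zero, hd0] at hE
  simp only [Matrix.cons_val] at hE
  have hc : ∀ j, colProd R j ≠ 0 := fun j => mul_ne_zero (mul_ne_zero (hn _ _) (hn _ _)) (hn _ _)
  have hc2 : ∀ j, colProd R j ^ 2 ≠ 0 := fun j => pow_ne_zero 2 (hc j)
  -- Two faces share the square term of their common edge, so their scalars agree.
  have t01 : t1 = t0 := mul_right_cancel₀ (hc2 0) (by linear_combination f0a - f1a)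
  have t02 : t2 = t0 := mul_right_cancel₀ (hc2 1) (by linear_combination f0b - f2a)
  have t03 : t3 = t0 := mul_right_cancel₀ (hc2 2) (by linear_combination f0c - f3a)
  rw [t01] at f1a f1b f1c f1d f1e f1f
  rw [t02] at f2a f2b f2c f2d f2e f2f
  rw [t03] at f3a f3b f3c f3d f3e f3f
  have hEe : E = 2 * t0 * kumE R := by
    have h00 := hn 0 0
    have h01 := hn 0 1
    have h02 := hn 0 2
    rw [f1e, f1f, f2e, f2f, f3e, f3f] at hE
    rw [kumE]
    field_simp
    linear_combination hE
  refine ⟨t0, ?_⟩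
  rw [hFe, f0a, f0b, f0c, f0d, f0e, f0f, f1b, f1c, f1d, f1e, f1f, f2c, f2d, f2e, f2f, f3d, f3e, f3f,
    hEe]
  simp only [kumForm, kumQ, kumG, kumL, map_mul, map_pow, map_neg, map_ofNat]
  ring

end KummerQuartic

namespace KummerQuartic

open MvPolynomial

variable {K : Type*} [Field K]

/-! ### Exchanging the two frames -/

theorem IsGenericRotation.col_dot {R : Matrix (Fin 3) (Fin 3) K} (hR : IsGenericRotation R)
    (k l : Fin 3) : R 0 k * R 0 l + R 1 k * R 1 l + R 2 k * R 2 l = if k = l then 1 else 0 :=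
  hR.transpose.row_dot k l

/-- The action of a rotation on quaternions. -/
def rot (R : Matrix (Fin 3) (Fin 3) K) (z : Fin 4 → K) : Fin 4 → K :=
  ![z 0, R 0 0 * z 1 + R 0 1 * z 2 + R 0 2 * z 3, R 1 0 * z 1 + R 1 1 * z 2 + R 1 2 * z 3,
    R 2 0 * z 1 + R 2 1 * z 2 + R 2 2 * z 3]

/-- Rotations preserve scalar and cross products, hence quaternion multiplication. Orthogonality of
the columns handles the scalar part, the cofactor relations the pure part. -/
theorem rot_qmul {R : Matrix (Fin 3) (Fin 3) K} (hR : IsGenericRotation R) (x y : Fin 4 → K) :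
    rot R (qmul x y) = qmul (rot R x) (rot R y) := by
  obtain ⟨⟨c00, c01, c02⟩, ⟨c10, c11, c12⟩, ⟨c20, c21, c22⟩⟩ := hR.cofactors
  have k00 := hR.col_dot 0 0
  have k11 := hR.col_dot 1 1
  have k22 := hR.col_dot 2 2
  have k01 := hR.col_dot 0 1
  have k02 := hR.col_dot 0 2
  have k12 := hR.col_dot 1 2
  simp only [if_true] at k00 k11 k22
  rw [if_neg (by decide)] at k01 k02 k12
  funext i
  fin_cases i <;> simp [rot, qmul]
  · linear_combination (x 1 * y 1) * k00 + (x 2 * y 2) * k11 + (x 3 * y 3) * k22 +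
      (x 2 * y 3 + x 3 * y 2) * k12 + (x 1 * y 3 + x 3 * y 1) * k02 +
      (x 1 * y 2 + x 2 * y 1) * k01
  · linear_combination (x 2 * y 3 - x 3 * y 2) * c00 + (-x 1 * y 3 + x 3 * y 1) * c01 +
      (x 1 * y 2 - x 2 * y 1) * c02
  · linear_combination (x 1 * y 2 - x 2 * y 1) * c12 + (-x 1 * y 3 + x 3 * y 1) * c11 +
      (x 2 * y 3 - x 3 * y 2) * c10
  · linear_combination (x 1 * y 2 - x 2 * y 1) * c22 + (-x 1 * y 3 + x 3 * y 1) * c21 +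
      (x 2 * y 3 - x 3 * y 2) * c20

/-- The conjugate of a quaternion. -/
def qconj (z : Fin 4 → K) : Fin 4 → K := ![z 0, - z 1, - z 2, - z 3]

theorem qconj_qmul (x y : Fin 4 → K) : qconj (qmul x y) = qmul (qconj y) (qconj x) := by
  funext i
  fin_cases i <;> simp [qconj, qmul] <;> ring

theorem rot_rowq {R : Matrix (Fin 3) (Fin 3) K} (hR : IsGenericRotation R) (ν : Fin 4) :
    rot R (rowq R ν) = qe K ν := by
  have d := hR.row_dot
  refine Fin.cases ?_ (fun k => ?_) ν
  · funext i
    fin_cases i <;> simp [rot, rowq, qe]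
  · rw [rowq_succ]
    funext i
    fin_cases i
    · simp [rot, qe]
    · change R 0 0 * R k 0 + R 0 1 * R k 1 + R 0 2 * R k 2 = qe K k.succ (Fin.succ 0)
      rw [d, qe, Pi.single_apply]; simp only [Fin.succ_inj]
    · change R 1 0 * R k 0 + R 1 1 * R k 1 + R 1 2 * R k 2 = qe K k.succ (Fin.succ 1)
      rw [d, qe, Pi.single_apply]; simp only [Fin.succ_inj]
    · change R 2 0 * R k 0 + R 2 1 * R k 1 + R 2 2 * R k 2 = qe K k.succ (Fin.succ 2)
      rw [d, qe, Pi.single_apply]; simp only [Fin.succ_inj]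

theorem rot_qe (R : Matrix (Fin 3) (Fin 3) K) (ν : Fin 4) :
    rot R (qe K ν) = rowq R.transpose ν := by
  refine Fin.cases ?_ (fun k => ?_) ν
  · funext i
    fin_cases i <;> simp [rot, rowq, qe]
  · rw [rowq_succ]
    funext i
    fin_cases k <;> fin_cases i <;> simp [rot, qe]

theorem rot_transpose_rot {R : Matrix (Fin 3) (Fin 3) K} (hR : IsGenericRotation R)
    (z : Fin 4 → K) : rot R.transpose (rot R z) = z := by
  have k00 := hR.col_dot 0 0
  have k11 := hR.col_dot 1 1
  have k22 := hR.col_dot 2 2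
  have k01 := hR.col_dot 0 1
  have k02 := hR.col_dot 0 2
  have k12 := hR.col_dot 1 2
  simp only [if_true] at k00 k11 k22
  rw [if_neg (by decide)] at k01 k02 k12
  funext i
  fin_cases i <;> simp [rot]
  · linear_combination z 1 * k00 + z 2 * k01 + z 3 * k02
  · linear_combination z 1 * k01 + z 2 * k11 + z 3 * k12
  · linear_combination z 1 * k02 + z 2 * k12 + z 3 * k22

/-- The projectivity that exchanges the two orthonormal frames of a quaternion frame. -/
def swapEquiv {R : Matrix (Fin 3) (Fin 3) K} (hR : IsGenericRotation R) :
    (Fin 4 → K) ≃ₗ[K] (Fin 4 → K) where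
  toFun z := - qconj (rot R z)
  invFun z := - qconj (rot R.transpose z)
  left_inv z := by
    conv_rhs => rw [← rot_transpose_rot hR z]
    funext i
    fin_cases i <;> simp [rot, qconj]
  right_inv z := by
    conv_rhs => rw [← rot_transpose_rot hR.transpose z]
    funext i
    fin_cases i <;> simp [rot, qconj]
  map_add' x y := by
    funext i
    fin_cases i <;> simp [rot, qconj] <;> ring
  map_smul' t x := by
    funext i
    fin_cases i <;> simp [rot, qconj] <;> ring

theorem swapEquiv_apply {R : Matrix (Fin 3) (Fin 3) K} (hR : IsGenericRotation R)
    (z : Fin 4 → K) : swapEquiv hR z = - qconj (rot R z) := rfl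

theorem qconj_qe (ν : Fin 4) : ∃ s : K, s * s = 1 ∧ qconj (qe K ν) = s • qe K ν := by
  refine Fin.cases ⟨1, by simp, ?_⟩ (fun k => ⟨-1, by simp, ?_⟩) ν
  · funext i; fin_cases i <;> simp [qconj, qe]
  · funext i; fin_cases k <;> fin_cases i <;> simp [qconj, qe]

theorem qconj_rowq (R : Matrix (Fin 3) (Fin 3) K) (ν : Fin 4) :
    ∃ s : K, s * s = 1 ∧ qconj (rowq R ν) = s • rowq R ν := by
  refine Fin.cases ⟨1, by simp, ?_⟩ (fun k => ⟨-1, by simp, ?_⟩) ν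
  · funext i; fin_cases i <;> simp [qconj, rowq, qe]
  · rw [rowq_succ]; funext i; fin_cases i <;> simp [qconj]

theorem smul_qmul_smul (s t : K) (x y : Fin 4 → K) :
    qmul (s • x) (t • y) = (s * t) • qmul x y := by
  funext i; fin_cases i <;> simp [qmul] <;> ring

/-- The rotation sends r_ν to e_ν and e_μ to the frame r' of the transpose, and conjugation reverses
products. So e_μ r_ν becomes e_ν r'_μ up to sign. -/
theorem swapEquiv_frame {R : Matrix (Fin 3) (Fin 3) K} (hR : IsGenericRotation R)
    (m : Fin 4 × Fin 4) :
    ∃ s : K, s ≠ 0 ∧ swapEquiv hR (frame R m) = s • frame R.transpose m.swap := by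
  obtain ⟨s, hs, h1⟩ := qconj_qe (K := K) m.2
  obtain ⟨t, ht, h2⟩ := qconj_rowq R.transpose m.1
  refine ⟨- (s * t), neg_ne_zero.2 (mul_ne_zero (left_ne_zero_of_mul_eq_one hs)
    (left_ne_zero_of_mul_eq_one ht)), ?_⟩
  rw [swapEquiv_apply, frame, rot_qmul hR, rot_rowq hR, rot_qe, qconj_qmul, h1, h2,
    smul_qmul_smul, neg_smul]
  rfl

/-! ### The discriminant -/

/-- The residual cubic factor of the discriminant of `kumForm` in the first coordinate. -/
noncomputable def kumD (c : Fin 3 → K) (e : K) : MvPolynomial (Fin 4) K :=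
  C (2 * c 0 ^ 2 * c 1 ^ 2 + 2 * c 0 ^ 2 * c 2 ^ 2 + 2 * c 1 ^ 2 * c 2 ^ 2 - c 0 ^ 4 - c 1 ^ 4 -
      c 2 ^ 4 + e ^ 2) * (X 1 * X 2 * X 3) +
    C (2 * c 1 * c 2 * (3 * c 0 ^ 2 - e - c 2 ^ 2 + c 1 ^ 2)) * (X 1 * X 3 ^ 2) +
    C (2 * c 1 * c 2 * (3 * c 0 ^ 2 + e + c 2 ^ 2 - c 1 ^ 2)) * (X 1 * X 2 ^ 2) +
    C (2 * c 0 * c 2 * (3 * c 1 ^ 2 - e + c 2 ^ 2 - c 0 ^ 2)) * (X 1 ^ 2 * X 2) +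
    C (2 * c 0 * c 2 * (3 * c 1 ^ 2 + e - c 2 ^ 2 + c 0 ^ 2)) * (X 2 * X 3 ^ 2) +
    C (2 * c 0 * c 1 * (3 * c 2 ^ 2 + e + c 1 ^ 2 - c 0 ^ 2)) * (X 1 ^ 2 * X 3) +
    C (2 * c 0 * c 1 * (3 * c 2 ^ 2 - e - c 1 ^ 2 + c 0 ^ 2)) * (X 2 ^ 2 * X 3) -
    C (4 * c 0 * c 1 * c 2) * (C (c 0) * X 1 ^ 3 + C (c 1) * X 2 ^ 3 + C (c 2) * X 3 ^ 3)

/-- On each of the planes X₁ = 0, X₂ = 0, X₃ = 0 the quartic is the square of a conic, so its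
discriminant in the first coordinate vanishes there. -/
theorem kumG_sq_sub (c : Fin 3 → K) (e : K) :
    kumG c e ^ 2 - kumQ c * kumL c ^ 2 = X 1 * X 2 * X 3 * kumD c e := by
  simp only [kumG, kumQ, kumL, kumD, map_mul, map_pow, map_add, map_sub, map_ofNat]
  ring

theorem isHomogeneous_kumD (c : Fin 3 → K) (e : K) : (kumD c e).IsHomogeneous 3 := by
  have h1 : ∀ i : Fin 4, (X i : MvPolynomial (Fin 4) K).IsHomogeneous 1 := isHomogeneous_X K
  have hC : ∀ (a : K) {p : MvPolynomial (Fin 4) K} {n : ℕ}, p.IsHomogeneous n →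
    (C a * p).IsHomogeneous n := fun a p n hp => by simpa using (isHomogeneous_C _ a).mul hp
  have h21 : ∀ i j : Fin 4, (X i * X j ^ 2 : MvPolynomial (Fin 4) K).IsHomogeneous 3 :=
    fun i j => (h1 i).mul ((h1 j).pow 2)
  have h12 : ∀ i j : Fin 4, (X i ^ 2 * X j : MvPolynomial (Fin 4) K).IsHomogeneous 3 :=
    fun i j => ((h1 i).pow 2).mul (h1 j)
  have h111 : ∀ i j k : Fin 4, (X i * X j * X k : MvPolynomial (Fin 4) K).IsHomogeneous 3 :=
    fun i j k => ((h1 i).mul (h1 j)).mul (h1 k)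
  have h3 : ∀ i : Fin 4, (X i ^ 3 : MvPolynomial (Fin 4) K).IsHomogeneous 3 :=
    fun i => (h1 i).pow 3
  rw [kumD]
  refine IsHomogeneous.sub (IsHomogeneous.add (IsHomogeneous.add (IsHomogeneous.add
    (IsHomogeneous.add (IsHomogeneous.add (IsHomogeneous.add ?_ ?_) ?_) ?_) ?_) ?_) ?_) ?_
  · exact hC _ (h111 1 2 3)
  · exact hC _ (h21 1 3)
  · exact hC _ (h21 1 2)
  · exact hC _ (h12 1 2)
  · exact hC _ (h21 2 3)
  · exact hC _ (h12 1 3)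
  · exact hC _ (h12 2 3)
  · exact hC _ (((hC _ (h3 1)).add (hC _ (h3 2))).add (hC _ (h3 3)))

theorem kumD_ne_zero (h2 : (2 : K) ≠ 0) {c : Fin 3 → K} (hc : ∀ j, c j ≠ 0) (e : K) :
    kumD c e ≠ 0 := by
  intro h
  have h1 : eval (Pi.single 1 1) (kumD c e) = - (2 * 2 * (c 0 * c 1 * c 2) * c 0) := by
    simp [kumD, -mul_eq_mul_right_iff, -mul_eq_mul_left_iff]; ring
  rw [h, map_zero] at h1
  have : 2 * 2 * (c 0 * c 1 * c 2) * c 0 ≠ 0 := by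
    refine mul_ne_zero (mul_ne_zero (mul_ne_zero h2 h2) (mul_ne_zero (mul_ne_zero ?_ ?_) ?_)) ?_ <;>
      exact hc _
  exact this (neg_eq_zero.1 h1.symm)

end KummerQuartic

/-! ### The discriminant as a product of six linear forms -/

namespace KummerQuartic

open MvPolynomial

variable {K : Type*} [Field K]

theorem pderiv_zero_kumForm (c : Fin 3 → K) (e : K) :
    pderiv 0 (kumForm c e) = 2 * (X 0 * kumQ c + kumG c e) := by
  have hG : pderiv 0 (kumG c e) = 0 := by simp [kumG, pderiv_X]
  have hL : pderiv 0 (kumL c) = 0 := by simp [kumL, pderiv_X]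
  have h22 : pderiv 0 (2 : MvPolynomial (Fin 4) K) = 0 := by
    rw [← map_ofNat C 2, pderiv_C]
  have hQ : pderiv 0 (kumQ c) = 0 := by simp [kumQ, pderiv_X, h22]
  simp [kumForm, hQ, hG, hL, h22, pderiv_X]
  ring

theorem eval_kumQ (c : Fin 3 → K) (x : Fin 4 → K) : eval x (kumQ c) =
    c 0 ^ 2 * x 1 ^ 2 + c 1 ^ 2 * x 2 ^ 2 + c 2 ^ 2 * x 3 ^ 2 - 2 * (c 0 * c 1) * (x 1 * x 2) -
      2 * (c 0 * c 2) * (x 1 * x 3) - 2 * (c 1 * c 2) * (x 2 * x 3) := by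
  simp [kumQ]

theorem eval_kumG (c : Fin 3 → K) (e : K) (x : Fin 4 → K) : eval x (kumG c e) =
    c 0 * c 1 * (x 1 ^ 2 * x 3 - x 2 ^ 2 * x 3) + c 0 * c 2 * (x 2 * x 3 ^ 2 - x 1 ^ 2 * x 2) +
      c 1 * c 2 * (x 1 * x 2 ^ 2 - x 1 * x 3 ^ 2) + e * (x 1 * x 2 * x 3) := by
  simp [kumG]

theorem eval_kumL (c : Fin 3 → K) (x : Fin 4 → K) : eval x (kumL c) =
    c 0 * (x 2 * x 3) + c 1 * (x 1 * x 3) + c 2 * (x 1 * x 2) := by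
  simp [kumL]

theorem eval_kumForm (c : Fin 3 → K) (e : K) (x : Fin 4 → K) : eval x (kumForm c e) =
    x 0 ^ 2 * eval x (kumQ c) + 2 * x 0 * eval x (kumG c e) + eval x (kumL c) ^ 2 := by
  simp [kumForm]

/-- The coordinates of `K³` and the linear forms given by the rows of `R`. -/
noncomputable def discForm (R : Matrix (Fin 3) (Fin 3) K) : Fin 3 ⊕ Fin 3 → MvPolynomial (Fin 4) K :=
  Sum.elim (fun j => X j.succ) fun l => C (R l 0) * X 1 + C (R l 1) * X 2 + C (R l 2) * X 3

theorem isHomogeneous_discForm (R : Matrix (Fin 3) (Fin 3) K) (a : Fin 3 ⊕ Fin 3) :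
    (discForm R a).IsHomogeneous 1 := by
  have hC : ∀ (a : K) (i : Fin 4), (C a * X i : MvPolynomial (Fin 4) K).IsHomogeneous 1 :=
    fun a i => by simpa using (isHomogeneous_C _ a).mul (isHomogeneous_X K i)
  cases a with
  | inl j => exact isHomogeneous_X K _
  | inr l => exact ((hC _ _).add (hC _ _)).add (hC _ _)

section

variable {R : Matrix (Fin 3) (Fin 3) K} (hR : IsGenericRotation R)

include hR

theorem discForm_ne_zero (a : Fin 3 ⊕ Fin 3) : ∃ i, eval (0 : Fin 4 → K) (pderiv i (discForm R a)) ≠ 0 := by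
  cases a with
  | inl j => exact ⟨j.succ, by simp [discForm]⟩
  | inr l => exact ⟨1, by simpa [discForm, pderiv_X] using hR.ne_zero l 0⟩

theorem not_X_dvd_discForm (j l : Fin 3) : ¬ (X j.succ ∣ discForm R (Sum.inr l)) := by
  rintro ⟨q, hq⟩
  have h1 : ∀ i : Fin 3, i ≠ j → R l i = 0 := by
    intro i hij
    have := congrArg (eval (Pi.single i.succ 1)) hq
    rw [map_mul, eval_X, Pi.single_eq_of_ne (fun h => hij (Fin.succ_injective _ h).symm),
      zero_mul] at this
    rw [← this]
    fin_cases i <;> simp [discForm]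
  have : ∃ i : Fin 3, i ≠ j := ⟨j + 1, by simp⟩
  obtain ⟨i, hi⟩ := this
  exact hR.ne_zero l i (h1 i hi)

/-- The quartic, in the coordinates of the other frame. -/
theorem exists_swap [Infinite K] (h2 : (2 : K) ≠ 0)
    (hs : ∀ m, SingAt (kumForm (colProd R) (kumE R)) (frame R m))
    (hF : (kumForm (colProd R) (kumE R)).IsHomogeneous 4) (h0 : kumForm (colProd R) (kumE R) ≠ 0) :
    ∃ t : K, t ≠ 0 ∧ ∀ x,
      eval x (kumQ (colProd R)) = t * eval (swapEquiv hR x) (kumQ (colProd R.transpose)) ∧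
      eval x (kumG (colProd R) (kumE R)) =
        - (t * eval (swapEquiv hR x) (kumG (colProd R.transpose) (kumE R.transpose))) ∧
      eval x (kumL (colProd R)) ^ 2 = t * eval (swapEquiv hR x) (kumL (colProd R.transpose)) ^ 2 := by
  -- The transformed quartic is singular at the frame of the transpose, and uniqueness identifies it
  -- up to a scalar.
  obtain ⟨t, ht⟩ := eq_kumForm_of_singAt h2 hR.transpose
    (isHomogeneous_imageForm (swapEquiv hR) hF) (fun m => by
      apply SingAt.imageForm
      obtain ⟨s, hs0, hsm⟩ := swapEquiv_frame hR m.swap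
      rw [Prod.swap_swap] at hsm
      rw [show frame R.transpose m = s⁻¹ • swapEquiv hR (frame R m.swap) by
        rw [hsm, smul_smul, inv_mul_cancel₀ hs0, one_smul], map_smul, LinearEquiv.symm_apply_apply]
      exact (hs _).smul hF _)
  have ht0 : t ≠ 0 := by
    rintro rfl
    rw [map_zero, zero_mul] at ht
    exact imageForm_ne_zero (swapEquiv hR) h0 ht
  refine ⟨t, ht0, fun x => ?_⟩
  have key : ∀ s : K, s ^ 2 * eval x (kumQ (colProd R)) +
      2 * s * eval x (kumG (colProd R) (kumE R)) + eval x (kumL (colProd R)) ^ 2 =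
      t * (s ^ 2 * eval (swapEquiv hR x) (kumQ (colProd R.transpose)) -
      2 * s * eval (swapEquiv hR x) (kumG (colProd R.transpose) (kumE R.transpose)) +
      eval (swapEquiv hR x) (kumL (colProd R.transpose)) ^ 2) := by
    intro s
    obtain ⟨y, hy⟩ : ∃ y : Fin 4 → K, y = ![s, x 1, x 2, x 3] := ⟨_, rfl⟩
    have h1 : eval y (kumForm (colProd R) (kumE R)) = t * eval (swapEquiv hR y)
        (kumForm (colProd R.transpose) (kumE R.transpose)) := by
      have := congrArg (eval (swapEquiv hR y)) ht
      rwa [eval_imageForm, LinearEquiv.symm_apply_apply, map_mul, eval_C] at this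
    have hy0 : y 0 = s := by rw [hy]; rfl
    have hy1 : y 1 = x 1 := by rw [hy]; rfl
    have hy2 : y 2 = x 2 := by rw [hy]; rfl
    have hy3 : y 3 = x 3 := by rw [hy]; rfl
    have gy0 : swapEquiv hR y 0 = - s := by rw [← hy0]; simp [swapEquiv_apply, qconj, rot]
    have gy1 : swapEquiv hR y 1 = swapEquiv hR x 1 := by
      simp [swapEquiv_apply, qconj, rot, hy1, hy2, hy3]
    have gy2 : swapEquiv hR y 2 = swapEquiv hR x 2 := by
      simp [swapEquiv_apply, qconj, rot, hy1, hy2, hy3]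
    have gy3 : swapEquiv hR y 3 = swapEquiv hR x 3 := by
      simp [swapEquiv_apply, qconj, rot, hy1, hy2, hy3]
    rw [eval_kumForm, eval_kumForm, eval_kumQ, eval_kumQ, eval_kumG, eval_kumG, eval_kumL,
      eval_kumL, hy0, hy1, hy2, hy3, gy0, gy1, gy2, gy3] at h1
    simp only [eval_kumQ, eval_kumG, eval_kumL]
    linear_combination h1
  -- The swap negates the first coordinate `s` and leaves the projected point independent of `s`.
  -- The values 0, 1, -1 separate the three coefficients in `s`.
  have k0 := key 0
  have k1 := key 1
  have k2 := key (-1)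
  refine ⟨?_, ?_, ?_⟩
  · apply mul_left_cancel₀ h2
    linear_combination k1 + k2 - 2 * k0
  · apply mul_left_cancel₀ (mul_ne_zero h2 h2)
    linear_combination k1 - k2
  · linear_combination k0

/-- The discriminant is divisible by the three coordinates and, through the swap, by the three row
forms. A coordinate divides no row form, since a row has no zero entries, so the divisibilities
combine; by degree only a constant remains. -/
theorem exists_disc_eq [Infinite K] (h2 : (2 : K) ≠ 0)
    (hs : ∀ m, SingAt (kumForm (colProd R) (kumE R)) (frame R m))
    (hF : (kumForm (colProd R) (kumE R)).IsHomogeneous 4) (h0 : kumForm (colProd R) (kumE R) ≠ 0) :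
    ∃ q : K, q ≠ 0 ∧ kumG (colProd R) (kumE R) ^ 2 - kumQ (colProd R) * kumL (colProd R) ^ 2 =
      C q * ∏ a, discForm R a := by
  have hc : ∀ j, colProd R j ≠ 0 := fun j =>
    mul_ne_zero (mul_ne_zero (hR.ne_zero _ _) (hR.ne_zero _ _)) (hR.ne_zero _ _)
  obtain ⟨t, ht, hsw⟩ := exists_swap hR h2 hs hF h0
  set D := kumD (colProd R) (kumE R) with hD
  obtain ⟨N, hN⟩ : ∃ N, X 1 * X 2 * X 3 * D = discForm R (Sum.inr 0) * discForm R (Sum.inr 1) *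
      discForm R (Sum.inr 2) * N := by
    refine ⟨C (t ^ 2) * imageForm (swapEquiv hR).symm (kumD (colProd R.transpose)
      (kumE R.transpose)), ?_⟩
    rw [← kumG_sq_sub]
    refine MvPolynomial.funext fun x => ?_
    obtain ⟨e1, e2, e3⟩ := hsw x
    have e4 := congrArg (eval (swapEquiv hR x)) (kumG_sq_sub (colProd R.transpose)
      (kumE R.transpose))
    simp only [map_sub, map_mul, map_pow, eval_imageForm, LinearEquiv.symm_symm, eval_X,
      eval_C] at e4 ⊢
    rw [e1, e2, e3]
    have l1 : swapEquiv hR x 1 = eval x (discForm R (Sum.inr 0)) := by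
      simp [swapEquiv_apply, qconj, rot, discForm]
    have l2 : swapEquiv hR x 2 = eval x (discForm R (Sum.inr 1)) := by
      simp [swapEquiv_apply, qconj, rot, discForm]
    have l3 : swapEquiv hR x 3 = eval x (discForm R (Sum.inr 2)) := by
      simp [swapEquiv_apply, qconj, rot, discForm]
    rw [l1, l2, l3] at e4
    linear_combination t ^ 2 * e4
  -- A coordinate is prime and does not divide the row forms, so it can be cancelled against the
  -- cofactor.
  have step : ∀ (j : Fin 3) {A N : MvPolynomial (Fin 4) K},
      X j.succ * A = discForm R (Sum.inr 0) * discForm R (Sum.inr 1) *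
        discForm R (Sum.inr 2) * N →
      ∃ N', A = discForm R (Sum.inr 0) * discForm R (Sum.inr 1) * discForm R (Sum.inr 2) * N' := by
    intro j A N h
    have hp : Prime (X j.succ : MvPolynomial (Fin 4) K) := X_prime
    have hd : X j.succ ∣ N := by
      have h1 : X j.succ ∣ discForm R (Sum.inr 0) * discForm R (Sum.inr 1) *
        discForm R (Sum.inr 2) * N := ⟨A, h.symm⟩
      rcases hp.dvd_or_dvd h1 with h1 | h1
      · rcases hp.dvd_or_dvd h1 with h1 | h1
        · rcases hp.dvd_or_dvd h1 with h1 | h1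
          · exact absurd h1 (not_X_dvd_discForm hR _ _)
          · exact absurd h1 (not_X_dvd_discForm hR _ _)
        · exact absurd h1 (not_X_dvd_discForm hR _ _)
      · exact h1
    obtain ⟨N', rfl⟩ := hd
    refine ⟨N', mul_left_cancel₀ hp.ne_zero ?_⟩
    rw [h]; ring
  obtain ⟨N1, hN1⟩ := step 0 (A := X 2 * X 3 * D) (by rw [← hN]; simp only [Fin.succ_zero_eq_one]; ring)
  obtain ⟨N2, hN2⟩ := step 1 (A := X 3 * D) (by rw [← hN1]; simp only [Fin.succ_one_eq_two]; ring)
  obtain ⟨N3, hN3⟩ := step 2 (A := D) (by rw [← hN2]; rfl)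
  have hD0 : D ≠ 0 := kumD_ne_zero h2 hc _
  have hne : ∀ l, discForm R (Sum.inr l) ≠ 0 := fun l h => by
    obtain ⟨i, hi⟩ := discForm_ne_zero hR (Sum.inr l)
    rw [h] at hi; simp at hi
  have hp0 : discForm R (Sum.inr 0) * discForm R (Sum.inr 1) * discForm R (Sum.inr 2) ≠ 0 :=
    mul_ne_zero (mul_ne_zero (hne _) (hne _)) (hne _)
  have hN30 : N3 ≠ 0 := by
    rintro rfl
    exact hD0 (by rw [hN3, mul_zero])
  have hdeg : N3.totalDegree = 0 := by
    have h3 := (isHomogeneous_kumD (colProd R) (kumE R)).totalDegree hD0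
    have h3' := (((isHomogeneous_discForm R (Sum.inr 0)).mul
      (isHomogeneous_discForm R (Sum.inr 1))).mul
      (isHomogeneous_discForm R (Sum.inr 2))).totalDegree hp0
    rw [← hD, hN3, totalDegree_mul_of_isDomain hp0 hN30, h3'] at h3
    omega
  obtain ⟨q, hq⟩ : ∃ q, N3 = C q := ⟨_, totalDegree_eq_zero_iff_eq_C.1 hdeg⟩
  refine ⟨q, ?_, ?_⟩
  · rintro rfl
    exact hN30 (by rw [hq, map_zero])
  · rw [kumG_sq_sub, ← hD, hN3, hq, Fintype.prod_sum_type, Fin.prod_univ_three,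
      Fin.prod_univ_three]
    simp only [discForm, Sum.elim_inl, Sum.elim_inr, Fin.succ_zero_eq_one, Fin.succ_one_eq_two]
    rw [show Fin.succ (2 : Fin 3) = 3 from rfl]
    ring

end

end KummerQuartic

/-! ### The singular points of the quartic of a frame -/

namespace KummerQuartic

open MvPolynomial

variable {K : Type*} [Field K]

/-- At a point where a product of polynomials and its partial derivatives vanish, two of the
factors vanish, provided that each factor has a nonzero gradient. -/
theorem exists_two_zeros {ι σ : Type*} [Fintype ι] {ℓ : ι → MvPolynomial σ K} {x : σ → K}
    (hℓ : ∀ a, ∃ i, eval x (pderiv i (ℓ a)) ≠ 0) (h0 : eval x (∏ a, ℓ a) = 0)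
    (h1 : ∀ i, eval x (pderiv i (∏ a, ℓ a)) = 0) :
    ∃ a b, a ≠ b ∧ eval x (ℓ a) = 0 ∧ eval x (ℓ b) = 0 := by
  classical
  rw [map_prod, Finset.prod_eq_zero_iff] at h0
  obtain ⟨a, -, ha⟩ := h0
  obtain ⟨i, hi⟩ := hℓ a
  have h2 := h1 i
  rw [← Finset.mul_prod_erase _ _ (Finset.mem_univ a), Derivation.leibniz, map_add, smul_eq_mul,
    smul_eq_mul, map_mul, map_mul, ha, zero_mul, zero_add, mul_eq_zero, or_iff_left hi,
    map_prod, Finset.prod_eq_zero_iff] at h2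
  obtain ⟨b, hb, hb0⟩ := h2
  exact ⟨a, b, (Finset.ne_of_mem_erase hb).symm, ha, hb0⟩

section

variable {R : Matrix (Fin 3) (Fin 3) K} (hR : IsGenericRotation R)

include hR

theorem eval_pderiv_discForm (x : Fin 4 → K) (a : Fin 3 ⊕ Fin 3) :
    ∃ i, eval x (pderiv i (discForm R a)) ≠ 0 := by
  cases a with
  | inl j => exact ⟨j.succ, by simp [discForm]⟩
  | inr l => exact ⟨1, by simpa [discForm, pderiv_X] using hR.ne_zero l 0⟩

/-- The conic of the first face passes through the row points; up to a factor this is the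
orthogonality of the two other rows. -/
theorem colProd_rel (l : Fin 3) : colProd R 0 * (R l 1 * R l 2) + colProd R 1 * (R l 0 * R l 2) +
    colProd R 2 * (R l 0 * R l 1) = 0 := by
  have d01 := hR.row_dot 0 1
  have d02 := hR.row_dot 0 2
  have d12 := hR.row_dot 1 2
  rw [if_neg (by decide)] at d01 d02 d12
  fin_cases l <;> simp only [colProd, Fin.zero_eta, Fin.mk_one, Fin.reduceFinMk]
  · linear_combination R 0 0 * R 0 1 * R 0 2 * d12
  · linear_combination R 1 0 * R 1 1 * R 1 2 * d02
  · linear_combination R 2 0 * R 2 1 * R 2 2 * d01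

theorem colProd_ne_zero (j : Fin 3) : colProd R j ≠ 0 :=
  mul_ne_zero (mul_ne_zero (hR.ne_zero _ _) (hR.ne_zero _ _)) (hR.ne_zero _ _)

/-- The tangent cone at the first coordinate point does not contain the points of the frame
outside the two orthonormal frames. -/
theorem eval_kumQ_frame_ne_zero (j l : Fin 3) :
    eval (frame R (j.succ, l.succ)) (kumQ (colProd R)) ≠ 0 := by
  have hrel := colProd_rel hR l
  have hc := colProd_ne_zero hR
  have hn := hR.ne_zero l
  -- At a mixed point the tangent cone takes a square value d², and `colProd_rel` expresses d times
  -- a matrix entry as a nonzero product.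
  have key : ∀ {a b c d : K}, a * b + c * d = 0 → a ≠ 0 → b ≠ 0 → c ≠ 0 → d ^ 2 ≠ 0 := by
    intro a b c d h ha hb hc' hd
    rw [pow_eq_zero_iff two_ne_zero] at hd
    rw [hd, mul_zero, add_zero] at h
    exact mul_ne_zero ha hb h
  have h1 : eval (frame R (1, l.succ)) (kumQ (colProd R)) ≠ 0 := by
    rw [frame_one, eval_kumQ]
    convert key (a := colProd R 0) (b := R l 1 * R l 2) (c := R l 0)
      (d := colProd R 1 * R l 2 + colProd R 2 * R l 1) (by linear_combination hrel) (hc 0)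
      (mul_ne_zero (hn _) (hn _)) (hn _) using 1
    simp only [Matrix.cons_val]; ring
  have h2 : eval (frame R (2, l.succ)) (kumQ (colProd R)) ≠ 0 := by
    rw [frame_two, eval_kumQ]
    convert key (a := colProd R 1) (b := R l 0 * R l 2) (c := R l 1)
      (d := colProd R 0 * R l 2 + colProd R 2 * R l 0) (by linear_combination hrel) (hc 1)
      (mul_ne_zero (hn _) (hn _)) (hn _) using 1
    simp only [Matrix.cons_val]; ring
  have h3 : eval (frame R (3, l.succ)) (kumQ (colProd R)) ≠ 0 := by
    rw [frame_three, eval_kumQ]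
    convert key (a := colProd R 2) (b := R l 0 * R l 1) (c := R l 2)
      (d := colProd R 0 * R l 1 + colProd R 1 * R l 0) (by linear_combination hrel) (hc 2)
      (mul_ne_zero (hn _) (hn _)) (hn _) using 1
    simp only [Matrix.cons_val]; ring
  fin_cases j
  exacts [h1, h2, h3]

omit hR in
theorem eval_kumQ_qe (c : Fin 3 → K) (k : Fin 3) (s : K) :
    eval (s • qe K k.succ) (kumQ c) = s ^ 2 * c k ^ 2 := by
  rw [eval_kumQ]
  fin_cases k <;> simp [qe] <;> ring

theorem eq_sum_discForm (x : Fin 4 → K) (j : Fin 3) :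
    x j.succ = R 0 j * eval x (discForm R (Sum.inr 0)) + R 1 j * eval x (discForm R (Sum.inr 1)) +
      R 2 j * eval x (discForm R (Sum.inr 2)) := by
  conv_lhs => rw [← rot_transpose_rot hR x]
  fin_cases j <;> simp [rot, discForm]

-- At a singular point the derivative by the first coordinate gives z₀ Q + G = 0, which determines
-- z₀ from the projection as long as Q does not vanish.
omit hR in
theorem eq_smul_of_singAt_kumForm (h2 : (2 : K) ≠ 0) {c : Fin 3 → K} {e : K} {x p : Fin 4 → K}
    (hx : SingAt (kumForm c e) x) (hp : SingAt (kumForm c e) p) (hQ : eval p (kumQ c) ≠ 0) {t : K}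
    (ht : t ≠ 0) (h : ∀ i : Fin 3, x i.succ = t * p i.succ) : x = t • p := by
  have h1 : x 1 = t * p 1 := h 0
  have h2' : x 2 = t * p 2 := h 1
  have h3 : x 3 = t * p 3 := h 2
  have dx := hx.2 0
  have dp := hp.2 0
  rw [pderiv_zero_kumForm, map_mul, map_ofNat, mul_eq_zero, or_iff_right h2, map_add, map_mul,
    eval_X] at dx dp
  rw [eval_kumQ, eval_kumG, h1, h2', h3] at dx
  have h0 : x 0 = t * p 0 := by
    apply mul_left_cancel₀ (mul_ne_zero (pow_ne_zero 2 ht) hQ)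
    rw [eval_kumG] at dp
    rw [eval_kumQ] at dp ⊢
    linear_combination dx - t ^ 3 * dp
  funext i
  refine Fin.cases h0 (fun i => h i) i

/-- Away from the centre, two of the six linear forms vanish at a singular point. Two coordinates
give a unit e_k, two row forms give a row r_k, and one of each gives a mixed product. -/
theorem exists_smul_frame_of_singAt [Infinite K] (h2 : (2 : K) ≠ 0)
    (hs : ∀ m, SingAt (kumForm (colProd R) (kumE R)) (frame R m))
    (hF : (kumForm (colProd R) (kumE R)).IsHomogeneous 4) (h0 : kumForm (colProd R) (kumE R) ≠ 0)
    {x : Fin 4 → K} (hx : SingAt (kumForm (colProd R) (kumE R)) x) :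
    ∃ (m : Fin 4 × Fin 4) (t : K), x = t • frame R m := by
  by_cases hx' : ∀ i : Fin 3, x i.succ = 0
  · refine ⟨(0, 0), x 0, ?_⟩
    rw [frame_zero_right]
    funext i
    refine Fin.cases (by simp [qe]) (fun i => ?_) i
    simp [qe, hx' i]
  push Not at hx'
  obtain ⟨i₀, hi₀⟩ := hx'
  obtain ⟨q, hq, hD⟩ := exists_disc_eq hR h2 hs hF h0
  obtain ⟨t, ht, hsw⟩ := exists_swap hR h2 hs hF h0
  have dx := hx.2 0
  rw [pderiv_zero_kumForm, map_mul, map_ofNat, mul_eq_zero, or_iff_right h2] at dx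
  -- In this form the discriminant visibly vanishes to second order at a singular point: the square
  -- has a vanishing base, and the quartic vanishes there with its gradient.
  have hid : C q * ∏ a, discForm R a = (X 0 * kumQ (colProd R) + kumG (colProd R) (kumE R)) ^ 2 -
      kumQ (colProd R) * kumForm (colProd R) (kumE R) := by
    rw [← hD, kumForm]; ring
  have e0 : eval x (∏ a, discForm R a) = 0 := by
    have := congrArg (eval x) hid
    rw [map_mul, eval_C, map_sub, map_pow, dx, map_mul, hx.1] at this
    exact (mul_eq_zero.1 (this.trans (by ring))).resolve_left hq
  have e1 : ∀ i, eval x (pderiv i (∏ a, discForm R a)) = 0 := by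
    intro i
    have := congrArg (fun P => eval x (pderiv i P)) hid
    simp only [map_sub, Derivation.leibniz_pow, Derivation.leibniz, map_add, map_mul, smul_eq_mul,
      hx.1, hx.2, nsmul_eq_mul, map_pow, map_natCast, pderiv_C, map_zero, eval_C] at this
    rw [map_add, map_mul] at dx
    rw [dx] at this
    refine (mul_eq_zero.1 (?_ : q * _ = 0)).resolve_left hq
    linear_combination this
  obtain ⟨a, b, hab, ha, hb⟩ := exists_two_zeros (fun a => eval_pderiv_discForm hR x a) e0 e1
  have third : ∀ i j : Fin 3, i ≠ j → ∃ k, ∀ l, l ≠ k → l = i ∨ l = j := by decide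
  have mixed : ∀ j l : Fin 3, eval x (discForm R (Sum.inl j)) = 0 →
      eval x (discForm R (Sum.inr l)) = 0 → ∃ (m : Fin 4 × Fin 4) (t : K), x = t • frame R m := by
    intro j l h1 h2'
    have hj : x j.succ = 0 := by simpa [discForm] using h1
    have hl : ∑ i : Fin 3, R l i * x i.succ = 0 := by
      rw [Fin.sum_univ_three]; simpa [discForm] using h2'
    rw [sum_fin_three_shift j, hj] at hl
    obtain ⟨k, k1, k2⟩ := exists_cross (a := R l (j + 1)) (b := R l (j + 2)) (x := x (j + 1).succ)
      (y := x (j + 2).succ) (by linear_combination hl) (hR.ne_zero _ _)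
    obtain ⟨f0, f1, f2, f3⟩ := frame_succ_succ R j l
    have hk : k ≠ 0 := by
      rintro rfl
      apply hi₀
      rcases fin_three_cases i₀ j with rfl | rfl | rfl
      · exact hj
      · rw [k1, zero_mul]
      · rw [k2, zero_mul, neg_zero]
    refine ⟨(j.succ, l.succ), - k, eq_smul_of_singAt_kumForm h2 hx (hs _)
      (eval_kumQ_frame_ne_zero hR j l) (neg_ne_zero.2 hk) fun i => ?_⟩
    rcases fin_three_cases i j with rfl | rfl | rfl
    · rw [hj, f1, mul_zero]
    · rw [k1, f2]; ring
    · rw [k2, f3]; ring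
  rcases a with i | l <;> rcases b with j | m
  · obtain ⟨k, hk⟩ := third i j fun h => hab (by rw [h])
    have hz : ∀ l, l ≠ k → x l.succ = 0 := by
      intro l hl
      rcases hk l hl with rfl | rfl
      · simpa [discForm] using ha
      · simpa [discForm] using hb
    have hk0 : x k.succ ≠ 0 := by
      by_cases h : i₀ = k
      · rwa [h] at hi₀
      · exact absurd (hz _ h) hi₀
    refine ⟨(k.succ, 0), x k.succ, eq_smul_of_singAt_kumForm h2 hx (hs _) ?_ hk0 fun l => ?_⟩
    · have := eval_kumQ_qe (colProd R) k 1
      rw [one_smul] at this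
      rw [frame_zero_right, this, one_pow, one_mul]
      exact pow_ne_zero 2 (colProd_ne_zero hR k)
    · rw [frame_zero_right, qe, Pi.single_apply]
      by_cases h : l = k
      · subst h; simp
      · rw [hz l h, if_neg (fun h' => h (Fin.succ_injective _ h')), mul_zero]
  · exact mixed i m ha hb
  · exact mixed j l hb ha
  · obtain ⟨k, hk⟩ := third l m fun h => hab (by rw [h])
    have hz : ∀ i, i ≠ k → eval x (discForm R (Sum.inr i)) = 0 := by
      intro i hi
      rcases hk i hi with rfl | rfl
      · exact ha
      · exact hb
    have hxk : ∀ j : Fin 3, x j.succ = eval x (discForm R (Sum.inr k)) * R k j := by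
      intro j
      rw [eq_sum_discForm hR x j]
      have : ∑ i, R i j * eval x (discForm R (Sum.inr i)) = R k j * eval x (discForm R (Sum.inr k)) :=
        Finset.sum_eq_single k (fun i _ hi => by rw [hz i hi, mul_zero]) (by simp)
      rw [Fin.sum_univ_three] at this
      rw [this, mul_comm]
    refine ⟨(0, k.succ), eval x (discForm R (Sum.inr k)), eq_smul_of_singAt_kumForm h2 hx (hs _)
      ?_ (fun h => hi₀ (by rw [hxk, h, zero_mul])) fun l => ?_⟩
    · obtain ⟨s, hs0, hsm⟩ := swapEquiv_frame hR (0, k.succ)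
      rw [(hsw _).1, hsm, Prod.swap_prod_mk, frame_zero_right, eval_kumQ_qe]
      exact mul_ne_zero ht (mul_ne_zero (pow_ne_zero 2 hs0)
        (pow_ne_zero 2 (colProd_ne_zero hR.transpose k)))
    · rw [hxk, frame_zero_left, Fin.cons_succ]

-- At the first coordinate point only the term X₀² Q has second-order part, so Q carries the tangent
-- cone.
omit hR in
theorem hess_kumForm (c : Fin 3 → K) (e : K) :
    hess (kumForm c e) (qe K 0) = hess (kumQ c) (qe K 0) := by
  have h22 : ∀ i, pderiv i (2 : MvPolynomial (Fin 4) K) = 0 := fun i => by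
    rw [← map_ofNat C 2, pderiv_C]
  have q0 : eval (qe K 0) (kumQ c) = 0 := by simp [kumQ, qe]
  have q1 : ∀ i, eval (qe K 0) (pderiv i (kumQ c)) = 0 := by
    intro i
    fin_cases i <;> simp [kumQ, qe, pderiv_X, h22]
  have l0 : eval (qe K 0) (kumL c) = 0 := by simp [kumL, qe]
  have l1 : ∀ i, eval (qe K 0) (pderiv i (kumL c)) = 0 := by
    intro i
    fin_cases i <;> simp [kumL, qe, pderiv_X]
  have g1 : ∀ i, eval (qe K 0) (pderiv i (kumG c e)) = 0 := by
    intro i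
    fin_cases i <;> simp [kumG, qe, pderiv_X]
  have g2 : ∀ i j, eval (qe K 0) (pderiv i (pderiv j (kumG c e))) = 0 := by
    intro i j
    fin_cases j <;> simp [kumG, pderiv_X] <;> fin_cases i <;> simp [qe]
  have g0 : eval (qe K 0) (kumG c e) = 0 := by simp [kumG, qe]
  have x0 : eval (qe K 0) (X 0) = 1 := by simp [qe]
  ext i j
  simp only [hess, Matrix.of_apply, kumForm, Derivation.leibniz, Derivation.leibniz_pow, map_add,
    map_mul, smul_eq_mul, nsmul_eq_mul, map_pow, q0, q1, l0, l1, g0, g1, g2, h22, map_zero, x0]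
  ring

theorem rank_hess_kumForm (h2 : (2 : K) ≠ 0) (e : K) :
    (hess (kumForm (colProd R) e) (qe K 0)).rank = 3 := by
  have hc := colProd_ne_zero hR
  generalize colProd R = c at hc
  have hM : hess (kumForm c e) (qe K 0) = !![0, 0, 0, 0;
      0, 2 * c 0 ^ 2, - (2 * (c 0 * c 1)), - (2 * (c 0 * c 2));
      0, - (2 * (c 0 * c 1)), 2 * c 1 ^ 2, - (2 * (c 1 * c 2));
      0, - (2 * (c 0 * c 2)), - (2 * (c 1 * c 2)), 2 * c 2 ^ 2] := by
    have h22 : ∀ i, pderiv i (2 : MvPolynomial (Fin 4) K) = 0 := fun i => by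
      rw [← map_ofNat C 2, pderiv_C]
    rw [hess_kumForm]
    ext i j
    fin_cases j <;> simp [hess, kumQ, pderiv_X, h22] <;> fin_cases i <;>
      simp <;> ring
  -- The kernel is the line of the point itself, because pairwise sums of the three row equations
  -- isolate the single coordinates.
  have hker : LinearMap.ker (hess (kumForm c e) (qe K 0)).mulVecLin = K ∙ (qe K 0) := by
    ext v
    rw [LinearMap.mem_ker, Matrix.mulVecLin_apply, Submodule.mem_span_singleton, hM]
    constructor
    · intro h
      have r1 := congrFun h 1
      have r2 := congrFun h 2
      have r3 := congrFun h 3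
      simp [Matrix.mulVec, dotProduct, Fin.sum_univ_four] at r1 r2 r3
      have s1 : c 0 * v 1 - c 1 * v 2 - c 2 * v 3 = 0 :=
        mul_left_cancel₀ (mul_ne_zero h2 (hc 0)) (by linear_combination r1)
      have s2 : c 1 * v 2 - c 0 * v 1 - c 2 * v 3 = 0 :=
        mul_left_cancel₀ (mul_ne_zero h2 (hc 1)) (by linear_combination r2)
      have s3 : c 2 * v 3 - c 0 * v 1 - c 1 * v 2 = 0 :=
        mul_left_cancel₀ (mul_ne_zero h2 (hc 2)) (by linear_combination r3)
      have v1 : v 1 = 0 := mul_left_cancel₀ (mul_ne_zero h2 (hc 0)) (by linear_combination - s2 - s3)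
      have v2 : v 2 = 0 := mul_left_cancel₀ (mul_ne_zero h2 (hc 1)) (by linear_combination - s1 - s3)
      have v3 : v 3 = 0 := mul_left_cancel₀ (mul_ne_zero h2 (hc 2)) (by linear_combination - s1 - s2)
      refine ⟨v 0, funext fun i => ?_⟩
      fin_cases i <;> simp [qe, v1, v2, v3]
    · rintro ⟨t, rfl⟩
      funext i
      fin_cases i <;> simp [qe, Matrix.mulVec, dotProduct, Fin.sum_univ_four]
  have h1 := (hess (kumForm c e) (qe K 0)).mulVecLin.finrank_range_add_finrank_ker
  rw [hker, finrank_span_singleton (by simp [qe]), Module.finrank_fin_fun] at h1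
  rw [Matrix.rank]
  omega

end

end KummerQuartic

/-! ### The quartic of a configuration -/

namespace KummerQuartic

open MvPolynomial

variable {K : Type*} [Field K]

theorem singAt_C_mul_iff {t : K} (ht : t ≠ 0) {F : MvPolynomial (Fin 4) K} {x : Fin 4 → K} :
    SingAt (C t * F) x ↔ SingAt F x := by
  simp [SingAt, ht]

theorem imageForm_C_mul (g : (Fin 4 → K) ≃ₗ[K] (Fin 4 → K)) (t : K) (F : MvPolynomial (Fin 4) K) :
    imageForm g (C t * F) = C t * imageForm g F := by
  simp [imageForm]

/-- The space of quartics that are singular at the points of a configuration is at most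
one-dimensional, the singular set is not larger, and one of the points is a node. -/
theorem quartic_of_config [IsAlgClosed K] (h2 : (2 : K) ≠ 0) {N : Set (ℙ K (Fin 4 → K))}
    {N' : Set (Submodule K (Fin 4 → K))} (h : IsNondegenerateConfig N N')
    {F : MvPolynomial (Fin 4) K} (hF : F.IsHomogeneous 4) (hF0 : F ≠ 0) (hs : N ⊆ singularSet F) :
    singularSet F = N ∧ (∃ p ∈ N, IsNode F p) ∧
      ∀ G : MvPolynomial (Fin 4) K, G.IsHomogeneous 4 → N ⊆ singularSet G → ∃ c, G = C c * F := by
  have : Infinite K := IsAlgClosed.instInfinite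
  obtain ⟨g, R, hR, hg, -⟩ := exists_frame_of_config h
  have key : ∀ G : MvPolynomial (Fin 4) K, G.IsHomogeneous 4 → N ⊆ singularSet G →
      ∃ c, imageForm g G = C c * kumForm (colProd R) (kumE R) := by
    intro G hG hNG
    refine eq_kumForm_of_singAt h2 hR (isHomogeneous_imageForm g hG) fun m => ?_
    rw [← mk_mem_singularSet (isHomogeneous_imageForm g hG) (frame_ne_zero hR m),
      singularSet_imageForm g hG]
    have : framePt hR m ∈ imagePoints g N := by rw [hg]; exact ⟨m, rfl⟩
    exact Set.image_mono hNG this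
  obtain ⟨t, ht⟩ := key F hF hs
  have ht0 : t ≠ 0 := by
    rintro rfl
    rw [map_zero, zero_mul] at ht
    exact imageForm_ne_zero g hF0 ht
  have hk : kumForm (colProd R) (kumE R) = C t⁻¹ * imageForm g F := by
    rw [ht, ← mul_assoc, ← map_mul, inv_mul_cancel₀ ht0, map_one, one_mul]
  have hkF : (kumForm (colProd R) (kumE R)).IsHomogeneous 4 := by
    rw [hk]; simpa using (isHomogeneous_C _ t⁻¹).mul (isHomogeneous_imageForm g hF)
  have hk0 : kumForm (colProd R) (kumE R) ≠ 0 := by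
    intro h0
    rw [h0, mul_zero] at ht
    exact imageForm_ne_zero g hF0 ht
  have hkiff : ∀ x, SingAt (kumForm (colProd R) (kumE R)) x ↔ SingAt (imageForm g F) x := fun x => by
    rw [hk, singAt_C_mul_iff (inv_ne_zero ht0)]
  have hks : ∀ m, SingAt (kumForm (colProd R) (kumE R)) (frame R m) := by
    intro m
    rw [hkiff, ← mk_mem_singularSet (isHomogeneous_imageForm g hF) (frame_ne_zero hR m),
      singularSet_imageForm g hF]
    have : framePt hR m ∈ imagePoints g N := by rw [hg]; exact ⟨m, rfl⟩
    exact Set.image_mono hs this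
  refine ⟨Set.Subset.antisymm ?_ hs, ?_, ?_⟩
  · intro p hp
    have hp' : g • p ∈ singularSet (imageForm g F) := by
      rw [singularSet_imageForm g hF]; exact ⟨p, hp, rfl⟩
    rw [mem_singularSet_iff, ← hkiff] at hp'
    obtain ⟨m, s, hm⟩ := exists_smul_frame_of_singAt hR h2 hks hkF hk0 hp'
    have hgp : g • p = framePt hR m := by
      conv_lhs => rw [← (g • p).mk_rep]
      exact mk_eq_mk_of_smul _ _ hm
    have : g • p ∈ imagePoints g N := by rw [hg, hgp]; exact ⟨m, rfl⟩
    obtain ⟨q, hq, hqp⟩ := this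
    rwa [← MulAction.injective g hqp]
  · have hmem : framePt hR (0, 0) ∈ imagePoints g N := by rw [hg]; exact ⟨_, rfl⟩
    obtain ⟨p, hp, hpe⟩ := hmem
    refine ⟨p, hp, ?_⟩
    have hnode : IsNode (imageForm g F) (framePt hR (0, 0)) := by
      rw [framePt, isNode_mk (isHomogeneous_imageForm g hF)]
      refine ⟨(hkiff _).1 (hks _), ?_⟩
      refine Eq.trans ?_ (rank_hess_kumForm hR h2 (kumE R))
      rw [frame_zero_right, ht]
      have : hess (C t * kumForm (colProd R) (kumE R)) (qe K 0) =
          Matrix.diagonal (fun _ => t) * hess (kumForm (colProd R) (kumE R)) (qe K 0) := by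
        ext i j
        simp [hess, Matrix.diagonal_mul]
      rw [this, Matrix.rank_mul_eq_right_of_isUnit_det]
      simpa [Matrix.det_diagonal] using ht0
    have := IsNode.imageForm (isHomogeneous_imageForm g hF) g.symm hnode
    rw [imageForm_symm_imageForm, ← hpe] at this
    have e : g.symm • (fun p => g • p) p = p := inv_smul_smul g p
    rwa [e] at this
  · intro G hG hNG
    obtain ⟨c, hc⟩ := key G hG hNG
    refine ⟨c * t⁻¹, ?_⟩
    rw [← imageForm_symm_imageForm g G, hc, hk, ← mul_assoc, ← map_mul, imageForm_C_mul,
      imageForm_symm_imageForm]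

/-! ### Hudson's normal form -/

theorem eval_hudson (v : Fin 5 → K) (x : Fin 4 → K) : eval x (hudson v) =
    v 0 * (x 0 ^ 4 + x 1 ^ 4 + x 2 ^ 4 + x 3 ^ 4) +
      2 * v 1 * (x 0 ^ 2 * x 1 ^ 2 + x 2 ^ 2 * x 3 ^ 2) +
      2 * v 2 * (x 0 ^ 2 * x 2 ^ 2 + x 1 ^ 2 * x 3 ^ 2) +
      2 * v 3 * (x 0 ^ 2 * x 3 ^ 2 + x 1 ^ 2 * x 2 ^ 2) + 4 * v 4 * (x 0 * x 1 * x 2 * x 3) := by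
  simp [hudson, Fin.sum_univ_four]

theorem eval_heis_hudson (m : Fin 4 × Fin 4) (v : Fin 5 → K) (x : Fin 4 → K) :
    eval (heis K m x) (hudson v) = eval x (hudson v) := by
  rw [eval_hudson, eval_hudson]
  simp only [heis_apply]
  obtain ⟨μ, ν⟩ := m
  fin_cases μ <;> fin_cases ν <;>
    simp [sgn, -mul_eq_mul_left_iff, -mul_eq_mul_right_iff] <;> ring

theorem imageForm_heis_hudson [Infinite K] (m : Fin 4 × Fin 4) (v : Fin 5 → K) :
    imageForm (heis K m) (hudson v) = hudson v := by
  refine MvPolynomial.funext fun x => ?_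
  rw [eval_imageForm, ← eval_heis_hudson m, LinearEquiv.apply_symm_apply]

/-- The matrix of the gradient of the Hudson forms at `a`. -/
def gradMatrix (a : Fin 4 → K) : Matrix (Fin 4) (Fin 5) K :=
  !![a 0 ^ 3, a 0 * a 1 ^ 2, a 0 * a 2 ^ 2, a 0 * a 3 ^ 2, a 1 * a 2 * a 3;
     a 1 ^ 3, a 1 * a 0 ^ 2, a 1 * a 3 ^ 2, a 1 * a 2 ^ 2, a 0 * a 2 * a 3;
     a 2 ^ 3, a 2 * a 3 ^ 2, a 2 * a 0 ^ 2, a 2 * a 1 ^ 2, a 0 * a 1 * a 3;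
     a 3 ^ 3, a 3 * a 2 ^ 2, a 3 * a 1 ^ 2, a 3 * a 0 ^ 2, a 0 * a 1 * a 2]

theorem eval_pderiv_hudson (v : Fin 5 → K) (a : Fin 4 → K) (i : Fin 4) :
    eval a (pderiv i (hudson v)) = 4 * (gradMatrix a).mulVec v i := by
  have h22 : ∀ i, pderiv i (2 : MvPolynomial (Fin 4) K) = 0 := fun i => by
    rw [← map_ofNat C 2, pderiv_C]
  have h44 : ∀ i, pderiv i (4 : MvPolynomial (Fin 4) K) = 0 := fun i => by
    rw [← map_ofNat C 4, pderiv_C]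
  fin_cases i <;>
    simp [hudson, gradMatrix, Matrix.mulVec, dotProduct, Fin.sum_univ_succ, pderiv_X, h22, h44] <;>
    ring

/-- Euler's relation divided by the degree 4, so that it is an identity without condition on the
characteristic. -/
theorem eval_hudson_eq_gradMatrix (v : Fin 5 → K) (a : Fin 4 → K) :
    eval a (hudson v) = ∑ i, a i * (gradMatrix a).mulVec v i := by
  rw [eval_hudson]
  simp [gradMatrix, Matrix.mulVec, dotProduct, Fin.sum_univ_succ]
  ring

theorem singAt_hudson_iff (h2 : (2 : K) ≠ 0) (v : Fin 5 → K) (a : Fin 4 → K) :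
    SingAt (hudson v) a ↔ (gradMatrix a).mulVec v = 0 := by
  have h4 : (4 : K) ≠ 0 := by
    rw [show (4 : K) = 2 * 2 by norm_num]; exact mul_ne_zero h2 h2
  constructor
  · intro h
    funext i
    have := h.2 i
    rw [eval_pderiv_hudson] at this
    exact (mul_eq_zero.1 this).resolve_left h4
  · intro h
    refine ⟨?_, fun i => ?_⟩
    · rw [eval_hudson_eq_gradMatrix, h]; simp
    · rw [eval_pderiv_hudson, h]; simp

theorem isHomogeneous_hudson (v : Fin 5 → K) : (hudson v).IsHomogeneous 4 := by
  have h1 : ∀ i : Fin 4, (X i : MvPolynomial (Fin 4) K).IsHomogeneous 1 := isHomogeneous_X K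
  have hC : ∀ (a : K) {p : MvPolynomial (Fin 4) K} {n : ℕ}, p.IsHomogeneous n →
    (C a * p).IsHomogeneous n := fun a p n hp => by simpa using (isHomogeneous_C _ a).mul hp
  have h22 : ∀ i j : Fin 4, (X i ^ 2 * X j ^ 2 : MvPolynomial (Fin 4) K).IsHomogeneous 4 :=
    fun i j => ((h1 i).pow 2).mul ((h1 j).pow 2)
  have h4 : ∀ i : Fin 4, (X i ^ 4 : MvPolynomial (Fin 4) K).IsHomogeneous 4 :=
    fun i => (h1 i).pow 4
  have e2 : (2 : MvPolynomial (Fin 4) K) = C 2 := (map_ofNat C 2).symm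
  have e4 : (4 : MvPolynomial (Fin 4) K) = C 4 := (map_ofNat C 4).symm
  rw [hudson, e2, e4]
  simp only [← map_mul C]
  refine IsHomogeneous.add (IsHomogeneous.add (IsHomogeneous.add (IsHomogeneous.add ?_ ?_) ?_) ?_) ?_
  · exact hC _ (IsHomogeneous.sum _ _ _ fun i _ => h4 i)
  · exact hC _ ((h22 0 1).add (h22 2 3))
  · exact hC _ ((h22 0 2).add (h22 1 3))
  · exact hC _ ((h22 0 3).add (h22 1 2))
  · exact hC _ ((((h1 0).mul (h1 1)).mul (h1 2)).mul (h1 3))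

theorem hudson_smul (c : K) (v : Fin 5 → K) : hudson (c • v) = C c * hudson v := by
  simp only [hudson, Pi.smul_apply, smul_eq_mul, map_mul]
  ring

theorem hudson_sub (v w : Fin 5 → K) : hudson (v - w) = hudson v - hudson w := by
  simp only [hudson, Pi.sub_apply, map_sub]
  ring

theorem hudson_eq_zero_iff (h2 : (2 : K) ≠ 0) (v : Fin 5 → K) : hudson v = 0 ↔ v = 0 := by
  constructor
  · intro h
    have key : ∀ x : Fin 4 → K, _ := fun x => (eval_hudson v x).symm.trans (by rw [h, map_zero])
    have k0 := key ![1, 0, 0, 0]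
    have k1 := key ![1, 1, 0, 0]
    have k2 := key ![1, 0, 1, 0]
    have k3 := key ![1, 0, 0, 1]
    have k4 := key ![1, 1, 1, 1]
    simp only [Matrix.cons_val] at k0 k1 k2 k3 k4
    have v0 : v 0 = 0 := by linear_combination k0
    have v1 : v 1 = 0 := mul_left_cancel₀ h2 (by linear_combination k1 - 2 * v0)
    have v2 : v 2 = 0 := mul_left_cancel₀ h2 (by linear_combination k2 - 2 * v0)
    have v3 : v 3 = 0 := mul_left_cancel₀ h2 (by linear_combination k3 - 2 * v0)
    have v4 : v 4 = 0 := mul_left_cancel₀ (mul_ne_zero h2 h2)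
      (by linear_combination k4 - 4 * v0 - 4 * v1 - 4 * v2 - 4 * v3)
    funext i
    fin_cases i <;> assumption
  · rintro rfl
    simp [hudson]

theorem hudson_injective (h2 : (2 : K) ≠ 0) : Function.Injective (hudson (K := K)) := by
  intro v w h
  rw [← sub_eq_zero, ← hudson_eq_zero_iff h2, hudson_sub, h, sub_self]

/-- Four linear equations in five unknowns: this is the existence of the Kummer quartic. -/
theorem exists_gradMatrix_mulVec_eq_zero (a : Fin 4 → K) :
    ∃ v : Fin 5 → K, v ≠ 0 ∧ (gradMatrix a).mulVec v = 0 := by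
  have h : LinearMap.ker (gradMatrix a).mulVecLin ≠ ⊥ :=
    LinearMap.ker_ne_bot_of_finrank_lt (by simp)
  obtain ⟨v, hv, hv0⟩ := Submodule.exists_mem_ne_zero_of_ne_bot h
  exact ⟨v, hv0, hv⟩

section Admissible

variable {a : Fin 4 → K} (ha : Admissible a)

include ha

/-- Hudson forms are invariant under the group, so a singularity at `a` spreads over the orbit. -/
theorem kummerOrbit_subset_singularSet [Infinite K] (h2 : (2 : K) ≠ 0) {v : Fin 5 → K}
    (hv : (gradMatrix a).mulVec v = 0) : kummerOrbit a ha ⊆ singularSet (hudson v) := by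
  rw [kummerOrbit_eq_range]
  rintro _ ⟨m, rfl⟩
  rw [orbitPt, mk_mem_singularSet (isHomogeneous_hudson v), ← imageForm_heis_hudson m]
  apply SingAt.imageForm
  rwa [LinearEquiv.symm_apply_apply, singAt_hudson_iff h2]

/-- The Hudson forms that define Kummer quartics with singular set `kummerOrbit a ha`. -/
theorem isKummerQuartic_hudson_iff [IsAlgClosed K] (h2 : (2 : K) ≠ 0) (v : Fin 5 → K) :
    (v ≠ 0 ∧ (gradMatrix a).mulVec v = 0) ↔
      (IsKummerQuartic (hudson v) ∧ singularSet (hudson v) = kummerOrbit a ha) := by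
  have : Infinite K := IsAlgClosed.instInfinite
  have hcfg := isNondegenerateConfig_kummerOrbit h2 ha
  constructor
  · rintro ⟨hv0, hv⟩
    have h0 : hudson v ≠ 0 := fun h => hv0 ((hudson_eq_zero_iff h2 v).1 h)
    have hs := (quartic_of_config h2 hcfg (isHomogeneous_hudson v) h0
      (kummerOrbit_subset_singularSet ha h2 hv)).1
    exact ⟨⟨h0, isHomogeneous_hudson v, by rw [hs, hcfg.card_points]⟩, hs⟩
  · rintro ⟨hK, hs⟩
    refine ⟨fun h => hK.ne_zero ((hudson_eq_zero_iff h2 v).2 h), ?_⟩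
    rw [← singAt_hudson_iff h2, ← mk_mem_singularSet (isHomogeneous_hudson v) ha.ne_zero, hs]
    exact MulAction.mem_orbit_self _

theorem exists_eq_hudson [IsAlgClosed K] (h2 : (2 : K) ≠ 0) {F : MvPolynomial (Fin 4) K}
    (hF : IsKummerQuartic F) (hs : singularSet F = kummerOrbit a ha) :
    ∃ v : Fin 5 → K, F = hudson v := by
  have : Infinite K := IsAlgClosed.instInfinite
  obtain ⟨v, hv0, hv⟩ := exists_gradMatrix_mulVec_eq_zero a
  obtain ⟨c, hc⟩ := (quartic_of_config h2 (isNondegenerateConfig_kummerOrbit h2 ha)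
    (isHomogeneous_hudson v) (fun h => hv0 ((hudson_eq_zero_iff h2 v).1 h))
    (kummerOrbit_subset_singularSet ha h2 hv)).2.2 F hF.homogeneous hs.ge
  exact ⟨c • v, by rw [hc, hudson_smul]⟩

theorem exists_smul_of_gradMatrix [IsAlgClosed K] (h2 : (2 : K) ≠ 0) {v w : Fin 5 → K}
    (hv0 : v ≠ 0) (hv : (gradMatrix a).mulVec v = 0) (hw : (gradMatrix a).mulVec w = 0) :
    ∃ c : K, w = c • v := by
  have : Infinite K := IsAlgClosed.instInfinite
  obtain ⟨c, hc⟩ := (quartic_of_config h2 (isNondegenerateConfig_kummerOrbit h2 ha)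
    (isHomogeneous_hudson v) (fun h => hv0 ((hudson_eq_zero_iff h2 v).1 h))
    (kummerOrbit_subset_singularSet ha h2 hv)).2.2 _ (isHomogeneous_hudson w)
    (kummerOrbit_subset_singularSet ha h2 hw)
  exact ⟨c, hudson_injective h2 (by rw [hc, hudson_smul])⟩

/-- Some point of the orbit is a node by `quartic_of_config`, and the invariance of the form moves
it to `a` and then to any other point. -/
theorem isNode_hudson [IsAlgClosed K] (h2 : (2 : K) ≠ 0) {v : Fin 5 → K} (hv0 : v ≠ 0)
    (hv : (gradMatrix a).mulVec v = 0) {p : ℙ K (Fin 4 → K)} (hp : p ∈ kummerOrbit a ha) :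
    IsNode (hudson v) p := by
  have : Infinite K := IsAlgClosed.instInfinite
  obtain ⟨q, hq, hqn⟩ := (quartic_of_config h2 (isNondegenerateConfig_kummerOrbit h2 ha)
    (isHomogeneous_hudson v) (fun h => hv0 ((hudson_eq_zero_iff h2 v).1 h))
    (kummerOrbit_subset_singularSet ha h2 hv)).2.1
  rw [kummerOrbit_eq_range] at hp hq
  obtain ⟨m, rfl⟩ := hp
  obtain ⟨n, rfl⟩ := hq
  have hb : ∀ n, orbitPt a ha.ne_zero n = heis K n • Projectivization.mk K a ha.ne_zero :=
    fun n => (smul_mk_eq (heis K n) ha.ne_zero).symm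
  have h1 := IsNode.imageForm (isHomogeneous_hudson v) (heis K n).symm hqn
  have h3 : imageForm (heis K n).symm (hudson v) = hudson v := by
    conv_lhs => rw [← imageForm_heis_hudson n v, imageForm_symm_imageForm]
  rw [h3, hb] at h1
  have h4 : (heis K n).symm • heis K n • Projectivization.mk K a ha.ne_zero =
    Projectivization.mk K a ha.ne_zero := inv_smul_smul (heis K n) _
  rw [h4] at h1
  have h5 := IsNode.imageForm (isHomogeneous_hudson v) (heis K m) h1
  rwa [imageForm_heis_hudson, ← hb] at h5

end Admissible

/-- The matrix B is the gradient matrix with its rows multiplied by the coordinates of `a`. The two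
kernels therefore agree when no coordinate vanishes. -/
theorem hudsonMatrix_mulVec (a : Fin 4 → K) (v : Fin 5 → K) (i : Fin 4) :
    (hudsonMatrix a).mulVec v i = a i * (gradMatrix a).mulVec v i := by
  fin_cases i <;>
    simp [hudsonMatrix, gradMatrix, Matrix.mulVec, dotProduct, Fin.sum_univ_succ] <;> ring

theorem hudsonMatrix_mulVec_eq_zero_iff {a : Fin 4 → K} (h : a 0 * a 1 * a 2 * a 3 ≠ 0)
    (v : Fin 5 → K) : (hudsonMatrix a).mulVec v = 0 ↔ (gradMatrix a).mulVec v = 0 := by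
  have ha : ∀ i, a i ≠ 0 := by
    intro i hi
    apply h
    fin_cases i <;> simp_all
  simp only [funext_iff, hudsonMatrix_mulVec, Pi.zero_apply, mul_eq_zero, ha, false_or]

theorem finrank_ker_hudsonMatrix [IsAlgClosed K] (h2 : (2 : K) ≠ 0) {a : Fin 4 → K}
    (ha : Admissible a) (h : a 0 * a 1 * a 2 * a 3 ≠ 0) :
    Module.finrank K (LinearMap.ker (hudsonMatrix a).mulVecLin) = 1 := by
  obtain ⟨v, hv0, hv⟩ := exists_gradMatrix_mulVec_eq_zero a
  refine finrank_eq_one_iff'.2 ⟨⟨v, (hudsonMatrix_mulVec_eq_zero_iff h v).2 hv⟩,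
    fun h => hv0 (congrArg Subtype.val h), fun ⟨w, hw⟩ => ?_⟩
  obtain ⟨c, hc⟩ := exists_smul_of_gradMatrix ha h2 hv0 hv
    ((hudsonMatrix_mulVec_eq_zero_iff h w).1 hw)
  exact ⟨c, Subtype.ext hc.symm⟩

theorem gradMatrix_segreCoefficients {a : Fin 4 → K} (h : a 0 = 0) :
    (gradMatrix a).mulVec (segreCoefficients a) = 0 := by
  funext i
  fin_cases i <;>
    simp [segreCoefficients, gradMatrix, Matrix.mulVec, dotProduct, Fin.sum_univ_succ, h] <;> ring

theorem isKummerQuartic_hudson_iff_segre [IsAlgClosed K] (h2 : (2 : K) ≠ 0) {a : Fin 4 → K}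
    (ha : Admissible a) (h0 : a 0 = 0) (v : Fin 5 → K) :
    (IsKummerQuartic (hudson v) ∧ singularSet (hudson v) = kummerOrbit a ha) ↔
      ∃ c : K, c ≠ 0 ∧ v = c • segreCoefficients a := by
  have hne : ∀ i, i ≠ 0 → a i ≠ 0 := fun i hi h => ha.no_two_zero i 0 hi ⟨h, h0⟩
  have hs0 : segreCoefficients a ≠ 0 := by
    intro h
    have := congrFun h 0
    simp [segreCoefficients, h2, hne 1 (by decide), hne 2 (by decide), hne 3 (by decide)] at this
  rw [← isKummerQuartic_hudson_iff ha h2]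
  constructor
  · rintro ⟨hv0, hv⟩
    obtain ⟨c, rfl⟩ := exists_smul_of_gradMatrix ha h2 hs0 (gradMatrix_segreCoefficients h0) hv
    exact ⟨c, fun h => hv0 (by rw [h, zero_smul]), rfl⟩
  · rintro ⟨c, hc, rfl⟩
    exact ⟨smul_ne_zero hc hs0, by rw [Matrix.mulVec_smul, gradMatrix_segreCoefficients h0,
      smul_zero]⟩

/-- Translating the coordinates only changes signs, so admissibility passes to the translated point.
-/
theorem heisForm_heis (a : Fin 4 → K) (μ : Fin 4) (m : Fin 4 × Fin 4) :
    heisForm (heis K (μ, 0) a) m = ((sgn m.2 μ : ℤ) : K) * heisForm a m := by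
  rw [heisForm, ← Equiv.sum_comp (xorEquiv μ), heisForm, Finset.mul_sum]
  refine Finset.sum_congr rfl fun i _ => ?_
  have e1 : ∀ i μ ν : Fin 4, i ^^^ μ ^^^ ν ^^^ μ = i ^^^ ν := by decide
  have e2 : ∀ i : Fin 4, sgn 0 i = 1 := by decide
  simp only [heis_apply, xorEquiv, Equiv.coe_fn_mk, xor_xor_self, e1, sgn_xor, e2]
  push_cast
  ring

theorem exists_admissible_zero (h2 : (2 : K) ≠ 0) {a : Fin 4 → K} (ha : Admissible a)
    (h : a 0 * a 1 * a 2 * a 3 = 0) :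
    ∃ (a' : Fin 4 → K) (ha' : Admissible a'), a' 0 = 0 ∧ kummerOrbit a' ha' = kummerOrbit a ha := by
  obtain ⟨μ, hμ⟩ : ∃ μ, a μ = 0 := by
    simp only [mul_eq_zero] at h
    rcases h with ((h | h) | h) | h
    exacts [⟨_, h⟩, ⟨_, h⟩, ⟨_, h⟩, ⟨_, h⟩]
  have ha' : Admissible (heis K (μ, 0) a) := admissible_of_heisForm fun m hm => by
    rw [heisForm_heis]
    exact mul_ne_zero (unit_cast_ne_zero _) (heisForm_ne_zero h2 ha hm)
  refine ⟨heis K (μ, 0) a, ha', ?_, ?_⟩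
  · have e : ∀ μ : Fin 4, 0 ^^^ μ = μ := by decide
    rw [heis_apply, e, hμ, mul_zero]
  · have e : Projectivization.mk K (heis K (μ, 0) a) ha'.ne_zero =
        (⟨heis K (μ, 0), heis_mem _⟩ : heisenbergGroup K) • Projectivization.mk K a ha.ne_zero :=
      (smul_mk_eq (heis K (μ, 0)) ha.ne_zero).symm
    rw [kummerOrbit, kummerOrbit, e, MulAction.orbit_smul]

/-- The points of a configuration are the nodes of a unique Kummer quartic. -/
theorem exists_kummerQuartic_of_config [IsAlgClosed K] (h2 : (2 : K) ≠ 0)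
    {N : Set (ℙ K (Fin 4 → K))} {N' : Set (Submodule K (Fin 4 → K))}
    (h : IsNondegenerateConfig N N') :
    ∃ F : MvPolynomial (Fin 4) K, IsKummerQuartic F ∧ singularSet F = N ∧
      (∀ p ∈ N, IsNode F p) ∧ ∀ G : MvPolynomial (Fin 4) K, IsKummerQuartic G →
        singularSet G = N → ∃ c : K, c ≠ 0 ∧ G = C c * F := by
  have : Infinite K := IsAlgClosed.instInfinite
  obtain ⟨a, ha, g, hg, -⟩ := exists_admissible_of_config h2 h
  obtain ⟨v, hv0, hv⟩ := exists_gradMatrix_mulVec_eq_zero a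
  obtain ⟨hK, hs⟩ := (isKummerQuartic_hudson_iff ha h2 v).1 ⟨hv0, hv⟩
  have hKF := IsKummerQuartic.imageForm g.symm hK
  have hsF : singularSet (imageForm g.symm (hudson v)) = N := by
    rw [singularSet_imageForm g.symm hK.homogeneous, hs, ← hg, imagePoints_symm]
  refine ⟨imageForm g.symm (hudson v), hKF, hsF, fun p hp => ?_, fun G hG hGs => ?_⟩
  · have hgp : g • p ∈ kummerOrbit a ha := by rw [← hg]; exact ⟨p, hp, rfl⟩
    have := IsNode.imageForm (isHomogeneous_hudson v) g.symm (isNode_hudson ha h2 hv0 hv hgp)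
    have e : g.symm • g • p = p := inv_smul_smul g p
    rwa [e] at this
  · obtain ⟨c, hc⟩ := (quartic_of_config h2 h hKF.homogeneous hKF.ne_zero hsF.ge).2.2 G
      hG.homogeneous hGs.ge
    refine ⟨c, ?_, hc⟩
    rintro rfl
    exact hG.ne_zero (by rw [hc, map_zero, zero_mul])

end KummerQuartic

/-! ### Bézout's inequality for plane curves -/

namespace KummerQuartic

open MvPolynomial

variable {K : Type*} [Field K]

/-- The dimension of the space of polynomials of degree at most `d` in two variables. -/
theorem two_mul_finrank_restrictTotalDegree (d : ℕ) :
    2 * Module.finrank K (restrictTotalDegree (Fin 2) K d) = (d + 1) * (d + 2) := by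
  have e : {s : Fin 2 →₀ ℕ | (s.sum fun _ e => e) ≤ d} ≃
      (Finset.range (d + 1)).sigma fun i => Finset.range (d + 1 - i) :=
    { toFun := fun s => ⟨⟨s.1 0, s.1 1⟩, by
        have h := s.2
        simp only [Set.mem_ofPred_eq] at h
        rw [Finsupp.sum_fintype _ _ (by simp), Fin.sum_univ_two] at h
        simp only [Finset.mem_sigma, Finset.mem_range]
        omega⟩
      invFun := fun t => ⟨Finsupp.equivFunOnFinite.symm ![t.1.1, t.1.2], by
        have h := t.2
        simp only [Finset.mem_sigma, Finset.mem_range] at h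
        simp only [Set.mem_ofPred_eq]
        rw [Finsupp.sum_fintype _ _ (by simp), Fin.sum_univ_two]
        simp
        omega⟩
      left_inv := fun s => by
        ext i
        fin_cases i <;> simp
      right_inv := fun t => by
        ext <;> simp }
  have h1 : Module.finrank K (restrictTotalDegree (Fin 2) K d) =
      ((Finset.range (d + 1)).sigma fun i => Finset.range (d + 1 - i)).card := by
    rw [restrictTotalDegree, Module.finrank_eq_nat_card_basis (basisRestrictSupport K _),
      Nat.card_congr e, Nat.card_eq_fintype_card, Fintype.card_coe]
  rw [h1, Finset.card_sigma]
  simp only [Finset.card_range]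
  have h2 : ∑ i ∈ Finset.range (d + 1), (d + 1 - i) = ∑ i ∈ Finset.range (d + 1), (i + 1) := by
    rw [← Finset.sum_range_reflect]
    exact Finset.sum_congr rfl fun i hi => by
      rw [Finset.mem_range] at hi
      omega
  rw [h2]
  clear h1 h2 e
  induction d with
  | zero => simp
  | succ d ih =>
    rw [Finset.sum_range_succ, mul_add, ih]
    ring

/-- Polynomials of large degree represent all elements of a finite dimensional quotient. -/
theorem exists_restrictTotalDegree_surjective {σ : Type*} (L : Ideal (MvPolynomial σ K))
    [Module.Finite K (MvPolynomial σ K ⧸ L)] :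
    ∃ d₀, ∀ d, d₀ ≤ d → Function.Surjective
      ((Ideal.Quotient.mkₐ K L).toLinearMap.domRestrict (restrictTotalDegree σ K d)) := by
  obtain ⟨s, hs⟩ := (inferInstance : Module.Finite K (MvPolynomial σ K ⧸ L)).fg_top
  choose r hr using fun y : MvPolynomial σ K ⧸ L => Ideal.Quotient.mkₐ_surjective K L y
  refine ⟨s.sup fun y => (r y).totalDegree, fun d hd => ?_⟩
  rw [← LinearMap.range_eq_top, eq_top_iff, ← hs, Submodule.span_le]
  intro y hy
  exact ⟨⟨r y, (mem_restrictTotalDegree _ _ _).2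
    ((Finset.le_sup (f := fun y => (r y).totalDegree) hy).trans hd)⟩, hr y⟩

/-- Bézout's inequality: an ideal containing two polynomials without common factor has colength
at most the product of their degrees. -/
theorem finrank_quotient_le {A f : MvPolynomial (Fin 2) K} (hf : f ≠ 0)
    (hrel : IsRelPrime A f) (L : Ideal (MvPolynomial (Fin 2) K))
    [Module.Finite K (MvPolynomial (Fin 2) K ⧸ L)] (hAL : A ∈ L) (hfL : f ∈ L) :
    Module.finrank K (MvPolynomial (Fin 2) K ⧸ L) ≤ A.totalDegree * f.totalDegree := by
  obtain ⟨d, hd⟩ := exists_restrictTotalDegree_surjective L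
  set a := A.totalDegree
  set b := f.totalDegree
  set π := (Ideal.Quotient.mkₐ K L).toLinearMap.domRestrict
    (restrictTotalDegree (Fin 2) K (d + a + b))
  have hπ : Function.Surjective π := hd _ (by omega)
  let mulR : ∀ (g : MvPolynomial (Fin 2) K) (m : ℕ),
      restrictTotalDegree (Fin 2) K m →ₗ[K] restrictTotalDegree (Fin 2) K (m + g.totalDegree) :=
    fun g m => (LinearMap.mulLeft K g).restrict fun p hp => by
      rw [mem_restrictTotalDegree] at hp ⊢
      rw [LinearMap.mulLeft_apply]
      exact (totalDegree_mul _ _).trans (by omega)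
  have incl : ∀ {m m' : ℕ}, m = m' →
      restrictTotalDegree (Fin 2) K m ≤ restrictTotalDegree (Fin 2) K m' := by
    rintro m _ rfl
    exact le_rfl
  -- The truncated Koszul complex of `A` and `f`: the image of `φ` lies in `L`, and by coprimality
  -- its kernel consists of the trivial syzygies, the image of `ψ`.
  let φ : (restrictTotalDegree (Fin 2) K (d + b) × restrictTotalDegree (Fin 2) K (d + a)) →ₗ[K]
      restrictTotalDegree (Fin 2) K (d + a + b) :=
    LinearMap.coprod
      ((Submodule.inclusion (incl (by omega : d + b + a = d + a + b))).comp (mulR A (d + b)))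
      (mulR f (d + a))
  have hφ : ∀ p, (φ p : MvPolynomial (Fin 2) K) = A * p.1 + f * p.2 := fun p => rfl
  let ψ : restrictTotalDegree (Fin 2) K d →ₗ[K]
      (restrictTotalDegree (Fin 2) K (d + b) × restrictTotalDegree (Fin 2) K (d + a)) :=
    (mulR f d).prod (-mulR A d)
  have hker : LinearMap.ker φ ≤ LinearMap.range ψ := by
    rintro ⟨p, r⟩ hpr
    have h0 : A * (p : MvPolynomial (Fin 2) K) + f * r = 0 := by
      rw [← hφ (p, r), LinearMap.mem_ker.1 hpr]
      rfl
    have h1 : f ∣ A * (p : MvPolynomial (Fin 2) K) := ⟨-r, by linear_combination h0⟩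
    obtain ⟨s, hs⟩ := hrel.symm.dvd_of_dvd_mul_left h1
    have hr : (r : MvPolynomial (Fin 2) K) = -(A * s) := by
      apply mul_left_cancel₀ hf
      rw [hs] at h0
      linear_combination h0
    have hsd : s ∈ restrictTotalDegree (Fin 2) K d := by
      rw [mem_restrictTotalDegree]
      by_cases hs0 : s = 0
      · simp [hs0]
      · have h2 := (mem_restrictTotalDegree _ _ _).1 p.2
        rw [hs, totalDegree_mul_of_isDomain hf hs0] at h2
        omega
    exact ⟨⟨s, hsd⟩, Prod.ext (Subtype.ext hs.symm) (Subtype.ext hr.symm)⟩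
  have hrange : LinearMap.range φ ≤ LinearMap.ker π := by
    rintro _ ⟨p, rfl⟩
    rw [LinearMap.mem_ker]
    change Ideal.Quotient.mk L (A * p.1 + f * p.2) = 0
    rw [Ideal.Quotient.eq_zero_iff_mem]
    exact L.add_mem (L.mul_mem_right _ hAL) (L.mul_mem_right _ hfL)
  have e1 := LinearMap.finrank_range_add_finrank_ker φ
  have e2 := LinearMap.finrank_range_add_finrank_ker π
  have e3 := LinearMap.finrank_range_le ψ
  have e4 := Submodule.finrank_mono hker
  have e5 := Submodule.finrank_mono hrange
  rw [LinearMap.range_eq_top.2 hπ, finrank_top] at e2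
  rw [Module.finrank_prod] at e1
  have v1 := two_mul_finrank_restrictTotalDegree (K := K) d
  have v2 := two_mul_finrank_restrictTotalDegree (K := K) (d + a)
  have v3 := two_mul_finrank_restrictTotalDegree (K := K) (d + b)
  have v4 := two_mul_finrank_restrictTotalDegree (K := K) (d + a + b)
  -- The alternating sum of the four dimensions is the mixed second difference of (d + 1)(d + 2)/2,
  -- which equals ab.
  nlinarith

/-- The maximal ideal of a point. -/
noncomputable def pointIdeal {σ : Type*} (x : σ → K) : Ideal (MvPolynomial σ K) :=
  RingHom.ker (aeval x : MvPolynomial σ K →ₐ[K] K)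

theorem mem_pointIdeal {σ : Type*} {x : σ → K} {p : MvPolynomial σ K} :
    p ∈ pointIdeal x ↔ eval x p = 0 := by
  rw [pointIdeal, RingHom.mem_ker, aeval_eq_eval]

theorem isCoprime_pointIdeal {σ : Type*} {x y : σ → K} (h : x ≠ y) :
    IsCoprime (pointIdeal x) (pointIdeal y) := by
  obtain ⟨i, hi⟩ := Function.ne_iff.1 h
  have hi' : x i - y i ≠ 0 := sub_ne_zero.2 hi
  rw [Ideal.isCoprime_iff_exists]
  refine ⟨-C (x i - y i)⁻¹ * (X i - C (x i)), ?_, C (x i - y i)⁻¹ * (X i - C (y i)), ?_, ?_⟩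
  · simp [mem_pointIdeal]
  · simp [mem_pointIdeal]
  · rw [show -C (x i - y i)⁻¹ * (X i - C (x i)) + C (x i - y i)⁻¹ * (X i - C (y i)) =
      C (x i - y i)⁻¹ * (C (x i) - C (y i)) by ring, ← C_sub, ← C_mul, inv_mul_cancel₀ hi', C_1]

/-- Bézout's inequality for ideals supported at distinct points. -/
theorem sum_finrank_quotient_le {A f : MvPolynomial (Fin 2) K} (hf : f ≠ 0)
    (hrel : IsRelPrime A f) {ι : Type*} [Fintype ι] {x : ι → Fin 2 → K}
    (hx : Function.Injective x) (L : ι → Ideal (MvPolynomial (Fin 2) K)) (n : ℕ)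
    (hL : ∀ i, pointIdeal (x i) ^ n ≤ L i)
    (hfin : ∀ i, Module.Finite K (MvPolynomial (Fin 2) K ⧸ L i))
    (hAL : ∀ i, A ∈ L i) (hfL : ∀ i, f ∈ L i) :
    ∑ i, Module.finrank K (MvPolynomial (Fin 2) K ⧸ L i) ≤ A.totalDegree * f.totalDegree := by
  have hco : Pairwise (Function.onFun IsCoprime L) := fun i j hij =>
    Ideal.isCoprime_iff_codisjoint.2 (Codisjoint.mono (hL i) (hL j)
      (Ideal.isCoprime_iff_codisjoint.1 (isCoprime_pointIdeal (hx.ne hij)).pow))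
  let e : (MvPolynomial (Fin 2) K ⧸ ⨅ i, L i) ≃ₗ[K] ∀ i, MvPolynomial (Fin 2) K ⧸ L i :=
    { Ideal.quotientInfRingEquivPiQuotient L hco with
      map_smul' := fun c y => by
        obtain ⟨y, rfl⟩ := Ideal.Quotient.mk_surjective y
        rfl }
  have : Module.Finite K (MvPolynomial (Fin 2) K ⧸ ⨅ i, L i) := Module.Finite.equiv e.symm
  rw [← Module.finrank_pi_fintype K, ← e.finrank_eq]
  exact finrank_quotient_le hf hrel _ (by simpa [Ideal.mem_iInf] using hAL)
    (by simpa [Ideal.mem_iInf] using hfL)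

end KummerQuartic

/-! ### Plane curves with double points of weight at most two -/

namespace KummerQuartic

open MvPolynomial

variable {K : Type*} [Field K]

theorem one_le_totalDegree {σ : Type*} {p : MvPolynomial σ K} (h0 : p ≠ 0) (hp : ¬ IsUnit p) :
    1 ≤ p.totalDegree := by
  by_contra h
  have h1 := totalDegree_eq_zero_iff_eq_C.1 (by omega : p.totalDegree = 0)
  refine hp ?_
  rw [h1]
  refine IsUnit.map C (isUnit_iff_ne_zero.2 fun hc => h0 ?_)
  rw [h1, hc, C_0]

theorem totalDegree_X_sub_C {σ : Type*} (i : σ) (c : K) :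
    (X i - C c : MvPolynomial σ K).totalDegree ≤ 1 :=
  (totalDegree_sub_C_le _ _).trans (totalDegree_X i).le

/-- A nonunit dividing a polynomial of degree one is a multiple of it. -/
theorem exists_C_mul_of_dvd {σ : Type*} {D L : MvPolynomial σ K} (hD : ¬ IsUnit D)
    (hL0 : L ≠ 0) (hL : L.totalDegree ≤ 1) (h : D ∣ L) : ∃ s : K, s ≠ 0 ∧ L = C s * D := by
  obtain ⟨s, rfl⟩ := h
  have hD0 : D ≠ 0 := left_ne_zero_of_mul hL0
  have hs0 : s ≠ 0 := right_ne_zero_of_mul hL0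
  have h1 := one_le_totalDegree hD0 hD
  rw [totalDegree_mul_of_isDomain hD0 hs0] at hL
  have h2 := totalDegree_eq_zero_iff_eq_C.1 (by omega : s.totalDegree = 0)
  refine ⟨coeff 0 s, fun hc => hs0 (by rw [h2, hc, C_0]), ?_⟩
  rw [← h2, mul_comm]

/-- An irreducible plane curve has infinitely many points outside a curve not containing it. -/
theorem infinite_zeros [IsAlgClosed K] {D E : MvPolynomial (Fin 2) K} (hD : Irreducible D)
    (hE : ¬ D ∣ E) : {x : Fin 2 → K | eval x D = 0 ∧ eval x E ≠ 0}.Infinite := by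
  intro hfin
  have hprime : Prime D := hD.prime
  -- If the exceptional set were finite, the Nullstellensatz would make `D` divide `E` times a
  -- product of X_i - z_i, hence one of these factors. Doing so for both coordinates makes X_0 - c
  -- and X_1 - d proportional, which is absurd.
  have key : ∀ i : Fin 2, ∃ c : K, D ∣ X i - C c := by
    intro i
    have h1 : E * ∏ z ∈ hfin.toFinset, (X i - C (z i)) ∈ Ideal.span {D} := by
      have hP : (Ideal.span {D}).IsPrime := (Ideal.span_singleton_prime hprime.ne_zero).2 hprime
      rw [← IsPrime.vanishingIdeal_zeroLocus (K := K) (Ideal.span {D}), mem_vanishingIdeal_iff]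
      intro x hx
      rw [mem_zeroLocus_iff] at hx
      have hxD := hx D (Ideal.mem_span_singleton_self D)
      rw [aeval_eq_eval] at hxD ⊢
      by_cases hxE : eval x E = 0
      · change eval x _ = 0
        rw [map_mul, hxE, zero_mul]
      · change eval x _ = 0
        rw [map_mul, map_prod, Finset.prod_eq_zero (i := x), mul_zero]
        · rw [Set.Finite.mem_toFinset]
          exact ⟨hxD, hxE⟩
        · simp
    rw [Ideal.mem_span_singleton] at h1
    obtain ⟨z, -, hz⟩ := (hprime.dvd_finsetProd_iff _).1 ((hprime.dvd_or_dvd h1).resolve_left hE)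
    exact ⟨z i, hz⟩
  have hne : ∀ (i j : Fin 2) (c : K), j ≠ i → pderiv j (X i - C c : MvPolynomial (Fin 2) K) = 0 ∧
      pderiv i (X i - C c : MvPolynomial (Fin 2) K) = 1 := by
    intro i j c hij
    simp [pderiv_X, hij]
  have hX : ∀ (i : Fin 2) (c : K), (X i - C c : MvPolynomial (Fin 2) K) ≠ 0 := by
    intro i c h
    have := (hne i (i + 1) c (by fin_cases i <;> decide)).2
    rw [h, map_zero] at this
    exact zero_ne_one this
  obtain ⟨c, hc⟩ := key 0
  obtain ⟨d, hd⟩ := key 1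
  obtain ⟨s, hs, hs'⟩ := exists_C_mul_of_dvd hD.not_isUnit (hX 0 c) (totalDegree_X_sub_C 0 c) hc
  obtain ⟨t, ht, ht'⟩ := exists_C_mul_of_dvd hD.not_isUnit (hX 1 d) (totalDegree_X_sub_C 1 d) hd
  have h1 : C t * (X 0 - C c) = C s * (X 1 - C d : MvPolynomial (Fin 2) K) := by
    rw [hs', ht']
    ring
  have h2 := congrArg (pderiv (0 : Fin 2)) h1
  rw [pderiv_C_mul, pderiv_C_mul, (hne 0 1 c (by decide)).2, (hne 1 0 d (by decide)).1] at h2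
  simp only [mul_one, mul_zero] at h2
  exact ht (by simpa [smul_eq_C_mul] using h2)

theorem infinite_zeros_of_not_isUnit [IsAlgClosed K] {A : MvPolynomial (Fin 2) K}
    (h0 : A ≠ 0) (hA : ¬ IsUnit A) : {x : Fin 2 → K | eval x A = 0}.Infinite := by
  obtain ⟨D, hD, hDA⟩ := WfDvdMonoid.exists_irreducible_factor hA h0
  refine (infinite_zeros hD (E := 1) fun h => hD.not_isUnit (isUnit_of_dvd_one h)).mono ?_
  rintro x ⟨hx, -⟩
  obtain ⟨E, rfl⟩ := hDA
  simp [hx]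

/-- A point of the plane with a pair of ideals `I`, `J` supported there, such as the ideal of a
finite subscheme of length `k` and its square. -/
structure IsFatPoint (x : Fin 2 → K) (k : ℕ) (I J : Ideal (MvPolynomial (Fin 2) K)) : Prop where
  mul_le : I * I ≤ J
  pow_le_left : pointIdeal x ^ 4 ≤ I
  pow_le_right : pointIdeal x ^ 4 ≤ J
  finite_left : Module.Finite K (MvPolynomial (Fin 2) K ⧸ I)
  finite_right : Module.Finite K (MvPolynomial (Fin 2) K ⧸ J)
  finrank_left : Module.finrank K (MvPolynomial (Fin 2) K ⧸ I) = k
  finrank_right : Module.finrank K (MvPolynomial (Fin 2) K ⧸ J) = 3 * k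
  grad : ∀ p ∈ J, eval x p = 0 ∧ ∀ i, eval x (pderiv i p) = 0

theorem finite_quotient_of_le {I J : Ideal (MvPolynomial (Fin 2) K)} (h : I ≤ J)
    (hI : Module.Finite K (MvPolynomial (Fin 2) K ⧸ I)) :
    Module.Finite K (MvPolynomial (Fin 2) K ⧸ J) :=
  Module.Finite.of_surjective (Ideal.Quotient.factorₐ K h).toLinearMap
    (Ideal.Quotient.factor_surjective h)

/-- Multiplication by `f` maps the quotient by `I`, of length k, to the quotient by `J`, of length
3k. The quotient by J + (f) is its cokernel, so at least 2k remains: a curve through `I` meets a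
curve in `J` with multiplicity at least 2k. -/
theorem IsFatPoint.two_mul_le {x : Fin 2 → K} {k : ℕ} {I J : Ideal (MvPolynomial (Fin 2) K)}
    (h : IsFatPoint x k I J) {f : MvPolynomial (Fin 2) K} (hf : f ∈ I) :
    2 * k ≤ Module.finrank K (MvPolynomial (Fin 2) K ⧸ (J ⊔ Ideal.span {f})) := by
  have := h.finite_left
  have := h.finite_right
  let μ : (MvPolynomial (Fin 2) K ⧸ I) →ₗ[K] (MvPolynomial (Fin 2) K ⧸ J) :=
    (Submodule.restrictScalars K I).liftQ
      ((Ideal.Quotient.mkₐ K J).toLinearMap.comp (LinearMap.mulLeft K f)) fun p hp => by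
        rw [LinearMap.mem_ker]
        change Ideal.Quotient.mk J (f * p) = 0
        rw [Ideal.Quotient.eq_zero_iff_mem]
        exact h.mul_le (Ideal.mul_mem_mul hf hp)
  set π := (Ideal.Quotient.factorₐ K (le_sup_left : J ≤ J ⊔ Ideal.span {f})).toLinearMap
  have hπ : Function.Surjective π :=
    Ideal.Quotient.factor_surjective le_sup_left
  have hker : LinearMap.ker π ≤ LinearMap.range μ := by
    intro y hy
    obtain ⟨p, rfl⟩ := Ideal.Quotient.mk_surjective y
    have hp : Ideal.Quotient.mk (J ⊔ Ideal.span {f}) p = 0 := hy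
    rw [Ideal.Quotient.eq_zero_iff_mem, Submodule.mem_sup] at hp
    obtain ⟨j, hj, r, hr, rfl⟩ := hp
    obtain ⟨c, rfl⟩ := Ideal.mem_span_singleton.1 hr
    refine ⟨Ideal.Quotient.mk I c, ?_⟩
    change Ideal.Quotient.mk J (f * c) = _
    rw [map_add, Ideal.Quotient.eq_zero_iff_mem.2 hj, zero_add]
  have e1 := LinearMap.finrank_range_add_finrank_ker π
  have e2 := LinearMap.finrank_range_le μ
  have e3 := Submodule.finrank_mono hker
  rw [LinearMap.range_eq_top.2 hπ, finrank_top, h.finrank_right] at e1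
  rw [h.finrank_left] at e2
  omega

theorem finite_quotient_pointIdeal (x : Fin 2 → K) :
    Module.Finite K (MvPolynomial (Fin 2) K ⧸ pointIdeal x) ∧
      Module.finrank K (MvPolynomial (Fin 2) K ⧸ pointIdeal x) = 1 := by
  let e := (Ideal.quotientKerAlgEquivOfSurjective
    (f := (aeval x : MvPolynomial (Fin 2) K →ₐ[K] K)) fun c => ⟨C c, by simp⟩).toLinearEquiv
  exact ⟨Module.Finite.equiv e.symm, e.finrank_eq.trans (Module.finrank_self K)⟩

section

variable {ι : Type*} {x : ι → Fin 2 → K} (hx : Function.Injective x) {k : ι → ℕ}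
  {I J : ι → Ideal (MvPolynomial (Fin 2) K)} (hfat : ∀ i, IsFatPoint (x i) (k i) (I i) (J i))

include hx hfat

/-- A curve of degree `n + 1` with many fat points has a proper factor. -/
theorem exists_factor_of_many_fatPoints (S : Finset ι) {A : MvPolynomial (Fin 2) K}
    (hAJ : ∀ i ∈ S, A ∈ J i) (P : Finset (Fin 2 → K)) (hP : ∀ p ∈ P, eval p A = 0)
    (hPx : ∀ p ∈ P, ∀ i ∈ S, x i ≠ p) {n : ℕ} (hn : A.totalDegree = n + 1)
    (h1 : 2 * (∑ i ∈ S, k i + P.card) < (n + 1) * (n + 2))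
    (h2 : (n + 1) * n < 2 * ∑ i ∈ S, k i + P.card) :
    ∃ D, ¬ IsUnit D ∧ D ∣ A ∧ D.totalDegree ≤ n := by
  have hfinI := fun i => (hfat i).finite_left
  -- There are fewer linear conditions than coefficients, so some nonzero `f` of degree at most n
  -- lies in every `I i` and passes through the points of `P`.
  let T : restrictTotalDegree (Fin 2) K n →ₗ[K]
      ((∀ i : S, MvPolynomial (Fin 2) K ⧸ I i) × (P → K)) :=
    (LinearMap.prod (LinearMap.pi fun i : S => (Ideal.Quotient.mkₐ K (I i)).toLinearMap)
      (LinearMap.pi fun p : P => (aeval (p : Fin 2 → K)).toLinearMap)).domRestrict _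
  have hT : LinearMap.ker T ≠ ⊥ := by
    apply LinearMap.ker_ne_bot_of_finrank_lt
    rw [Module.finrank_prod, Module.finrank_pi_fintype, Module.finrank_fintype_fun_eq_card,
      Fintype.card_coe]
    simp only [(hfat _).finrank_left]
    rw [Finset.sum_coe_sort S k]
    have := two_mul_finrank_restrictTotalDegree (K := K) n
    omega
  obtain ⟨⟨f, hfd⟩, hfT, hf0⟩ := Submodule.exists_mem_ne_zero_of_ne_bot hT
  rw [mem_restrictTotalDegree] at hfd
  have hf : f ≠ 0 := fun h => hf0 (Subtype.ext h)
  have hfI : ∀ i ∈ S, f ∈ I i := fun i hi => by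
    have := congrFun (congrArg Prod.fst (LinearMap.mem_ker.1 hfT)) ⟨i, hi⟩
    exact Ideal.Quotient.eq_zero_iff_mem.1 this
  have hfP : ∀ p ∈ P, eval p f = 0 := fun p hp => by
    have := congrFun (congrArg Prod.snd (LinearMap.mem_ker.1 hfT)) ⟨p, hp⟩
    rwa [← mem_pointIdeal]
  have hnot : ¬ IsRelPrime A f := by
    -- Without a common factor, `A` and `f` would meet with total multiplicity at most (n + 1) n,
    -- less than the weight imposed.
    intro hrel
    have hb := sum_finrank_quotient_le hf hrel (ι := S ⊕ P)
      (x := Sum.elim (fun i => x i) fun p => p) ?_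
      (Sum.elim (fun i => J i ⊔ Ideal.span {f}) fun p => pointIdeal p) 4 ?_ ?_ ?_ ?_
    · rw [Fintype.sum_sum_type] at hb
      have hp : ∑ p : P, Module.finrank K (MvPolynomial (Fin 2) K ⧸ pointIdeal (p : Fin 2 → K)) =
          P.card := by
        rw [Finset.sum_congr rfl fun p _ => (finite_quotient_pointIdeal _).2]
        simp
      change (∑ i : S, Module.finrank K (MvPolynomial (Fin 2) K ⧸ (J i ⊔ Ideal.span {f}))) +
        ∑ p : P, Module.finrank K (MvPolynomial (Fin 2) K ⧸ pointIdeal (p : Fin 2 → K)) ≤ _ at hb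
      rw [hp] at hb
      have hs : ∑ i : S, 2 * k i ≤ ∑ i : S,
          Module.finrank K (MvPolynomial (Fin 2) K ⧸ (J i ⊔ Ideal.span {f})) :=
        Finset.sum_le_sum fun i _ => (hfat i).two_mul_le (hfI i i.2)
      rw [Finset.sum_coe_sort S fun i => 2 * k i, ← Finset.mul_sum] at hs
      rw [hn] at hb
      have := Nat.mul_le_mul_left (n + 1) hfd
      omega
    · rintro (i | p) (j | q) h
      · exact congrArg Sum.inl (Subtype.ext (hx h))
      · exact absurd h (hPx q q.2 i i.2)
      · exact absurd h.symm (hPx p p.2 j j.2)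
      · exact congrArg Sum.inr (Subtype.ext h)
    · rintro (i | p)
      · exact (hfat i).pow_le_right.trans le_sup_left
      · exact Ideal.pow_le_self (by decide)
    · rintro (i | p)
      · exact finite_quotient_of_le le_sup_left (hfat i).finite_right
      · exact (finite_quotient_pointIdeal _).1
    · rintro (i | p)
      · exact Ideal.mem_sup_left (hAJ i i.2)
      · exact mem_pointIdeal.2 (hP p p.2)
    · rintro (i | p)
      · exact Ideal.mem_sup_right (Ideal.mem_span_singleton_self f)
      · exact mem_pointIdeal.2 (hfP p p.2)
  rw [IsRelPrime] at hnot
  push Not at hnot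
  obtain ⟨D, hDA, ⟨E, rfl⟩, hD⟩ := hnot
  refine ⟨D, hD, hDA, ?_⟩
  rw [totalDegree_mul_of_isDomain (left_ne_zero_of_mul hf) (right_ne_zero_of_mul hf)] at hfd
  omega

/-- Two curves without common factor meet in a bounded number of points. -/
theorem sum_le_of_mem_left (S : Finset ι) {C D : MvPolynomial (Fin 2) K} (hD : D ≠ 0)
    (hrel : IsRelPrime C D) (hC : ∀ i ∈ S, C ∈ I i) (hD' : ∀ i ∈ S, D ∈ I i) :
    ∑ i ∈ S, k i ≤ C.totalDegree * D.totalDegree := by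
  have := sum_finrank_quotient_le hD hrel (ι := S) (x := fun i => x i)
    (hx.comp Subtype.val_injective) (fun i => I i) 4 (fun i => (hfat i).pow_le_left)
    (fun i => (hfat i).finite_left) (fun i => hC i i.2) (fun i => hD' i i.2)
  simp only [(hfat _).finrank_left] at this
  rwa [Finset.sum_coe_sort S k] at this

end

/-- A factorization of a divisor of `A` lying in `J` splits along `I` and `J`. -/
def SplitsAlong (I J : Ideal (MvPolynomial (Fin 2) K)) (A : MvPolynomial (Fin 2) K) : Prop :=
  ∀ C D, C * D ∣ A → C * D ∈ J → C ∈ J ∨ D ∈ J ∨ C ∈ I ∧ D ∈ I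

theorem SplitsAlong.of_dvd {I J : Ideal (MvPolynomial (Fin 2) K)} {A B : MvPolynomial (Fin 2) K}
    (h : SplitsAlong I J A) (hBA : B ∣ A) : SplitsAlong I J B :=
  fun C D hCD => h C D (hCD.trans hBA)

/-- A polynomial is a product of polynomials of degree one. -/
def IsProductOfLinear (A : MvPolynomial (Fin 2) K) : Prop :=
  ∃ (s : Multiset (MvPolynomial (Fin 2) K)) (c : K),
    (∀ ℓ ∈ s, ℓ.totalDegree = 1) ∧ A = C c * s.prod

theorem IsProductOfLinear.mul {A B : MvPolynomial (Fin 2) K} (hA : IsProductOfLinear A)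
    (hB : IsProductOfLinear B) : IsProductOfLinear (A * B) := by
  obtain ⟨s, c, hs, rfl⟩ := hA
  obtain ⟨t, d, ht, rfl⟩ := hB
  refine ⟨s + t, c * d, fun ℓ hℓ => (Multiset.mem_add.1 hℓ).elim (hs ℓ) (ht ℓ), ?_⟩
  rw [Multiset.prod_add, C_mul]
  ring

theorem exists_eq_of_totalDegree_le_one {A : MvPolynomial (Fin 2) K} (hA : A.totalDegree ≤ 1) :
    ∃ a b c : K, A = C a + C b * X 0 + C c * X 1 := by
  refine ⟨coeff 0 A, coeff (Finsupp.single 0 1) A, coeff (Finsupp.single 1 1) A, ?_⟩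
  ext s
  by_cases hs : 1 < s.degree
  · have h1 : coeff s A = 0 := coeff_eq_zero_of_totalDegree_lt (hA.trans_lt hs)
    have h0 : s ≠ 0 := by
      rintro rfl
      simp at hs
    have hi : ∀ i, s ≠ Finsupp.single i 1 := by
      rintro i rfl
      simp at hs
    simp [h1, coeff_C, coeff_X, coeff_C_mul, h0.symm, (hi 0).symm, (hi 1).symm]
  · rw [Finsupp.degree_eq_sum, Fin.sum_univ_two] at hs
    have h : s = 0 ∨ s = Finsupp.single 0 1 ∨ s = Finsupp.single 1 1 := by
      rcases Nat.eq_zero_or_pos (s 0) with h0 | h0 <;> rcases Nat.eq_zero_or_pos (s 1) with h1 | h1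
      · left
        ext i
        fin_cases i <;> simp [h0, h1]
      · right; right
        ext i
        fin_cases i <;> simp [h0]
        omega
      · right; left
        ext i
        fin_cases i <;> simp [h1]
        omega
      · omega
    rcases h with rfl | rfl | rfl
    · simp [coeff_X]
    · simp [coeff_C, coeff_X, Finsupp.single_left_inj, eq_comm (a := (0 : Fin 2 →₀ ℕ))]
    · simp [coeff_C, coeff_X, Finsupp.single_left_inj, eq_comm (a := (0 : Fin 2 →₀ ℕ))]

theorem exists_eval_pderiv_ne_zero {A : MvPolynomial (Fin 2) K} (hA : A.totalDegree = 1)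
    (x : Fin 2 → K) : ∃ i, eval x (pderiv i A) ≠ 0 := by
  obtain ⟨a, b, c, rfl⟩ := exists_eq_of_totalDegree_le_one hA.le
  by_contra! h
  have h0 := h 0
  have h1 := h 1
  simp [pderiv_X] at h0 h1
  simp [h0, h1] at hA

section

variable [IsAlgClosed K] {ι : Type*} {x : ι → Fin 2 → K} (hx : Function.Injective x) {k : ι → ℕ}
  {I J : ι → Ideal (MvPolynomial (Fin 2) K)} (hfat : ∀ i, IsFatPoint (x i) (k i) (I i) (J i))
  (hk : ∀ i, k i ≤ 2)

include hx hfat hk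

/-- A squarefree curve of degree `n ≥ 2` with fat points of large total weight is reducible. -/
theorem exists_mul_of_two_mul_sum_ge {n : ℕ} (A : MvPolynomial (Fin 2) K)
    (hn : A.totalDegree = n + 2) (S : Finset ι) (hAJ : ∀ i ∈ S, A ∈ J i)
    (hS : (n + 2) * (n + 1) ≤ 2 * ∑ i ∈ S, k i) :
    ∃ C D, ¬ IsUnit C ∧ A = C * D ∧ C.totalDegree ≤ n + 1 := by
  classical
  have hA0 : A ≠ 0 := by
    rintro rfl
    simp at hn
  have hAu : ¬ IsUnit A := by
    intro h
    rw [MvPolynomial.isUnit_iff_totalDegree_of_isReduced] at h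
    omega
  -- A minimal subset reaching the bound overshoots it little: weights are at most two, so with (n +
  -- 2)(n + 1) = 2m the total weight is m or m + 1.
  obtain ⟨S', hS'S, hmin⟩ : ∃ S' ⊆ S, (n + 2) * (n + 1) ≤ 2 * ∑ i ∈ S', k i ∧
      ∀ i ∈ S', 2 * ∑ j ∈ S'.erase i, k j < (n + 2) * (n + 1) := by
    obtain ⟨S', hS', hmin⟩ := exists_minimal_of_wellFoundedLT
      (fun T : Finset ι => T ⊆ S ∧ (n + 2) * (n + 1) ≤ 2 * ∑ i ∈ T, k i) ⟨S, subset_rfl, hS⟩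
    refine ⟨S', hS'.1, hS'.2, fun i hi => ?_⟩
    by_contra! h
    exact absurd (hmin ⟨(Finset.erase_subset _ _).trans hS'.1, h⟩ (Finset.erase_subset _ _) hi)
      (Finset.notMem_erase i S')
  obtain ⟨m, hm⟩ : ∃ m, (n + 2) * (n + 1) = 2 * m := by
    obtain ⟨m, hm⟩ := Nat.even_mul_succ_self (n + 1)
    exact ⟨m, by linarith⟩
  have hne : S'.Nonempty := by
    rw [Finset.nonempty_iff_ne_empty]
    rintro rfl
    simp at hmin
  have hle : ∑ i ∈ S', k i ≤ m + 1 := by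
    obtain ⟨i, hi⟩ := hne
    have h1 := hmin.2 i hi
    have h2 := Finset.add_sum_erase S' k hi
    have h3 := hk i
    omega
  have hm' : m + 1 < m + (n + 2) := by omega
  -- Simple points of the curve bring the number of conditions to exactly m + 1. This keeps `f`
  -- available and makes the Bézout estimate strict.
  obtain ⟨P, hP0, hPS, hPc⟩ : ∃ P : Finset (Fin 2 → K), (∀ p ∈ P, eval p A = 0) ∧
      (∀ p ∈ P, ∀ i ∈ S', x i ≠ p) ∧ ∑ i ∈ S', k i + P.card = m + 1 := by
    obtain ⟨t, ht, htc⟩ := ((infinite_zeros_of_not_isUnit hA0 hAu).sdiff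
      (S'.image x).finite_toSet).exists_subset_card_eq (m + 1 - ∑ i ∈ S', k i)
    refine ⟨t, fun p hp => (ht hp).1, fun p hp i hi h => (ht hp).2 ?_, by omega⟩
    rw [← h]
    exact Finset.mem_coe.2 (Finset.mem_image_of_mem x hi)
  obtain ⟨D, hD, ⟨E, hE⟩, hDd⟩ := exists_factor_of_many_fatPoints hx hfat S'
    (fun i hi => hAJ i (hS'S hi)) P hP0 hPS (n := n + 1) hn
    (by rw [hPc]; nlinarith) (by
      have h1 := hmin.1
      change (n + 2) * (n + 1) < _
      omega)
  exact ⟨D, E, hD, hE, hDd⟩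

/-- The bound on the total weight of the fat points of a squarefree plane curve. -/
theorem two_mul_sum_le (n : ℕ) : ∀ A : MvPolynomial (Fin 2) K, A.totalDegree = n →
    Squarefree A → ∀ S : Finset ι, (∀ i ∈ S, A ∈ J i) → (∀ i ∈ S, SplitsAlong (I i) (J i) A) →
    2 * ∑ i ∈ S, k i ≤ n * (n - 1) ∧
      (2 * ∑ i ∈ S, k i = n * (n - 1) → IsProductOfLinear A) := by
  classical
  induction n using Nat.strong_induction_on with
  | _ n ih =>
  intro A hn hsq S hAJ hsplit
  have hA0 : A ≠ 0 := hsq.ne_zero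
  rcases n with _ | _ | n
  · have hAC := totalDegree_eq_zero_iff_eq_C.1 hn
    have hS : S = ∅ := by
      by_contra h
      obtain ⟨i, hi⟩ := Finset.nonempty_iff_ne_empty.2 h
      have h1 := ((hfat i).grad A (hAJ i hi)).1
      rw [hAC, eval_C] at h1
      exact hA0 (by rw [hAC, h1, C_0])
    refine ⟨by simp [hS], fun _ => ⟨0, coeff 0 A, by simp, ?_⟩⟩
    rw [Multiset.prod_zero, mul_one]
    exact hAC
  · have hS : S = ∅ := by
      by_contra h
      obtain ⟨i, hi⟩ := Finset.nonempty_iff_ne_empty.2 h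
      obtain ⟨j, hj⟩ := exists_eval_pderiv_ne_zero hn (x i)
      exact hj (((hfat i).grad A (hAJ i hi)).2 j)
    exact ⟨by simp [hS], fun _ => ⟨{A}, 1, by simpa using hn, by simp⟩⟩
  · by_cases hbig : (n + 2) * (n + 1) ≤ 2 * ∑ i ∈ S, k i
    swap
    · have he : (n + 1 + 1) * (n + 1 + 1 - 1) = (n + 2) * (n + 1) := rfl
      rw [he]
      exact ⟨by omega, fun h => by omega⟩
    obtain ⟨C, D, hC, rfl, hCd⟩ := exists_mul_of_two_mul_sum_ge hx hfat hk A hn S hAJ hbig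
    have hC0 : C ≠ 0 := left_ne_zero_of_mul hA0
    have hD0 : D ≠ 0 := right_ne_zero_of_mul hA0
    rw [totalDegree_mul_of_isDomain hC0 hD0] at hn
    have hc1 := one_le_totalDegree hC0 hC
    obtain ⟨hrel, hCs, hDs⟩ := squarefree_mul_iff.1 hsq
    -- The points are sorted by whether the first factor carries the whole double point, the second
    -- does, or the two factors share it.
    set S₁ := S.filter fun i => C ∈ J i
    set S₂ := (S.filter fun i => ¬ C ∈ J i).filter fun i => D ∈ J i
    set S₃ := (S.filter fun i => ¬ C ∈ J i).filter fun i => ¬ D ∈ J i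
    have hsum : ∑ i ∈ S, k i = ∑ i ∈ S₁, k i + (∑ i ∈ S₂, k i + ∑ i ∈ S₃, k i) := by
      rw [Finset.sum_filter_add_sum_filter_not, Finset.sum_filter_add_sum_filter_not]
    have h1 := ih C.totalDegree (by omega) C rfl hCs S₁ (fun i hi => (Finset.mem_filter.1 hi).2)
      fun i hi => (hsplit i (Finset.mem_filter.1 hi).1).of_dvd (dvd_mul_right _ _)
    have h2 := ih D.totalDegree (by omega) D rfl hDs S₂ (fun i hi => (Finset.mem_filter.1 hi).2)
      fun i hi => (hsplit i (Finset.mem_filter.1 (Finset.mem_filter.1 hi).1).1).of_dvd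
        (dvd_mul_left _ _)
    have hmem : ∀ i ∈ S₃, C ∈ I i ∧ D ∈ I i := fun i hi => by
      simp only [S₃, Finset.mem_filter] at hi
      obtain ⟨⟨hiS, hiC⟩, hiD⟩ := hi
      exact ((hsplit i hiS C D dvd_rfl (hAJ i hiS)).resolve_left hiC).resolve_left hiD
    have h3 := sum_le_of_mem_left hx hfat S₃ hD0 hrel (fun i hi => (hmem i hi).1)
      fun i hi => (hmem i hi).2
    obtain ⟨c, hc⟩ : ∃ c, C.totalDegree = c + 1 := ⟨C.totalDegree - 1, by omega⟩
    obtain ⟨d, hd⟩ : ∃ d, D.totalDegree = d + 1 := ⟨D.totalDegree - 1, by omega⟩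
    rw [hc, hd] at hn h3
    rw [hc, Nat.add_sub_cancel] at h1
    rw [hd, Nat.add_sub_cancel] at h2
    have hn' : n = c + d := by omega
    subst hn'
    -- The bound for a product is the sum of the bounds for the factors plus twice their Bézout
    -- number. Equality for the product therefore forces equality for both factors.
    have he : (c + d + 1 + 1) * (c + d + 1 + 1 - 1) = (c + 1) * c + (d + 1) * d +
        2 * ((c + 1) * (d + 1)) := by
      rw [Nat.add_sub_cancel]
      ring
    rw [he]
    exact ⟨by omega, fun h => (h1.2 (by omega)).mul (h2.2 (by omega))⟩

end

end KummerQuartic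

/-! ### Short subschemes of a line and the squares of their ideals -/

namespace KummerQuartic

open MvPolynomial

variable {K : Type*} [Field K]

/-- Restriction of a polynomial to the line through `x` in the direction `u`. -/
noncomputable def lineRestrict (x u : Fin 2 → K) : MvPolynomial (Fin 2) K →ₐ[K] Polynomial K :=
  aeval fun i => Polynomial.C (x i) + Polynomial.C (u i) * Polynomial.X

/-- The derivative in the direction `v`. -/
noncomputable def dirDeriv (v : Fin 2 → K) :
    Derivation K (MvPolynomial (Fin 2) K) (MvPolynomial (Fin 2) K) :=
  (C (v 0) : MvPolynomial (Fin 2) K) • pderiv 0 + (C (v 1) : MvPolynomial (Fin 2) K) • pderiv 1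

theorem dirDeriv_apply (v : Fin 2 → K) (p : MvPolynomial (Fin 2) K) :
    dirDeriv v p = C (v 0) * pderiv 0 p + C (v 1) * pderiv 1 p := rfl

@[simp]
theorem lineRestrict_X (x u : Fin 2 → K) (i : Fin 2) :
    lineRestrict x u (X i) = Polynomial.C (x i) + Polynomial.C (u i) * Polynomial.X := by
  simp [lineRestrict]

@[simp]
theorem lineRestrict_C (x u : Fin 2 → K) (c : K) : lineRestrict x u (C c) = Polynomial.C c := by
  simp [lineRestrict]

theorem eval_zero_lineRestrict (x u : Fin 2 → K) (p : MvPolynomial (Fin 2) K) :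
    (lineRestrict x u p).eval 0 = eval x p := by
  induction p using MvPolynomial.induction_on with
  | C c => simp
  | add p q hp hq => simp [hp, hq]
  | mul_X p i hp => simp [hp]

theorem X_dvd_lineRestrict_iff {x u : Fin 2 → K} {p : MvPolynomial (Fin 2) K} :
    Polynomial.X ∣ lineRestrict x u p ↔ eval x p = 0 := by
  rw [Polynomial.X_dvd_iff, Polynomial.coeff_zero_eq_eval_zero, eval_zero_lineRestrict]

theorem derivative_lineRestrict (x u : Fin 2 → K) (p : MvPolynomial (Fin 2) K) :
    Polynomial.derivative (lineRestrict x u p) = lineRestrict x u (dirDeriv u p) := by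
  induction p using MvPolynomial.induction_on with
  | C c => simp
  | add p q hp hq => simp [hp, hq]
  | mul_X p i hp =>
    rw [Derivation.leibniz, map_mul, map_add, Polynomial.derivative_mul, hp, smul_eq_mul,
      smul_eq_mul, map_mul, map_mul]
    have : lineRestrict x u (dirDeriv u (X i)) = Polynomial.C (u i) := by
      fin_cases i <;> simp [dirDeriv_apply, pderiv_X]
    rw [this]
    simp
    ring

/-- The ideal of the subscheme of length `k` of the line through `x` with direction `u`. -/
noncomputable def lineIdeal (x u : Fin 2 → K) (k : ℕ) : Ideal (MvPolynomial (Fin 2) K) :=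
  (Ideal.span {Polynomial.X ^ k}).comap (lineRestrict x u)

theorem mem_lineIdeal {x u : Fin 2 → K} {k : ℕ} {p : MvPolynomial (Fin 2) K} :
    p ∈ lineIdeal x u k ↔ Polynomial.X ^ k ∣ lineRestrict x u p := by
  rw [lineIdeal, Ideal.mem_comap, Ideal.mem_span_singleton]

/-- The square of `lineIdeal x u k`, for any direction `v` transverse to `u`. -/
noncomputable def lineIdealSq (x u v : Fin 2 → K) (k : ℕ) : Ideal (MvPolynomial (Fin 2) K) where
  carrier := {p | Polynomial.X ^ (2 * k) ∣ lineRestrict x u p ∧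
    Polynomial.X ^ k ∣ lineRestrict x u (dirDeriv v p)}
  add_mem' := fun hp hq => by
    simp only [Set.mem_ofPred_eq, map_add]
    exact ⟨dvd_add hp.1 hq.1, dvd_add hp.2 hq.2⟩
  zero_mem' := by simp
  smul_mem' := fun c p hp => by
    simp only [Set.mem_ofPred_eq, smul_eq_mul, Derivation.leibniz, map_add, map_mul]
    exact ⟨dvd_mul_of_dvd_right hp.1 _, dvd_add (dvd_mul_of_dvd_right hp.2 _)
      (dvd_mul_of_dvd_left ((pow_dvd_pow _ (by omega)).trans hp.1) _)⟩

theorem mem_lineIdealSq {x u v : Fin 2 → K} {k : ℕ} {p : MvPolynomial (Fin 2) K} :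
    p ∈ lineIdealSq x u v k ↔ Polynomial.X ^ (2 * k) ∣ lineRestrict x u p ∧
      Polynomial.X ^ k ∣ lineRestrict x u (dirDeriv v p) := Iff.rfl

theorem lineIdeal_mul_le (x u v : Fin 2 → K) (k : ℕ) :
    lineIdeal x u k * lineIdeal x u k ≤ lineIdealSq x u v k := by
  rw [Ideal.mul_le]
  intro p hp q hq
  rw [mem_lineIdeal] at hp hq
  rw [mem_lineIdealSq, Derivation.leibniz, map_add, smul_eq_mul, smul_eq_mul, map_mul, map_mul,
    map_mul, two_mul, pow_add]
  exact ⟨mul_dvd_mul hp hq, dvd_add (dvd_mul_of_dvd_left hp _) (dvd_mul_of_dvd_left hq _)⟩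

theorem pointIdeal_sq_le (x u : Fin 2 → K) {k : ℕ} (hk : k ≤ 2) :
    pointIdeal x ^ 2 ≤ lineIdeal x u k := by
  rw [pow_two, Ideal.mul_le]
  intro p hp q hq
  rw [mem_pointIdeal, ← X_dvd_lineRestrict_iff (u := u)] at hp hq
  rw [mem_lineIdeal, map_mul]
  exact (pow_dvd_pow _ hk).trans (by rw [pow_two]; exact mul_dvd_mul hp hq)

theorem finrank_quotient_X_pow (k : ℕ) :
    Module.Finite K (Polynomial K ⧸ Ideal.span {(Polynomial.X ^ k : Polynomial K)}) ∧
    Module.finrank K (Polynomial K ⧸ Ideal.span {(Polynomial.X ^ k : Polynomial K)}) = k :=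
  ⟨(Polynomial.monic_X_pow k).finite_quotient, by
    rw [finrank_quotient_span_eq_natDegree, Polynomial.natDegree_X_pow]⟩

section

variable {x u v : Fin 2 → K} (hdet : u 0 * v 1 - u 1 * v 0 ≠ 0)

include hdet

/-- In affine coordinates α along the line and β across it, the polynomial s(α) + β t(α) has the
prescribed restriction and transverse derivative. -/
theorem exists_lineRestrict_eq (s t : Polynomial K) : ∃ p : MvPolynomial (Fin 2) K,
    lineRestrict x u p = s ∧ lineRestrict x u (dirDeriv v p) = t := by
  set α : MvPolynomial (Fin 2) K :=
    C (u 0 * v 1 - u 1 * v 0)⁻¹ * (C (v 1) * (X 0 - C (x 0)) - C (v 0) * (X 1 - C (x 1))) with hα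
  set β : MvPolynomial (Fin 2) K :=
    C (u 0 * v 1 - u 1 * v 0)⁻¹ * (C (u 0) * (X 1 - C (x 1)) - C (u 1) * (X 0 - C (x 0))) with hβ
  have hinv : Polynomial.C (u 0 * v 1 - u 1 * v 0)⁻¹ *
      (Polynomial.C (u 0) * Polynomial.C (v 1) - Polynomial.C (u 1) * Polynomial.C (v 0)) = 1 := by
    rw [← Polynomial.C_mul, ← Polynomial.C_mul, ← Polynomial.C_sub, ← Polynomial.C_mul,
      inv_mul_cancel₀ hdet, Polynomial.C_1]
  have hα1 : lineRestrict x u α = Polynomial.X := by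
    simp only [hα, map_mul, map_sub, lineRestrict_C, lineRestrict_X]
    linear_combination Polynomial.X * hinv
  have hβ1 : lineRestrict x u β = 0 := by
    simp only [hβ, map_mul, map_sub, lineRestrict_C, lineRestrict_X]
    ring
  have hα2 : dirDeriv v α = 0 := by
    simp [hα, dirDeriv_apply, pderiv_X]
    exact Or.inr (by ring)
  have hβ2 : lineRestrict x u (dirDeriv v β) = 1 := by
    simp [hβ, dirDeriv_apply, pderiv_X]
    linear_combination hinv
  have hσ1 : ∀ s : Polynomial K, lineRestrict x u (Polynomial.aeval α s) = s := fun s => by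
    rw [← Polynomial.aeval_algHom_apply, hα1, Polynomial.aeval_X_left_apply]
  have hσ2 : ∀ s : Polynomial K, dirDeriv v (Polynomial.aeval α s) = 0 := fun s => by
    rw [Derivation.map_aeval, hα2, smul_zero]
  refine ⟨Polynomial.aeval α s + β * Polynomial.aeval α t, ?_, ?_⟩
  · rw [map_add, map_mul, hσ1, hβ1, zero_mul, add_zero]
  · rw [map_add, hσ2, zero_add, Derivation.leibniz, hσ2, smul_zero, zero_add, smul_eq_mul, map_mul,
      hσ1, hβ2, mul_one]

/-- The quotients are K[X]/X^k and the product of K[X]/X^(2k) with K[X]/X^k, of lengths k and 3k. -/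
theorem isFatPoint_lineIdeal {k : ℕ} (hk0 : 1 ≤ k) (hk : k ≤ 2) :
    IsFatPoint x k (lineIdeal x u k) (lineIdealSq x u v k) := by
  have hsq := pointIdeal_sq_le x u hk
  have hmul := lineIdeal_mul_le x u v k
  let φ : MvPolynomial (Fin 2) K →ₐ[K] Polynomial K ⧸ Ideal.span {(Polynomial.X ^ k : Polynomial K)} :=
    (Ideal.Quotient.mkₐ K _).comp (lineRestrict x u)
  have hφ : Function.Surjective φ := fun y => by
    obtain ⟨s, rfl⟩ := Ideal.Quotient.mk_surjective y
    obtain ⟨p, hp, -⟩ := exists_lineRestrict_eq (x := x) hdet s 0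
    exact ⟨p, congrArg _ hp⟩
  have hφker : RingHom.ker φ = lineIdeal x u k := by
    ext p
    rw [RingHom.mem_ker, lineIdeal, Ideal.mem_comap, ← Ideal.Quotient.eq_zero_iff_mem]
    rfl
  let e := ((Ideal.quotientEquivAlgOfEq K hφker).symm.trans
    (Ideal.quotientKerAlgEquivOfSurjective hφ)).toLinearEquiv
  let ψ : MvPolynomial (Fin 2) K →ₗ[K]
      (Polynomial K ⧸ Ideal.span {(Polynomial.X ^ (2 * k) : Polynomial K)}) ×
        (Polynomial K ⧸ Ideal.span {(Polynomial.X ^ k : Polynomial K)}) :=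
    LinearMap.prod
      ((Ideal.Quotient.mkₐ K _).toLinearMap.comp (lineRestrict x u).toLinearMap)
      ((Ideal.Quotient.mkₐ K _).toLinearMap.comp
        ((lineRestrict x u).toLinearMap.comp (dirDeriv v).toLinearMap))
  have hψ : Function.Surjective ψ := fun y => by
    obtain ⟨s, hs⟩ := Ideal.Quotient.mk_surjective y.1
    obtain ⟨t, ht⟩ := Ideal.Quotient.mk_surjective y.2
    obtain ⟨p, hp, hp'⟩ := exists_lineRestrict_eq (x := x) hdet s t
    refine ⟨p, Prod.ext ?_ ?_⟩
    · exact (congrArg (Ideal.Quotient.mk _) hp).trans hs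
    · exact (congrArg (Ideal.Quotient.mk _) hp').trans ht
  have hψker : LinearMap.ker ψ = (lineIdealSq x u v k).restrictScalars K := by
    ext p
    rw [LinearMap.mem_ker, Submodule.restrictScalars_mem, mem_lineIdealSq, Prod.ext_iff,
      ← Ideal.mem_span_singleton, ← Ideal.mem_span_singleton, ← Ideal.Quotient.eq_zero_iff_mem,
      ← Ideal.Quotient.eq_zero_iff_mem]
    rfl
  let e' := ψ.quotKerEquivOfSurjective hψ
  rw [hψker] at e'
  let e'' := (Submodule.Quotient.restrictScalarsEquiv K (lineIdealSq x u v k)).symm.trans e'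
  have h1 := finrank_quotient_X_pow (K := K) k
  have h2 := finrank_quotient_X_pow (K := K) (2 * k)
  have := h1.1
  have := h2.1
  refine ⟨hmul, (Ideal.pow_le_pow_right (by decide)).trans hsq, ?_, Module.Finite.equiv e.symm,
    Module.Finite.equiv e''.symm, e.finrank_eq.trans h1.2, ?_, ?_⟩
  · rw [show 4 = 2 + 2 from rfl, pow_add]
    exact (Ideal.mul_mono hsq hsq).trans hmul
  · rw [e''.finrank_eq, Module.finrank_prod, h1.2, h2.2]
    ring
  · intro p hp
    rw [mem_lineIdealSq] at hp
    have hp0 : eval x p = 0 :=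
      X_dvd_lineRestrict_iff.1 ((dvd_pow_self _ (by omega)).trans hp.1)
    have hpv : eval x (dirDeriv v p) = 0 :=
      X_dvd_lineRestrict_iff.1 ((dvd_pow_self _ (by omega)).trans hp.2)
    -- The restriction is divisible by X^(2k) with k ≥ 1, so its derivative along the line vanishes
    -- at the point too.
    have hpu : eval x (dirDeriv u p) = 0 := by
      rw [← eval_zero_lineRestrict x u, ← derivative_lineRestrict]
      obtain ⟨s, hs⟩ := (pow_dvd_pow Polynomial.X (by omega : 2 ≤ 2 * k)).trans hp.1
      rw [hs]
      simp
    rw [dirDeriv_apply] at hpv hpu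
    simp only [map_add, map_mul, eval_C] at hpv hpu
    refine ⟨hp0, fun i => mul_left_cancel₀ hdet ?_⟩
    fin_cases i
    · simp only [Fin.zero_eta]
      linear_combination v 1 * hpu - u 1 * hpv
    · simp only [Fin.mk_one]
      linear_combination u 0 * hpv - v 0 * hpu

end

section

variable {x u v : Fin 2 → K} {k : ℕ} {C D : MvPolynomial (Fin 2) K}

/-- A factor that does not vanish at the point is a unit locally and can be cancelled. -/
theorem mem_lineIdealSq_of_mul (hCD : C * D ∈ lineIdealSq x u v k) (hC : eval x C ≠ 0) :
    D ∈ lineIdealSq x u v k := by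
  have hX : Prime (Polynomial.X : Polynomial K) := Polynomial.prime_X
  have hC' : ¬ Polynomial.X ∣ lineRestrict x u C := fun h => hC (X_dvd_lineRestrict_iff.1 h)
  rw [mem_lineIdealSq, map_mul, Derivation.leibniz, map_add, smul_eq_mul, smul_eq_mul, map_mul,
    map_mul] at hCD
  have h1 := hX.pow_dvd_of_dvd_mul_left _ hC' hCD.1
  refine ⟨h1, hX.pow_dvd_of_dvd_mul_left _ hC' ?_⟩
  exact (dvd_add_left (dvd_mul_of_dvd_left ((pow_dvd_pow _ (by omega)).trans h1) _)).1 hCD.2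

theorem splitsAlong_lineIdeal_one (A : MvPolynomial (Fin 2) K) :
    SplitsAlong (lineIdeal x u 1) (lineIdealSq x u v 1) A := by
  intro C D _ hCD
  by_cases hC : eval x C = 0
  · by_cases hD : eval x D = 0
    · right; right
      rw [mem_lineIdeal, mem_lineIdeal, pow_one]
      exact ⟨X_dvd_lineRestrict_iff.2 hC, X_dvd_lineRestrict_iff.2 hD⟩
    · left
      rw [mul_comm] at hCD
      exact mem_lineIdealSq_of_mul hCD hD
  · exact Or.inr (Or.inl (mem_lineIdealSq_of_mul hCD hC))

/-- The nonzero second transverse derivative means that if both factors vanish at the point, each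
has nonzero first derivative along `v`. The two conditions defining the square then force both to be
tangent to the line. -/
theorem splitsAlong_lineIdeal_two {A : MvPolynomial (Fin 2) K}
    (hA : eval x (dirDeriv v (dirDeriv v A)) ≠ 0) :
    SplitsAlong (lineIdeal x u 2) (lineIdealSq x u v 2) A := by
  intro C D hCDA hCD
  by_cases hC : eval x C = 0
  swap
  · exact Or.inr (Or.inl (mem_lineIdealSq_of_mul hCD hC))
  by_cases hD : eval x D = 0
  swap
  · left
    rw [mul_comm] at hCD
    exact mem_lineIdealSq_of_mul hCD hD
  right; right
  have hdv : eval x (dirDeriv v (C * D)) = 0 := by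
    rw [dirDeriv_apply]
    simp [hC, hD]
  obtain ⟨E, rfl⟩ := hCDA
  have hne : eval x (dirDeriv v C) * eval x (dirDeriv v D) ≠ 0 := by
    intro h0
    apply hA
    rw [Derivation.leibniz (dirDeriv v) (C * D) E]
    simp only [map_add, smul_eq_mul, Derivation.leibniz (dirDeriv v) (C * D), map_mul,
      Derivation.leibniz (dirDeriv v) E, hdv, hC, hD]
    rw [Derivation.leibniz (dirDeriv v) C D]
    simp only [map_add, smul_eq_mul, Derivation.leibniz, map_mul, hC, hD]
    linear_combination 2 * eval x E * h0
  rw [mem_lineIdealSq, map_mul, Derivation.leibniz, map_add, smul_eq_mul, smul_eq_mul, map_mul,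
    map_mul] at hCD
  obtain ⟨c, hc⟩ := X_dvd_lineRestrict_iff (u := u).2 hC
  obtain ⟨d, hd⟩ := X_dvd_lineRestrict_iff (u := u).2 hD
  rw [hc, hd] at hCD
  have h1 : c.eval 0 * d.eval 0 = 0 := by
    obtain ⟨s, hs⟩ := hCD.1
    have : c * d = Polynomial.X ^ 2 * s :=
      mul_left_cancel₀ (pow_ne_zero 2 Polynomial.X_ne_zero) (by linear_combination hs)
    rw [← Polynomial.eval_mul, this]
    simp
  have h2 : c.eval 0 * eval x (dirDeriv v D) + d.eval 0 * eval x (dirDeriv v C) = 0 := by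
    obtain ⟨s, hs⟩ := hCD.2
    have : c * lineRestrict x u (dirDeriv v D) + d * lineRestrict x u (dirDeriv v C) =
        Polynomial.X * s := mul_left_cancel₀ Polynomial.X_ne_zero (by linear_combination hs)
    rw [← eval_zero_lineRestrict x u, ← eval_zero_lineRestrict x u, ← Polynomial.eval_mul,
      ← Polynomial.eval_mul, ← Polynomial.eval_add, this]
    simp
  have h3 : c.eval 0 = 0 ∧ d.eval 0 = 0 := by
    rcases mul_eq_zero.1 h1 with h | h
    · rw [h, zero_mul, zero_add] at h2
      exact ⟨h, (mul_eq_zero.1 h2).resolve_right (left_ne_zero_of_mul hne)⟩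
    · rw [h, zero_mul, add_zero] at h2
      exact ⟨(mul_eq_zero.1 h2).resolve_right (right_ne_zero_of_mul hne), h⟩
  rw [mem_lineIdeal, mem_lineIdeal, hc, hd, pow_two]
  rw [← Polynomial.coeff_zero_eq_eval_zero, ← Polynomial.coeff_zero_eq_eval_zero,
    ← Polynomial.X_dvd_iff, ← Polynomial.X_dvd_iff] at h3
  exact ⟨mul_dvd_mul_left _ h3.1, mul_dvd_mul_left _ h3.2⟩

end

end KummerQuartic

/-! ### Surfaces z² q + 2 z g + h = 0 and their branch curves -/

namespace KummerQuartic

open MvPolynomial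

variable {K : Type*} [Field K]

theorem card_common_zeros_le {A f : MvPolynomial (Fin 2) K} (hf : f ≠ 0) (hrel : IsRelPrime A f)
    (S : Finset (Fin 2 → K)) (hA : ∀ x ∈ S, eval x A = 0) (hfS : ∀ x ∈ S, eval x f = 0) :
    S.card ≤ A.totalDegree * f.totalDegree := by
  have h := sum_finrank_quotient_le hf hrel (ι := S) (x := fun x => x) Subtype.val_injective
    (fun x => pointIdeal x) 1 (fun x => (pow_one _).le) (fun x => (finite_quotient_pointIdeal _).1)
    (fun x => mem_pointIdeal.2 (hA x x.2)) (fun x => mem_pointIdeal.2 (hfS x x.2))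
  rw [Finset.sum_congr rfl fun x _ => (finite_quotient_pointIdeal _).2] at h
  simpa using h

theorem X_pow_two_dvd {p : Polynomial K} (h0 : p.eval 0 = 0) (h1 : p.derivative.eval 0 = 0) :
    Polynomial.X ^ 2 ∣ p := by
  rw [← Polynomial.coeff_zero_eq_eval_zero, ← Polynomial.X_dvd_iff] at h0
  obtain ⟨s, rfl⟩ := h0
  rw [pow_two]
  refine mul_dvd_mul_left _ ?_
  rw [Polynomial.X_dvd_iff, Polynomial.coeff_zero_eq_eval_zero]
  simpa using h1

theorem mem_lineIdeal_two {x u : Fin 2 → K} {p : MvPolynomial (Fin 2) K} (h0 : eval x p = 0)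
    (h1 : eval x (dirDeriv u p) = 0) : p ∈ lineIdeal x u 2 := by
  rw [mem_lineIdeal]
  apply X_pow_two_dvd
  · rw [eval_zero_lineRestrict, h0]
  · rw [derivative_lineRestrict, eval_zero_lineRestrict, h1]

theorem mem_lineIdealSq_one {x u v : Fin 2 → K} {p : MvPolynomial (Fin 2) K} (h0 : eval x p = 0)
    (h1 : ∀ i, eval x (pderiv i p) = 0) : p ∈ lineIdealSq x u v 1 := by
  have hd : ∀ w, eval x (dirDeriv w p) = 0 := fun w => by
    rw [dirDeriv_apply]
    simp [h1]
  rw [mem_lineIdealSq, pow_one]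
  refine ⟨mem_lineIdeal.1 (mem_lineIdeal_two h0 (hd u)), X_dvd_lineRestrict_iff.2 (hd v)⟩

/-- The number of singular points of a squarefree plane curve. -/
theorem two_mul_card_singular_le [IsAlgClosed K] {A : MvPolynomial (Fin 2) K} (hA : Squarefree A)
    (S : Finset (Fin 2 → K)) (h0 : ∀ x ∈ S, eval x A = 0)
    (h1 : ∀ x ∈ S, ∀ i, eval x (pderiv i A) = 0) :
    2 * S.card ≤ A.totalDegree * (A.totalDegree - 1) := by
  have hdet : (![1, 0] : Fin 2 → K) 0 * (![0, 1] : Fin 2 → K) 1 -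
      (![1, 0] : Fin 2 → K) 1 * (![0, 1] : Fin 2 → K) 0 ≠ 0 := by simp
  have h := (two_mul_sum_le (x := fun x : Fin 2 → K => x) Function.injective_id
    (fun x => isFatPoint_lineIdeal (x := x) hdet le_rfl one_le_two) (fun _ => one_le_two)
    A.totalDegree A rfl hA S (fun x hx => mem_lineIdealSq_one (h0 x hx) (h1 x hx))
    fun x _ => splitsAlong_lineIdeal_one A).1
  simpa using h

/-- The singular points of the affine surface `z² q + 2 z g + h = 0`. -/
def affSing (q g h : MvPolynomial (Fin 2) K) : Set (K × (Fin 2 → K)) :=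
  {p | p.1 * eval p.2 q + eval p.2 g = 0 ∧ p.1 * eval p.2 g + eval p.2 h = 0 ∧
    ∀ i, p.1 ^ 2 * eval p.2 (pderiv i q) + 2 * p.1 * eval p.2 (pderiv i g) +
      eval p.2 (pderiv i h) = 0}

theorem mem_affSing {q g h : MvPolynomial (Fin 2) K} {z : K} {x : Fin 2 → K} :
    (z, x) ∈ affSing q g h ↔ z * eval x q + eval x g = 0 ∧ z * eval x g + eval x h = 0 ∧
      ∀ i, z ^ 2 * eval x (pderiv i q) + 2 * z * eval x (pderiv i g) + eval x (pderiv i h) = 0 :=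
  Iff.rfl

theorem eval_pderiv_mul {σ : Type*} (x : σ → K) (i : σ) (a b : MvPolynomial σ K) :
    eval x (pderiv i (a * b)) = eval x a * eval x (pderiv i b) + eval x b * eval x (pderiv i a) := by
  rw [Derivation.leibniz]
  simp

theorem not_infinite_base {q g h : MvPolynomial (Fin 2) K} (hfin : (affSing q g h).Finite) {S : Set (Fin 2 → K)}
    (hS : S.Infinite) (h' : ∀ x ∈ S, ∃ z, (z, x) ∈ affSing q g h) : False :=
  hS ((hfin.image Prod.snd).subset fun x hx => by
    obtain ⟨z, hz⟩ := h' x hx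
    exact ⟨(z, x), hz, rfl⟩)

section

variable [IsAlgClosed K] {q g h : MvPolynomial (Fin 2) K}

theorem not_forall_mem_affSing (hfin : (affSing q g h).Finite) (x : Fin 2 → K) :
    ¬ ∀ z, (z, x) ∈ affSing q g h := by
  intro hz
  have : Infinite K := IsAlgClosed.instInfinite
  exact Set.infinite_univ ((hfin.image Prod.fst).subset fun z _ => ⟨(z, x), hz z, rfl⟩)

/-- The gradients of `q` and `g` do not both vanish at a point where `q` and `g` vanish. -/
theorem not_all_zero (hfin : (affSing q g h).Finite) {z : K} {x : Fin 2 → K}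
    (hzx : (z, x) ∈ affSing q g h) (hq : eval x q = 0) (hq' : ∀ i, eval x (pderiv i q) = 0)
    (hg' : ∀ i, eval x (pderiv i g) = 0) : False := by
  rw [mem_affSing] at hzx
  have hg : eval x g = 0 := by simpa [hq] using hzx.1
  have hh : eval x h = 0 := by simpa [hg] using hzx.2.1
  have hh' : ∀ i, eval x (pderiv i h) = 0 := fun i => by simpa [hq', hg'] using hzx.2.2 i
  -- Then also `h` and its gradient vanish, and the whole line above `x` is singular.
  exact not_forall_mem_affSing hfin x fun t => by simp [mem_affSing, hq, hg, hh, hq', hg', hh']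

variable (h2 : (2 : K) ≠ 0)

include h2

/-- Two polynomials with a common factor `D` of multiplicity one in the first. -/
theorem infinite_of_dvd {D g₁ h₁ : MvPolynomial (Fin 2) K} (hD : Irreducible D)
    (hfin : (affSing q (D * g₁) (D * h₁)).Finite)
    (hq : ∀ x, eval x D = 0 → eval x q = 0 ∧ ∀ i, eval x (pderiv i q) = 0) : D ∣ g₁ := by
  by_contra hg
  refine not_infinite_base hfin (infinite_zeros hD hg) fun x hx => ?_
  obtain ⟨hDx, hgx⟩ := hx
  obtain ⟨hqx, hqx'⟩ := hq x hDx
  -- Above a point of `D` all equations hold except the gradient in the plane, which is the gradient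
  -- of `D` times 2 z g₁ + h₁; this z makes it vanish.
  refine ⟨-eval x h₁ / (2 * eval x g₁), ?_⟩
  rw [mem_affSing]
  simp only [map_mul, hDx, hqx, hqx', eval_pderiv_mul, zero_mul, mul_zero, add_zero, zero_add,
    true_and]
  intro i
  field_simp
  ring

/-- For q = 0 the singular points project injectively to common zeros of `g` and `h` freed of their
common factor. Bézout allows at most 3 · 4 = 12 of these, fewer than 15. -/
theorem q_ne_zero (hg : g.totalDegree ≤ 3) (hh : h.totalDegree ≤ 4)
    (hcard : (affSing q g h).ncard = 15) : q ≠ 0 := by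
  classical
  rintro rfl
  have hfin : (affSing 0 g h).Finite := Set.finite_of_ncard_ne_zero (by omega)
  have hg0 : g ≠ 0 := by
    rintro rfl
    obtain ⟨⟨z, x⟩, hzx⟩ := Set.nonempty_of_ncard_ne_zero (by omega : (affSing 0 0 h).ncard ≠ 0)
    exact not_all_zero hfin hzx (by simp) (by simp) (by simp)
  obtain ⟨a, b, c, hrel, hca, hcb⟩ := UniqueFactorizationMonoid.exists_reduced_factors g hg0 h
  subst hca hcb
  have hc0 : c ≠ 0 := left_ne_zero_of_mul hg0
  have ha0 : a ≠ 0 := right_ne_zero_of_mul hg0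
  -- A common component through `x` would divide `g` twice by `infinite_of_dvd`, and then the
  -- gradient of `g` would vanish at `x`.
  have hcx : ∀ z x, (z, x) ∈ affSing 0 (c * a) (c * b) → eval x c ≠ 0 := by
    intro z x hzx hcx
    obtain ⟨D, hDc, hD, hDx⟩ : ∃ D, D ∣ c ∧ Irreducible D ∧ eval x D = 0 := by
      obtain ⟨u, hu⟩ := UniqueFactorizationMonoid.factors_prod hc0
      have h1 : (UniqueFactorizationMonoid.factors c).prod ∈ pointIdeal x := by
        rw [← hu] at hcx
        rw [map_mul] at hcx
        exact mem_pointIdeal.2 ((mul_eq_zero.1 hcx).resolve_right (u.isUnit.map (eval x)).ne_zero)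
      have : (pointIdeal x).IsPrime := RingHom.ker_isPrime _
      obtain ⟨D, hD, hDx⟩ := (Ideal.IsPrime.multiset_prod_mem_iff_exists_mem this _).1 h1
      exact ⟨D, UniqueFactorizationMonoid.dvd_of_mem_factors hD,
        UniqueFactorizationMonoid.irreducible_of_factor D hD, mem_pointIdeal.1 hDx⟩
    obtain ⟨e, rfl⟩ := hDc
    rw [mul_assoc, mul_assoc] at hfin hzx
    obtain ⟨f, hf⟩ := infinite_of_dvd h2 hD hfin fun x _ => by simp
    rw [hf] at hfin hzx
    exact not_all_zero hfin hzx (by simp) (by simp) fun i => by simp [hDx]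
  -- Two singular points above `x` differ by 2(z - w) times the gradient of `g`, which would have to
  -- vanish.
  have hinj : Set.InjOn Prod.snd (affSing 0 (c * a) (c * b)) := by
    rintro ⟨z, x⟩ hz ⟨w, y⟩ hw rfl
    by_contra hne
    have hzw : z - w ≠ 0 := sub_ne_zero.2 fun h => hne (by rw [h])
    refine not_all_zero hfin hz (by simp) (by simp) fun i => ?_
    have h1 := (mem_affSing.1 hz).2.2 i
    have h3 := (mem_affSing.1 hw).2.2 i
    simp only [map_zero, mul_zero, zero_add] at h1 h3
    exact mul_left_cancel₀ (mul_ne_zero h2 hzw) (by linear_combination h1 - h3)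
  have hzero : ∀ z x, (z, x) ∈ affSing 0 (c * a) (c * b) → eval x a = 0 ∧ eval x b = 0 := by
    intro z x hzx
    have hc := hcx z x hzx
    rw [mem_affSing] at hzx
    have h1 := hzx.1
    have h3 := hzx.2.1
    simp only [map_zero, mul_zero, zero_add, map_mul] at h1
    rw [map_mul, h1, mul_zero, zero_add, map_mul] at h3
    exact ⟨(mul_eq_zero.1 h1).resolve_left hc, (mul_eq_zero.1 h3).resolve_left hc⟩
  have hb0 : b ≠ 0 := by
    rintro rfl
    have hau : IsUnit a := hrel dvd_rfl (dvd_zero a)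
    obtain ⟨⟨z, x⟩, hzx⟩ := Set.nonempty_of_ncard_ne_zero
      (by omega : (affSing 0 (c * a) (c * 0)).ncard ≠ 0)
    exact (hau.map (eval x)).ne_zero (hzero z x hzx).1
  have hle := card_common_zeros_le hb0 hrel (hfin.image Prod.snd).toFinset
    (fun x hx => by
      obtain ⟨⟨z, y⟩, hzy, rfl⟩ := (Set.Finite.mem_toFinset _).1 hx
      exact (hzero z y hzy).1)
    (fun x hx => by
      obtain ⟨⟨z, y⟩, hzy, rfl⟩ := (Set.Finite.mem_toFinset _).1 hx
      exact (hzero z y hzy).2)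
  rw [← Set.ncard_eq_toFinset_card _ (hfin.image _), hinj.ncard_image, hcard] at hle
  rw [totalDegree_mul_of_isDomain hc0 ha0] at hg
  rw [totalDegree_mul_of_isDomain hc0 hb0] at hh
  have := Nat.mul_le_mul (by omega : a.totalDegree ≤ 3) (by omega : b.totalDegree ≤ 4)
  omega

end

section

variable {q g h : MvPolynomial (Fin 2) K}

/-- The branch curve of the projection of the surface `z² q + 2 z g + h = 0` to the plane. -/
theorem eval_disc_eq_zero {z : K} {x : Fin 2 → K} (hzx : (z, x) ∈ affSing q g h) :
    eval x (g ^ 2 - q * h) = 0 ∧ ∀ i, eval x (pderiv i (g ^ 2 - q * h)) = 0 := by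
  obtain ⟨h1, h2, h3⟩ := mem_affSing.1 hzx
  refine ⟨?_, fun i => ?_⟩
  · simp only [map_sub, map_mul, map_pow]
    linear_combination eval x g * h1 - eval x q * h2
  · rw [pow_two, map_sub, map_sub, eval_pderiv_mul, eval_pderiv_mul]
    linear_combination -eval x q * h3 i + (2 * eval x (pderiv i g) + z * eval x (pderiv i q)) * h1
      - eval x (pderiv i q) * h2

/-- A singular point of the branch curve outside `q = 0` lies below a singular point. -/
theorem mem_affSing_of_disc {x : Fin 2 → K} (hq : eval x q ≠ 0)
    (h0 : eval x (g ^ 2 - q * h) = 0) (h1 : ∀ i, eval x (pderiv i (g ^ 2 - q * h)) = 0) :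
    (-eval x g / eval x q, x) ∈ affSing q g h := by
  simp only [map_sub, map_mul, map_pow] at h0
  rw [mem_affSing]
  refine ⟨?_, ?_, fun i => ?_⟩
  · field_simp
    ring
  · field_simp
    linear_combination -h0
  · have h3 := h1 i
    rw [pow_two, map_sub, map_sub, eval_pderiv_mul, eval_pderiv_mul] at h3
    field_simp
    linear_combination -eval x q * h3 + eval x (pderiv i q) * h0

variable [IsAlgClosed K]

/-- Off q = 0 every point of a double component lies below a singular point of the surface, so a
double component not contained in q = 0 would give infinitely many. -/
theorem dvd_of_sq_dvd_disc (hfin : (affSing q g h).Finite) {D : MvPolynomial (Fin 2) K}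
    (hD : Irreducible D) (hDB : D ^ 2 ∣ g ^ 2 - q * h) : D ∣ q := by
  by_contra hDq
  obtain ⟨E, hE⟩ := hDB
  refine not_infinite_base hfin (infinite_zeros hD hDq) fun x hx => ?_
  refine ⟨_, mem_affSing_of_disc hx.2 ?_ fun i => ?_⟩
  · simp [hE, hx.1]
  · rw [hE, pow_two]
    simp [hx.1]

/-- A zero discriminant is divisible by the square of every X_0 - c, so `q` is divisible by each of
these and vanishes everywhere. -/
theorem disc_ne_zero (hfin : (affSing q g h).Finite) (hq : q ≠ 0) : g ^ 2 - q * h ≠ 0 := by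
  intro h0
  have : Infinite K := IsAlgClosed.instInfinite
  apply hq
  apply MvPolynomial.funext
  intro x
  have hirr : Irreducible (X 0 - C (x 0) : MvPolynomial (Fin 2) K) := by
    have hd : pderiv 0 (X 0 - C (x 0) : MvPolynomial (Fin 2) K) = 1 := by simp
    have h0 : (X 0 - C (x 0) : MvPolynomial (Fin 2) K) ≠ 0 := fun h => by
      rw [h, map_zero] at hd
      exact zero_ne_one hd
    refine ⟨fun hu => (hu.map (eval x)).ne_zero (by simp), fun a b hab => ?_⟩
    by_contra! hn
    have hab0 := hab ▸ h0
    have h1 := one_le_totalDegree (left_ne_zero_of_mul hab0) hn.1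
    have h2 := one_le_totalDegree (right_ne_zero_of_mul hab0) hn.2
    have h3 := totalDegree_X_sub_C (0 : Fin 2) (x 0)
    rw [hab, totalDegree_mul_of_isDomain (left_ne_zero_of_mul hab0)
      (right_ne_zero_of_mul hab0)] at h3
    omega
  obtain ⟨e, he⟩ := dvd_of_sq_dvd_disc hfin hirr (by rw [h0]; exact dvd_zero _)
  simp [he]

end

end KummerQuartic

/-! ### The branch curve is reduced -/

namespace KummerQuartic

open MvPolynomial

variable {K : Type*} [Field K] [IsAlgClosed K] (h2 : (2 : K) ≠ 0)
  {q g h : MvPolynomial (Fin 2) K}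

theorem exists_quadratic_root {K : Type*} [Field K] [IsAlgClosed K] {a : K} (b c : K) (ha : a ≠ 0) :
    ∃ z, z ^ 2 * a + 2 * z * b + c = 0 := by
  obtain ⟨s, hs⟩ := IsAlgClosed.exists_pow_nat_eq (b ^ 2 - a * c) (n := 2) (by decide)
  refine ⟨(s - b) / a, ?_⟩
  field_simp
  linear_combination hs

/-- A double component of the branch curve is a double line in `q = 0`. -/
theorem exists_double_line (hfin : (affSing q g h).Finite) (hq0 : q ≠ 0) (hq : q.totalDegree ≤ 2)
    {D : MvPolynomial (Fin 2) K} (hD : Irreducible D) (hDB : D ^ 2 ∣ g ^ 2 - q * h) :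
    D.totalDegree = 1 ∧ ∃ c : K, c ≠ 0 ∧ q = C c * D ^ 2 ∧ D ∣ g := by
  have hp := hD.prime
  obtain ⟨q₁, rfl⟩ := dvd_of_sq_dvd_disc hfin hD hDB
  have hDg : D ∣ g := by
    have h1 : D ∣ g ^ 2 := by
      have h3 : D ∣ g ^ 2 - D * q₁ * h := (dvd_pow_self D two_ne_zero).trans hDB
      have h4 : D ∣ D * q₁ * h := by
        rw [mul_assoc]
        exact dvd_mul_right _ _
      simpa using dvd_add h3 h4
    exact hp.dvd_of_dvd_pow h1
  obtain ⟨g₁, rfl⟩ := hDg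
  have hDq : D ∣ q₁ := by
    by_contra hDq
    have hDh : D ∣ h := by
      have h1 : D ∣ q₁ * h := by
        obtain ⟨e, he⟩ := hDB
        exact ⟨g₁ ^ 2 - e, mul_left_cancel₀ hp.ne_zero (by linear_combination -he)⟩
      exact (hp.dvd_or_dvd h1).resolve_left hDq
    obtain ⟨h₁, rfl⟩ := hDh
    -- If `D` divides q, g and h but not the cofactor `q₁`, then above each point of `D` off q₁ = 0
    -- a root of z² q₁ + 2 z g₁ + h₁ is a singular point.
    refine not_infinite_base hfin (infinite_zeros hD hDq) fun x hx => ?_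
    obtain ⟨hDx, hqx⟩ := hx
    obtain ⟨z, hz⟩ := exists_quadratic_root (eval x g₁) (eval x h₁) hqx
    refine ⟨z, ?_⟩
    rw [mem_affSing]
    simp only [map_mul, hDx, eval_pderiv_mul, zero_mul, mul_zero, add_zero, zero_add, true_and]
    intro i
    linear_combination eval x (pderiv i D) * hz
  obtain ⟨q₂, rfl⟩ := hDq
  have hq20 : q₂ ≠ 0 := right_ne_zero_of_mul (right_ne_zero_of_mul hq0)
  have hd := one_le_totalDegree hp.ne_zero hD.not_isUnit
  rw [totalDegree_mul_of_isDomain hp.ne_zero (right_ne_zero_of_mul hq0),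
    totalDegree_mul_of_isDomain hp.ne_zero hq20] at hq
  have hC := totalDegree_eq_zero_iff_eq_C.1 (by omega : q₂.totalDegree = 0)
  refine ⟨by omega, coeff 0 q₂, fun hc => hq20 (by rw [hC, hc, C_0]), ?_, dvd_mul_right _ _⟩
  rw [← hC]
  ring

include h2 in
/-- The surface with a double line in `q = 0` has few singular points above that line. -/
theorem ncard_above_line_le {D g₁ : MvPolynomial (Fin 2) K} {c : K} (hD : Irreducible D)
    (hD1 : D.totalDegree = 1) (hh : h.totalDegree ≤ 4)
    (hfin : (affSing (C c * D ^ 2) (D * g₁) h).Finite) :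
    {p ∈ affSing (C c * D ^ 2) (D * g₁) h | eval p.2 D = 0}.ncard ≤ 4 := by
  classical
  set Z := {p ∈ affSing (C c * D ^ 2) (D * g₁) h | eval p.2 D = 0}
  have hZfin : Z.Finite := hfin.subset (Set.sep_subset _ _)
  have hq' : ∀ x, eval x D = 0 → eval x (C c * D ^ 2) = 0 ∧
      ∀ i, eval x (pderiv i (C c * D ^ 2)) = 0 := fun x hx => by
    refine ⟨by simp [hx], fun i => ?_⟩
    rw [eval_pderiv_mul, pow_two, eval_pderiv_mul]
    simp [hx]
  -- Above the line the equations reduce to h = 0 and 2 z g₁ ∂D + ∂h = 0. As g₁ ≠ 0 and ∂D ≠ 0, the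
  -- second determines z from x.
  have hZ : ∀ z x, (z, x) ∈ Z → eval x D = 0 ∧ eval x g₁ ≠ 0 ∧ eval x h = 0 ∧
      ∀ i, 2 * z * (eval x g₁ * eval x (pderiv i D)) + eval x (pderiv i h) = 0 := by
    rintro z x ⟨hzx, hDx⟩
    change eval x D = 0 at hDx
    obtain ⟨hqx, hqx'⟩ := hq' x hDx
    have h4 := (mem_affSing.1 hzx).2
    simp only [hqx', map_mul, eval_pderiv_mul, hDx, zero_mul, mul_zero, zero_add] at h4
    refine ⟨hDx, fun hg => ?_, h4.1, h4.2⟩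
    exact not_all_zero hfin hzx hqx hqx' fun i => by simp [hDx, hg]
  by_cases hDh : D ∣ h
  · obtain ⟨h₁, rfl⟩ := hDh
    obtain ⟨e, rfl⟩ := infinite_of_dvd h2 hD hfin hq'
    have : Z = ∅ := Set.eq_empty_of_forall_notMem fun p hp =>
      (hZ p.1 p.2 hp).2.1 (by simp [(hZ p.1 p.2 hp).1])
    simp [this]
  · have hh0 : h ≠ 0 := fun h0 => hDh (h0 ▸ dvd_zero D)
    have hinj : Set.InjOn Prod.snd Z := by
      rintro ⟨z, x⟩ hz ⟨w, y⟩ hw rfl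
      obtain ⟨i, hi⟩ := exists_eval_pderiv_ne_zero hD1 x
      have h3 := (hZ z x hz).2.2.2 i
      have h4 := (hZ w x hw).2.2.2 i
      have h5 : z = w := mul_left_cancel₀
        (mul_ne_zero h2 (mul_ne_zero (hZ z x hz).2.1 hi)) (by linear_combination h3 - h4)
      rw [h5]
    have hle := card_common_zeros_le hh0 ((hD.isRelPrime_iff_not_dvd).2 hDh)
      (hZfin.image Prod.snd).toFinset
      (fun x hx => by
        obtain ⟨⟨z, y⟩, hzy, rfl⟩ := (Set.Finite.mem_toFinset _).1 hx
        exact (hZ z y hzy).1)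
      (fun x hx => by
        obtain ⟨⟨z, y⟩, hzy, rfl⟩ := (Set.Finite.mem_toFinset _).1 hx
        exact (hZ z y hzy).2.2.1)
    rw [← Set.ncard_eq_toFinset_card _ (hZfin.image _), hinj.ncard_image, hD1, one_mul] at hle
    omega

/-- The surface with a double line in `q = 0` has few singular points away from that line. -/
theorem ncard_off_line_le {D g₁ : MvPolynomial (Fin 2) K} {c : K} (hD : Irreducible D)
    (hD1 : D.totalDegree = 1) (hc : c ≠ 0) (hg : (D * g₁).totalDegree ≤ 3) (hh : h.totalDegree ≤ 4)
    (hfin : (affSing (C c * D ^ 2) (D * g₁) h).Finite) :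
    {p ∈ affSing (C c * D ^ 2) (D * g₁) h | ¬ eval p.2 D = 0}.ncard ≤ 6 := by
  classical
  set Z := {p ∈ affSing (C c * D ^ 2) (D * g₁) h | ¬ eval p.2 D = 0}
  have hZfin : Z.Finite := hfin.subset (Set.sep_subset _ _)
  have hD0 := hD.ne_zero
  have hq0 : C c * D ^ 2 ≠ 0 := mul_ne_zero (C_ne_zero.2 hc) (pow_ne_zero 2 hD0)
  have hB0 := disc_ne_zero hfin hq0
  set E := g₁ ^ 2 - C c * h with hE
  have hBE : (D * g₁) ^ 2 - C c * D ^ 2 * h = D ^ 2 * E := by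
    rw [hE]
    ring
  have hE0 : E ≠ 0 := fun h0 => hB0 (by rw [hBE, h0, mul_zero])
  have hEd : E.totalDegree ≤ 4 := by
    have h1 : g₁.totalDegree ≤ 2 := by
      by_cases h0 : g₁ = 0
      · simp [h0]
      · rw [totalDegree_mul_of_isDomain hD0 h0] at hg
        omega
    refine (totalDegree_sub _ _).trans (max_le ((totalDegree_pow _ _).trans (by omega)) ?_)
    refine (totalDegree_mul _ _).trans ?_
    rw [totalDegree_C]
    omega
  -- All further factors `D` are removed as well. The rest is squarefree of degree at most four,
  -- hence has at most 4 · 3 / 2 = 6 singular points, and the singular points off the line lie above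
  -- them.
  obtain ⟨E₀, hEE, hDE⟩ :=
    (FiniteMultiplicity.of_not_isUnit hD.not_isUnit hE0).exists_eq_pow_mul_and_not_dvd
  set P := D ^ 2 * D ^ multiplicity D E with hP
  have hBP : (D * g₁) ^ 2 - C c * D ^ 2 * h = P * E₀ := by
    rw [hBE, hP, mul_assoc, ← hEE]
  have hE₀ : E₀ ≠ 0 := fun h0 => hE0 (by rw [hEE, h0, mul_zero])
  have hdeg : E₀.totalDegree ≤ 4 := by
    rw [hEE, totalDegree_mul_of_isDomain (pow_ne_zero _ hD0) hE₀] at hEd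
    omega
  have hsq : Squarefree E₀ := by
    rw [squarefree_iff_irreducible_sq_not_dvd_of_ne_zero hE₀]
    intro D' hD' hdvd
    have h1 := dvd_of_sq_dvd_disc hfin hD' (by
      rw [hBP, pow_two]
      exact dvd_mul_of_dvd_right hdvd _)
    have h3 : D' ∣ D := by
      rcases hD'.prime.dvd_or_dvd h1 with h | h
      · exact absurd (isUnit_of_dvd_unit h ((isUnit_iff_ne_zero.2 hc).map C)) hD'.not_isUnit
      · exact hD'.prime.dvd_of_dvd_pow h
    exact hDE (((hD'.associated_of_dvd hD h3).symm.dvd.trans (dvd_mul_right _ _)).trans hdvd)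
  have hZ : ∀ z x, (z, x) ∈ Z → eval x E₀ = 0 ∧ ∀ i, eval x (pderiv i E₀) = 0 := by
    rintro z x ⟨hzx, hDx⟩
    have hPx : eval x P ≠ 0 := by
      rw [hP, map_mul, map_pow, map_pow]
      exact mul_ne_zero (pow_ne_zero _ hDx) (pow_ne_zero _ hDx)
    obtain ⟨h0, h1⟩ := eval_disc_eq_zero hzx
    rw [hBP, map_mul] at h0
    have hx0 := (mul_eq_zero.1 h0).resolve_left hPx
    refine ⟨hx0, fun i => ?_⟩
    have h3 := h1 i
    rw [hBP, eval_pderiv_mul, hx0, zero_mul, add_zero] at h3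
    exact (mul_eq_zero.1 h3).resolve_left hPx
  have hinj : Set.InjOn Prod.snd Z := by
    rintro ⟨z, x⟩ hz ⟨w, y⟩ hw rfl
    have hqx : eval x (C c * D ^ 2) ≠ 0 := by
      rw [map_mul, eval_C, map_pow]
      exact mul_ne_zero hc (pow_ne_zero _ hz.2)
    have h3 := (mem_affSing.1 hz.1).1
    have h4 := (mem_affSing.1 hw.1).1
    have h5 : z = w := mul_right_cancel₀ hqx (by linear_combination h3 - h4)
    rw [h5]
  have hle := two_mul_card_singular_le hsq (hZfin.image Prod.snd).toFinset
    (fun x hx => by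
      obtain ⟨⟨z, y⟩, hzy, rfl⟩ := (Set.Finite.mem_toFinset _).1 hx
      exact (hZ z y hzy).1)
    (fun x hx => by
      obtain ⟨⟨z, y⟩, hzy, rfl⟩ := (Set.Finite.mem_toFinset _).1 hx
      exact (hZ z y hzy).2)
  rw [← Set.ncard_eq_toFinset_card _ (hZfin.image _), hinj.ncard_image] at hle
  have := Nat.mul_le_mul hdeg (Nat.sub_le_sub_right hdeg 1)
  omega

include h2

/-- The branch curve of a surface with fifteen singular points is reduced. -/
theorem squarefree_disc (hq : q.totalDegree ≤ 2) (hg : g.totalDegree ≤ 3) (hh : h.totalDegree ≤ 4)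
    (hcard : (affSing q g h).ncard = 15) : Squarefree (g ^ 2 - q * h) := by
  have hfin : (affSing q g h).Finite := Set.finite_of_ncard_ne_zero (by omega)
  have hq0 := q_ne_zero h2 hg hh hcard
  rw [squarefree_iff_irreducible_sq_not_dvd_of_ne_zero (disc_ne_zero hfin hq0)]
  intro D hD hDB
  rw [← pow_two] at hDB
  -- A double component leaves at most 4 + 6 singular points in place of 15.
  obtain ⟨hD1, c, hc, rfl, g₁, rfl⟩ := exists_double_line hfin hq0 hq hD hDB
  have h1 := ncard_above_line_le h2 hD hD1 hh hfin
  have h3 := ncard_off_line_le hD hD1 hc hg hh hfin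
  have h4 : affSing (C c * D ^ 2) (D * g₁) h =
      {p ∈ affSing (C c * D ^ 2) (D * g₁) h | eval p.2 D = 0} ∪
      {p ∈ affSing (C c * D ^ 2) (D * g₁) h | ¬ eval p.2 D = 0} := by
    rw [← Set.sep_or]
    simp [em]
  have h5 := Set.ncard_union_le {p ∈ affSing (C c * D ^ 2) (D * g₁) h | eval p.2 D = 0}
    {p ∈ affSing (C c * D ^ 2) (D * g₁) h | ¬ eval p.2 D = 0}
  rw [← h4] at h5
  omega

/-- Two singular points on a line of the projection. -/
theorem exists_fatPoint_of_two (hfin : (affSing q g h).Finite) {x : Fin 2 → K} {z w : K}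
    (hzw : z ≠ w) (hz : (z, x) ∈ affSing q g h) (hw : (w, x) ∈ affSing q g h) :
    {t | (t, x) ∈ affSing q g h}.ncard = 2 ∧ ∃ I J, IsFatPoint x 2 I J ∧ g ^ 2 - q * h ∈ J ∧
      SplitsAlong I J (g ^ 2 - q * h) ∧
      ∀ C D, C * D = g ^ 2 - q * h → eval x C = 0 → D ∉ J := by
  have hd : z - w ≠ 0 := sub_ne_zero.2 hzw
  have hz' := mem_affSing.1 hz
  have hw' := mem_affSing.1 hw
  have hq0 : eval x q = 0 := mul_left_cancel₀ hd (by linear_combination hz'.1 - hw'.1)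
  have hg0 : eval x g = 0 := by simpa [hq0] using hz'.1
  have hh0 : eval x h = 0 := by simpa [hg0] using hz'.2.1
  -- Both values of z satisfy the gradient equation, so the gradients of `g` and `h` at `x` are
  -- multiples of that of `q`.
  have hgi : ∀ i, 2 * eval x (pderiv i g) = -(z + w) * eval x (pderiv i q) := fun i =>
    mul_left_cancel₀ hd (by linear_combination hz'.2.2 i - hw'.2.2 i)
  have hhi : ∀ i, eval x (pderiv i h) = z * w * eval x (pderiv i q) := fun i => by
    linear_combination hz'.2.2 i - z * hgi i
  obtain ⟨i, hi⟩ : ∃ i, eval x (pderiv i q) ≠ 0 := by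
    by_contra! h0
    refine not_all_zero hfin hz hq0 h0 fun i => mul_left_cancel₀ h2 ?_
    rw [hgi, h0, mul_zero, mul_zero]
  refine ⟨?_, ?_⟩
  · refine (congrArg Set.ncard (?_ : _ = {z, w})).trans (Set.ncard_pair hzw)
    ext t
    constructor
    · intro ht
      have h3 := (mem_affSing.1 ht).2.2 i
      have h4 : (t - z) * (t - w) = 0 := mul_right_cancel₀ hi (by
        linear_combination h3 - t * hgi i - hhi i)
      rcases mul_eq_zero.1 h4 with h5 | h5
      · exact Or.inl (sub_eq_zero.1 h5)
      · exact Or.inr (sub_eq_zero.1 h5)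
    · rintro (rfl | rfl)
      · exact hz
      · exact hw
  -- The direction `u` is tangent to q = 0, hence also to g = 0 and h = 0 by the proportionality of
  -- the gradients. So q, g, h lie in the ideal of length two, and the branch curve lies in its
  -- square.
  · set u : Fin 2 → K := ![-eval x (pderiv 1 q), eval x (pderiv 0 q)] with hu
    set v : Fin 2 → K := Pi.single i 1 with hv
    have hdet : u 0 * v 1 - u 1 * v 0 ≠ 0 := by
      fin_cases i
      · simpa [hu, hv] using hi
      · simpa [hu, hv] using hi
    have huv : ∀ (t : Fin 2 → K) (p : MvPolynomial (Fin 2) K), eval x (dirDeriv t p) =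
        t 0 * eval x (pderiv 0 p) + t 1 * eval x (pderiv 1 p) := fun t p => by
      rw [dirDeriv_apply]
      simp
    have hqu : eval x (dirDeriv u q) = 0 := by
      rw [huv]
      simp [hu]
      ring
    have hgt : ∀ t, 2 * eval x (dirDeriv t g) = -(z + w) * eval x (dirDeriv t q) := fun t => by
      rw [huv, huv]
      linear_combination t 0 * hgi 0 + t 1 * hgi 1
    have hht : ∀ t, eval x (dirDeriv t h) = z * w * eval x (dirDeriv t q) := fun t => by
      rw [huv, huv]
      linear_combination t 0 * hhi 0 + t 1 * hhi 1
    have hgu : eval x (dirDeriv u g) = 0 := mul_left_cancel₀ h2 (by rw [hgt, hqu]; ring)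
    have hhu : eval x (dirDeriv u h) = 0 := by rw [hht, hqu, mul_zero]
    have hqv : eval x (dirDeriv v q) ≠ 0 := by
      rw [huv]
      fin_cases i
      · simpa [hv] using hi
      · simpa [hv] using hi
    -- Twice the second derivative of the branch curve along `v` is (z - w)² (∂_v q)², which is
    -- nonzero.
    have hsecond : ∀ C D, C * D = g ^ 2 - q * h → eval x (dirDeriv v (dirDeriv v (C * D))) ≠ 0 := by
      intro C D hCD h0
      rw [hCD, pow_two] at h0
      simp only [map_sub, Derivation.leibniz, smul_eq_mul, map_add, map_mul, hq0, hg0, hh0] at h0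
      have h3 : (z - w) ^ 2 * eval x (dirDeriv v q) ^ 2 = 0 := by
        linear_combination 2 * h0 + 4 * eval x (dirDeriv v q) * hht v -
          (2 * eval x (dirDeriv v g) - (z + w) * eval x (dirDeriv v q)) * hgt v
      exact mul_ne_zero (pow_ne_zero 2 hd) (pow_ne_zero 2 hqv) h3
    have hfat := isFatPoint_lineIdeal (x := x) hdet one_le_two le_rfl
    refine ⟨_, _, hfat, ?_, splitsAlong_lineIdeal_two ?_, ?_⟩
    · rw [pow_two]
      exact sub_mem (hfat.mul_le (Ideal.mul_mem_mul (mem_lineIdeal_two hg0 hgu)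
        (mem_lineIdeal_two hg0 hgu))) (hfat.mul_le (Ideal.mul_mem_mul
        (mem_lineIdeal_two hq0 hqu) (mem_lineIdeal_two hh0 hhu)))
    · have := hsecond 1 (g ^ 2 - q * h) (one_mul _)
      rwa [one_mul] at this
    · intro C D hCD hCx hDJ
      obtain ⟨hD0, hD1⟩ := hfat.grad D hDJ
      have hDv : eval x (dirDeriv v D) = 0 := by
        rw [huv, hD1, hD1]
        ring
      refine hsecond C D hCD ?_
      simp only [Derivation.leibniz, smul_eq_mul, map_add, map_mul, hCx, hD0, hDv]
      ring

/-- The weight of a point of the branch curve is the number of singular points above it. One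
singular point gives the square of the maximal ideal, two give the square of an ideal of length two.
-/
theorem exists_fatPoint (hfin : (affSing q g h).Finite) {x : Fin 2 → K} {z : K}
    (hz : (z, x) ∈ affSing q g h) :
    ∃ k, k = {t | (t, x) ∈ affSing q g h}.ncard ∧ k ≤ 2 ∧ ∃ I J, IsFatPoint x k I J ∧
      g ^ 2 - q * h ∈ J ∧ SplitsAlong I J (g ^ 2 - q * h) ∧
      (k = 1 ∨ k = 2 ∧ ∀ C D, C * D = g ^ 2 - q * h → eval x C = 0 → D ∉ J) := by
  by_cases hex : ∃ w, z ≠ w ∧ (w, x) ∈ affSing q g h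
  · obtain ⟨w, hzw, hw⟩ := hex
    obtain ⟨hk, I, J, hfat, hB, hs, hn⟩ := exists_fatPoint_of_two h2 hfin hzw hz hw
    exact ⟨2, hk.symm, le_rfl, I, J, hfat, hB, hs, Or.inr ⟨rfl, hn⟩⟩
  · have hone : {t | (t, x) ∈ affSing q g h} = {z} := by
      ext t
      rw [Set.mem_singleton_iff]
      constructor
      · intro ht
        by_contra hne
        exact hex ⟨t, fun h => hne h.symm, ht⟩
      · rintro rfl
        exact hz
    have hdet : (![1, 0] : Fin 2 → K) 0 * (![0, 1] : Fin 2 → K) 1 -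
        (![1, 0] : Fin 2 → K) 1 * (![0, 1] : Fin 2 → K) 0 ≠ 0 := by simp
    obtain ⟨h0, h1⟩ := eval_disc_eq_zero hz
    exact ⟨1, by rw [hone, Set.ncard_singleton], one_le_two, _, _,
      isFatPoint_lineIdeal (x := x) hdet le_rfl one_le_two, mem_lineIdealSq_one h0 h1,
      splitsAlong_lineIdeal_one _, Or.inl rfl⟩

end KummerQuartic

/-! ### The branch curve consists of six lines -/

namespace KummerQuartic

open MvPolynomial

variable {K : Type*} [Field K]

theorem totalDegree_multiset_prod_linear (s : Multiset (MvPolynomial (Fin 2) K))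
    (hs : ∀ ℓ ∈ s, ℓ.totalDegree = 1) : s.prod ≠ 0 ∧ s.prod.totalDegree = s.card := by
  induction s using Multiset.induction_on with
  | empty => simp
  | cons a s ih =>
    obtain ⟨h0, h1⟩ := ih fun ℓ hℓ => hs ℓ (Multiset.mem_cons_of_mem hℓ)
    have ha := hs a (Multiset.mem_cons_self a s)
    have ha0 : a ≠ 0 := by
      rintro rfl
      simp at ha
    rw [Multiset.prod_cons, Multiset.card_cons, totalDegree_mul_of_isDomain ha0 h0, h1, ha,
      add_comm]
    exact ⟨mul_ne_zero ha0 h0, rfl⟩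

theorem exists_family_of_multiset {M : Type*} [CommMonoid M] {n : ℕ} (s : Multiset M)
    (hs : s.card = n) : ∃ ℓ : Fin n → M, (∀ k, ℓ k ∈ s) ∧ s.prod = ∏ k, ℓ k := by
  induction s using Quotient.inductionOn with
  | _ L =>
    subst hs
    exact ⟨L.get, fun k => L.get_mem k, (Fin.prod_univ_getElem L).symm⟩

/-- The branch curve of the projection from a node of a quartic with sixteen singular points
consists of six lines. -/
theorem exists_disc_eq_prod [IsAlgClosed K] (h2 : (2 : K) ≠ 0) {q g h : MvPolynomial (Fin 2) K}
    (hq : q.totalDegree ≤ 2) (hg : g.totalDegree ≤ 3) (hh : h.totalDegree ≤ 4)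
    (hcard : (affSing q g h).ncard = 15) :
    ∃ ℓ : Fin 6 → MvPolynomial (Fin 2) K, (∀ k, (ℓ k).totalDegree = 1) ∧
      (∃ c : K, c ≠ 0 ∧ g ^ 2 - q * h = C c * ∏ k, ℓ k) ∧
      (∀ k l, k ≠ l → IsRelPrime (ℓ k) (ℓ l)) ∧ Set.InjOn Prod.snd (affSing q g h) := by
  classical
  have hfin : (affSing q g h).Finite := Set.finite_of_ncard_ne_zero (by omega)
  have hsq := squarefree_disc h2 hq hg hh hcard
  set B := g ^ 2 - q * h with hB
  set S := (hfin.image Prod.snd).toFinset with hS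
  have hdata : ∀ x : S, ∃ k, k = {t | (t, (x : Fin 2 → K)) ∈ affSing q g h}.ncard ∧ k ≤ 2 ∧
      ∃ I J, IsFatPoint x k I J ∧ B ∈ J ∧ SplitsAlong I J B ∧
      (k = 1 ∨ k = 2 ∧ ∀ C D, C * D = B → eval (x : Fin 2 → K) C = 0 → D ∉ J) := fun x => by
    obtain ⟨p, hp, hpx⟩ := (Set.Finite.mem_toFinset _).1 x.2
    exact exists_fatPoint h2 hfin (x := x) (z := p.1) (by rw [← hpx]; exact hp)
  choose k hk hk2 I J hfat hBJ hsplit hcase using hdata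
  -- Counting the singular points by fibres of the projection.
  have hsum : ∑ x : S, k x = 15 := by
    rw [← hcard, Set.ncard_eq_toFinset_card _ hfin, Finset.card_eq_sum_card_fiberwise
      (f := Prod.snd) (t := S), ← Finset.sum_coe_sort S]
    · refine Finset.sum_congr rfl fun x _ => ?_
      rw [hk, ← Set.ncard_coe_finset, ← Set.ncard_image_of_injective _
        (f := fun t : K => (t, (x : Fin 2 → K))) fun a b hab => congrArg Prod.fst hab]
      congr 1
      ext ⟨t, y⟩
      simp only [Set.mem_image, Set.mem_ofPred_eq, Prod.mk.injEq,
        Finset.coe_filter, Set.Finite.mem_toFinset]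
      constructor
      · rintro ⟨t, ht, rfl, rfl⟩
        exact ⟨ht, rfl⟩
      · rintro ⟨ht, rfl⟩
        exact ⟨t, ht, rfl, rfl⟩
    · intro p hp
      rw [hS, Set.Finite.coe_toFinset]
      exact ⟨p, (Set.Finite.mem_toFinset _).1 hp, rfl⟩
  have hdeg : B.totalDegree ≤ 6 :=
    (totalDegree_sub _ _).trans (max_le ((totalDegree_pow _ _).trans (by omega))
      ((totalDegree_mul _ _).trans (by omega)))
  have hmain := two_mul_sum_le (x := fun x : S => (x : Fin 2 → K)) Subtype.val_injective hfat hk2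
    B.totalDegree B rfl hsq Finset.univ (fun x _ => hBJ x) fun x _ => hsplit x
  rw [hsum] at hmain
  -- Degree at most five would allow total weight at most 5 · 4 / 2 = 10.
  have hdeg6 : B.totalDegree = 6 := by
    by_contra hne
    have := Nat.mul_le_mul (by omega : B.totalDegree ≤ 5) (by omega : B.totalDegree - 1 ≤ 4)
    omega
  obtain ⟨s, c, hs, hBs⟩ := hmain.2 (by rw [hdeg6])
  have hc : c ≠ 0 := by
    rintro rfl
    rw [C_0, zero_mul] at hBs
    exact hsq.ne_zero hBs
  obtain ⟨hs0, hsd⟩ := totalDegree_multiset_prod_linear s hs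
  have hs6 : s.card = 6 := by
    rw [← hsd, ← hdeg6, hBs, totalDegree_mul_of_isDomain (C_ne_zero.2 hc) hs0, totalDegree_C,
      zero_add]
  obtain ⟨ℓ, hℓs, hprod⟩ := exists_family_of_multiset s hs6
  have hℓ1 : ∀ a, (ℓ a).totalDegree = 1 := fun a => hs _ (hℓs a)
  rw [hprod] at hBs
  have hfac : ∀ a, B = ℓ a * (C c * ∏ b ∈ Finset.univ.erase a, ℓ b) := fun a => by
    rw [hBs, ← Finset.mul_prod_erase _ _ (Finset.mem_univ a)]
    ring
  have hrel : ∀ a b, a ≠ b → IsRelPrime (ℓ a) (ℓ b) := by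
    intro a b hab
    have h1 := hsq
    rw [hfac a, squarefree_mul_iff] at h1
    rw [← Finset.mul_prod_erase _ _ (Finset.mem_erase.2 ⟨hab.symm, Finset.mem_univ b⟩)] at h1
    exact (IsRelPrime.of_mul_right_left (IsRelPrime.of_mul_right_right h1.1))
  refine ⟨ℓ, hℓ1, ⟨c, hc, hBs⟩, hrel, ?_⟩
  -- At a point of weight two, two different lines of the branch curve would both contain a scheme
  -- of length two, against Bézout.
  have hk1 : ∀ x, k x = 1 := by
    intro x
    refine (hcase x).resolve_right ?_
    rintro ⟨hkx, hnot⟩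
    have hgrad := (hfat x).grad B (hBJ x)
    have hI : ∀ a, eval (x : Fin 2 → K) (ℓ a) = 0 → ℓ a ∈ I x := by
      intro a ha
      rcases hsplit x _ _ (hfac a).symm.dvd ((hfac a) ▸ hBJ x) with h1 | h1 | h1
      · obtain ⟨i, hi⟩ := exists_eval_pderiv_ne_zero (hℓ1 a) x
        exact absurd (((hfat x).grad _ h1).2 i) hi
      · exact absurd h1 (hnot _ _ (hfac a).symm ha)
      · exact h1.1
    obtain ⟨a, b, hab, ha, hb⟩ := exists_two_zeros (x := (x : Fin 2 → K)) (ℓ := ℓ)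
      (fun a => exists_eval_pderiv_ne_zero (hℓ1 a) x)
      (by
        have := hgrad.1
        rw [hBs, map_mul, eval_C] at this
        exact (mul_eq_zero.1 this).resolve_left hc)
      (fun i => by
        have := hgrad.2 i
        rw [hBs, pderiv_C_mul, map_mul, eval_C] at this
        exact (mul_eq_zero.1 this).resolve_left hc)
    have hle := sum_le_of_mem_left (x := fun x : S => (x : Fin 2 → K)) Subtype.val_injective hfat
      {x} (fun h0 => by have := hℓ1 b; rw [h0] at this; simp at this) (hrel a b hab)
      (fun y hy => by rw [Finset.mem_singleton.1 hy]; exact hI a ha)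
      (fun y hy => by rw [Finset.mem_singleton.1 hy]; exact hI b hb)
    rw [Finset.sum_singleton, hkx, hℓ1, hℓ1] at hle
    omega
  rintro ⟨z, x⟩ hz ⟨w, y⟩ hw rfl
  have hxS : x ∈ S := (Set.Finite.mem_toFinset _).2 ⟨(z, x), hz, rfl⟩
  obtain ⟨t, ht⟩ := Set.ncard_eq_one.1 ((hk ⟨x, hxS⟩).symm.trans (hk1 _))
  have h1 : z = t := ht.le hz
  have h3 : w = t := ht.le hw
  rw [h1, h3]

/-- The incidences between the singular points of `z² q + 2 z g + h = 0` and the six lines of the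
branch curve. -/
theorem exists_six_lines [IsAlgClosed K] (h2 : (2 : K) ≠ 0) {q g h : MvPolynomial (Fin 2) K}
    (hq : q.totalDegree ≤ 2) (hg : g.totalDegree ≤ 3) (hh : h.totalDegree ≤ 4)
    (hcard : (affSing q g h).ncard = 15) :
    ∃ ℓ : Fin 6 → MvPolynomial (Fin 2) K, (∀ k, (ℓ k).totalDegree = 1) ∧
      (∀ p ∈ affSing q g h, {k | eval p.2 (ℓ k) = 0}.ncard = 2) ∧
      ∀ k l, k ≠ l → {p ∈ affSing q g h | eval p.2 (ℓ k) = 0 ∧ eval p.2 (ℓ l) = 0}.ncard = 1 := by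
  classical
  have hfin : (affSing q g h).Finite := Set.finite_of_ncard_ne_zero (by omega)
  obtain ⟨ℓ, hℓ1, ⟨c, hc, hB⟩, hrel, hinj⟩ := exists_disc_eq_prod h2 hq hg hh hcard
  have huniq : ∀ k l x y, k ≠ l → eval x (ℓ k) = 0 → eval x (ℓ l) = 0 → eval y (ℓ k) = 0 →
      eval y (ℓ l) = 0 → x = y := by
    intro k l x y hkl hxk hxl hyk hyl
    by_contra hxy
    have hle := card_common_zeros_le (fun h0 => by have := hℓ1 l; rw [h0] at this; simp at this)
      (hrel k l hkl) {x, y} (by simp [hxk, hyk]) (by simp [hxl, hyl])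
    rw [Finset.card_pair hxy, hℓ1, hℓ1] at hle
    omega
  -- A product of linear forms has zero gradient at a zero only where two of the factors vanish.
  have hpair : ∀ p : affSing q g h, ∃ s ∈ Finset.powersetCard 2 (Finset.univ : Finset (Fin 6)),
      ∀ k ∈ s, eval p.1.2 (ℓ k) = 0 := by
    rintro ⟨⟨z, x⟩, hzx⟩
    obtain ⟨h0, h1⟩ := eval_disc_eq_zero hzx
    rw [hB] at h0 h1
    obtain ⟨a, b, hab, ha, hb⟩ := exists_two_zeros (x := x) (ℓ := ℓ)
      (fun a => exists_eval_pderiv_ne_zero (hℓ1 a) x)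
      (by
        rw [map_mul, eval_C] at h0
        exact (mul_eq_zero.1 h0).resolve_left hc)
      (fun i => by
        have := h1 i
        rw [pderiv_C_mul, map_mul, eval_C] at this
        exact (mul_eq_zero.1 this).resolve_left hc)
    refine ⟨{a, b}, ?_, ?_⟩
    · rw [Finset.mem_powersetCard]
      exact ⟨Finset.subset_univ _, Finset.card_pair hab⟩
    · simp [ha, hb]
  choose pr hpr hpr0 using hpair
  have hprinj : Function.Injective pr := by
    intro p p' hpp
    obtain ⟨-, hcard2⟩ := Finset.mem_powersetCard.1 (hpr p)
    obtain ⟨a, b, hab, hs⟩ := Finset.card_eq_two.1 hcard2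
    have ha : a ∈ pr p := by simp [hs]
    have hb : b ∈ pr p := by simp [hs]
    exact Subtype.ext (hinj p.2 p'.2 (huniq a b _ _ hab (hpr0 p a ha) (hpr0 p b hb)
      (hpr0 p' a (hpp ▸ ha)) (hpr0 p' b (hpp ▸ hb))))
  have : Fintype (affSing q g h) := hfin.fintype
  -- Fifteen singular points are assigned injectively to the fifteen pairs of lines, so every pair
  -- occurs.
  have hsurj : Finset.univ.image pr = Finset.powersetCard 2 (Finset.univ : Finset (Fin 6)) := by
    apply Finset.eq_of_subset_of_card_le
    · intro s hs
      obtain ⟨p, -, rfl⟩ := Finset.mem_image.1 hs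
      exact hpr p
    · rw [Finset.card_image_of_injective _ hprinj, Finset.card_univ, ← Nat.card_eq_fintype_card,
        Nat.card_coe_set_eq, hcard, Finset.card_powersetCard]
      decide
  have hex : ∀ k l, k ≠ l → ∃ p : affSing q g h, pr p = {k, l} := by
    intro k l hkl
    have : ({k, l} : Finset (Fin 6)) ∈ Finset.univ.image pr := by
      rw [hsurj, Finset.mem_powersetCard]
      exact ⟨Finset.subset_univ _, Finset.card_pair hkl⟩
    obtain ⟨p, -, hp⟩ := Finset.mem_image.1 this
    exact ⟨p, hp⟩
  refine ⟨ℓ, hℓ1, ?_, ?_⟩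
  · intro p hp
    -- A third line through the point would form with one of the first two a pair that belongs to
    -- another singular point above the same intersection.
    have hset : {k | eval p.2 (ℓ k) = 0} = (pr ⟨p, hp⟩ : Set (Fin 6)) := by
      ext k
      rw [Set.mem_ofPred_eq, Finset.mem_coe]
      refine ⟨fun hk => ?_, fun hk => hpr0 ⟨p, hp⟩ k hk⟩
      by_contra hkp
      obtain ⟨a, ha⟩ : (pr ⟨p, hp⟩).Nonempty := by
        rw [← Finset.card_pos, (Finset.mem_powersetCard.1 (hpr _)).2]
        decide
      have hka : k ≠ a := by
        rintro rfl
        exact hkp ha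
      obtain ⟨p', hp'⟩ := hex k a hka
      have h1 := huniq k a p.2 p'.1.2 hka hk (hpr0 ⟨p, hp⟩ a ha) (hpr0 p' k (by simp [hp']))
        (hpr0 p' a (by simp [hp']))
      have h3 : (⟨p, hp⟩ : affSing q g h) = p' := Subtype.ext (hinj hp p'.2 h1)
      apply hkp
      rw [h3, hp']
      simp
    rw [hset, Set.ncard_coe_finset]
    exact (Finset.mem_powersetCard.1 (hpr _)).2
  · intro k l hkl
    obtain ⟨p, hp⟩ := hex k l hkl
    rw [Set.ncard_eq_one]
    refine ⟨p, ?_⟩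
    ext p'
    rw [Set.mem_singleton_iff]
    constructor
    · rintro ⟨hp', hk, hl⟩
      exact hinj hp' p.2 (huniq k l _ _ hkl hk hl (hpr0 p k (by simp [hp]))
        (hpr0 p l (by simp [hp])))
    · rintro rfl
      exact ⟨p.2, hpr0 p k (by simp [hp]), hpr0 p l (by simp [hp])⟩

end KummerQuartic

/-! ### Affine equation seen from a singular point -/

namespace KummerQuartic

open MvPolynomial

variable {K : Type*} [Field K]

/-- Six planes through `P` such that every other point of `S` lies on two of them, and any two of
them have exactly one further point of `S` in common. -/
def HasSixPlanes (S : Set (ℙ K (Fin 4 → K))) (P : ℙ K (Fin 4 → K)) : Prop :=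
  ∃ T : Fin 6 → Submodule K (Fin 4 → K), (∀ k, Module.finrank K (T k) = 3 ∧ P.submodule ≤ T k) ∧
    (∀ Q ∈ S, Q ≠ P → {k | Q.submodule ≤ T k}.ncard = 2) ∧
    ∀ k l, k ≠ l → {Q ∈ S | Q ≠ P ∧ Q.submodule ≤ T k ∧ Q.submodule ≤ T l}.ncard = 1

/-- Dehomogenization with respect to the second coordinate, as a polynomial in the first one. -/
noncomputable def chart : MvPolynomial (Fin 4) K →ₐ[K] Polynomial (MvPolynomial (Fin 2) K) :=
  aeval ![Polynomial.X, 1, Polynomial.C (X 0), Polynomial.C (X 1)]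

theorem chart_C (c : K) :
    chart (C c) = (Polynomial.C (C c) : Polynomial (MvPolynomial (Fin 2) K)) := by
  rw [chart, aeval_C]
  rfl

theorem chart_monomial (d : Fin 4 →₀ ℕ) (c : K) :
    chart (monomial d c) = Polynomial.C (C c * (X 0 ^ d 2 * X 1 ^ d 3)) * Polynomial.X ^ d 0 := by
  rw [monomial_eq, map_mul, chart_C, Finsupp.prod_fintype _ _ (by simp), Fin.prod_univ_four]
  simp [chart]
  ring

theorem coeff_chart (F : MvPolynomial (Fin 4) K) (j : ℕ) :
    (chart F).coeff j = ∑ d ∈ F.support,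
      if j = d 0 then C (coeff d F) * (X 0 ^ d 2 * X 1 ^ d 3) else 0 := by
  conv_lhs => rw [← F.support_sum_monomial_coeff]
  rw [map_sum, Polynomial.finsetSum_coeff]
  exact Finset.sum_congr rfl fun d _ => by rw [chart_monomial, Polynomial.coeff_C_mul_X_pow]

theorem totalDegree_coeff_chart {F : MvPolynomial (Fin 4) K} {n : ℕ} (hF : F.IsHomogeneous n)
    (j : ℕ) : ((chart F).coeff j).totalDegree ≤ n - j := by
  rw [coeff_chart]
  refine totalDegree_finsetSum_le fun d hd => ?_
  split_ifs with hj
  · have hsum : d.degree = n := by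
      by_contra h
      exact mem_support_iff.1 hd (hF.coeff_eq_zero h)
    rw [Finsupp.degree_eq_sum, Fin.sum_univ_four] at hsum
    refine (totalDegree_mul _ _).trans ?_
    rw [totalDegree_C, zero_add]
    refine (totalDegree_mul _ _).trans ?_
    rw [totalDegree_X_pow, totalDegree_X_pow]
    omega
  · simp

theorem derivative_chart (F : MvPolynomial (Fin 4) K) :
    Polynomial.derivative (chart F) = chart (pderiv 0 F) := by
  induction F using MvPolynomial.induction_on with
  | C c => simp
  | add p q hp hq => simp [hp, hq]
  | mul_X p i hp =>
    rw [Derivation.leibniz, map_mul, map_add, Polynomial.derivative_mul, hp, smul_eq_mul,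
      smul_eq_mul, map_mul, map_mul]
    have h1 : chart (X i : MvPolynomial (Fin 4) K) = (![Polynomial.X, 1, Polynomial.C (X 0),
        Polynomial.C (X 1)] : Fin 4 → Polynomial (MvPolynomial (Fin 2) K)) i := by
      rw [chart, aeval_X]
    have h2 : Polynomial.derivative (chart (X i : MvPolynomial (Fin 4) K)) =
        chart (pderiv 0 (X i : MvPolynomial (Fin 4) K)) := by
      rw [h1]
      fin_cases i <;> simp [pderiv_X]
    rw [h2]
    ring

theorem eval_eval_chart (z : K) (x : Fin 2 → K) (F : MvPolynomial (Fin 4) K) :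
    eval x ((chart F).eval (C z)) = eval ![z, 1, x 0, x 1] F := by
  induction F using MvPolynomial.induction_on with
  | C c => simp
  | add p q hp hq => simp [hp, hq]
  | mul_X p i hp =>
    rw [map_mul, Polynomial.eval_mul, map_mul, hp, map_mul, chart, aeval_X, eval_X]
    fin_cases i <;> simp

theorem pderiv_eval_chart (z : K) (i : Fin 2) (F : MvPolynomial (Fin 4) K) :
    pderiv i ((chart F).eval (C z)) = (chart (pderiv (Fin.natAdd 2 i) F)).eval (C z) := by
  induction F using MvPolynomial.induction_on with
  | C c => simp
  | add p q hp hq => simp [hp, hq]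
  | mul_X p j hp =>
    rw [map_mul, Polynomial.eval_mul, Derivation.leibniz, hp, Derivation.leibniz, map_add,
      Polynomial.eval_add, smul_eq_mul, smul_eq_mul, smul_eq_mul, smul_eq_mul, map_mul, map_mul,
      Polynomial.eval_mul, Polynomial.eval_mul]
    congr 2
    rw [chart, aeval_X]
    fin_cases i <;> fin_cases j <;> simp [pderiv_X]

/-- Being singular at the first coordinate point excludes the terms of degree at least three in that
coordinate, so the affine equation is quadratic in it. -/
theorem chart_eq_of_singAt {F : MvPolynomial (Fin 4) K} (hF : F.IsHomogeneous 4)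
    (hs : SingAt F (Pi.single 0 1)) :
    chart F = Polynomial.C ((chart F).coeff 2) * Polynomial.X ^ 2 +
      Polynomial.C ((chart F).coeff 1) * Polynomial.X + Polynomial.C ((chart F).coeff 0) := by
  refine Polynomial.ext fun j => ?_
  by_cases hj : 3 ≤ j
  · have h1 : (chart F).coeff j = 0 := by
      rw [coeff_chart]
      refine Finset.sum_eq_zero fun d _ => ?_
      split_ifs with h
      · rw [coeff_eq_zero_of_singAt hF hs (by omega), C_0, zero_mul]
      · rfl
    rw [h1]
    simp [Polynomial.coeff_X, Polynomial.coeff_C, Polynomial.coeff_X_pow]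
    rw [if_neg (by omega), if_neg (by omega), if_neg (by omega)]
    simp
  · interval_cases j <;> simp [Polynomial.coeff_X, Polynomial.coeff_C, Polynomial.coeff_X_pow]

/-- The derivative by the dehomogenizing coordinate follows from the other ones by Euler's relation.
The middle coefficient is halved to match the form z² q + 2 z g + h. -/
theorem singAt_chart_iff (h2 : (2 : K) ≠ 0) {F : MvPolynomial (Fin 4) K} (hF : F.IsHomogeneous 4)
    (hs : SingAt F (Pi.single 0 1)) (z : K) (x : Fin 2 → K) :
    SingAt F ![z, 1, x 0, x 1] ↔ (z, x) ∈ affSing ((chart F).coeff 2)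
      (C 2⁻¹ * (chart F).coeff 1) ((chart F).coeff 0) := by
  set q := (chart F).coeff 2
  set g := (chart F).coeff 1
  set h := (chart F).coeff 0
  have hch : chart F = Polynomial.C q * Polynomial.X ^ 2 + Polynomial.C g * Polynomial.X +
    Polynomial.C h := chart_eq_of_singAt hF hs
  have e0 : eval ![z, 1, x 0, x 1] F = z ^ 2 * eval x q + z * eval x g + eval x h := by
    rw [← eval_eval_chart, hch]
    simp
    ring
  have e1 : eval ![z, 1, x 0, x 1] (pderiv 0 F) = 2 * (z * eval x q) + eval x g := by
    rw [← eval_eval_chart, ← derivative_chart, hch]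
    simp
    ring
  have e2 : ∀ i : Fin 2, eval ![z, 1, x 0, x 1] (pderiv (Fin.natAdd 2 i) F) =
      z ^ 2 * eval x (pderiv i q) + z * eval x (pderiv i g) + eval x (pderiv i h) := fun i => by
    rw [← eval_eval_chart, ← pderiv_eval_chart, hch]
    simp
  have heuler := congrArg (eval ![z, 1, x 0, x 1]) hF.sum_X_mul_pderiv
  rw [map_sum, Fin.sum_univ_four] at heuler
  simp only [map_mul, eval_X, Matrix.cons_val, one_mul, nsmul_eq_mul, map_natCast] at heuler
  rw [mem_affSing]
  simp only [pderiv_C_mul, map_mul, eval_C]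
  have hhalf : (2 : K) * 2⁻¹ = 1 := mul_inv_cancel₀ h2
  constructor
  · rintro ⟨hv, hd⟩
    rw [e0] at hv
    have hd0 := hd 0
    rw [e1] at hd0
    refine ⟨?_, ?_, fun i => ?_⟩
    · linear_combination 2⁻¹ * hd0 - z * eval x q * hhalf
    · linear_combination hv - 2⁻¹ * z * hd0 + (z ^ 2 * eval x q) * hhalf +
        (z * eval x g) * hhalf
    · have := hd (Fin.natAdd 2 i)
      rw [e2] at this
      linear_combination this + z * eval x (pderiv i g) * hhalf
  · rintro ⟨h1, h3, h4⟩
    have hd0 : 2 * (z * eval x q) + eval x g = 0 := by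
      linear_combination 2 * h1 - eval x g * hhalf
    have hv : z ^ 2 * eval x q + z * eval x g + eval x h = 0 := by
      linear_combination h3 + z * h1 - z * eval x g * hhalf
    have hd2 : ∀ i : Fin 2, eval ![z, 1, x 0, x 1] (pderiv (Fin.natAdd 2 i) F) = 0 := fun i => by
      rw [e2]
      linear_combination h4 i - z * eval x (pderiv i g) * hhalf
    rw [← e1] at hd0
    rw [← e0] at hv
    have h2' := hd2 0
    have h3' := hd2 1
    simp only [Fin.isValue, Fin.reduceNatAdd] at h2' h3'
    rw [hv, hd0, h2', h3'] at heuler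
    refine ⟨hv, fun i => ?_⟩
    fin_cases i
    · exact hd0
    · simpa using heuler
    · exact h2'
    · exact h3'

end KummerQuartic

/-! ### The six planes through a singular point -/

namespace KummerQuartic

open MvPolynomial

variable {K : Type*} [Field K]

theorem affine_ne_zero (z : K) (x : Fin 2 → K) : (![z, 1, x 0, x 1] : Fin 4 → K) ≠ 0 :=
  fun h => one_ne_zero (congrFun h 1)

/-- A line of the affine plane spans a plane together with the first coordinate point. -/
theorem exists_plane_of_line {ℓ : MvPolynomial (Fin 2) K} (hℓ : ℓ.totalDegree = 1) :
    ∃ W : Submodule K (Fin 4 → K), Module.finrank K W = 3 ∧ Pi.single 0 1 ∈ W ∧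
      ∀ z x, ![z, 1, x 0, x 1] ∈ W ↔ eval x ℓ = 0 := by
  obtain ⟨a, b, c, rfl⟩ := exists_eq_of_totalDegree_le_one hℓ.le
  have h0 : (![0, a, b, c] : Fin 4 → K) ≠ 0 := by
    intro h
    have ha : a = 0 := congrFun h 1
    have hb : b = 0 := congrFun h 2
    have hc : c = 0 := congrFun h 3
    simp [ha, hb, hc] at hℓ
  refine ⟨_, finrank_ker_dotProduct h0, ?_, fun z x => ?_⟩
  · rw [LinearMap.mem_ker]
    simp [dotProductBilin, dotProduct, Fin.sum_univ_four]
  · rw [LinearMap.mem_ker]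
    simp [dotProductBilin, dotProduct, Fin.sum_univ_four]

/-- The planes through the first coordinate point, when it is singular and the other singular
points lie in the affine chart. -/
theorem hasSixPlanes_of_chart [IsAlgClosed K] (h2 : (2 : K) ≠ 0) {F : MvPolynomial (Fin 4) K}
    (hF : IsKummerQuartic F) {P : ℙ K (Fin 4 → K)}
    (hP : P = Projectivization.mk K (Pi.single 0 1) (by simp)) (hPS : P ∈ singularSet F)
    (hchart : ∀ Q ∈ singularSet F, Q ≠ P → Q.rep 1 ≠ 0) : HasSixPlanes (singularSet F) P := by
  subst hP
  set P := Projectivization.mk K (Pi.single 0 1 : Fin 4 → K) (by simp) with hP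
  have hhom := hF.homogeneous
  have hs : SingAt F (Pi.single 0 1) := (mk_mem_singularSet hhom (by simp)).1 hPS
  set q := (chart F).coeff 2
  set g := C 2⁻¹ * (chart F).coeff 1
  set h := (chart F).coeff 0
  have hdq : q.totalDegree ≤ 2 := totalDegree_coeff_chart hhom 2
  have hdg : g.totalDegree ≤ 3 := by
    refine (totalDegree_mul _ _).trans ?_
    rw [totalDegree_C, zero_add]
    exact totalDegree_coeff_chart hhom 1
  have hdh : h.totalDegree ≤ 4 := totalDegree_coeff_chart hhom 0
  let Ψ : K × (Fin 2 → K) → ℙ K (Fin 4 → K) := fun p =>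
    Projectivization.mk K ![p.1, 1, p.2 0, p.2 1] (affine_ne_zero _ _)
  have hΨinj : Function.Injective Ψ := by
    rintro ⟨z, x⟩ ⟨w, y⟩ hzw
    obtain ⟨c, hc⟩ := (Projectivization.mk_eq_mk_iff' K _ _ _ _).1 hzw
    have h1 := congrFun hc 1
    simp only [Pi.smul_apply, Matrix.cons_val, smul_eq_mul, mul_one] at h1
    rw [h1, one_smul] at hc
    have e0 : w = z := congrFun hc 0
    have e2 : y 0 = x 0 := congrFun hc 2
    have e3 : y 1 = x 1 := congrFun hc 3
    refine Prod.ext e0.symm (funext fun i => ?_)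
    fin_cases i
    · exact e2.symm
    · exact e3.symm
  have hΨmem : ∀ p, Ψ p ∈ singularSet F ↔ p ∈ affSing q g h := fun p =>
    (mk_mem_singularSet hhom _).trans (singAt_chart_iff h2 hhom hs p.1 p.2)
  have hΨP : ∀ p, Ψ p ≠ P := by
    intro p hp
    obtain ⟨c, hc⟩ := (Projectivization.mk_eq_mk_iff' K _ _ _ _).1 hp
    simpa using congrFun hc 1
  have hΨsurj : ∀ Q ∈ singularSet F, Q ≠ P → ∃ p, Ψ p = Q := by
    intro Q hQ hQP
    have h1 := hchart Q hQ hQP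
    refine ⟨(Q.rep 0 / Q.rep 1, ![Q.rep 2 / Q.rep 1, Q.rep 3 / Q.rep 1]), ?_⟩
    rw [← Q.mk_rep]
    refine mk_eq_mk_of_smul _ _ (c := (Q.rep 1)⁻¹) ?_
    rw [Q.mk_rep]
    funext i
    fin_cases i <;> simp [h1] <;> ring
  have himage : Ψ '' affSing q g h = singularSet F \ {P} := by
    ext Q
    constructor
    · rintro ⟨p, hp, rfl⟩
      exact ⟨(hΨmem p).2 hp, hΨP p⟩
    · rintro ⟨hQ, hQP⟩
      obtain ⟨p, rfl⟩ := hΨsurj Q hQ hQP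
      exact ⟨p, (hΨmem p).1 hQ, rfl⟩
  have hcard : (affSing q g h).ncard = 15 := by
    rw [← Set.ncard_image_of_injective _ hΨinj, himage, Set.ncard_sdiff_singleton_of_mem hPS,
      hF.card_singular]
  obtain ⟨ℓ, hℓ1, htwo, hone⟩ := exists_six_lines h2 hdq hdg hdh hcard
  choose T hT3 hT0 hT using fun k => exists_plane_of_line (hℓ1 k)
  have hΨT : ∀ p k, (Ψ p).submodule ≤ T k ↔ eval p.2 (ℓ k) = 0 := fun p k =>
    (mk_submodule_le _ _).trans (hT k p.1 p.2)
  refine ⟨T, fun k => ⟨hT3 k, (mk_submodule_le _ _).2 (hT0 k)⟩, fun Q hQ hQP => ?_,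
    fun k l hkl => ?_⟩
  · obtain ⟨p, rfl⟩ := hΨsurj Q hQ hQP
    simp only [hΨT]
    exact htwo p ((hΨmem p).1 hQ)
  · rw [← hone k l hkl, ← Set.ncard_image_of_injective _ hΨinj]
    congr 1
    ext Q
    constructor
    · rintro ⟨hQ, hQP, hk, hl⟩
      obtain ⟨p, rfl⟩ := hΨsurj Q hQ hQP
      exact ⟨p, ⟨(hΨmem p).1 hQ, (hΨT p k).1 hk, (hΨT p l).1 hl⟩, rfl⟩
    · rintro ⟨p, ⟨hp, hk, hl⟩, rfl⟩
      exact ⟨(hΨmem p).2 hp, hΨP p, (hΨT p k).2 hk, (hΨT p l).2 hl⟩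

theorem HasSixPlanes.of_imagePoints (γ : (Fin 4 → K) ≃ₗ[K] (Fin 4 → K))
    {S : Set (ℙ K (Fin 4 → K))} {P : ℙ K (Fin 4 → K)}
    (h : HasSixPlanes (imagePoints γ S) (γ • P)) : HasSixPlanes S P := by
  obtain ⟨T, hT, htwo, hone⟩ := h
  have hinj : Function.Injective fun Q : ℙ K (Fin 4 → K) => γ • Q := MulAction.injective γ
  have hle : ∀ (Q : ℙ K (Fin 4 → K)) k, Q.submodule ≤
      (T k).map (γ.symm : (Fin 4 → K) →ₗ[K] (Fin 4 → K)) ↔ (γ • Q).submodule ≤ T k := fun Q k => by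
    rw [← smul_submodule_le γ.symm (γ • Q)]
    rw [show γ.symm • γ • Q = Q from inv_smul_smul γ Q]
  refine ⟨fun k => (T k).map (γ.symm : (Fin 4 → K) →ₗ[K] (Fin 4 → K)),
    fun k => ⟨?_, (hle P k).2 (hT k).2⟩, fun Q hQ hQP => ?_, fun k l hkl => ?_⟩
  · rw [LinearEquiv.finrank_map_eq]
    exact (hT k).1
  · simp only [hle]
    exact htwo (γ • Q) ⟨Q, hQ, rfl⟩ (hinj.ne hQP)
  · simp only [hle]
    rw [← hone k l hkl, ← Set.ncard_image_of_injective _ hinj]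
    congr 1
    ext Q
    constructor
    · rintro ⟨Q, ⟨hQ, hQP, hk, hl⟩, rfl⟩
      exact ⟨⟨Q, hQ, rfl⟩, hinj.ne hQP, hk, hl⟩
    · rintro ⟨⟨Q, hQ, rfl⟩, hQP, hk, hl⟩
      exact ⟨Q, ⟨hQ, fun h => hQP (by rw [h]), hk, hl⟩, rfl⟩

/-- The shear adding `t z₂ + t² z₃` to the coordinate `z₁`. -/
def shear (t : K) : (Fin 4 → K) ≃ₗ[K] (Fin 4 → K) where
  toFun z := ![z 0, z 1 + t * z 2 + t ^ 2 * z 3, z 2, z 3]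
  invFun z := ![z 0, z 1 - t * z 2 - t ^ 2 * z 3, z 2, z 3]
  map_add' x y := by
    funext i
    fin_cases i <;> (simp; try ring)
  map_smul' c x := by
    funext i
    fin_cases i <;> (simp; try ring)
  left_inv x := by
    funext i
    fin_cases i <;> (simp; try ring)
  right_inv x := by
    funext i
    fin_cases i <;> (simp; try ring)

/-- After moving `P` to the first coordinate point, a shear with general parameter makes the second
coordinate nonzero at the finitely many other points. -/
theorem exists_chart [Infinite K] {S : Set (ℙ K (Fin 4 → K))} (hS : S.Finite)
    (P : ℙ K (Fin 4 → K)) : ∃ γ : (Fin 4 → K) ≃ₗ[K] (Fin 4 → K),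
      γ • P = Projectivization.mk K (Pi.single 0 1) (by simp) ∧
      ∀ Q ∈ imagePoints γ S, Q ≠ γ • P → Q.rep 1 ≠ 0 := by
  classical
  have : MulAction.IsPretransitive ((Fin 4 → K) ≃ₗ[K] (Fin 4 → K)) (ℙ K (Fin 4 → K)) :=
    MulAction.isPretransitive_of_is_two_pretransitive
  set E := Projectivization.mk K (Pi.single 0 1 : Fin 4 → K) (by simp) with hE
  obtain ⟨γ, hγ⟩ := MulAction.exists_smul_eq ((Fin 4 → K) ≃ₗ[K] (Fin 4 → K)) P E
  -- The second coordinate of the sheared point as a polynomial in the parameter. It vanishes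
  -- identically only for the first coordinate point.
  let f : ℙ K (Fin 4 → K) → Polynomial K := fun Q => Polynomial.C ((γ • Q).rep 1) +
    Polynomial.C ((γ • Q).rep 2) * Polynomial.X + Polynomial.C ((γ • Q).rep 3) * Polynomial.X ^ 2
  have hf : ∀ Q, Q ≠ P → f Q ≠ 0 := by
    intro Q hQP h0
    have hc : ∀ j, (f Q).coeff j = 0 := fun j => by rw [h0, Polynomial.coeff_zero]
    have h1 := hc 0
    have h2 := hc 1
    have h3 := hc 2
    simp [f, Polynomial.coeff_X, Polynomial.coeff_C, Polynomial.coeff_X_pow] at h1 h2 h3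
    apply hQP
    apply MulAction.injective γ
    change γ • Q = γ • P
    rw [hγ, hE, ← (γ • Q).mk_rep]
    refine mk_eq_mk_of_smul _ _ (c := (γ • Q).rep 0) ?_
    funext i
    fin_cases i <;> simp [h1, h2, h3]
  obtain ⟨t, ht⟩ : ∃ t, (∏ Q ∈ hS.toFinset.erase P, f Q).eval t ≠ 0 := by
    by_contra! h
    have h0 : ∏ Q ∈ hS.toFinset.erase P, f Q ≠ 0 :=
      Finset.prod_ne_zero_iff.2 fun Q hQ => hf Q (Finset.ne_of_mem_erase hQ)
    exact h0 (Polynomial.funext fun t => by rw [h, Polynomial.eval_zero])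
  rw [Polynomial.eval_prod, Finset.prod_ne_zero_iff] at ht
  have hmul : ∀ Q : ℙ K (Fin 4 → K), ((shear t * γ) • Q) = shear t • (γ • Q) := fun Q => mul_smul _ _ _
  refine ⟨shear t * γ, ?_, ?_⟩
  · rw [hmul, hγ, hE, smul_mk_eq]
    congr 1
    funext i
    fin_cases i <;> simp [shear]
  · rintro _ ⟨Q, hQ, rfl⟩ hQP
    have hQP' : Q ≠ P := by
      rintro rfl
      exact hQP rfl
    have h1 := ht Q (Finset.mem_erase.2 ⟨hQP', hS.mem_toFinset.2 hQ⟩)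
    change ((shear t * γ) • Q).rep 1 ≠ 0
    rw [hmul]
    have h3 : (γ • Q).rep ≠ 0 := (γ • Q).rep_nonzero
    have h4 : shear t • (γ • Q) = Projectivization.mk K (shear t (γ • Q).rep)
        (by simpa using h3) := by
      conv_lhs => rw [← (γ • Q).mk_rep]
      rw [smul_mk_eq]
    rw [h4]
    obtain ⟨c, hc⟩ := Projectivization.exists_smul_eq_mk_rep K (shear t (γ • Q).rep)
      (by simpa using h3)
    rw [← hc]
    have h5 : (shear t (γ • Q).rep) 1 ≠ 0 := by
      convert h1 using 1
      simp [shear, f]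
      ring
    simpa [Units.smul_def] using h5

/-- The six tropes through a node of a Kummer quartic. -/
theorem hasSixPlanes_singularSet [IsAlgClosed K] (h2 : (2 : K) ≠ 0) {F : MvPolynomial (Fin 4) K}
    (hF : IsKummerQuartic F) {P : ℙ K (Fin 4 → K)} (hP : P ∈ singularSet F) :
    HasSixPlanes (singularSet F) P := by
  have : Infinite K := IsAlgClosed.instInfinite
  obtain ⟨γ, hγ, hchart⟩ := exists_chart
    (Set.finite_of_ncard_ne_zero (by rw [hF.card_singular]; decide) : (singularSet F).Finite) P
  apply HasSixPlanes.of_imagePoints γ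
  rw [← singularSet_imageForm γ hF.homogeneous] at hchart ⊢
  refine hasSixPlanes_of_chart h2 (IsKummerQuartic.imageForm γ hF) hγ ?_ hchart
  rw [singularSet_imageForm γ hF.homogeneous]
  exact ⟨P, hP, rfl⟩

end KummerQuartic

/-! ### From six planes through every point to a configuration -/

namespace KummerQuartic

variable {K : Type*} [Field K]

/-- Two finite sets with a relation of valencies `a` and `b`. -/
theorem card_mul_eq_of_valency {α β : Type*} (r : α → β → Prop) (s : Finset α) (t : Finset β)
    [∀ x y, Decidable (r x y)] {a b : ℕ} (ha : ∀ x ∈ s, (t.bipartiteAbove r x).card = a)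
    (hb : ∀ y ∈ t, (s.bipartiteBelow r y).card = b) : s.card * a = t.card * b := by
  have := Finset.sum_card_bipartiteAbove_eq_sum_card_bipartiteBelow r (s := s) (t := t)
  rwa [Finset.sum_const_nat ha, Finset.sum_const_nat hb] at this

section

variable {S : Set (ℙ K (Fin 4 → K))} (hS : S.ncard = 16)

include hS

/-- Double counting with the five other planes: a point of S on `T k` other than `P` lies on exactly
one of them, and each of them contains exactly one such point. -/
theorem ncard_points_on_plane {P : ℙ K (Fin 4 → K)} {T : Fin 6 → Submodule K (Fin 4 → K)}
    (htwo : ∀ Q ∈ S, Q ≠ P → {k | Q.submodule ≤ T k}.ncard = 2)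
    (hone : ∀ k l, k ≠ l → {Q ∈ S | Q ≠ P ∧ Q.submodule ≤ T k ∧ Q.submodule ≤ T l}.ncard = 1)
    (k : Fin 6) : {Q ∈ S | Q ≠ P ∧ Q.submodule ≤ T k}.ncard = 5 := by
  classical
  have hfin : S.Finite := Set.finite_of_ncard_ne_zero (by omega)
  set A := hfin.toFinset.filter fun Q => Q ≠ P ∧ Q.submodule ≤ T k with hA
  have h := card_mul_eq_of_valency (fun (Q : ℙ K (Fin 4 → K)) l => Q.submodule ≤ T l) A
    (Finset.univ.erase k) (a := 1) (b := 1) ?_ ?_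
  · rw [mul_one, mul_one, Finset.card_erase_of_mem (Finset.mem_univ k), Finset.card_univ,
      Fintype.card_fin] at h
    refine Eq.trans ?_ h
    rw [← Set.ncard_coe_finset]
    congr 1
    ext Q
    simp [hA]
  · intro Q hQ
    rw [hA, Finset.mem_filter, hfin.mem_toFinset] at hQ
    have h1 := htwo Q hQ.1 hQ.2.1
    have h2 : (Finset.univ.erase k).bipartiteAbove
        (fun (Q : ℙ K (Fin 4 → K)) l => Q.submodule ≤ T l) Q =
        (Finset.univ.filter fun l => Q.submodule ≤ T l).erase k := by
      ext l
      simp [Finset.bipartiteAbove]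
    rw [h2, Finset.card_erase_of_mem (by simpa using hQ.2.2)]
    rw [← Set.ncard_coe_finset]
    have h3 : ((Finset.univ.filter fun l => Q.submodule ≤ T l : Finset (Fin 6)) : Set (Fin 6)) =
        {l | Q.submodule ≤ T l} := by
      ext l
      simp
    rw [h3, h1]
  · intro l hl
    rw [← hone k l (Finset.ne_of_mem_erase hl).symm, ← Set.ncard_coe_finset]
    congr 1
    ext Q
    simp [hA, Finset.bipartiteBelow, and_assoc]

end

theorem submodule_inj {P Q : ℙ K (Fin 4 → K)} (h : P.submodule ≤ Q.submodule) : P = Q := by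
  have h1 : P.submodule = Q.submodule :=
    Submodule.eq_of_le_of_finrank_eq h (by rw [P.finrank_submodule, Q.finrank_submodule])
  exact Projectivization.submodule_injective h1

/-- Two distinct planes containing `P` and `Q` meet in the line joining them. -/
theorem inf_eq_sup {P Q : ℙ K (Fin 4 → K)} (hPQ : P ≠ Q) {V W : Submodule K (Fin 4 → K)}
    (hV : Module.finrank K V = 3) (hW : Module.finrank K W = 3) (hVW : V ≠ W)
    (hPV : P.submodule ≤ V) (hPW : P.submodule ≤ W) (hQV : Q.submodule ≤ V)
    (hQW : Q.submodule ≤ W) : V ⊓ W = P.submodule ⊔ Q.submodule := by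
  have hle : P.submodule ⊔ Q.submodule ≤ V ⊓ W :=
    sup_le (le_inf hPV hPW) (le_inf hQV hQW)
  have h1 : Module.finrank K ↥(V ⊓ W) < 3 := by
    by_contra! h
    have hV' : V ⊓ W = V := Submodule.eq_of_le_of_finrank_le inf_le_left (by omega)
    have hW' : V ⊓ W = W := Submodule.eq_of_le_of_finrank_le inf_le_right (by omega)
    exact hVW (hV'.symm.trans hW')
  have h2 : 1 < Module.finrank K ↥(P.submodule ⊔ Q.submodule) := by
    by_contra! h
    have : P.submodule = P.submodule ⊔ Q.submodule :=
      Submodule.eq_of_le_of_finrank_le le_sup_left (by rw [P.finrank_submodule]; exact h)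
    exact hPQ (submodule_inj (this ▸ le_sup_right : Q.submodule ≤ P.submodule)).symm
  exact (Submodule.eq_of_le_of_finrank_le hle (by omega)).symm

/-- The planes of the configuration are all planes containing exactly six points of S. Such a
description does not refer to a centre, so the planes found at different points match. -/
theorem exists_config_of_hasSixPlanes {S : Set (ℙ K (Fin 4 → K))} (hS : S.ncard = 16)
    (hsix : ∀ P ∈ S, HasSixPlanes S P) :
    ∃ N' : Set (Submodule K (Fin 4 → K)), IsNondegenerateConfig S N' := by
  classical
  have hfin : S.Finite := Set.finite_of_ncard_ne_zero (by omega)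
  choose! T hT htwo hone using hsix
  have hfive : ∀ P ∈ S, ∀ k, {Q ∈ S | Q ≠ P ∧ Q.submodule ≤ T P k}.ncard = 5 := fun P hP =>
    ncard_points_on_plane hS (htwo P hP) (hone P hP)
  have hinsert : ∀ P ∈ S, ∀ W : Submodule K (Fin 4 → K), P.submodule ≤ W →
      {Q ∈ S | Q.submodule ≤ W}.ncard = {Q ∈ S | Q ≠ P ∧ Q.submodule ≤ W}.ncard + 1 := by
    intro P hP W hPW
    rw [← Set.ncard_insert_of_notMem (a := P) (fun h => h.2.1 rfl)
      (hfin.subset (Set.sep_subset _ _))]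
    congr 1
    ext Q
    simp only [Set.mem_ofPred_eq, Set.mem_insert_iff]
    by_cases hQ : Q = P
    · simp [hQ, hP, hPW]
    · simp [hQ]
  have hTinj : ∀ P ∈ S, Function.Injective (T P) := by
    intro P hP k l hkl
    by_contra hne
    have h1 := hone P hP k l hne
    have h5 := hfive P hP k
    rw [← hkl] at h1
    simp only [and_self] at h1
    omega
  -- No three points of S are collinear: both planes through P containing Q would contain R, but
  -- these planes have only one further common point in S.
  have hcol : ∀ P ∈ S, ∀ Q ∈ S, ∀ R ∈ S, Q ≠ P → R ≠ P →
      R.submodule ≤ P.submodule ⊔ Q.submodule → R = Q := by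
    intro P hP Q hQ R hR hQP hRP hle
    obtain ⟨k, l, hkl, hset⟩ := Set.ncard_eq_two.1 (htwo P hP Q hQ hQP)
    have hk : Q.submodule ≤ T P k := hset.ge (Or.inl rfl)
    have hl : Q.submodule ≤ T P l := hset.ge (Or.inr rfl)
    obtain ⟨Z, hZ⟩ := Set.ncard_eq_one.1 (hone P hP k l hkl)
    have h1 : Q = Z := hZ.le ⟨hQ, hQP, hk, hl⟩
    have h2 : R = Z := hZ.le ⟨hR, hRP, hle.trans (sup_le (hT P hP k).2 hk),
      hle.trans (sup_le (hT P hP l).2 hl)⟩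
    rw [h1, h2]
  let N' : Set (Submodule K (Fin 4 → K)) :=
    {W | Module.finrank K W = 3 ∧ {Q ∈ S | Q.submodule ≤ W}.ncard = 6}
  have hTN : ∀ P ∈ S, ∀ k, T P k ∈ N' := fun P hP k =>
    ⟨(hT P hP k).1, by rw [hinsert P hP _ (hT P hP k).2, hfive P hP]⟩
  -- If `W` were none of the planes `T P l`, its five points other than P would give ten incidences
  -- with them. But `W` meets each of the six in a line through P, which carries at most one further
  -- point: at most six incidences.
  have hNT : ∀ P ∈ S, ∀ W ∈ N', P.submodule ≤ W → ∃ k, T P k = W := by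
    intro P hP W hW hPW
    by_contra! hne
    have h5 : {Q ∈ S | Q ≠ P ∧ Q.submodule ≤ W}.ncard = 5 := by
      have := hW.2
      rw [hinsert P hP W hPW] at this
      omega
    set A := hfin.toFinset.filter fun Q => Q ≠ P ∧ Q.submodule ≤ W with hA
    have hA5 : A.card = 5 := by
      rw [← h5, ← Set.ncard_coe_finset]
      congr 1
      ext Q
      simp [hA]
    have h := Finset.sum_card_bipartiteAbove_eq_sum_card_bipartiteBelow
      (fun (Q : ℙ K (Fin 4 → K)) l => Q.submodule ≤ T P l) (s := A) (t := Finset.univ)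
    rw [Finset.sum_const_nat (m := 2)] at h
    · have hle : ∑ l : Fin 6, (A.bipartiteBelow
          (fun (Q : ℙ K (Fin 4 → K)) l => Q.submodule ≤ T P l) l).card ≤ ∑ l : Fin 6, 1 := by
        refine Finset.sum_le_sum fun l _ => Finset.card_le_one.2 fun Q hQ R hR => ?_
        simp only [Finset.bipartiteBelow, hA, Finset.mem_filter, hfin.mem_toFinset] at hQ hR
        obtain ⟨⟨hQS, hQP, hQW⟩, hQl⟩ := hQ
        obtain ⟨⟨hRS, hRP, hRW⟩, hRl⟩ := hR
        refine (hcol P hP Q hQS R hRS hQP hRP ?_).symm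
        rw [← inf_eq_sup hQP.symm (hT P hP l).1 hW.1 (hne l) (hT P hP l).2 hPW hQl hQW]
        exact le_inf hRl hRW
      simp only [Finset.sum_const, Finset.card_univ, Fintype.card_fin, smul_eq_mul] at hle
      omega
    · intro Q hQ
      rw [hA, Finset.mem_filter, hfin.mem_toFinset] at hQ
      rw [← htwo P hP Q hQ.1 hQ.2.1, ← Set.ncard_coe_finset]
      congr 1
      ext l
      simp [Finset.bipartiteAbove]
  have hthrough : ∀ P ∈ S, {W | W ∈ N' ∧ P.submodule ≤ W} = Set.range (T P) := by
    intro P hP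
    ext W
    constructor
    · rintro ⟨hW, hPW⟩
      exact hNT P hP W hW hPW
    · rintro ⟨k, rfl⟩
      exact ⟨hTN P hP k, (hT P hP k).2⟩
  have hsixW : ∀ P ∈ S, {W | W ∈ N' ∧ P.submodule ≤ W}.ncard = 6 := by
    intro P hP
    rw [hthrough P hP, ← Set.image_univ, Set.ncard_image_of_injective _ (hTinj P hP),
      Set.ncard_univ, Nat.card_eq_fintype_card, Fintype.card_fin]
  have hN'fin : N'.Finite := by
    refine (hfin.biUnion fun P _ => Set.finite_range (T P)).subset fun W hW => ?_
    obtain ⟨P, hP, hPW⟩ := Set.nonempty_of_ncard_ne_zero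
      (by rw [hW.2]; decide : {Q ∈ S | Q.submodule ≤ W}.ncard ≠ 0)
    obtain ⟨k, hk⟩ := hNT P hP W hW hPW
    exact Set.mem_biUnion hP ⟨k, hk⟩
  -- Counting flags, 16 · 6 = |N'| · 6.
  have hcard : N'.ncard = 16 := by
    have h := card_mul_eq_of_valency
      (fun (Q : ℙ K (Fin 4 → K)) (W : Submodule K (Fin 4 → K)) => Q.submodule ≤ W)
      hfin.toFinset hN'fin.toFinset (a := 6) (b := 6) ?_ ?_
    · rw [← Set.ncard_eq_toFinset_card _ hfin, ← Set.ncard_eq_toFinset_card _ hN'fin, hS] at h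
      omega
    · intro P hP
      rw [← hsixW P (hfin.mem_toFinset.1 hP), ← Set.ncard_coe_finset]
      congr 1
      ext W
      simp [Finset.bipartiteAbove]
    · intro W hW
      rw [← (hN'fin.mem_toFinset.1 hW).2, ← Set.ncard_coe_finset]
      congr 1
      ext P
      simp [Finset.bipartiteBelow]
  have hmeet : ∀ W₁ ∈ N', ∀ W₂ ∈ N', W₁ ≠ W₂ → ∀ P ∈ S, P.submodule ≤ W₁ → P.submodule ≤ W₂ →
      {p | p ∈ S ∧ p.submodule ≤ W₁ ∧ p.submodule ≤ W₂}.ncard = 2 := by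
    intro W₁ hW₁ W₂ hW₂ hne P hP h1 h2
    obtain ⟨k, rfl⟩ := hNT P hP W₁ hW₁ h1
    obtain ⟨l, rfl⟩ := hNT P hP W₂ hW₂ h2
    have h3 := hinsert P hP (T P k ⊓ T P l) (le_inf h1 h2)
    simp only [le_inf_iff] at h3
    rw [hone P hP k l fun h => hne (by rw [h])] at h3
    exact h3
  refine ⟨N', fun W hW => hW.1, hS, hcard, hsixW, fun W hW => hW.2, ?_⟩
  intro W₁ hW₁ W₂ hW₂ hne
  -- Planes with a common point of S share exactly two, and otherwise none. The six points of W₁ lie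
  -- on five other planes each, so the fifteen other planes share 30 = 15 · 2 incidences with W₁,
  -- and none of them can fall below two.
  by_contra hnot
  set A := hfin.toFinset.filter fun Q => Q.submodule ≤ W₁ with hA
  set B := hN'fin.toFinset.erase W₁ with hB
  have hA6 : A.card = 6 := by
    rw [← hW₁.2, ← Set.ncard_coe_finset]
    congr 1
    ext Q
    simp [hA]
  have hB15 : B.card = 15 := by
    rw [hB, Finset.card_erase_of_mem (hN'fin.mem_toFinset.2 hW₁),
      ← Set.ncard_eq_toFinset_card _ hN'fin, hcard]
  have hbelow : ∀ W ∈ B, ((A.bipartiteBelow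
      (fun (Q : ℙ K (Fin 4 → K)) (W : Submodule K (Fin 4 → K)) => Q.submodule ≤ W) W).card : ℕ) =
      {p | p ∈ S ∧ p.submodule ≤ W₁ ∧ p.submodule ≤ W}.ncard := by
    intro W _
    rw [← Set.ncard_coe_finset]
    congr 1
    ext Q
    simp [Finset.bipartiteBelow, hA, and_assoc]
  have h := Finset.sum_card_bipartiteAbove_eq_sum_card_bipartiteBelow
    (fun (Q : ℙ K (Fin 4 → K)) (W : Submodule K (Fin 4 → K)) => Q.submodule ≤ W) (s := A) (t := B)
  rw [Finset.sum_const_nat (m := 5), hA6] at h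
  · have hle : ∀ W ∈ B, (A.bipartiteBelow
        (fun (Q : ℙ K (Fin 4 → K)) (W : Submodule K (Fin 4 → K)) => Q.submodule ≤ W) W).card ≤ 2 ∧
        (W = W₂ → (A.bipartiteBelow (fun (Q : ℙ K (Fin 4 → K)) (W : Submodule K (Fin 4 → K)) =>
          Q.submodule ≤ W) W).card < 2) := by
      intro W hW
      rw [hbelow W hW]
      rw [hB, Finset.mem_erase, hN'fin.mem_toFinset] at hW
      have h2 : {p | p ∈ S ∧ p.submodule ≤ W₁ ∧ p.submodule ≤ W}.ncard ≤ 2 := by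
        rcases Set.eq_empty_or_nonempty {p | p ∈ S ∧ p.submodule ≤ W₁ ∧ p.submodule ≤ W} with
          h0 | ⟨P, hP, h1, h2⟩
        · simp [h0]
        · exact (hmeet W₁ hW₁ W hW.2 hW.1.symm P hP h1 h2).le
      refine ⟨h2, ?_⟩
      rintro rfl
      omega
    have hW₂B : W₂ ∈ B := Finset.mem_erase.2 ⟨hne.symm, hN'fin.mem_toFinset.2 hW₂⟩
    have hlt := Finset.sum_lt_sum (fun W hW => (hle W hW).1) ⟨W₂, hW₂B, (hle W₂ hW₂B).2 rfl⟩
    rw [Finset.sum_const, hB15, smul_eq_mul] at hlt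
    omega
  · intro P hP
    rw [hA, Finset.mem_filter, hfin.mem_toFinset] at hP
    have h1 : B.bipartiteAbove
        (fun (Q : ℙ K (Fin 4 → K)) (W : Submodule K (Fin 4 → K)) => Q.submodule ≤ W) P =
        (hN'fin.toFinset.filter fun W => P.submodule ≤ W).erase W₁ := by
      ext W
      simp [Finset.bipartiteAbove, hB, and_assoc]
    have h2 : (hN'fin.toFinset.filter fun W => P.submodule ≤ W).card = 6 := by
      rw [← hsixW P hP.1, ← Set.ncard_coe_finset]
      congr 1
      ext W
      simp
    rw [h1, Finset.card_erase_of_mem (by simp [hW₁, hP.2]), h2]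

/-- The singular points of a Kummer quartic are the points of a nondegenerate configuration. -/
theorem exists_config_of_isKummerQuartic {K : Type*} [Field K] [IsAlgClosed K] (h2 : (2 : K) ≠ 0)
    {F : MvPolynomial (Fin 4) K} (hF : IsKummerQuartic F) :
    ∃ N' : Set (Submodule K (Fin 4 → K)), IsNondegenerateConfig (singularSet F) N' :=
  exists_config_of_hasSixPlanes hF.card_singular fun _ hP => hasSixPlanes_singularSet h2 hF hP

end KummerQuartic
-- The main theorem
theorem mainTheorem3 {K : Type*} [Field K] [IsAlgClosed K] (hK : ringChar K ≠ 2) :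
    -- every nondegenerate configuration has the normal form, and is strictly self-dual
    (∀ (N : Set (ℙ K (Fin 4 → K))) (N' : Set (Submodule K (Fin 4 → K))),
      IsNondegenerateConfig N N' →
        (∃ (a : Fin 4 → K) (ha : Admissible a),
          ProjectivelyEquivalent N N' (kummerOrbit a ha) (orthogonalPlanes (kummerOrbit a ha))) ∧
        StrictlySelfDual N N') ∧
    -- conversely, all the normal forms are nondegenerate configurations
    (∀ (a : Fin 4 → K) (ha : Admissible a),
      IsNondegenerateConfig (kummerOrbit a ha) (orthogonalPlanes (kummerOrbit a ha))) ∧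
    -- the points of a configuration are the nodes of a unique Kummer quartic
    (∀ (N : Set (ℙ K (Fin 4 → K))) (N' : Set (Submodule K (Fin 4 → K))),
      IsNondegenerateConfig N N' →
        ∃ F : MvPolynomial (Fin 4) K, IsKummerQuartic F ∧ singularSet F = N ∧
          (∀ p ∈ N, IsNode F p) ∧
          ∀ G : MvPolynomial (Fin 4) K, IsKummerQuartic G → singularSet G = N →
            ∃ c : K, c ≠ 0 ∧ G = MvPolynomial.C c * F) ∧
    -- all Kummer quartics arise in this way
    (∀ F : MvPolynomial (Fin 4) K, IsKummerQuartic F →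
      (∃ N' : Set (Submodule K (Fin 4 → K)), IsNondegenerateConfig (singularSet F) N') ∧
      ∃ (g : (Fin 4 → K) ≃ₗ[K] (Fin 4 → K)) (a : Fin 4 → K) (ha : Admissible a),
        IsKummerQuartic (imageForm g F) ∧ singularSet (imageForm g F) = kummerOrbit a ha) ∧
    -- the Kummer quartic of a configuration in normal form has a Hudson equation
    (∀ (a : Fin 4 → K) (ha : Admissible a) (F : MvPolynomial (Fin 4) K),
      IsKummerQuartic F → singularSet F = kummerOrbit a ha → ∃ v : Fin 5 → K, F = hudson v) ∧
    -- the coefficients for `b ≠ 0`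
    (∀ (a : Fin 4 → K) (ha : Admissible a), a 0 * a 1 * a 2 * a 3 ≠ 0 →
      Module.finrank K (LinearMap.ker (hudsonMatrix a).mulVecLin) = 1 ∧
      ∀ v : Fin 5 → K, (v ≠ 0 ∧ (hudsonMatrix a).mulVec v = 0) ↔
        (IsKummerQuartic (hudson v) ∧ singularSet (hudson v) = kummerOrbit a ha)) ∧
    -- the case `b = 0`: one may assume `a₁ = 0`, and the coefficients are then explicit
    (∀ (a : Fin 4 → K) (ha : Admissible a), a 0 * a 1 * a 2 * a 3 = 0 →
      ∃ (a' : Fin 4 → K) (ha' : Admissible a'), a' 0 = 0 ∧ kummerOrbit a' ha' = kummerOrbit a ha) ∧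
    (∀ (a : Fin 4 → K) (ha : Admissible a), a 0 = 0 →
      ∀ v : Fin 5 → K, (IsKummerQuartic (hudson v) ∧ singularSet (hudson v) = kummerOrbit a ha) ↔
        ∃ c : K, c ≠ 0 ∧ v = c • segreCoefficients a) := by
  have h2 : (2 : K) ≠ 0 := Ring.two_ne_zero hK
  have : Infinite K := IsAlgClosed.instInfinite
  refine ⟨fun N N' h => ?_, fun a ha => KummerQuartic.isNondegenerateConfig_kummerOrbit h2 ha,
    fun N N' h => KummerQuartic.exists_kummerQuartic_of_config h2 h, fun F hF => ?_,
    fun a ha F hF hs => KummerQuartic.exists_eq_hudson ha h2 hF hs, fun a ha hb => ?_,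
    fun a ha hb => KummerQuartic.exists_admissible_zero h2 ha hb,
    fun a ha h0 v => KummerQuartic.isKummerQuartic_hudson_iff_segre h2 ha h0 v⟩
  · obtain ⟨a, ha, hpe⟩ := KummerQuartic.exists_admissible_of_config h2 h
    exact ⟨⟨a, ha, hpe⟩, KummerQuartic.ProjectivelyEquivalent.strictlySelfDual hpe⟩
  · obtain ⟨N', hN'⟩ := KummerQuartic.exists_config_of_isKummerQuartic h2 hF
    obtain ⟨a, ha, g, hg, -⟩ := KummerQuartic.exists_admissible_of_config h2 hN'
    exact ⟨⟨N', hN'⟩, g, a, ha, KummerQuartic.IsKummerQuartic.imageForm g hF, by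
      rw [KummerQuartic.singularSet_imageForm g hF.homogeneous, hg]⟩
  · refine ⟨KummerQuartic.finrank_ker_hudsonMatrix h2 ha hb, fun v => ?_⟩
    rw [KummerQuartic.hudsonMatrix_mulVec_eq_zero_iff hb]
    exact KummerQuartic.isKummerQuartic_hudson_iff ha h2 v
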